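/- Let $K\subset\mathbb C$ be an imaginary quadratic field of discriminant $-D$, with ring of integers $\mathcal O_K$, $w=|\mathcal O_K^\times|$ and different $\mathcal D=(\delta)$, $\delta^2=-D$; write $\mathbb A_K=\mathbb C\times\mathbb A_K^f$. Let $p$ be a prime number, $\mathfrak m\neq 0$ an ideal of $\mathcal O_K$ coprime to $(p)$, and $\mathfrak n=(p)\mathfrak m$. Let $I_1=\mathcal O_K,I_2,\dots,I_h$ represent the ideal class group, where $I_j$ for $j\ge 2$ is a prime ideal, all coprime to $\mathfrak n\mathcal D$; let $t_j\in\mathbb A_K^{f,\times}$ be a uniformizer at $I_j$ and $1$ elsewhere ($t_1=1$). Let $k,\ell\ge 0$, $N=k+\ell+2$, and let $V_N$ be the space of homogeneous polynomials $\sum_{n=0}^N P_nX^{N-n}Y^n$ over $\mathbb C$ with the right action $(P\rho(\gamma))(X,Y)=P(aX-bY,-cX+dY)$ of $\gamma=\begin{pmatrix}a&b\\c&d\end{pmatrix}$. Let $\varphi$ be a Hecke character of $K$ of infinity type $(-k,-\ell)$ (type $(u,v)$ means $z\mapsto z^u\bar z^v$ on $\mathbb C^\times$) and conductor dividing $\mathfrak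 n$. A Bianchi modular form of weight $(k,\ell)$, level $K_0(\mathfrak n)$ and central action $\varphi$ is a function $\mathcal F:\mathrm{GL}_2(\mathbb A_K)\to V_N$, smooth and of moderate growth in the variable in $\mathrm{GL}_2(\mathbb C)$, left invariant under $\mathrm{GL}_2(K)$, with $\mathcal F(zg)=\varphi(z)\mathcal F(g)$ for $z\in\mathbb A_K^\times$, with $\mathcal F(gu_fu_\infty)=\prod_{\mathfrak q\mid\mathfrak n}\varphi_{\mathfrak q}(d_{\mathfrak q})\,\mathcal F(g)\rho(u_\infty)$ for $u_f=\begin{pmatrix}*&*\\ *&d\end{pmatrix}\in K_0(\mathfrak n)$, $u_\infty\in\mathrm{SU}_2(\mathbb C)$, and which is an eigenfunction of the two components $\tfrac12H^2+EF+FE$ of the Casimir operator of $\mathfrak{sl}_2(\mathbb C)\otimes_{\mathbb R}\mathbb C$, belonging to the identity and to complex conjugation, with eigenvalues $\tfrac{k^2}2+k$ and $\tfrac{\ell^2}2+\ell$ respectively. Its Fourier coefficients $c(\mathfrak a,\mathcal F)$, for nonzero integral ideals $\mathfrak a$, are given by the expansion, for every finite idele $t$ and $z\in\mathbb C$, $$\mathcal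 F\left[\begin{pmatrix}t&0\\0&1\end{pmatrix}_f\begin{pmatrix}1&z\\0&1\end{pmatrix}_\infty\right]=|t|\Big[(\text{term constant in }z)+\sum_{\alpha\in K^\times}c(\alpha t\mathcal D,\mathcal F)\,W(\alpha)\,e^{2\pi i(\alpha z+\overline{\alpha z})}\Big],$$ $$W(s)=\sum_{n=0}^{N}\binom Nn\Big(\frac{s}{i|s|}\Big)^{\ell+1-n}K_{n-\ell-1}(4\pi|s|)X^{N-n}Y^n ,$$ where $K_\nu$ is the modified Bessel function. For each $j$ put $f^j(z,t)=t^{-1}\mathcal F\left[\begin{pmatrix}t_j&0\\0&1\end{pmatrix}_f\begin{pmatrix}t&z\\0&1\end{pmatrix}_\infty\right]=\sum_n f^j_n(z,t)X^{N-n}Y^n$ for $(z,t)\in\mathcal H_3=\mathbb C\times\mathbb R_{>0}$. For $\gamma\in\mathrm{GL}_2(\mathbb C)$ with lower row $(c,d)$ put $J(\gamma;(z,t))=\begin{pmatrix}cz+d&\overline{ct}\\-ct&\overline{cz+d}\end{pmatrix}$ and $(f^j|_\gamma)(z,t)=\det(\gamma)^{-k/2}\overline{\det(\gamma)}^{-\ell/2}f^j(\gamma\cdot(z,t))\,\rho(J(\gamma/\sqrt{\det\gamma};(z,t)))^{-1}$.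 Say that $f^j$ quasi-vanishes at a cusp $s\in\mathbb P^1(K)$ if for $\sigma\in\mathrm{GL}_2(K)$ with $\sigma\infty=s$ the components $(f^j|_\sigma)_n$, $1\le n\le k+\ell+1$, have zero constant Fourier term (mean value over a lattice of periods in $z$). Let $$\Gamma_j(\mathfrak m)=\left\{\begin{pmatrix}a&b\\c&d\end{pmatrix}\in\mathrm{SL}_2(K):a,d\in\mathcal O_K,\ b\in I_j,\ c\in\mathfrak mI_j^{-1}\right\},\qquad C_j=\Gamma_j(\mathfrak m)\infty\cup\Gamma_j(\mathfrak m)0 .$$ $\mathcal F$ is called $C$-cuspidal if every $f^j$ quasi-vanishes at all cusps in $C_j$. Let $\mathcal F$ be $C$-cuspidal, and let $\psi$ be a Hecke character of $K$ of conductor $\mathfrak f$ coprime to $\mathfrak m$ and to all $I_j$, and of infinity type $(q,r)$ with integers $0\le q\le k$, $0\le r\le\ell$. Write $\psi_{\mathfrak f}=\prod_{\mathfrak q\mid\mathfrak f}\psi_{\mathfrak q}$, and let $\psi(\mathfrak a)$ be the value on ideals of $\psi$ ($0$ if $\mathfrak a$ is not coprime to $\mathfrak f$). For each $j$ and each class $x\in\mathfrak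 f^{-1}/\mathcal O_K$ consisting of elements $b$ with $((b)\mathfrak f,\mathfrak f)=1$, let $a_j(x)\in\mathfrak f^{-1}I_j$ be a representative of $x$ which lies in $C_j$, or, more generally, at which $f^j$ quasi-vanishes. Put $$c^j_{q,r}(a)=2\binom{k+\ell+2}{\ell+q-r+1}^{-1}(-1)^{\ell-r+1}\int_0^\infty t^{q+r}f^j_{\ell+q-r+1}(a,t)\,dt,$$ $$W(\psi)=\psi_\infty(\delta)\sum_{x}\psi_{\mathfrak f}(b)\,e^{2\pi i\,\mathrm{Tr}_{K/\mathbb Q}(b/\delta)}\qquad(b\in x),$$ where $x$ runs over these classes. Then the integrals defining $c^j_{q,r}(a_j(x))$ converge absolutely; the series $$L(\mathcal F,\psi,s)=\sum_{0\ne\mathfrak a\subset\mathcal O_K}c(\mathfrak a,\mathcal F)\psi(\mathfrak a)N(\mathfrak a)^{-s}$$ converges absolutely on some right half-plane and continues to an entire function of $s$; and the value of this function at $s=1$ is $$L(\mathcal F,\psi,1)=\frac{(-1)^{\ell+q+r}\,2\,(2\pi i)^{q+r+2}}{D\,w\,\Gamma(q+1)\Gamma(r+1)\,W(\psi)}\sum_{j=1}^h\psi(t_j)\sum_{x}\psi_{\mathfrak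 f}(a_j(x))\,c^j_{q,r}(a_j(x)).$$ -/

import Mathlib

open NumberField IsDedekindDomain IsDedekindDomain.HeightOneSpectrum
open scoped nonZeroDivisors ComplexConjugate Classical

noncomputable section

namespace Bianchi

/-! ## Homogeneous polynomials and special functions -/

/-- `V N`: homogeneous polynomials of degree `N` in `X, Y` over the complex numbers. The vector `P`
stands for `∑ n, P n • X ^ (N - n) * Y ^ n`. -/
abbrev V (N : ℕ) : Type := Fin (N + 1) → ℂ

/-- The coefficient of `X ^ (N - n) * Y ^ n`. -/
def V.comp {N : ℕ} (P : V N) (n : ℕ) : ℂ := if h : n < N + 1 then P ⟨n, h⟩ else 0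

/-- The right action of two by two matrices on homogeneous polynomials,
`(P ρ(γ))(X, Y) = P (a X - b Y, - c X + d Y)` for `γ = (a b; c d)`
(the polynomial is computed in the affine coordinate `X = 1`, `Y = T`).
It is the substitution action `P ↦ P (γ (X, Y)ᵗ)` written in the variables `X, -Y`; with this sign
the Whittaker vectors of Bianchi modular forms are the functions `whittaker` below. -/
def rho (N : ℕ) (γ : Matrix (Fin 2) (Fin 2) ℂ) (P : V N) : V N := fun n =>
  (∑ m : Fin (N + 1), Polynomial.C (P m) *
    (Polynomial.C (γ 0 0) - Polynomial.C (γ 0 1) * Polynomial.X) ^ (N - (m : ℕ)) *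
    (-Polynomial.C (γ 1 0) + Polynomial.C (γ 1 1) * Polynomial.X) ^ (m : ℕ)).coeff n

/-- The modified Bessel function of the second kind `K_ν (x)`, for `x > 0`. -/
def besselK (ν x : ℝ) : ℝ :=
  ∫ u in Set.Ioi (0 : ℝ), Real.exp (-x * Real.cosh u) * Real.cosh (ν * u)

/-- The Whittaker function `W : ℂ \ {0} → V (k + ℓ + 2)` of weight `(k, ℓ)`. -/
def whittaker (k ℓ : ℕ) (s : ℂ) : V (k + ℓ + 2) := fun n =>
  ((k + ℓ + 2).choose n : ℂ) * (s / (Complex.I * ‖s‖)) ^ ((ℓ : ℤ) + 1 - (n : ℕ)) *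
    (besselK ((n : ℕ) - ℓ - 1) (4 * Real.pi * ‖s‖) : ℂ)

/-- The mean value of a function that is periodic under the lattice spanned by the `ω i`. -/
def latticeMean {ι : Type*} [Fintype ι] (ω : ι → ℂ) (g : ℂ → ℂ) : ℂ :=
  ∫ x : ι → ℝ in Set.Icc 0 1, g (∑ i, (x i : ℂ) * ω i)

/-! ## Ideles, Hecke characters -/

variable (K : Type*) [Field K] [NumberField K]

/-- The finite adeles of `K`. For `K` imaginary quadratic the adele ring is `ℂ × Af K`. -/
abbrev Af : Type _ := FiniteAdeleRing (𝓞 K) K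

variable {K}

/-- The finite idele with given local components. -/
def finiteIdele (x : ∀ v : HeightOneSpectrum (𝓞 K), (v.adicCompletion K)ˣ)
    (hx : ∀ᶠ v in Filter.cofinite, Valued.v (x v : v.adicCompletion K) = 1) : (Af K)ˣ where
  val := ⟨fun v => (x v : v.adicCompletion K), by
    filter_upwards [hx] with v hv
    exact (mem_adicCompletionIntegers (𝓞 K) K v).2 hv.le⟩
  inv := ⟨fun v => ((x v)⁻¹ : (v.adicCompletion K)ˣ), by
    filter_upwards [hx] with v hv
    refine (mem_adicCompletionIntegers (𝓞 K) K v).2 ?_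
    simp [hv]⟩
  val_inv := by
    refine FiniteAdeleRing.ext K fun v => ?_
    exact Units.mul_inv (x v)
  inv_val := by
    refine FiniteAdeleRing.ext K fun v => ?_
    exact Units.inv_mul (x v)

/-- The idele with component `x` at `v` and `1` at all other places. -/
def localIdele (v : HeightOneSpectrum (𝓞 K)) (x : (v.adicCompletion K)ˣ) : (Af K)ˣ :=
  finiteIdele (Pi.mulSingle v x) (by
    have h : ({v} : Set (HeightOneSpectrum (𝓞 K)))ᶜ ∈ Filter.cofinite :=
      (Set.finite_singleton v).compl_mem_cofinite
    filter_upwards [h] with w hw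
    rw [Pi.mulSingle_eq_of_ne hw]
    simp)

lemma exists_uniformizer (v : HeightOneSpectrum (𝓞 K)) :
    ∃ π : (v.adicCompletion K)ˣ,
      Valued.v (π : v.adicCompletion K) = WithZero.exp (-1 : ℤ) := by
  obtain ⟨π, hπ⟩ := v.valuation_exists_uniformizer K
  have h : Valued.v ((π : v.adicCompletion K)) = WithZero.exp (-1 : ℤ) := by
    rw [valuedAdicCompletion_eq_valuation', hπ]
  refine ⟨Units.mk0 (π : v.adicCompletion K) ?_, h⟩
  intro h0
  rw [h0, map_zero] at h
  exact WithZero.coe_ne_zero h.symm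

/-- A fixed uniformizer of the completion of `K` at `v`. -/
def uniformizer (v : HeightOneSpectrum (𝓞 K)) : (v.adicCompletion K)ˣ :=
  (exists_uniformizer v).choose

/-- The finite idele `∏ π_v ^ (v J)` attached to a fractional ideal `J`. -/
def ideleOf (J : FractionalIdeal (𝓞 K)⁰ K) : (Af K)ˣ :=
  finiteIdele (fun v => uniformizer v ^ FractionalIdeal.count K v J) (by
    filter_upwards [FractionalIdeal.finite_factors (K := K) J] with v hv
    simp [hv])

/-- `TrivialOn ψ 𝔤`: the idele class character `ψ` is trivial on the integral finite ideles
that are congruent to `1` modulo the nonzero ideal `𝔤`. -/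
def TrivialOn (ψ : ℂˣ × (Af K)ˣ →* ℂˣ) (𝔤 : Ideal (𝓞 K)) : Prop :=
  ∀ u : (Af K)ˣ, (∀ v : HeightOneSpectrum (𝓞 K), Valued.v ((u : Af K) v) = 1 ∧
    Valued.v ((u : Af K) v - 1) ≤
      WithZero.exp (-FractionalIdeal.count K v (𝔤 : FractionalIdeal (𝓞 K)⁰ K))) →
    ψ (1, u) = 1

/-- `𝔣` is the conductor of `ψ`. -/
def IsConductor (ψ : ℂˣ × (Af K)ˣ →* ℂˣ) (𝔣 : Ideal (𝓞 K)) : Prop :=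
  𝔣 ≠ ⊥ ∧ TrivialOn ψ 𝔣 ∧ ∀ 𝔤 : Ideal (𝓞 K), 𝔤 ≠ ⊥ → TrivialOn ψ 𝔤 → 𝔣 ∣ 𝔤

/-- `ψ` is a Hecke character of `K` (a continuous character of the idele class group) of infinity
type `(a, b)`: its restriction to `ℂˣ` is `z ↦ z ^ a * conj z ^ b`. Here `K` is embedded in `ℂ`
by `τ`. -/
structure IsHeckeCharacter (τ : K →+* ℂ) (ψ : ℂˣ × (Af K)ˣ →* ℂˣ) (a b : ℤ) : Prop where
  continuous : Continuous ψ
  trivial_on_principal : ∀ x : Kˣ,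
    ψ (Units.map (τ : K →* ℂ) x, FiniteAdeleRing.unitEmbedding (𝓞 K) K x) = 1
  infinity_type : ∀ z : ℂˣ, ((ψ (z, 1) : ℂˣ) : ℂ) = (z : ℂ) ^ a * conj (z : ℂ) ^ b

/-- The component of `ψ` at infinity, extended by zero. -/
def atInfinity (ψ : ℂˣ × (Af K)ˣ →* ℂˣ) (z : ℂ) : ℂ :=
  if h : z = 0 then 0 else ψ (Units.mk0 z h, 1)

/-- The component of `ψ` at `v`, extended by zero. -/
def atPlace (ψ : ℂˣ × (Af K)ˣ →* ℂˣ) (v : HeightOneSpectrum (𝓞 K))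
    (x : v.adicCompletion K) : ℂ :=
  if h : x = 0 then 0 else ψ (1, localIdele v (Units.mk0 x h))

/-- `ψ_𝔣 (x) = ∏_{v ∣ 𝔣} ψ_v (x_v)`. -/
def atIdeal (ψ : ℂˣ × (Af K)ˣ →* ℂˣ) (𝔣 : Ideal (𝓞 K)) (x : Af K) : ℂ :=
  ∏ᶠ (v : HeightOneSpectrum (𝓞 K)) (_ : v.asIdeal ∣ 𝔣), atPlace ψ v (x v)

/-- The function on nonzero integral ideals attached to a Hecke character of conductor `𝔣`. -/
def onIdeals (ψ : ℂˣ × (Af K)ˣ →* ℂˣ) (𝔣 𝔞 : Ideal (𝓞 K)) : ℂ :=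
  if IsCoprime 𝔞 𝔣 then ψ (1, ideleOf (𝔞 : FractionalIdeal (𝓞 K)⁰ K)) else 0

/-! ## Bianchi modular forms -/

/-- The open compact group `K₀(𝔫)`. -/
def K0 (𝔫 : Ideal (𝓞 K)) : Set (GL (Fin 2) (Af K)) :=
  {u | ∀ v : HeightOneSpectrum (𝓞 K),
    (∀ i j : Fin 2, Valued.v ((u i j) v) ≤ 1) ∧
    Valued.v ((u.det : Af K) v) = 1 ∧
    Valued.v ((u 1 0) v) ≤
      WithZero.exp (-FractionalIdeal.count K v (𝔫 : FractionalIdeal (𝓞 K)⁰ K))}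

/-- The diagonal matrix `(x 0; 0 1)`. -/
def diagOne {R : Type*} [CommRing R] (x : Rˣ) : GL (Fin 2) R :=
  Matrix.GeneralLinearGroup.mk'' !![(x : R), 0; 0, 1] (by simp)

/-- A function on `GL₂(ℂ)`, extended by zero to all matrices. -/
def extend {N : ℕ} (Φ : GL (Fin 2) ℂ → V N) (A : Fin 2 → Fin 2 → ℂ) : V N :=
  if h : (Matrix.of A).det ≠ 0 then Φ (Matrix.GeneralLinearGroup.mkOfDetNeZero (Matrix.of A) h)
  else 0

/-- The (real) left invariant vector field on `GL₂(ℂ)` given by the matrix `X`: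
the derivative of `s ↦ Φ (A exp (s X))` at `s = 0`. -/
def lieDeriv {N : ℕ} (X : Matrix (Fin 2) (Fin 2) ℂ) (Φ : (Fin 2 → Fin 2 → ℂ) → V N) :
    (Fin 2 → Fin 2 → ℂ) → V N :=
  fun A => fderiv ℝ Φ A (Matrix.of.symm (Matrix.of A * X))

/-- The two components of the complexified Lie algebra action: `ε = 1` for the component of
`sl₂(ℂ) ⊗_ℝ ℂ` belonging to the identity of `ℂ`, `ε = -1` for the one belonging to complex
conjugation. -/
def lieComp {N : ℕ} (ε : ℂ) (X : Matrix (Fin 2) (Fin 2) ℂ) (Φ : (Fin 2 → Fin 2 → ℂ) → V N) :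
    (Fin 2 → Fin 2 → ℂ) → V N :=
  fun A => (1 / 2 : ℂ) • (lieDeriv X Φ A - (ε * Complex.I) • lieDeriv (Complex.I • X) Φ A)

/-- The component `H² / 2 + E F + F E` of the Casimir operator. -/
def casimir {N : ℕ} (ε : ℂ) (Φ : (Fin 2 → Fin 2 → ℂ) → V N) : (Fin 2 → Fin 2 → ℂ) → V N :=
  fun A => (1 / 2 : ℂ) • lieComp ε !![1, 0; 0, -1] (lieComp ε !![1, 0; 0, -1] Φ) A
    + lieComp ε !![0, 1; 0, 0] (lieComp ε !![0, 0; 1, 0] Φ) A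
    + lieComp ε !![0, 0; 1, 0] (lieComp ε !![0, 1; 0, 0] Φ) A

/-- Bianchi modular forms of weight `(k, ℓ)`, level `K₀(𝔫)` and central action `φ`, as functions on
`GL₂(ℂ) × GL₂(Af K)`. -/
structure IsBianchiModularForm (τ : K →+* ℂ) (𝔫 : Ideal (𝓞 K)) (k ℓ : ℕ)
    (φ : ℂˣ × (Af K)ˣ →* ℂˣ)
    (F : GL (Fin 2) ℂ → GL (Fin 2) (Af K) → V (k + ℓ + 2)) : Prop where
  left_invariant : ∀ (γ : GL (Fin 2) K) (g : GL (Fin 2) ℂ) (x : GL (Fin 2) (Af K)),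
    F (Matrix.GeneralLinearGroup.map τ γ * g)
      (Matrix.GeneralLinearGroup.map (algebraMap K (Af K)) γ * x) = F g x
  central : ∀ (z : ℂˣ) (y : (Af K)ˣ) (g : GL (Fin 2) ℂ) (x : GL (Fin 2) (Af K)),
    F (Matrix.GeneralLinearGroup.scalar (Fin 2) z * g)
      (Matrix.GeneralLinearGroup.scalar (Fin 2) y * x) = ((φ (z, y) : ℂˣ) : ℂ) • F g x
  right_equivariant : ∀ (u : GL (Fin 2) ℂ) (y : GL (Fin 2) (Af K)),
    (u : Matrix (Fin 2) (Fin 2) ℂ) ∈ Matrix.specialUnitaryGroup (Fin 2) ℂ → y ∈ K0 𝔫 →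
    ∀ (g : GL (Fin 2) ℂ) (x : GL (Fin 2) (Af K)),
      F (g * u) (x * y) = atIdeal φ 𝔫 (y 1 1) • rho (k + ℓ + 2) u (F g x)
  smooth : ∀ x : GL (Fin 2) (Af K),
    ContDiffOn ℝ (⊤ : ℕ∞) (extend fun g => F g x) {A | (Matrix.of A).det ≠ 0}
  casimir_id : ∀ (x : GL (Fin 2) (Af K)) (A : Fin 2 → Fin 2 → ℂ), (Matrix.of A).det ≠ 0 →
    casimir 1 (extend fun g => F g x) A =
      ((k : ℂ) ^ 2 / 2 + k) • extend (fun g => F g x) A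
  casimir_conj : ∀ (x : GL (Fin 2) (Af K)) (A : Fin 2 → Fin 2 → ℂ), (Matrix.of A).det ≠ 0 →
    casimir (-1) (extend fun g => F g x) A =
      ((ℓ : ℂ) ^ 2 / 2 + ℓ) • extend (fun g => F g x) A
  moderate_growth : ∀ x : GL (Fin 2) (Af K), ∃ (C : ℝ) (M : ℕ), ∀ g : GL (Fin 2) ℂ,
    ‖F g x‖ ≤ C * (∑ i, ∑ j, ‖g i j‖ + ‖(g.det : ℂ)⁻¹‖) ^ M

/-- Representatives `I j` of the class group, indexed by the classes `j`: the trivial class is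
represented by `𝓞 K`, every other class by a prime ideal, all coprime to the level `𝔫` and to the
different `𝔇`. -/
structure ClassReps (I : ClassGroup (𝓞 K) → Ideal (𝓞 K)) (𝔫 𝔇 : Ideal (𝓞 K)) : Prop where
  one : I 1 = ⊤
  prime : ∀ j, j ≠ 1 → (I j).IsPrime
  ne_bot : ∀ j, I j ≠ ⊥
  class_eq : ∀ j (h : I j ∈ (Ideal (𝓞 K))⁰), ClassGroup.mk0 ⟨I j, h⟩ = j
  coprime_level : ∀ j, IsCoprime (I j) 𝔫
  coprime_different : ∀ j, IsCoprime (I j) 𝔇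

/-- The descent `f^J : ℂ × ℝ_{>0} → V (k + ℓ + 2)` of `F` to hyperbolic space, for the integral
ideal `J` (one of the representatives of the class group) with idele `t_J`:
`f^J (z, t) = t⁻¹ F ((t z; 0 1), (t_J 0; 0 1))`. -/
def descent {N : ℕ} (F : GL (Fin 2) ℂ → GL (Fin 2) (Af K) → V N) (J : Ideal (𝓞 K))
    (z : ℂ) (t : ℝ) : V N :=
  (t : ℂ)⁻¹ • extend (fun g => F g (diagOne (ideleOf (J : FractionalIdeal (𝓞 K)⁰ K))))
    (Matrix.of.symm !![(t : ℂ), z; 0, 1])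

/-- The Fourier coefficient `c (𝔞, F)` at the nonzero integral ideal `𝔞`, where `𝔇` is the
different. With `t` a finite idele of the fractional ideal `J = 𝔞 𝔇⁻¹`, the Fourier expansion
`F ((1 z; 0 1), (t 0; 0 1)) = |t| (constant term + ∑ α, c (α t 𝔇, F) W(α) e(Tr (α z)))`
is periodic in `z` under `J`, and `c (𝔞, F)` is read off from the term `α = 1`, in the
component `n = ℓ + 1`, in which `W(1)` is a multiple of `K_0(4 π)`. -/
def fourierCoeff (τ : K →+* ℂ) (𝔇 : Ideal (𝓞 K)) {k ℓ : ℕ}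
    (F : GL (Fin 2) ℂ → GL (Fin 2) (Af K) → V (k + ℓ + 2)) (𝔞 : Ideal (𝓞 K)) : ℂ :=
  let J : FractionalIdeal (𝓞 K)⁰ K := 𝔞 * (𝔇 : FractionalIdeal (𝓞 K)⁰ K)⁻¹
  if h : J ≠ 0 then
    latticeMean (fun i => τ (basisOfFractionalIdeal K (Units.mk0 J h) i)) (fun z =>
        (extend (fun g => F g (diagOne (ideleOf J))) (Matrix.of.symm !![1, z; 0, 1])).comp (ℓ + 1) *
          Complex.exp (-(2 * Real.pi * Complex.I * (z + conj z)))) /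
      (((FractionalIdeal.absNorm J)⁻¹ : ℚ) * (whittaker k ℓ 1).comp (ℓ + 1))
  else 0

/-! ## Cusps and `C`-cuspidality -/

/-- The slash operator: for `γ = (a b; c d)` in `GL₂(ℂ)`,
`(f|γ)(z, t) = det γ ^ (-k/2) conj (det γ) ^ (-ℓ/2) f (γ (z, t)) ρ(J)⁻¹`, where
`J = (c z + d, conj (c t); - c t, conj (c z + d))` is formed for `γ / √(det γ)`. -/
def slash (k ℓ : ℕ) (f : ℂ → ℝ → V (k + ℓ + 2)) (γ : GL (Fin 2) ℂ) (z : ℂ) (t : ℝ) :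
    V (k + ℓ + 2) :=
  let a := γ 0 0
  let b := γ 0 1
  let c := γ 1 0
  let d := γ 1 1
  let D : ℂ := γ.det
  let r : ℝ := ‖c * z + d‖ ^ 2 + ‖c * t‖ ^ 2
  let z' : ℂ := ((a * z + b) * conj (c * z + d) + a * conj c * (t : ℂ) ^ 2) / r
  let t' : ℝ := ‖a * d - b * c‖ * t / r
  let e : ℂ := D ^ (1 / 2 : ℂ)
  let J : Matrix (Fin 2) (Fin 2) ℂ :=
    !![(c * z + d) / e, conj (c * t / e); -(c * t / e), conj ((c * z + d) / e)]
  (D ^ (-(k : ℂ) / 2) * conj D ^ (-(ℓ : ℂ) / 2)) • rho (k + ℓ + 2) J⁻¹ (f z' t')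

/-- The constant term (mean value over a lattice of periods in `z`, for each height `t`) of a
function on hyperbolic space that is periodic in `z` vanishes. -/
def ConstantTermVanishes (g : ℂ → ℝ → ℂ) : Prop :=
  ∀ t : ℝ, 0 < t → ∀ ω : Fin 2 → ℂ, LinearIndependent ℝ ω →
    (∀ i z, g (z + ω i) t = g z t) → latticeMean ω (fun z => g z t) = 0

/-- `f` quasi-vanishes at the cusp `s`: the constant terms of the components `1 ≤ n ≤ k + ℓ + 1`
of `f|σ` vanish, for `σ` in `GL₂(K)` with `σ ∞ = s`. -/
def QuasiVanishesAt (τ : K →+* ℂ) (k ℓ : ℕ) (f : ℂ → ℝ → V (k + ℓ + 2)) (s : OnePoint K) : Prop :=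
  ∀ σ : GL (Fin 2) K, σ • (OnePoint.infty : OnePoint K) = s →
    ∀ n : ℕ, 1 ≤ n → n ≤ k + ℓ + 1 →
      ConstantTermVanishes fun z t =>
        (slash k ℓ f (Matrix.GeneralLinearGroup.map τ σ) z t).comp n

/-- The group `Γ_J(𝔪) = {(a b; c d) ∈ SL₂(K) : a, d ∈ 𝓞 K, b ∈ J, c ∈ 𝔪 J⁻¹}`, that is,
`SL₂(K) ∩ g_J K₀(𝔪) g_J⁻¹` with `g_J = (t_J 0; 0 1)`. -/
def Gam (J 𝔪 : Ideal (𝓞 K)) : Set (GL (Fin 2) K) :=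
  {γ | γ.det = 1 ∧ γ 0 0 ∈ (1 : FractionalIdeal (𝓞 K)⁰ K) ∧
    γ 0 1 ∈ (J : FractionalIdeal (𝓞 K)⁰ K) ∧
    γ 1 0 ∈ (𝔪 : FractionalIdeal (𝓞 K)⁰ K) * (J : FractionalIdeal (𝓞 K)⁰ K)⁻¹ ∧
    γ 1 1 ∈ (1 : FractionalIdeal (𝓞 K)⁰ K)}

/-- The set of cusps `C_J = Γ_J(𝔪) ∞ ∪ Γ_J(𝔪) 0`. -/
def cusps (J 𝔪 : Ideal (𝓞 K)) : Set (OnePoint K) :=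
  {s | ∃ γ ∈ Gam J 𝔪, s = γ • (OnePoint.infty : OnePoint K) ∨ s = γ • ((0 : K) : OnePoint K)}

/-- `F` is `C`-cuspidal: each descent `f^j` quasi-vanishes at all cusps in `C_j`. -/
def IsCCuspidal (τ : K →+* ℂ) (I : ClassGroup (𝓞 K) → Ideal (𝓞 K)) (𝔪 : Ideal (𝓞 K)) (k ℓ : ℕ)
    (F : GL (Fin 2) ℂ → GL (Fin 2) (Af K) → V (k + ℓ + 2)) : Prop :=
  ∀ j, ∀ s ∈ cusps (I j) 𝔪, QuasiVanishesAt τ k ℓ (descent F (I j)) s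

/-! ## The ingredients of the integral formula -/

variable (K) in
/-- The ring of integers as an additive subgroup of `K`. -/
def intSubgroup : AddSubgroup K := (algebraMap (𝓞 K) K).range.toAddSubgroup

/-- The classes `[a]` in `𝔣⁻¹ / 𝓞 K` with `((a) 𝔣, 𝔣) = 1`. -/
def primClasses (𝔣 : Ideal (𝓞 K)) : Set (K ⧸ intSubgroup K) :=
  {x | ∃ a : K, QuotientAddGroup.mk a = x ∧
    FractionalIdeal.spanSingleton (𝓞 K)⁰ a * (𝔣 : FractionalIdeal (𝓞 K)⁰ K) +
      (𝔣 : FractionalIdeal (𝓞 K)⁰ K) = 1}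

/-- The Gauss sum `W(ψ) = ψ_∞(δ) ∑_{[a]} ψ_𝔣(a) e ^ (2 π i Tr (a / δ))`. -/
def gaussSum (τ : K →+* ℂ) (δ : 𝓞 K) (ψ : ℂˣ × (Af K)ˣ →* ℂˣ) (𝔣 : Ideal (𝓞 K)) : ℂ :=
  atInfinity ψ (τ δ) * ∑ᶠ x ∈ primClasses 𝔣,
    atIdeal ψ 𝔣 (algebraMap K (Af K) (Quotient.out x)) *
      Complex.exp (2 * Real.pi * Complex.I *
        (Algebra.trace ℚ K (Quotient.out x / (δ : K)) : ℚ))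

/-- The coefficient
`c_{q,r}(a) = 2 binom(k+ℓ+2, ℓ+q-r+1)⁻¹ (-1)^(ℓ-r+1) ∫_0^∞ t^(q+r) f_{ℓ+q-r+1}(a, t) dt`. -/
def mellinCoeff (k ℓ : ℕ) (f : ℂ → ℝ → V (k + ℓ + 2)) (q r : ℕ) (a : ℂ) : ℂ :=
  2 * ((k + ℓ + 2).choose (ℓ + 1 + q - r) : ℂ)⁻¹ * (-1) ^ (ℓ + 1 - r) *
    ∫ t in Set.Ioi (0 : ℝ), (t : ℂ) ^ (q + r) * (f a t).comp (ℓ + 1 + q - r)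

/-- `L` is (the analytic continuation to all of `ℂ` of) the `L`-function
`L(F, ψ, s) = ∑_𝔞 c(𝔞, F) ψ(𝔞) N(𝔞)^(-s)`: `L` is entire, and on some right half-plane the series
converges absolutely to `L`. -/
def IsLFunction (τ : K →+* ℂ) (𝔇 : Ideal (𝓞 K)) {k ℓ : ℕ}
    (F : GL (Fin 2) ℂ → GL (Fin 2) (Af K) → V (k + ℓ + 2))
    (ψ : ℂˣ × (Af K)ˣ →* ℂˣ) (𝔣 : Ideal (𝓞 K)) (L : ℂ → ℂ) : Prop :=
  Differentiable ℂ L ∧ ∃ σ : ℝ, ∀ s : ℂ, σ < s.re →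
    HasSum (fun 𝔞 : {𝔞 : Ideal (𝓞 K) // 𝔞 ≠ ⊥} =>
      fourierCoeff τ 𝔇 F 𝔞.1 * onIdeals ψ 𝔣 𝔞.1 * (Ideal.absNorm 𝔞.1 : ℂ) ^ (-s)) (L s)

end Bianchi

end

noncomputable section

namespace Bianchi

section

/-! ### The modified Bessel function -/

/-! The Dirichlet series is compared, one ideal class at a time, with Mellin transforms of the
descents `f^j` along the vertical geodesics ending at the cusps `a_j(x)`.

Fourier expansion. Average the form over unipotent translations against an additive character of
frequency `α`. The two Casimir equations, the `SU₂`-equivariance and the central character leave a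
system of ordinary differential equations in the height `t`. One Casimir equation makes the top
component a solution of a Bessel equation, moderate growth selects the `K`-Bessel function, and the
other Casimir equation then determines all lower components. So the average is a multiple of `t² W(α
t)` (`IsArchimedeanForm.exists_unipotentAverage_eq`). The multiples grow at most polynomially in
`α`, hence the expansion converges absolutely (`IsCoefficientFamily.hasSum`), and up to the norm of
`J` they are the coefficients `c(𝔞, F)` (`IsBianchiModularForm.fourierCoeff_eq`).

Entire continuation. Quasi-vanishing removes the constant terms of the components `1 ≤ n ≤ k + ℓ +
1`. An expansion without constant term decays faster than any power as `t → ∞`. Applied to the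
translate of the form by a matrix taking `∞` to `a`, the same argument gives decay as `t → 0` above
`a`. Hence the Mellin transforms converge everywhere and are entire
(`IsBianchiModularForm.isRapidlyDecreasing_descent`).

Unfolding. Every nonzero integral ideal is `α δ I_j` with `α` in the trace dual of `I_j`; its class
determines `j`, and `α` is unique up to the `w` units (`ClassReps.card_fiber`). Insert the expansion
in `∑_x ψ_𝔣(a_j(x)) f^j_n(a_j(x), t)` with `n = ℓ + 1 + q - r`. The additive characters add up to a
Gauss sum twisted by `α δ`, which is `ψ_𝔣(α δ)⁻¹` times the plain one, or zero if the ideal is not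
prime to `𝔣` (`sum_finitePart_mul_traceChar`). The Mellin transform of `K_{q-r}` contributes two
Gamma factors (`mellin_besselK`). As `ψ` is trivial on principal ideles, `ψ(α δ I_j)` is `ψ(t_j)`
times `ψ_𝔣(α δ)⁻¹` times the inverse of the infinity type, so exactly the terms of the Dirichlet
series appear (`IsBianchiModularForm.hasSum_traceDual`). The Gauss sum is nonzero
(`finiteGaussSum_ne_zero`) and may be divided out; summing over `j`, dividing by `w` and putting `s
= 1` gives the formula. -/

open MeasureTheory Set Filter Topology Asymptotics in
lemma mul_le_add_cosh {x a u : ℝ} (hx : 0 < x) (hu : 0 ≤ u) :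
    a * u ≤ a ^ 2 / x + x * Real.cosh u := by
  have h1 : 1 + u + u ^ 2 / 2 ≤ Real.exp u := Real.quadratic_le_exp_of_nonneg hu
  have h2 : u ^ 2 / 4 ≤ Real.cosh u := by
    rw [Real.cosh_eq]
    have := Real.exp_pos (-u)
    linarith
  have h3 : x * (u ^ 2 / 4) ≤ x * Real.cosh u := mul_le_mul_of_nonneg_left h2 hx.le
  -- Completing the square: the quadratic growth of `cosh` absorbs any linear exponent `a * u`, at
  -- the price of the constant `a ^ 2 / x`.
  have h4 : a ^ 2 / x + x * (u ^ 2 / 4) - a * u = (a / x - u / 2) ^ 2 * x := by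
    field_simp
    ring
  have h5 : 0 ≤ (a / x - u / 2) ^ 2 * x := by positivity
  linarith

lemma cosh_mul_le_exp (ν u : ℝ) (hu : 0 ≤ u) : Real.cosh (ν * u) ≤ Real.exp (|ν| * u) := by
  rw [← Real.cosh_abs, abs_mul, abs_of_nonneg hu]
  rw [Real.cosh_eq]
  have : Real.exp (-(|ν| * u)) ≤ Real.exp (|ν| * u) :=
    Real.exp_le_exp.2 (by have : 0 ≤ |ν| * u := by positivity
                          linarith)
  linarith

/-- Applying `mul_le_add_cosh` with `a = |ν| + 1` leaves a factor `exp (-u)` to spare; this majorant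
serves both for integrability and for boundary terms at infinity. -/
lemma exp_neg_cosh_mul_cosh_le {x : ℝ} (hx : 0 < x) (ν : ℝ) {u : ℝ} (hu : 0 ≤ u) :
    Real.exp (-x * Real.cosh u) * Real.cosh (ν * u) ≤
      Real.exp ((|ν| + 1) ^ 2 / x) * Real.exp (-1 * u) := by
  calc _ ≤ Real.exp (-x * Real.cosh u) * Real.exp (|ν| * u) :=
        mul_le_mul_of_nonneg_left (cosh_mul_le_exp ν u hu) (Real.exp_pos _).le
    _ ≤ _ := by
        rw [← Real.exp_add, ← Real.exp_add]
        refine Real.exp_le_exp.2 ?_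
        have := mul_le_add_cosh (a := |ν| + 1) hx hu
        linarith

lemma integrableOn_besselK {x : ℝ} (hx : 0 < x) (ν : ℝ) :
    MeasureTheory.IntegrableOn
      (fun u => Real.exp (-x * Real.cosh u) * Real.cosh (ν * u)) (Set.Ioi 0) := by
  refine integrable_of_isBigO_exp_neg (b := 1) one_pos (by fun_prop) ?_
  refine Asymptotics.IsBigO.of_bound (Real.exp ((|ν| + 1) ^ 2 / x)) ?_
  filter_upwards [Filter.eventually_ge_atTop 0] with u hu
  rw [Real.norm_of_nonneg (by positivity), Real.norm_of_nonneg (by positivity)]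
  exact exp_neg_cosh_mul_cosh_le hx ν hu

lemma cosh_mul_cosh_mul (ν u : ℝ) : Real.cosh u * Real.cosh (ν * u) =
    (Real.cosh ((ν + 1) * u) + Real.cosh ((ν - 1) * u)) / 2 := by
  rw [add_mul, sub_mul, one_mul, Real.cosh_add, Real.cosh_sub]
  ring

lemma sinh_mul_sinh_mul (ν u : ℝ) : Real.sinh u * Real.sinh (ν * u) =
    (Real.cosh ((ν + 1) * u) - Real.cosh ((ν - 1) * u)) / 2 := by
  rw [add_mul, sub_mul, one_mul, Real.cosh_add, Real.cosh_sub]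
  ring

/-- Differentiation under the integral sign brings down `-cosh u`, and the product formula for
`cosh` turns it into the two neighbouring orders. On the ball of radius `x / 2` one has `y > x / 2`,
whence the majorant. -/
lemma hasDerivAt_besselK_aux {x : ℝ} (hx : 0 < x) (ν : ℝ) :
    HasDerivAt (besselK ν) (-(besselK (ν + 1) x + besselK (ν - 1) x) / 2) x := by
  have hi : ∀ y : ℝ, 0 < y → MeasureTheory.IntegrableOn (fun u => Real.exp (-y * Real.cosh u) *
      (Real.cosh u * Real.cosh (ν * u))) (Set.Ioi 0) := by
    intro y hy
    refine ((integrableOn_besselK hy (ν + 1)).add (integrableOn_besselK hy (ν - 1))).div_const 2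
      |>.congr ?_
    refine Filter.Eventually.of_forall fun u => ?_
    simp only [Pi.add_apply]
    rw [cosh_mul_cosh_mul]
    ring
  have key := hasDerivAt_integral_of_dominated_loc_of_deriv_le
    (μ := MeasureTheory.volume.restrict (Set.Ioi (0 : ℝ)))
    (F := fun y u => Real.exp (-y * Real.cosh u) * Real.cosh (ν * u))
    (F' := fun y u => -(Real.exp (-y * Real.cosh u) * (Real.cosh u * Real.cosh (ν * u))))
    (bound := fun u => Real.exp (-(x / 2) * Real.cosh u) * (Real.cosh u * Real.cosh (ν * u)))
    (x₀ := x) (s := Metric.ball x (x / 2)) (Metric.ball_mem_nhds _ (by positivity))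
    (Filter.Eventually.of_forall fun y =>
      (by fun_prop : Continuous fun u => Real.exp (-y * Real.cosh u) * Real.cosh (ν * u)).aestronglyMeasurable)
    (integrableOn_besselK hx ν)
    (by fun_prop : Continuous _).aestronglyMeasurable ?_ (hi _ (by positivity)) ?_
  · refine key.2.congr_deriv ?_
    rw [MeasureTheory.integral_neg]
    unfold besselK
    rw [neg_div, ← MeasureTheory.integral_add (integrableOn_besselK hx _) (integrableOn_besselK hx _),
      ← MeasureTheory.integral_div]
    congr 1
    refine MeasureTheory.integral_congr_ae (Filter.Eventually.of_forall fun u => ?_)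
    simp only
    rw [cosh_mul_cosh_mul]
    ring
  · refine Filter.Eventually.of_forall fun u y hy => ?_
    rw [norm_neg, Real.norm_of_nonneg (by have := Real.cosh_pos u; positivity)]
    refine mul_le_mul_of_nonneg_right (Real.exp_le_exp.2 ?_) (by have := Real.cosh_pos u; positivity)
    rw [Metric.mem_ball, Real.dist_eq, abs_lt] at hy
    exact mul_le_mul_of_nonneg_right (by linarith) (Real.cosh_pos u).le
  · refine Filter.Eventually.of_forall fun u y _ => ?_
    have h1 : HasDerivAt (fun y : ℝ => -y * Real.cosh u) (-1 * Real.cosh u) y :=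
      (hasDerivAt_neg y).mul_const _
    refine (h1.exp.mul_const (Real.cosh (ν * u))).congr_deriv ?_
    ring

lemma tendsto_exp_neg_cosh_mul_sinh {x : ℝ} (hx : 0 < x) (ν : ℝ) :
    Filter.Tendsto (fun u => Real.exp (-x * Real.cosh u) * Real.sinh (ν * u)) Filter.atTop
      (nhds 0) := by
  refine squeeze_zero_norm' (a := fun u => Real.exp ((|ν| + 1) ^ 2 / x) * Real.exp (-1 * u)) ?_ ?_
  · filter_upwards [Filter.eventually_ge_atTop 0] with u hu
    rw [norm_mul, Real.norm_of_nonneg (Real.exp_pos _).le]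
    refine le_trans (mul_le_mul_of_nonneg_left ?_ (Real.exp_pos _).le)
      (exp_neg_cosh_mul_cosh_le hx ν hu)
    rw [Real.norm_eq_abs]
    exact abs_le.2 ⟨by rw [← neg_le_neg_iff, neg_neg, ← Real.sinh_neg, ← Real.cosh_neg]
                       exact (Real.sinh_lt_cosh _).le, (Real.sinh_lt_cosh _).le⟩
  · have : Filter.Tendsto (fun u : ℝ => Real.exp (-1 * u)) Filter.atTop (nhds 0) := by
      simpa using Real.tendsto_exp_neg_atTop_nhds_zero
    simpa using this.const_mul (Real.exp ((|ν| + 1) ^ 2 / x))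

/-- Integration by parts: `exp (-x cosh u) sinh (ν u)` vanishes at `0` and at infinity, so its
derivative has integral zero. -/
lemma mul_besselK {x : ℝ} (hx : 0 < x) (ν : ℝ) :
    ν * besselK ν x = x * (besselK (ν + 1) x - besselK (ν - 1) x) / 2 := by
  have hd : ∀ u ∈ Set.Ici (0 : ℝ), HasDerivAt (fun u => Real.exp (-x * Real.cosh u) * Real.sinh (ν * u))
      (ν * (Real.exp (-x * Real.cosh u) * Real.cosh (ν * u)) -
        x * (Real.exp (-x * Real.cosh u) * Real.cosh ((ν + 1) * u) -
          Real.exp (-x * Real.cosh u) * Real.cosh ((ν - 1) * u)) / 2) u := by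
    intro u _
    have h1 : HasDerivAt (fun u : ℝ => -x * Real.cosh u) (-x * Real.sinh u) u :=
      (Real.hasDerivAt_cosh u).const_mul _
    have h2 : HasDerivAt (fun u : ℝ => ν * u) ν u := by simpa using (hasDerivAt_id u).const_mul ν
    refine (h1.exp.mul h2.sinh).congr_deriv ?_
    have := sinh_mul_sinh_mul ν u
    linear_combination (-x * Real.exp (-x * Real.cosh u)) * this
  have I0 := (integrableOn_besselK hx ν).const_mul ν
  have I1 := (((integrableOn_besselK hx (ν + 1)).sub (integrableOn_besselK hx (ν - 1))).const_mul x).div_const 2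
  have key := MeasureTheory.integral_Ioi_of_hasDerivAt_of_tendsto' hd
    (I0.sub I1) (tendsto_exp_neg_cosh_mul_sinh hx ν)
  have e := MeasureTheory.integral_sub I0 I1
  simp only [Pi.sub_apply] at e
  rw [e] at key
  rw [MeasureTheory.integral_const_mul, MeasureTheory.integral_div, MeasureTheory.integral_const_mul,
    MeasureTheory.integral_sub (integrableOn_besselK hx (ν + 1)) (integrableOn_besselK hx (ν - 1))] at key
  simp only [mul_zero, Real.sinh_zero, sub_zero] at key
  unfold besselK
  linarith

/-- `x K_ν' (x) = ν K_ν (x) - x K_{ν+1} (x)` -/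
lemma hasDerivAt_besselK {x : ℝ} (hx : 0 < x) (ν : ℝ) :
    HasDerivAt (besselK ν) ((ν * besselK ν x - x * besselK (ν + 1) x) / x) x := by
  refine (hasDerivAt_besselK_aux hx ν).congr_deriv ?_
  have := mul_besselK hx ν
  field_simp
  linarith

/-- `x K_ν' (x) = -ν K_ν (x) - x K_{ν-1} (x)` -/
lemma hasDerivAt_besselK' {x : ℝ} (hx : 0 < x) (ν : ℝ) :
    HasDerivAt (besselK ν) ((-ν * besselK ν x - x * besselK (ν - 1) x) / x) x := by
  refine (hasDerivAt_besselK_aux hx ν).congr_deriv ?_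
  have := mul_besselK hx ν
  field_simp
  linarith

lemma besselK_nonneg (ν x : ℝ) : 0 ≤ besselK ν x :=
  MeasureTheory.integral_nonneg fun u => by positivity

/-- Only the range `0 < u ≤ 1 / 2` is kept, where `cosh u ≤ 3 / 2`. In `eq_const_mul_besselK` it
matters that the rate `3 / 2` is less than `2`. -/
lemma le_besselK {x : ℝ} (hx : 0 < x) (ν : ℝ) : 1 / 2 * Real.exp (-(3 / 2) * x) ≤ besselK ν x := by
  have h1 : Real.cosh (1 / 2) ≤ 3 / 2 := by
    refine (Real.cosh_le_exp_half_sq (1 / 2)).trans ?_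
    have : Real.exp ((1 / 2) ^ 2 / 2) ≤ 1 / (1 - (1 / 2) ^ 2 / 2) :=
      Real.exp_bound_div_one_sub_of_interval (by norm_num) (by norm_num)
    refine this.trans (by norm_num)
  have h2 : ∫ u in Set.Ioc (0 : ℝ) (1 / 2), Real.exp (-(3 / 2) * x) ≤
      ∫ u in Set.Ioc (0 : ℝ) (1 / 2), Real.exp (-x * Real.cosh u) * Real.cosh (ν * u) := by
    refine MeasureTheory.setIntegral_mono_on (MeasureTheory.integrableOn_const (by simp))
      ((integrableOn_besselK hx ν).mono_set Set.Ioc_subset_Ioi_self) measurableSet_Ioc fun u hu => ?_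
    have h3 : Real.cosh u ≤ 3 / 2 := by
      refine le_trans ?_ h1
      rw [Real.cosh_le_cosh, abs_of_pos hu.1, abs_of_pos (by norm_num)]
      exact hu.2
    calc Real.exp (-(3 / 2) * x) ≤ Real.exp (-x * Real.cosh u) := by
          refine Real.exp_le_exp.2 ?_
          nlinarith
      _ ≤ _ := le_mul_of_one_le_right (Real.exp_pos _).le (Real.one_le_cosh _)
  have h4 := MeasureTheory.setIntegral_mono_set (integrableOn_besselK hx ν)
    (Filter.Eventually.of_forall fun u => by positivity)
    (Filter.Eventually.of_forall (Set.Ioc_subset_Ioi_self : Set.Ioc (0 : ℝ) (1 / 2) ⊆ Set.Ioi 0))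
  refine le_trans (le_of_eq ?_) (h2.trans h4)
  simp

lemma besselK_pos {x : ℝ} (hx : 0 < x) (ν : ℝ) : 0 < besselK ν x :=
  lt_of_lt_of_le (by positivity) (le_besselK hx ν)

/-- Since `cosh u ≥ 1`, passing from `x₀` to `x` multiplies the integrand by at most `exp (x₀ - x)`.
-/
lemma besselK_le {x₀ x : ℝ} (h0 : 0 < x₀) (hx : x₀ ≤ x) (ν : ℝ) :
    besselK ν x ≤ besselK ν x₀ * Real.exp x₀ * Real.exp (-x) := by
  unfold besselK
  rw [mul_assoc, ← MeasureTheory.integral_mul_const]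
  refine MeasureTheory.setIntegral_mono_on (integrableOn_besselK (h0.trans_le hx) ν)
    ((integrableOn_besselK h0 ν).mul_const _) measurableSet_Ioi fun u _ => ?_
  rw [mul_right_comm]
  refine mul_le_mul_of_nonneg_right ?_ (Real.cosh_pos _).le
  rw [← Real.exp_add, ← Real.exp_add]
  refine Real.exp_le_exp.2 ?_
  nlinarith [Real.one_le_cosh u]

end

section

/-! ### Solutions of moderate growth of the modified Bessel equation -/

lemma hasDerivAt_besselK_scaled {c t : ℝ} (hc : 0 < c) (ht : 0 < t) (ν : ℝ) :
    HasDerivAt (fun t => besselK ν (c * t))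
      ((ν * besselK ν (c * t) - c * t * besselK (ν + 1) (c * t)) / t) t := by
  have h := (hasDerivAt_besselK (mul_pos hc ht) ν).comp t ((hasDerivAt_id t).const_mul c)
  refine h.congr_deriv ?_
  field_simp

lemma hasDerivAt_besselK_scaled' {c t : ℝ} (hc : 0 < c) (ht : 0 < t) (ν : ℝ) :
    HasDerivAt (fun t => besselK ν (c * t))
      ((-ν * besselK ν (c * t) - c * t * besselK (ν - 1) (c * t)) / t) t := by
  have h := (hasDerivAt_besselK' (mul_pos hc ht) ν).comp t ((hasDerivAt_id t).const_mul c)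
  refine h.congr_deriv ?_
  field_simp

/-- With `θ = t d/dt`, the two first order recurrences combine into the modified Bessel equation `θ²
κ = ((c t)² + ν²) κ`. It is kept as a first order system for `κ` and `θ κ`. -/
lemma hasDerivAt_besselK_scaled_two {c t : ℝ} (hc : 0 < c) (ht : 0 < t) (ν : ℝ) :
    HasDerivAt (fun t => -ν * besselK ν (c * t) - c * t * besselK (ν - 1) (c * t))
      (((c * t) ^ 2 + ν ^ 2) * besselK ν (c * t) / t) t := by
  have h0 := (hasDerivAt_besselK_scaled' hc ht ν).const_mul (-ν)
  have h1 := hasDerivAt_besselK_scaled hc ht (ν - 1)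
  have h2 : HasDerivAt (fun t : ℝ => c * t) c t := by simpa using (hasDerivAt_id t).const_mul c
  refine (h0.sub (h2.mul h1)).congr_deriv ?_
  rw [sub_add_cancel]
  field_simp
  ring

lemma const_of_hasDerivAt_zero {f : ℝ → ℂ} (h : ∀ t, 0 < t → HasDerivAt f 0 t) {s t : ℝ}
    (hs : 0 < s) (ht : 0 < t) : f s = f t :=
  isOpen_Ioi.is_const_of_deriv_eq_zero (isPreconnected_Ioi)
    (fun x hx => (h x hx).differentiableAt.differentiableWithinAt)
    (fun x hx => (h x hx).deriv) hs ht

lemma not_exp_le_pow {c : ℝ} (hc : 0 < c) (B : ℝ) (n : ℕ) :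
    ¬ ∀ t : ℝ, 2 ≤ t → Real.exp (c * t) ≤ B * t ^ n := by
  intro h
  have h1 := (isLittleO_pow_exp_pos_mul_atTop n hc).def
    (show (0 : ℝ) < 1 / (2 * (|B| + 1)) by positivity)
  obtain ⟨t, ht1, ht2⟩ := (h1.and (Filter.eventually_ge_atTop 2)).exists
  have h2 := h t ht2
  rw [Real.norm_of_nonneg (by positivity), Real.norm_of_nonneg (by positivity)] at ht1
  have h3 : B * t ^ n ≤ |B| * (1 / (2 * (|B| + 1)) * Real.exp (c * t)) :=
    (mul_le_mul_of_nonneg_right (le_abs_self B) (by positivity)).trans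
      (mul_le_mul_of_nonneg_left ht1 (abs_nonneg B))
  have h4 : |B| * (1 / (2 * (|B| + 1)) * Real.exp (c * t)) ≤ 1 / 2 * Real.exp (c * t) := by
    rw [← mul_assoc]
    refine mul_le_mul_of_nonneg_right ?_ (Real.exp_pos _).le
    rw [mul_one_div, div_le_div_iff₀ (by positivity) (by norm_num)]
    linarith
  have := Real.exp_pos (c * t)
  linarith

/-- The Wronskian `W` of `y` and the Bessel function `κ` (formed with `t d/dt`) is constant, and `(y
/ κ)' = -W / (t κ²)`. If `W = 0`, the quotient is constant. Otherwise the decay of `κ` forces `y /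
κ` to grow like `exp (2 c t) / t` at least, and the lower bound for `κ` then makes `y` grow
exponentially. -/
theorem eq_const_mul_besselK {c ν : ℝ} (hc : 0 < c) {y y1 : ℝ → ℂ}
    (h : ∀ t, 0 < t → HasDerivAt y (y1 t / t) t)
    (h1 : ∀ t, 0 < t → HasDerivAt y1 ((((c * t) ^ 2 + ν ^ 2 : ℝ) : ℂ) * y t / t) t)
    {B : ℝ} {M : ℕ} (hb : ∀ t, 1 ≤ t → ‖y t‖ ≤ B * t ^ M) :
    ∃ C : ℂ, ∀ t, 0 < t → y t = C * besselK ν (c * t) := by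
  set κ : ℝ → ℝ := fun t => besselK ν (c * t) with hκ
  set κ1 : ℝ → ℝ := fun t => -ν * besselK ν (c * t) - c * t * besselK (ν - 1) (c * t) with hκ1
  have k0 : ∀ t, 0 < t → HasDerivAt (fun t => (κ t : ℂ)) ((κ1 t / t : ℝ) : ℂ) t :=
    fun t ht => (hasDerivAt_besselK_scaled' hc ht ν).ofReal_comp
  have k1 : ∀ t, 0 < t → HasDerivAt (fun t => (κ1 t : ℂ))
      ((((c * t) ^ 2 + ν ^ 2) * κ t / t : ℝ) : ℂ) t :=
    fun t ht => (hasDerivAt_besselK_scaled_two hc ht ν).ofReal_comp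
  have kpos : ∀ t, 0 < t → 0 < κ t := fun t ht => besselK_pos (mul_pos hc ht) ν
  have kne : ∀ t, 0 < t → (κ t : ℂ) ≠ 0 := fun t ht => by exact_mod_cast (kpos t ht).ne'
  have tne : ∀ t : ℝ, 0 < t → (t : ℂ) ≠ 0 := fun t ht => by exact_mod_cast ht.ne'
  have hW : ∀ t, 0 < t → HasDerivAt (fun t => y t * κ1 t - y1 t * κ t) 0 t := by
    intro t ht
    refine (((h t ht).mul (k1 t ht)).sub ((h1 t ht).mul (k0 t ht))).congr_deriv ?_
    have := tne t ht
    push_cast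
    field_simp
    ring
  set W : ℂ := y 1 * κ1 1 - y1 1 * κ 1 with hWdef
  have hWt : ∀ t, 0 < t → y t * κ1 t - y1 t * κ t = W := fun t ht =>
    const_of_hasDerivAt_zero hW ht one_pos
  have hY : ∀ t, 0 < t → HasDerivAt (fun t => y t / κ t) (-W / (t * κ t ^ 2)) t := by
    intro t ht
    refine ((h t ht).div (k0 t ht) (kne t ht)).congr_deriv ?_
    rw [← hWt t ht]
    have := tne t ht
    have := kne t ht
    push_cast
    field_simp
    ring
  by_cases hW0 : W = 0
  · refine ⟨y 1 / κ 1, fun t ht => ?_⟩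
    have := const_of_hasDerivAt_zero (f := fun t => y t / κ t) (fun t ht => by simpa [hW0] using hY t ht)
      ht one_pos
    rw [← this]
    exact (div_mul_cancel₀ _ (kne t ht)).symm
  exfalso
  -- Dividing by `-W` makes the derivative the positive real number `1 / (t κ²)`, so real
  -- monotonicity and the mean value theorem apply to the real part.
  set R : ℝ → ℝ := fun t => (-(y t / κ t) / W).re with hR
  have hRd : ∀ t, 0 < t → HasDerivAt R (1 / (t * κ t ^ 2)) t := by
    intro t ht
    have h2 : HasDerivAt (fun t => -(y t / κ t) / W) ((1 / (t * κ t ^ 2) : ℝ) : ℂ) t := by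
      refine ((hY t ht).neg.div_const W).congr_deriv ?_
      push_cast
      field_simp
    have h3 := (Complex.reCLM.hasFDerivAt.comp_hasDerivAt t h2)
    exact h3.congr_deriv (Complex.ofReal_re _)
  set A : ℝ := besselK ν c * Real.exp c with hA
  have hApos : 0 < A := mul_pos (besselK_pos hc ν) (Real.exp_pos _)
  have hkA : ∀ t, 1 ≤ t → κ t ≤ A * Real.exp (-(c * t)) := fun t ht =>
    besselK_le hc (by nlinarith) ν
  have hmono : MonotoneOn R (Set.Ici 1) := by
    refine monotoneOn_of_deriv_nonneg (convex_Ici 1)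
      (fun t ht => (hRd t (one_pos.trans_le ht)).continuousAt.continuousWithinAt)
      (fun t ht => ?_) fun t ht => ?_
    · rw [interior_Ici] at ht
      exact (hRd t (one_pos.trans ht)).differentiableAt.differentiableWithinAt
    · rw [interior_Ici] at ht
      rw [(hRd t (one_pos.trans ht)).deriv]
      have : 0 < t := one_pos.trans ht
      positivity
  -- Mean value theorem on `[t - 1, t]`, with `κ ≤ A exp (-c ξ)` at the intermediate point.
  have hRlow : ∀ t, 2 ≤ t → R 1 + Real.exp (2 * c * (t - 1)) / (A ^ 2 * t) ≤ R t := by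
    intro t ht
    obtain ⟨ξ, hξ, e⟩ := exists_hasDerivAt_eq_slope R (fun t => 1 / (t * κ t ^ 2))
      (show t - 1 < t by linarith)
      (fun s hs => (hRd s (by linarith [hs.1])).continuousAt.continuousWithinAt)
      (fun s hs => hRd s (by linarith [hs.1]))
    have h2 : R 1 ≤ R (t - 1) :=
      hmono (Set.mem_Ici.2 le_rfl) (Set.mem_Ici.2 (by linarith)) (by linarith)
    have hξ1 : 1 ≤ ξ := by linarith [hξ.1]
    have hξ0 : 0 < ξ := by linarith
    have h3 : ξ * κ ξ ^ 2 ≤ t * (A * Real.exp (-(c * ξ))) ^ 2 := by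
      refine mul_le_mul hξ.2.le (pow_le_pow_left₀ (kpos ξ hξ0).le (hkA ξ hξ1) 2) (by positivity)
        (by linarith)
    have h4 : Real.exp (2 * c * (t - 1)) / (A ^ 2 * t) ≤ 1 / (ξ * κ ξ ^ 2) := by
      rw [div_le_div_iff₀ (by positivity) (mul_pos hξ0 (pow_pos (kpos ξ hξ0) 2)), one_mul]
      calc Real.exp (2 * c * (t - 1)) * (ξ * κ ξ ^ 2)
          ≤ Real.exp (2 * c * ξ) * (t * (A * Real.exp (-(c * ξ))) ^ 2) := by
            refine mul_le_mul (Real.exp_le_exp.2 ?_) h3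
              (mul_pos hξ0 (pow_pos (kpos ξ hξ0) 2)).le (Real.exp_pos _).le
            nlinarith [hξ.1]
        _ = A ^ 2 * t * (Real.exp (2 * c * ξ) * Real.exp (-(c * ξ)) ^ 2) := by ring
        _ = A ^ 2 * t := by
            rw [← Real.exp_nat_mul, ← Real.exp_add]
            rw [show 2 * c * ξ + ((2 : ℕ) : ℝ) * -(c * ξ) = 0 by push_cast; ring]
            simp
    have h5 : R t - R (t - 1) = 1 / (ξ * κ ξ ^ 2) := by
      have e' : 1 / (ξ * κ ξ ^ 2) = (R t - R (t - 1)) / (t - (t - 1)) := e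
      rw [e']
      simp
    linarith
  have hyR : ∀ t, 2 ≤ t → ‖W‖ * (κ t * R t) ≤ B * t ^ M := by
    intro t ht
    have t0 : 0 < t := by linarith
    refine le_trans ?_ (hb t (by linarith))
    have e : y t = -(-(y t / κ t) / W) * W * κ t := by
      have := kne t t0
      field_simp
    rw [e, norm_mul, norm_mul, norm_neg, Complex.norm_real, Real.norm_of_nonneg (kpos t t0).le]
    have : R t ≤ ‖-(y t / κ t) / W‖ := Complex.re_le_norm _
    calc ‖W‖ * (κ t * R t) = R t * (‖W‖ * κ t) := by ring
      _ ≤ ‖-(y t / κ t) / W‖ * (‖W‖ * κ t) :=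
        mul_le_mul_of_nonneg_right this (mul_nonneg (norm_nonneg _) (kpos t t0).le)
      _ = _ := by ring
  have hWpos : 0 < ‖W‖ := norm_pos_iff.2 hW0
  -- The rate is `2 c - 3 c / 2 = c / 2`. The exponent `M + 1` accounts for the denominator `t` in
  -- `hRlow`.
  refine not_exp_le_pow (c := c / 2) (by positivity)
    ((B / ‖W‖ + A * |R 1|) * 2 * Real.exp (2 * c) * A ^ 2) (M + 1) fun t ht => ?_
  have t0 : 0 < t := by linarith
  have e1 : κ t * R t ≤ B / ‖W‖ * t ^ M := by
    have := hyR t ht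
    rw [div_mul_eq_mul_div, le_div_iff₀ hWpos]
    linarith
  have e2 : κ t * (R 1 + Real.exp (2 * c * (t - 1)) / (A ^ 2 * t)) ≤ κ t * R t :=
    mul_le_mul_of_nonneg_left (hRlow t ht) (kpos t t0).le
  have e3 : 1 / 2 * Real.exp (-(3 / 2) * (c * t)) ≤ κ t := le_besselK (mul_pos hc t0) ν
  have e4 : κ t ≤ A := by
    refine (hkA t (by linarith)).trans (mul_le_of_le_one_right hApos.le ?_)
    rw [Real.exp_le_one_iff]
    have := mul_pos hc t0
    linarith
  have e5 : -(A * |R 1|) ≤ κ t * R 1 := by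
    have : |κ t * R 1| ≤ A * |R 1| := by
      rw [abs_mul, abs_of_pos (kpos t t0)]
      exact mul_le_mul_of_nonneg_right e4 (abs_nonneg _)
    linarith [neg_abs_le (κ t * R 1)]
  have e6 : 1 / 2 * Real.exp (-(3 / 2) * (c * t)) * (Real.exp (2 * c * (t - 1)) / (A ^ 2 * t)) ≤
      κ t * (Real.exp (2 * c * (t - 1)) / (A ^ 2 * t)) :=
    mul_le_mul_of_nonneg_right e3 (by positivity)
  have ht1 : 1 ≤ t ^ M := one_le_pow₀ (by linarith)
  have e7 : 1 / 2 * Real.exp (-(3 / 2) * (c * t)) * (Real.exp (2 * c * (t - 1)) / (A ^ 2 * t)) ≤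
      (B / ‖W‖ + A * |R 1|) * t ^ M := by
    have : A * |R 1| ≤ A * |R 1| * t ^ M := le_mul_of_one_le_right (by positivity) ht1
    rw [mul_add] at e2
    rw [add_mul]
    linarith
  have e8 : Real.exp (-(3 / 2) * (c * t)) * Real.exp (2 * c * (t - 1)) * Real.exp (2 * c) =
      Real.exp (c / 2 * t) := by
    rw [← Real.exp_add, ← Real.exp_add]
    congr 1
    ring
  have e9 : 1 / 2 * Real.exp (-(3 / 2) * (c * t)) * (Real.exp (2 * c * (t - 1)) / (A ^ 2 * t)) =
      Real.exp (c / 2 * t) / (2 * Real.exp (2 * c) * A ^ 2 * t) := by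
    rw [← e8]
    field_simp
  rw [e9, div_le_iff₀ (by positivity)] at e7
  refine e7.trans (le_of_eq ?_)
  ring

end

section

/-! ### The Mellin transform of the modified Bessel function -/

lemma ofReal_exp_cpow (u : ℝ) (w : ℂ) : ((Real.exp u : ℝ) : ℂ) ^ w = Complex.exp (u * w) := by
  rw [Complex.cpow_def_of_ne_zero (by exact_mod_cast (Real.exp_pos u).ne'), ← Complex.ofReal_log
    (Real.exp_pos u).le, Real.log_exp]

/-- The logistic substitution `x = e ^ u / (e ^ u + e ^ (-u))`. -/
def logistic (u : ℝ) : ℝ := Real.exp u * (1 / (2 * Real.cosh u))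

lemma one_sub_logistic (u : ℝ) : 1 - logistic u = Real.exp (-u) * (1 / (2 * Real.cosh u)) := by
  have := Real.cosh_pos u
  unfold logistic
  field_simp
  rw [Real.cosh_eq]
  ring

lemma hasDerivAt_logistic (u : ℝ) : HasDerivAt logistic (2 * (1 / (2 * Real.cosh u)) ^ 2) u := by
  have := Real.cosh_pos u
  have h := (Real.hasDerivAt_exp u).mul (((Real.hasDerivAt_cosh u).const_mul 2).inv (by positivity))
  have e : logistic = fun u => Real.exp u * (2 * Real.cosh u)⁻¹ := by
    funext u
    simp only [logistic, one_div]
  rw [e]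
  refine h.congr_deriv ?_
  have h1 : Real.cosh u - Real.sinh u = Real.exp (-u) := Real.cosh_sub_sinh u
  have h2 : Real.exp u * Real.exp (-u) = 1 := by rw [← Real.exp_add]; simp
  simp only [Pi.inv_apply]
  field_simp
  linear_combination Real.exp u * h1 + h2

lemma logistic_image : logistic '' Set.univ = Set.Ioo 0 1 := by
  ext x
  constructor
  · rintro ⟨u, -, rfl⟩
    have := Real.cosh_pos u
    refine ⟨by unfold logistic; positivity, ?_⟩
    have : 0 < 1 - logistic u := by rw [one_sub_logistic]; positivity
    linarith
  · rintro ⟨h0, h1⟩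
    refine ⟨Real.log (x / (1 - x)) / 2, trivial, ?_⟩
    set u := Real.log (x / (1 - x)) / 2
    have hx : 0 < x / (1 - x) := div_pos h0 (by linarith)
    have e1 : Real.exp u * Real.exp u = x / (1 - x) := by
      rw [← Real.exp_add, ← Real.exp_log hx]
      congr 1
      simp only [u]
      ring
    have e2 : Real.exp u * Real.exp (-u) = 1 := by rw [← Real.exp_add]; simp
    have hp := Real.exp_pos u
    unfold logistic
    rw [Real.cosh_eq]
    have h3 : (1 - x) ≠ 0 := by linarith
    field_simp at e1
    have : 0 < Real.exp u + Real.exp (-u) := by positivity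
    field_simp
    have h4 : Real.exp u * Real.exp u = x * (Real.exp u * Real.exp u + Real.exp u * Real.exp (-u)) := by
      rw [e2]
      linear_combination e1
    exact mul_left_cancel₀ hp.ne' (by linear_combination h4)

lemma logistic_injective : Function.Injective logistic := by
  refine (strictMono_of_hasDerivAt_pos hasDerivAt_logistic fun u => ?_).injective
  have := Real.cosh_pos u
  positivity

/-- With `x = e ^ u / (2 cosh u)` and `1 - x = e ^ (-u) / (2 cosh u)`, the Jacobian `2 (2 cosh u)⁻²`
supplies exactly the two powers of `2 cosh u` missing from the exponents `p - 1` and `q - 1`. -/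
lemma beta_integrand (u : ℝ) (p q : ℂ) :
    |2 * (1 / (2 * Real.cosh u)) ^ 2| •
      ((logistic u : ℂ) ^ (p - 1) * (1 - (logistic u : ℂ)) ^ (q - 1)) =
    2 * (Complex.exp (u * (p - q)) * ((1 / (2 * Real.cosh u) : ℝ) : ℂ) ^ (p + q)) := by
  have hc := Real.cosh_pos u
  have hy : 0 ≤ 1 / (2 * Real.cosh u) := by positivity
  have hyne : ((1 / (2 * Real.cosh u) : ℝ) : ℂ) ≠ 0 := by
    exact_mod_cast (show (1 / (2 * Real.cosh u) : ℝ) ≠ 0 by positivity)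
  have h1 : (1 - (logistic u : ℂ)) = ((1 - logistic u : ℝ) : ℂ) := by push_cast; rfl
  rw [h1, one_sub_logistic, abs_of_nonneg (by positivity)]
  unfold logistic
  rw [Complex.ofReal_mul, Complex.ofReal_mul (Real.exp (-u)),
    Complex.mul_cpow_ofReal_nonneg (Real.exp_pos _).le hy,
    Complex.mul_cpow_ofReal_nonneg (Real.exp_pos _).le hy, ofReal_exp_cpow, ofReal_exp_cpow]
  set y : ℂ := ((1 / (2 * Real.cosh u) : ℝ) : ℂ) with hyd
  have e1 : y ^ (p + q) = y ^ (p - 1) * y ^ (q - 1) * y ^ 2 := by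
    rw [← Complex.cpow_add _ _ hyne, ← Complex.cpow_natCast y 2, ← Complex.cpow_add _ _ hyne]
    congr 1
    push_cast
    ring
  have e2 : Complex.exp (u * (p - q)) = Complex.exp (u * (p - 1)) * Complex.exp ((-u : ℝ) * (q - 1)) := by
    rw [← Complex.exp_add]
    congr 1
    push_cast
    ring
  rw [e1, e2, Complex.real_smul, Complex.ofReal_mul, Complex.ofReal_pow, ← hyd]
  push_cast
  ring

lemma integral_exp_mul_cosh_cpow {p q : ℂ} (hp : 0 < p.re) (hq : 0 < q.re) :
    MeasureTheory.Integrable (fun u : ℝ =>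
      Complex.exp (u * (p - q)) * ((1 / (2 * Real.cosh u) : ℝ) : ℂ) ^ (p + q)) ∧
    ∫ u : ℝ, Complex.exp (u * (p - q)) * ((1 / (2 * Real.cosh u) : ℝ) : ℂ) ^ (p + q) =
      Complex.betaIntegral p q / 2 := by
  have hd : ∀ u ∈ (Set.univ : Set ℝ), HasDerivWithinAt logistic (2 * (1 / (2 * Real.cosh u)) ^ 2)
      Set.univ u := fun u _ => (hasDerivAt_logistic u).hasDerivWithinAt
  have e := MeasureTheory.integral_image_eq_integral_abs_deriv_smul MeasurableSet.univ hd
    logistic_injective.injOn (fun x : ℝ => (x : ℂ) ^ (p - 1) * (1 - (x : ℂ)) ^ (q - 1))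
  have i := MeasureTheory.integrableOn_image_iff_integrableOn_abs_deriv_smul MeasurableSet.univ hd
    logistic_injective.injOn (fun x : ℝ => (x : ℂ) ^ (p - 1) * (1 - (x : ℂ)) ^ (q - 1))
  simp only [beta_integrand, logistic_image, MeasureTheory.Measure.restrict_univ,
    MeasureTheory.integrableOn_univ] at e i
  constructor
  · have h1 := (intervalIntegrable_iff_integrableOn_Ioo_of_le zero_le_one).1
      (Complex.betaIntegral_convergent hp hq)
    have h2 := (i.1 h1).const_mul (1 / 2 : ℂ)
    refine h2.congr (Filter.Eventually.of_forall fun u => ?_)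
    simp only
    ring
  · rw [Complex.betaIntegral, intervalIntegral.integral_of_le zero_le_one,
      MeasureTheory.integral_Ioc_eq_integral_Ioo, e, MeasureTheory.integral_const_mul]
    ring

/-- Splitting `cosh (ν u)` into exponentials and reflecting `u` turns the half line into the whole
line, where the logistic substitution gives a Beta integral with parameters `(s + ν) / 2` and `(s -
ν) / 2`, of sum `s`. -/
lemma integral_Ioi_cosh_mul_cpow {ν : ℝ} {s : ℂ} (hs : |ν| < s.re) :
    MeasureTheory.IntegrableOn (fun u : ℝ =>
      (Real.cosh (ν * u) : ℂ) * ((1 / Real.cosh u : ℝ) : ℂ) ^ s) (Set.Ioi 0) ∧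
    Complex.Gamma s * ∫ u in Set.Ioi (0 : ℝ),
      (Real.cosh (ν * u) : ℂ) * ((1 / Real.cosh u : ℝ) : ℂ) ^ s =
      2 ^ (s - 2) * Complex.Gamma ((s - ν) / 2) * Complex.Gamma ((s + ν) / 2) := by
  have hp : 0 < ((s + ν) / 2).re := by
    have := neg_abs_le ν
    rw [show (s + ν) / 2 = (s + ν) * ((1 / 2 : ℝ) : ℂ) by push_cast; ring, Complex.re_mul_ofReal]
    simp only [Complex.add_re, Complex.ofReal_re]
    linarith
  have hq : 0 < ((s - ν) / 2).re := by
    have := le_abs_self ν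
    rw [show (s - ν) / 2 = (s - ν) * ((1 / 2 : ℝ) : ℂ) by push_cast; ring, Complex.re_mul_ofReal]
    simp only [Complex.sub_re, Complex.ofReal_re]
    linarith
  obtain ⟨hi, he⟩ := integral_exp_mul_cosh_cpow hp hq
  rw [show (s + ν) / 2 - (s - ν) / 2 = ν by ring, show (s + ν) / 2 + (s - ν) / 2 = s by ring] at hi he
  set h : ℝ → ℂ := fun u => Complex.exp (u * ν) * ((1 / (2 * Real.cosh u) : ℝ) : ℂ) ^ s with hh
  have h1 : ∀ u : ℝ, (Real.cosh (ν * u) : ℂ) * ((1 / Real.cosh u : ℝ) : ℂ) ^ s =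
      2 ^ (s - 1) * (h u + h (-u)) := by
    intro u
    have hc := Real.cosh_pos u
    have e1 : ((1 / (2 * Real.cosh u) : ℝ) : ℂ) ^ s = 2 ^ (-s) * ((1 / Real.cosh u : ℝ) : ℂ) ^ s := by
      rw [show (1 / (2 * Real.cosh u) : ℝ) = 2⁻¹ * (1 / Real.cosh u) by field_simp,
        Complex.ofReal_mul, Complex.mul_cpow_ofReal_nonneg (by norm_num) (by positivity),
        Complex.cpow_neg]
      congr 1
      push_cast
      rw [Complex.inv_cpow _ _ (by
        rw [show (2 : ℂ) = ((2 : ℝ) : ℂ) by norm_num, Complex.arg_ofReal_of_nonneg (by norm_num)]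
        exact Real.pi_pos.ne)]
    have e2 : (2 : ℂ) ^ (s - 1) * 2 ^ (-s) = 1 / 2 := by
      rw [← Complex.cpow_add _ _ two_ne_zero, show s - 1 + -s = -1 by ring, Complex.cpow_neg_one]
      norm_num
    simp only [hh, Real.cosh_neg]
    rw [e1]
    have e3 : (Real.cosh (ν * u) : ℂ) = (Complex.exp (u * ν) + Complex.exp ((-u : ℝ) * ν)) / 2 := by
      rw [Complex.ofReal_cosh, Complex.cosh]
      push_cast
      ring_nf
    rw [e3]
    linear_combination (-(Complex.exp (u * ν) + Complex.exp ((-u : ℝ) * ν)) *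
      ((1 / Real.cosh u : ℝ) : ℂ) ^ s) * e2
  have hi2 : MeasureTheory.Integrable (fun u => h (-u)) := hi.comp_neg
  constructor
  · refine MeasureTheory.IntegrableOn.congr_fun
      (((hi.add hi2).const_mul (2 ^ (s - 1))).integrableOn) (fun u _ => (h1 u).symm) measurableSet_Ioi
  · simp only [h1]
    rw [MeasureTheory.integral_const_mul, MeasureTheory.integral_add hi.integrableOn hi2.integrableOn,
      integral_comp_neg_Ioi, neg_zero, add_comm, ← Set.compl_Iic,
      MeasureTheory.integral_add_compl measurableSet_Iic hi, he, mul_assoc (2 ^ (s - 2)),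
      mul_comm (Complex.Gamma ((s - ν) / 2)), Complex.Gamma_mul_Gamma_eq_betaIntegral hp hq,
      show (s + ν) / 2 + (s - ν) / 2 = s by ring]
    have : (2 : ℂ) ^ (s - 1) = 2 ^ (s - 2) * 2 := by
      rw [show s - 1 = s - 2 + 1 by ring, Complex.cpow_add _ _ two_ne_zero, Complex.cpow_one]
    rw [this]
    ring

/-- Fubini: for fixed `u` the integral over `t` is Euler's integral for `Γ(s) (cosh u)⁻ˢ`, and the
remaining integral over `u` is `integral_Ioi_cosh_mul_cpow`. -/
theorem mellin_besselK {ν : ℝ} {s : ℂ} (hs : |ν| < s.re) :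
    MeasureTheory.IntegrableOn (fun t : ℝ => (t : ℂ) ^ (s - 1) * (besselK ν t : ℂ)) (Set.Ioi 0) ∧
    ∫ t in Set.Ioi (0 : ℝ), (t : ℂ) ^ (s - 1) * (besselK ν t : ℂ) =
      2 ^ (s - 2) * Complex.Gamma ((s - ν) / 2) * Complex.Gamma ((s + ν) / 2) := by
  have hs0 : 0 < s.re := (abs_nonneg ν).trans_lt hs
  set f : ℝ → ℝ → ℂ := fun t u => (t : ℂ) ^ (s - 1) *
    ((Real.exp (-t * Real.cosh u) * Real.cosh (ν * u) : ℝ) : ℂ) with hf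
  have hin : ∀ t : ℝ, (t : ℂ) ^ (s - 1) * (besselK ν t : ℂ) = ∫ u in Set.Ioi (0 : ℝ), f t u := by
    intro t
    simp only [hf]
    rw [MeasureTheory.integral_const_mul, integral_complex_ofReal]
    rfl
  have hg : ∀ u : ℝ, ∀ σ : ℂ, 0 < σ.re → ∫ t in Set.Ioi (0 : ℝ), (t : ℂ) ^ (σ - 1) *
      ((Real.exp (-t * Real.cosh u) * Real.cosh (ν * u) : ℝ) : ℂ) =
      Complex.Gamma σ * ((Real.cosh (ν * u) : ℂ) * ((1 / Real.cosh u : ℝ) : ℂ) ^ σ) := by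
    intro u σ hσ
    have := Complex.integral_cpow_mul_exp_neg_mul_Ioi hσ (Real.cosh_pos u)
    push_cast at this ⊢
    calc _ = ∫ t in Set.Ioi (0 : ℝ), (t : ℂ) ^ (σ - 1) * Complex.exp (-(Complex.cosh u * t)) *
          Complex.cosh (ν * u) := by
            refine MeasureTheory.integral_congr_ae (Filter.Eventually.of_forall fun t => ?_)
            simp only
            rw [show -(t : ℂ) * Complex.cosh u = -(Complex.cosh u * t) by ring]
            ring
      _ = _ := by
            rw [MeasureTheory.integral_mul_const, this]
            ring
  have hnorm : ∀ t ∈ Set.Ioi (0 : ℝ), ∀ u, ‖f t u‖ = t ^ (s.re - 1) *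
      (Real.exp (-t * Real.cosh u) * Real.cosh (ν * u)) := by
    intro t ht u
    simp only [hf]
    rw [norm_mul, Complex.norm_cpow_eq_rpow_re_of_pos ht, Complex.norm_real,
      Real.norm_of_nonneg (by positivity)]
    simp
  have hint : MeasureTheory.Integrable (Function.uncurry f)
      ((MeasureTheory.volume.restrict (Set.Ioi 0)).prod (MeasureTheory.volume.restrict (Set.Ioi 0))) := by
    have hmeas : MeasureTheory.AEStronglyMeasurable (Function.uncurry f)
        ((MeasureTheory.volume.restrict (Set.Ioi 0)).prod
          (MeasureTheory.volume.restrict (Set.Ioi 0))) := by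
      refine Measurable.aestronglyMeasurable ?_
      simp only [hf, Function.uncurry_def]
      fun_prop
    rw [MeasureTheory.integrable_prod_iff' hmeas]
    constructor
    · refine Filter.Eventually.of_forall fun u => ?_
      have h1 := integrableOn_rpow_mul_exp_neg_mul_rpow (s := s.re - 1) (p := 1) (b := Real.cosh u)
        (by linarith) one_pos (Real.cosh_pos u)
      have h2 := h1.mul_const (Real.cosh (ν * u))
      refine MeasureTheory.Integrable.mono' h2 ?_ ?_
      · refine Measurable.aestronglyMeasurable ?_
        simp only [hf, Function.uncurry_def]
        fun_prop
      · refine (MeasureTheory.ae_restrict_iff' measurableSet_Ioi).2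
          (Filter.Eventually.of_forall fun t ht => le_of_eq ?_)
        have := hnorm t ht u
        simp only [Function.uncurry_apply_pair] at this ⊢
        rw [this, Real.rpow_one, mul_assoc, show -t * Real.cosh u = -Real.cosh u * t by ring]
    -- Absolute convergence is the same computation with `s` replaced by its real part.
    · have h1 := ((integral_Ioi_cosh_mul_cpow (ν := ν) (s := (s.re : ℂ)) (by simpa using hs)).1.norm).const_mul
        ‖Complex.Gamma (s.re : ℂ)‖
      refine h1.congr (Filter.Eventually.of_forall fun u => ?_)
      simp only
      rw [← norm_mul, ← hg u _ (by simpa using hs0)]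
      have e : ∀ t ∈ Set.Ioi (0 : ℝ), (t : ℂ) ^ ((s.re : ℂ) - 1) *
          ((Real.exp (-t * Real.cosh u) * Real.cosh (ν * u) : ℝ) : ℂ) = ((‖f t u‖ : ℝ) : ℂ) := by
        intro t ht
        rw [hnorm t ht u, Complex.ofReal_mul (t ^ (s.re - 1)), Complex.ofReal_cpow (le_of_lt ht)]
        push_cast
        rfl
      rw [MeasureTheory.setIntegral_congr_fun measurableSet_Ioi e, integral_complex_ofReal, Complex.norm_real,
        Real.norm_of_nonneg (MeasureTheory.integral_nonneg fun t => norm_nonneg _)]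
      rfl
  constructor
  · refine hint.integral_prod_left.congr (Filter.Eventually.of_forall fun t => ?_)
    exact (hin t).symm
  · simp only [hin]
    rw [MeasureTheory.integral_integral_swap hint]
    simp only [hf]
    rw [← (integral_Ioi_cosh_mul_cpow hs).2, ← MeasureTheory.integral_const_mul]
    exact MeasureTheory.integral_congr_ae (Filter.Eventually.of_forall fun u => hg u s hs0)

end

section

/-! ### Invariant differential operators on `GL₂(ℂ)` -/

/-- The open set of invertible matrices. -/
def invertibleMatrices : Set (Fin 2 → Fin 2 → ℂ) := {A | (Matrix.of A).det ≠ 0}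

lemma isOpen_invertibleMatrices : IsOpen invertibleMatrices := by
  refine isOpen_ne_fun ?_ continuous_const
  simp only [Matrix.det_fin_two, Matrix.of_apply]
  fun_prop

/-- Right multiplication by a matrix. -/
def mulRight (X : Matrix (Fin 2) (Fin 2) ℂ) : (Fin 2 → Fin 2 → ℂ) →L[ℝ] (Fin 2 → Fin 2 → ℂ) :=
  LinearMap.toContinuousLinearMap
    { toFun := fun A => Matrix.of.symm (Matrix.of A * X)
      map_add' := fun A B => by rw [← Matrix.of_add_of, add_mul]; rfl
      map_smul' := fun c A => by rw [← Matrix.smul_of, Matrix.smul_mul]; rfl }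

@[simp] lemma mulRight_apply (X : Matrix (Fin 2) (Fin 2) ℂ) (A : Fin 2 → Fin 2 → ℂ) :
    mulRight X A = Matrix.of.symm (Matrix.of A * X) := rfl

section operators

variable {N : ℕ} {Φ Ψ : (Fin 2 → Fin 2 → ℂ) → V N} {A : Fin 2 → Fin 2 → ℂ}

lemma lieDeriv_apply (X : Matrix (Fin 2) (Fin 2) ℂ) :
    lieDeriv X Φ A = fderiv ℝ Φ A (mulRight X A) := rfl

lemma differentiableAt_of_smooth (h : ContDiffOn ℝ (⊤ : ℕ∞) Φ invertibleMatrices)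
    (hA : A ∈ invertibleMatrices) : DifferentiableAt ℝ Φ A :=
  (h.contDiffAt (isOpen_invertibleMatrices.mem_nhds hA)).differentiableAt (by simp)

lemma lieDeriv_smooth (h : ContDiffOn ℝ (⊤ : ℕ∞) Φ invertibleMatrices)
    (X : Matrix (Fin 2) (Fin 2) ℂ) : ContDiffOn ℝ (⊤ : ℕ∞) (lieDeriv X Φ) invertibleMatrices := by
  have h1 : ContDiffOn ℝ (⊤ : ℕ∞) (fderiv ℝ Φ) invertibleMatrices :=
    h.fderiv_of_isOpen isOpen_invertibleMatrices (by simp)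
  exact h1.clm_apply (mulRight X).contDiff.contDiffOn

lemma lieDeriv_congr (h : ∀ B ∈ invertibleMatrices, Φ B = Ψ B) (hA : A ∈ invertibleMatrices)
    (X : Matrix (Fin 2) (Fin 2) ℂ) : lieDeriv X Φ A = lieDeriv X Ψ A := by
  rw [lieDeriv_apply, lieDeriv_apply, Filter.EventuallyEq.fderiv_eq]
  filter_upwards [isOpen_invertibleMatrices.mem_nhds hA] with B hB using h B hB

lemma lieDeriv_add_left (X Y : Matrix (Fin 2) (Fin 2) ℂ) :
    lieDeriv (X + Y) Φ A = lieDeriv X Φ A + lieDeriv Y Φ A := by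
  simp only [lieDeriv_apply, mulRight_apply, Matrix.mul_add]
  exact map_add (fderiv ℝ Φ A) _ _

lemma lieDeriv_smul_left (c : ℝ) (X : Matrix (Fin 2) (Fin 2) ℂ) :
    lieDeriv (c • X) Φ A = c • lieDeriv X Φ A := by
  simp only [lieDeriv_apply, mulRight_apply, Matrix.mul_smul]
  exact map_smul (fderiv ℝ Φ A) _ _

lemma lieDeriv_neg_left (X : Matrix (Fin 2) (Fin 2) ℂ) :
    lieDeriv (-X) Φ A = -lieDeriv X Φ A := by
  rw [← neg_one_smul ℝ X, lieDeriv_smul_left, neg_one_smul]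

lemma lieDeriv_sub_left (X Y : Matrix (Fin 2) (Fin 2) ℂ) :
    lieDeriv (X - Y) Φ A = lieDeriv X Φ A - lieDeriv Y Φ A := by
  rw [sub_eq_add_neg, lieDeriv_add_left, lieDeriv_neg_left, sub_eq_add_neg]

lemma lieDeriv_add (hΦ : DifferentiableAt ℝ Φ A) (hΨ : DifferentiableAt ℝ Ψ A)
    (X : Matrix (Fin 2) (Fin 2) ℂ) :
    lieDeriv X (fun B => Φ B + Ψ B) A = lieDeriv X Φ A + lieDeriv X Ψ A := by
  simp only [lieDeriv_apply]
  rw [fderiv_fun_add hΦ hΨ]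
  rfl

lemma lieDeriv_map (T : V N →ₗ[ℂ] V N) (hΦ : DifferentiableAt ℝ Φ A)
    (X : Matrix (Fin 2) (Fin 2) ℂ) :
    lieDeriv X (fun B => T (Φ B)) A = T (lieDeriv X Φ A) := by
  simp only [lieDeriv_apply]
  have h := ((LinearMap.toContinuousLinearMap (T.restrictScalars ℝ)).hasFDerivAt.comp A
    hΦ.hasFDerivAt).fderiv
  have e : (fun B => T (Φ B)) = (LinearMap.toContinuousLinearMap (T.restrictScalars ℝ)) ∘ Φ := rfl
  rw [e, h]
  rfl

lemma lieDeriv_smul (c : ℂ) (hΦ : DifferentiableAt ℝ Φ A) (X : Matrix (Fin 2) (Fin 2) ℂ) :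
    lieDeriv X (fun B => c • Φ B) A = c • lieDeriv X Φ A :=
  lieDeriv_map (c • LinearMap.id) hΦ X

/-- The vector field `A ↦ A * Y` is not constant: its derivative in the direction `A * X` is `A * X
* Y`, whence the first order term. Antisymmetrizing gives the commutator rule `lieDeriv_comm`. -/
lemma lieDeriv_lieDeriv (h : ContDiffOn ℝ (⊤ : ℕ∞) Φ invertibleMatrices)
    (hA : A ∈ invertibleMatrices) (X Y : Matrix (Fin 2) (Fin 2) ℂ) :
    lieDeriv X (lieDeriv Y Φ) A =
      fderiv ℝ (fderiv ℝ Φ) A (mulRight X A) (mulRight Y A) + lieDeriv (X * Y) Φ A := by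
  have h1 : DifferentiableAt ℝ (fderiv ℝ Φ) A :=
    ((h.fderiv_of_isOpen isOpen_invertibleMatrices (m := (⊤ : ℕ∞)) (by simp)).contDiffAt
      (isOpen_invertibleMatrices.mem_nhds hA)).differentiableAt (by simp)
  have h2 := (h1.hasFDerivAt.clm_apply (mulRight Y).hasFDerivAt).fderiv
  rw [lieDeriv_apply]
  have e : lieDeriv Y Φ = fun B => fderiv ℝ Φ B (mulRight Y B) := rfl
  rw [e, h2]
  simp only [add_apply, ContinuousLinearMap.comp_apply,
    ContinuousLinearMap.flip_apply]
  rw [add_comm]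
  congr 1
  simp [lieDeriv_apply, Matrix.mul_assoc]

lemma lieDeriv_comm (h : ContDiffOn ℝ (⊤ : ℕ∞) Φ invertibleMatrices)
    (hA : A ∈ invertibleMatrices) (X Y : Matrix (Fin 2) (Fin 2) ℂ) :
    lieDeriv X (lieDeriv Y Φ) A =
      lieDeriv Y (lieDeriv X Φ) A + lieDeriv (X * Y - Y * X) Φ A := by
  have h1 : IsSymmSndFDerivAt ℝ Φ A :=
    (h.contDiffAt (isOpen_invertibleMatrices.mem_nhds hA)).isSymmSndFDerivAt
      (by simp only [minSmoothness_of_isRCLikeNormedField]; exact WithTop.coe_le_coe.2 (le_top : (2 : ℕ∞) ≤ ⊤))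
  rw [lieDeriv_lieDeriv h hA, lieDeriv_lieDeriv h hA, lieDeriv_sub_left, h1.eq]
  abel

lemma lieComp_smooth (h : ContDiffOn ℝ (⊤ : ℕ∞) Φ invertibleMatrices) (ε : ℂ)
    (X : Matrix (Fin 2) (Fin 2) ℂ) : ContDiffOn ℝ (⊤ : ℕ∞) (lieComp ε X Φ) invertibleMatrices :=
  ((lieDeriv_smooth h X).sub ((lieDeriv_smooth h _).const_smul _)).const_smul _

lemma lieComp_congr (h : ∀ B ∈ invertibleMatrices, Φ B = Ψ B) (hA : A ∈ invertibleMatrices) (ε : ℂ)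
    (X : Matrix (Fin 2) (Fin 2) ℂ) : lieComp ε X Φ A = lieComp ε X Ψ A := by
  simp only [lieComp, lieDeriv_congr h hA]

lemma lieComp_add (hΦ : DifferentiableAt ℝ Φ A) (hΨ : DifferentiableAt ℝ Ψ A) (ε : ℂ)
    (X : Matrix (Fin 2) (Fin 2) ℂ) :
    lieComp ε X (fun B => Φ B + Ψ B) A = lieComp ε X Φ A + lieComp ε X Ψ A := by
  simp only [lieComp, lieDeriv_add hΦ hΨ]
  module

lemma lieComp_map (T : V N →ₗ[ℂ] V N) (hΦ : DifferentiableAt ℝ Φ A) (ε : ℂ)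
    (X : Matrix (Fin 2) (Fin 2) ℂ) :
    lieComp ε X (fun B => T (Φ B)) A = T (lieComp ε X Φ A) := by
  simp only [lieComp, lieDeriv_map T hΦ, map_smul, map_sub]

lemma lieComp_lieComp (h : ContDiffOn ℝ (⊤ : ℕ∞) Φ invertibleMatrices)
    (hA : A ∈ invertibleMatrices) (ε ε' : ℂ) (X Y : Matrix (Fin 2) (Fin 2) ℂ) :
    lieComp ε X (lieComp ε' Y Φ) A = (1 / 4 : ℂ) • (lieDeriv X (lieDeriv Y Φ) A
      - (ε' * Complex.I) • lieDeriv X (lieDeriv (Complex.I • Y) Φ) A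
      - (ε * Complex.I) • lieDeriv (Complex.I • X) (lieDeriv Y Φ) A
      - (ε * ε') • lieDeriv (Complex.I • X) (lieDeriv (Complex.I • Y) Φ) A) := by
  have d : ∀ Z, DifferentiableAt ℝ (lieDeriv Z Φ) A := fun Z =>
    differentiableAt_of_smooth (lieDeriv_smooth h Z) hA
  have e : lieComp ε' Y Φ = fun A => (1 / 2 : ℂ) • lieDeriv Y Φ A +
      (-(1 / 2) * (ε' * Complex.I)) • lieDeriv (Complex.I • Y) Φ A := by
    funext B
    simp only [lieComp]
    module
  have k : ∀ Z, lieDeriv Z (lieComp ε' Y Φ) A = (1 / 2 : ℂ) • lieDeriv Z (lieDeriv Y Φ) A +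
      (-(1 / 2) * (ε' * Complex.I)) • lieDeriv Z (lieDeriv (Complex.I • Y) Φ) A := by
    intro Z
    rw [e, lieDeriv_add ((d _).fun_const_smul _) ((d _).fun_const_smul _), lieDeriv_smul _ (d _),
      lieDeriv_smul _ (d _)]
  rw [lieComp, k, k]
  match_scalars <;> first | ring1 | (ring_nf; simp only [Complex.I_sq]; ring1)

/-- Because `ε² = 1` and `[i X, i Y] = -[X, Y]`, the four commutators coming from `½ (X - ε i · (i
X))` recombine into the same expression for `[X, Y]`. -/
lemma lieComp_comm (h : ContDiffOn ℝ (⊤ : ℕ∞) Φ invertibleMatrices)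
    (hA : A ∈ invertibleMatrices) {ε : ℂ} (hε : ε * ε = 1) (X Y : Matrix (Fin 2) (Fin 2) ℂ) :
    lieComp ε X (lieComp ε Y Φ) A =
      lieComp ε Y (lieComp ε X Φ) A + lieComp ε (X * Y - Y * X) Φ A := by
  rw [lieComp_lieComp h hA, lieComp_lieComp h hA, lieDeriv_comm h hA X Y,
    lieDeriv_comm h hA X (Complex.I • Y), lieDeriv_comm h hA (Complex.I • X) Y,
    lieDeriv_comm h hA (Complex.I • X) (Complex.I • Y), hε, lieComp]
  have e1 : X * (Complex.I • Y) - (Complex.I • Y) * X = Complex.I • (X * Y - Y * X) := by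
    simp [smul_sub]
  have e2 : (Complex.I • X) * Y - Y * (Complex.I • X) = Complex.I • (X * Y - Y * X) := by
    simp [smul_sub]
  have e3 : (Complex.I • X) * (Complex.I • Y) - (Complex.I • Y) * (Complex.I • X) =
      -(X * Y - Y * X) := by
    simp only [Matrix.smul_mul, Matrix.mul_smul, smul_smul, Complex.I_mul_I]
    module
  rw [e1, e2, e3, lieDeriv_neg_left]
  module

end operators

/-! ### The infinitesimal action on homogeneous polynomials -/

/-- The derivative of `rho` at the identity. -/
def drho (N : ℕ) (X : Matrix (Fin 2) (Fin 2) ℂ) : V N →ₗ[ℂ] V N where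
  toFun P := fun n => (((N : ℂ) - (n : ℕ)) * X 0 0 + (n : ℕ) * X 1 1) * P n
    - X 0 1 * ((N : ℂ) + 1 - (n : ℕ)) * (if (n : ℕ) = 0 then 0 else V.comp P (n - 1))
    - X 1 0 * ((n : ℕ) + 1) * V.comp P (n + 1)
  map_add' P Q := by
    funext n
    simp only [V.comp, Pi.add_apply]
    split_ifs <;> ring
  map_smul' c P := by
    funext n
    simp only [V.comp, Pi.smul_apply, smul_eq_mul, RingHom.id_apply]
    split_ifs <;> ring

lemma drho_apply {N : ℕ} (X : Matrix (Fin 2) (Fin 2) ℂ) (P : V N) (n : Fin (N + 1)) :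
    drho N X P n = (((N : ℂ) - (n : ℕ)) * X 0 0 + (n : ℕ) * X 1 1) * P n
    - X 0 1 * ((N : ℂ) + 1 - (n : ℕ)) * (if (n : ℕ) = 0 then 0 else V.comp P (n - 1))
    - X 1 0 * ((n : ℕ) + 1) * V.comp P (n + 1) := rfl

/-- Coefficientwise differentiability of a curve of polynomials. -/
def HasCoeffDeriv (p : ℝ → Polynomial ℂ) (p' : Polynomial ℂ) (s : ℝ) : Prop :=
  ∀ n, HasDerivAt (fun s => (p s).coeff n) (p'.coeff n) s

lemma HasCoeffDeriv.mul {p q : ℝ → Polynomial ℂ} {p' q' : Polynomial ℂ} {s : ℝ}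
    (hp : HasCoeffDeriv p p' s) (hq : HasCoeffDeriv q q' s) :
    HasCoeffDeriv (fun s => p s * q s) (p' * q s + p s * q') s := by
  intro n
  simp only [Polynomial.coeff_add, Polynomial.coeff_mul, ← Finset.sum_add_distrib]
  exact HasDerivAt.fun_sum fun i _ => (hp i.1).mul (hq i.2)

lemma HasCoeffDeriv.pow {p : ℝ → Polynomial ℂ} {p' : Polynomial ℂ} {s : ℝ}
    (hp : HasCoeffDeriv p p' s) (n : ℕ) :
    HasCoeffDeriv (fun s => p s ^ n) (n * p s ^ (n - 1) * p') s := by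
  induction n with
  | zero => intro m; simpa using hasDerivAt_const _ _
  | succ n ih =>
    have h := ih.mul hp
    simp only [← pow_succ] at h
    convert h using 1
    rcases n with _ | n
    · simp
    · simp only [Nat.add_sub_cancel, Nat.cast_add, Nat.cast_one, pow_succ]
      ring

lemma hasCoeffDeriv_linear {a b : ℝ → ℂ} {a' b' : ℂ} {s : ℝ} (ha : HasDerivAt a a' s)
    (hb : HasDerivAt b b' s) :
    HasCoeffDeriv (fun s => Polynomial.C (a s) + Polynomial.C (b s) * Polynomial.X)
      (Polynomial.C a' + Polynomial.C b' * Polynomial.X) s := by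
  intro n
  simp only [Polynomial.coeff_add, Polynomial.coeff_C, Polynomial.coeff_C_mul, Polynomial.coeff_X]
  refine HasDerivAt.add ?_ (hb.mul_const _)
  split_ifs
  · exact ha
  · exact hasDerivAt_const _ _

/-- At the identity the two linear forms are `1` and `X`, so after the product rule only the
monomials with index `n - 1`, `n` and `n + 1` contribute to the coefficient `n`. -/
lemma hasDerivAt_rho {N : ℕ} (P : V N) {γ : ℝ → Matrix (Fin 2) (Fin 2) ℂ}
    {X : Matrix (Fin 2) (Fin 2) ℂ} (h1 : γ 0 = 1)
    (h : ∀ i j, HasDerivAt (fun s => γ s i j) (X i j) 0) :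
    HasDerivAt (fun s => rho N (γ s) P) (drho N X P) 0 := by
  rw [hasDerivAt_pi]
  intro n
  simp only [rho, Polynomial.finsetSum_coeff]
  have key : ∀ m : Fin (N + 1), HasDerivAt (fun s => (Polynomial.C (P m) *
      (Polynomial.C (γ s 0 0) - Polynomial.C (γ s 0 1) * Polynomial.X) ^ (N - (m : ℕ)) *
      (-Polynomial.C (γ s 1 0) + Polynomial.C (γ s 1 1) * Polynomial.X) ^ (m : ℕ)).coeff n)
      (P m * (((N : ℂ) - (m : ℕ)) * (X 0 0 * (if n = m then 1 else 0) -
        X 0 1 * (if (n : ℕ) = m + 1 then 1 else 0)) +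
        (m : ℕ) * (-X 1 0 * (if (n : ℕ) + 1 = m then 1 else 0) + X 1 1 * (if n = m then 1 else 0)))) 0 := by
    intro m
    have e1 := (hasCoeffDeriv_linear (h 0 0) ((h 0 1).neg)).pow (N - m)
    have e2 := (hasCoeffDeriv_linear ((h 1 0).neg) (h 1 1)).pow m
    have e3 := (e1.mul e2) n
    have e4 := e3.const_mul (P m)
    simp only [Pi.neg_apply, h1, Matrix.one_apply_eq, Polynomial.C_neg, neg_mul] at e4
    have e5 : ∀ s, (Polynomial.C (P m) *
      (Polynomial.C (γ s 0 0) - Polynomial.C (γ s 0 1) * Polynomial.X) ^ (N - (m : ℕ)) *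
      (-Polynomial.C (γ s 1 0) + Polynomial.C (γ s 1 1) * Polynomial.X) ^ (m : ℕ)).coeff n =
      P m * (((Polynomial.C (γ s 0 0) + -(Polynomial.C (γ s 0 1) * Polynomial.X)) ^ (N - (m : ℕ)) *
      (-Polynomial.C (γ s 1 0) + Polynomial.C (γ s 1 1) * Polynomial.X) ^ (m : ℕ)).coeff n) := by
      intro s
      rw [mul_assoc, Polynomial.coeff_C_mul, sub_eq_add_neg]
    simp only [e5]
    refine e4.congr_deriv ?_
    congr 1
    simp only [ne_eq, zero_ne_one, one_ne_zero, not_false_eq_true, Matrix.one_apply_ne, map_zero,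
      zero_mul, neg_zero, add_zero, map_one, one_pow, mul_one, one_mul, zero_add]
    have hm : ((N - (m : ℕ) : ℕ) : ℂ) = (N : ℂ) - (m : ℕ) := Nat.cast_sub (by omega)
    have hn : (n = m) ↔ ((n : ℕ) = m) := Fin.ext_iff
    rw [Polynomial.coeff_add, mul_assoc, mul_assoc, ← Polynomial.C_eq_natCast, ← Polynomial.C_eq_natCast,
      Polynomial.coeff_C_mul, Polynomial.coeff_C_mul, hm]
    congr 1
    · congr 1
      rw [add_mul, neg_mul, mul_assoc, ← pow_succ', Polynomial.coeff_add, Polynomial.coeff_neg,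
        Polynomial.coeff_C_mul, Polynomial.coeff_C_mul, Polynomial.coeff_X_pow, Polynomial.coeff_X_pow]
      simp only [hn]
      ring
    · rcases Nat.eq_zero_or_pos (m : ℕ) with h0 | h0
      · simp [h0]
      · congr 1
        rw [mul_add, mul_neg, mul_left_comm _ (Polynomial.C (X 1 1)), ← pow_succ,
          Nat.sub_add_cancel h0, mul_comm _ (Polynomial.C (X 1 0)), Polynomial.coeff_add,
          Polynomial.coeff_neg, Polynomial.coeff_C_mul, Polynomial.coeff_C_mul,
          Polynomial.coeff_X_pow, Polynomial.coeff_X_pow]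
        have : ((n : ℕ) = m - 1) ↔ ((n : ℕ) + 1 = m) := by omega
        simp only [hn, this]
        ring
  refine (HasDerivAt.fun_sum fun m _ => key m).congr_deriv ?_
  have s1 : ∀ c : Fin (N + 1) → ℂ, ∑ m, c m * (if n = m then 1 else 0) = c n := by
    intro c; simp
  have s2 : ∀ c : ℕ → ℂ, ∑ m : Fin (N + 1), c m * P m * (if (n : ℕ) = m + 1 then 1 else 0) =
      if (n : ℕ) = 0 then 0 else c (n - 1) * V.comp P (n - 1) := by
    intro c
    split_ifs with h0
    · refine Finset.sum_eq_zero fun m _ => ?_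
      rw [if_neg (by omega), mul_zero]
    · have hlt : (n : ℕ) - 1 < N + 1 := by omega
      rw [Finset.sum_eq_single ⟨(n : ℕ) - 1, hlt⟩]
      · rw [V.comp, dif_pos hlt, if_pos (by simp only; omega), mul_one]
      · intro m _ hm
        rw [if_neg, mul_zero]
        intro h
        exact hm (Fin.ext (by simp only; omega))
      · simp
  have s3 : ∀ c : ℕ → ℂ, ∑ m : Fin (N + 1), c m * P m * (if (n : ℕ) + 1 = m then 1 else 0) =
      c (n + 1) * V.comp P (n + 1) := by
    intro c
    rw [V.comp]
    split_ifs with h0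
    · rw [Finset.sum_eq_single ⟨(n : ℕ) + 1, h0⟩]
      · rw [if_pos rfl, mul_one]
      · intro m _ hm
        rw [if_neg, mul_zero]
        intro h
        exact hm (Fin.ext h.symm)
      · simp
    · rw [mul_zero]
      refine Finset.sum_eq_zero fun m _ => ?_
      rw [if_neg (by omega), mul_zero]
  have e : ∀ m : Fin (N + 1), P m * (((N : ℂ) - (m : ℕ)) * (X 0 0 * (if n = m then 1 else 0) -
        X 0 1 * (if (n : ℕ) = m + 1 then 1 else 0)) +
        (m : ℕ) * (-X 1 0 * (if (n : ℕ) + 1 = m then 1 else 0) + X 1 1 * (if n = m then 1 else 0))) =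
      ((((N : ℂ) - (m : ℕ)) * X 0 0 + (m : ℕ) * X 1 1) * P m) * (if n = m then 1 else 0)
      - (fun m : ℕ => X 0 1 * ((N : ℂ) - m)) m * P m * (if (n : ℕ) = m + 1 then 1 else 0)
      - (fun m : ℕ => X 1 0 * (m : ℂ)) m * P m * (if (n : ℕ) + 1 = m then 1 else 0) := by
    intro m
    ring
  have t2 := s2 fun m : ℕ => X 0 1 * ((N : ℂ) - m)
  have t3 := s3 fun m : ℕ => X 1 0 * (m : ℂ)
  simp only [e, Finset.sum_sub_distrib]
  rw [s1, t2, t3, drho_apply]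
  split_ifs with h0
  · push_cast; ring
  · have : (((n : ℕ) - 1 : ℕ) : ℂ) = (n : ℕ) - 1 := by
      rw [Nat.cast_sub (by omega)]; simp
    rw [this]
    push_cast
    ring

end

section

/-! ### The archimedean component of a Bianchi modular form -/

/-- The properties of `g ↦ F g x` used in the archimedean analysis. -/
structure IsArchimedeanForm (k ℓ : ℕ) (Φ : (Fin 2 → Fin 2 → ℂ) → V (k + ℓ + 2)) : Prop where
  smooth : ContDiffOn ℝ (⊤ : ℕ∞) Φ invertibleMatrices
  unitary : ∀ A ∈ invertibleMatrices, ∀ u ∈ Matrix.specialUnitaryGroup (Fin 2) ℂ,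
    Φ (Matrix.of.symm (Matrix.of A * u)) = rho (k + ℓ + 2) u (Φ A)
  central : ∀ A ∈ invertibleMatrices, ∀ z : ℂ, z ≠ 0 →
    Φ (z • A) = (z ^ (-(k : ℤ)) * conj z ^ (-(ℓ : ℤ))) • Φ A
  casimir_id : ∀ A ∈ invertibleMatrices, casimir 1 Φ A = ((k : ℂ) ^ 2 / 2 + k) • Φ A
  casimir_conj : ∀ A ∈ invertibleMatrices, casimir (-1) Φ A = ((ℓ : ℂ) ^ 2 / 2 + ℓ) • Φ A
  growth : ∃ (C : ℝ) (M : ℕ), ∀ A ∈ invertibleMatrices,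
    ‖Φ A‖ ≤ C * (∑ i, ∑ j, ‖A i j‖ + ‖((Matrix.of A).det)⁻¹‖) ^ M

namespace IsArchimedeanForm

variable {k ℓ : ℕ} {Φ : (Fin 2 → Fin 2 → ℂ) → V (k + ℓ + 2)} {A : Fin 2 → Fin 2 → ℂ}

lemma hasDerivAt_mul_curve (A : Fin 2 → Fin 2 → ℂ) {u : ℝ → Matrix (Fin 2) (Fin 2) ℂ}
    {X : Matrix (Fin 2) (Fin 2) ℂ} (hu : ∀ i j, HasDerivAt (fun s => u s i j) (X i j) 0) :
    HasDerivAt (fun s => Matrix.of.symm (Matrix.of A * u s)) (mulRight X A) 0 := by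
  rw [hasDerivAt_pi]
  intro i
  rw [hasDerivAt_pi]
  intro j
  simp only [mulRight_apply, Matrix.of_symm_apply, Matrix.mul_apply, Matrix.of_apply]
  exact HasDerivAt.fun_sum fun m _ => (hu m j).const_mul _

/-- The parameter `-1` is exempt because the central curve `(1 + s) • 1`, to which this is applied,
degenerates there; only `s` near `0` matters. -/
lemma lieDeriv_eq_of_curve {N : ℕ} {Φ : (Fin 2 → Fin 2 → ℂ) → V N}
    (hΦ : DifferentiableAt ℝ Φ A) {u : ℝ → Matrix (Fin 2) (Fin 2) ℂ}
    {X : Matrix (Fin 2) (Fin 2) ℂ} (h1 : u 0 = 1)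
    (hu : ∀ i j, HasDerivAt (fun s => u s i j) (X i j) 0) {g : ℝ → V N} {g' : V N}
    (hg : HasDerivAt g g' 0) (h : ∀ s, s ≠ -1 → Φ (Matrix.of.symm (Matrix.of A * u s)) = g s) :
    lieDeriv X Φ A = g' := by
  have e0 : Matrix.of.symm (Matrix.of A * u 0) = A := by rw [h1, mul_one]; rfl
  have h2 : HasDerivAt (fun s => Φ (Matrix.of.symm (Matrix.of A * u s))) (lieDeriv X Φ A) 0 := by
    have h3 : HasFDerivAt Φ (fderiv ℝ Φ A) (Matrix.of.symm (Matrix.of A * u 0)) := by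
      rw [e0]; exact hΦ.hasFDerivAt
    exact h3.comp_hasDerivAt (0 : ℝ) (hasDerivAt_mul_curve A hu)
  refine h2.unique (hg.congr_of_eventuallyEq ?_)
  filter_upwards [isOpen_ne.mem_nhds (show (0 : ℝ) ≠ -1 by norm_num)] with s hs using h s hs

variable (hΦ : IsArchimedeanForm k ℓ Φ) (hA : A ∈ invertibleMatrices)
include hΦ hA

/-- Along `su₂` the derivative of `Φ` is algebraic. With the three directions treated next and the
centre, only the directions of the Borel subgroup `(t z; 0 1)` remain genuine derivatives. -/
lemma lieDeriv_unitary {u : ℝ → Matrix (Fin 2) (Fin 2) ℂ} {X : Matrix (Fin 2) (Fin 2) ℂ}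
    (h1 : u 0 = 1) (hu : ∀ i j, HasDerivAt (fun s => u s i j) (X i j) 0)
    (hsu : ∀ s, u s ∈ Matrix.specialUnitaryGroup (Fin 2) ℂ) :
    lieDeriv X Φ A = drho (k + ℓ + 2) X (Φ A) :=
  lieDeriv_eq_of_curve (differentiableAt_of_smooth hΦ.smooth hA) h1 hu (hasDerivAt_rho _ h1 hu)
    fun s _ => hΦ.unitary A hA _ (hsu s)

lemma lieDeriv_rotation :
    lieDeriv !![0, 1; -1, 0] Φ A = drho (k + ℓ + 2) !![0, 1; -1, 0] (Φ A) := by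
  refine hΦ.lieDeriv_unitary hA (u := fun s => !![(Real.cos s : ℂ), (Real.sin s : ℂ);
    -(Real.sin s : ℂ), (Real.cos s : ℂ)]) ?_ ?_ ?_
  · simp [Matrix.one_fin_two]
  · have hc : HasDerivAt (fun s : ℝ => (Real.cos s : ℂ)) 0 0 := by
      simpa using (Real.hasDerivAt_cos 0).ofReal_comp
    have hs : HasDerivAt (fun s : ℝ => (Real.sin s : ℂ)) 1 0 := by
      simpa using (Real.hasDerivAt_sin 0).ofReal_comp
    intro i j
    fin_cases i <;> fin_cases j <;> simp only [Fin.zero_eta, Fin.mk_one, Matrix.of_apply,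
      Matrix.cons_val', Matrix.cons_val_zero, Matrix.cons_val_one, Matrix.cons_val_fin_one]
    exacts [hc, hs, hs.neg, hc]
  · intro s
    have h : (Real.cos s : ℂ) ^ 2 + (Real.sin s : ℂ) ^ 2 = 1 := by
      exact_mod_cast Real.cos_sq_add_sin_sq s
    rw [Matrix.mem_specialUnitaryGroup_iff, Matrix.mem_unitaryGroup_iff]
    constructor
    · ext i j
      fin_cases i <;> fin_cases j <;>
        simp [Matrix.mul_apply, Matrix.star_apply, Fin.sum_univ_two, ← Complex.cos_conj, ← Complex.sin_conj] <;>
        push_cast at h <;> first | ring1 | linear_combination h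
    · rw [Matrix.det_fin_two_of]
      linear_combination h

lemma lieDeriv_rotation' :
    lieDeriv !![0, Complex.I; Complex.I, 0] Φ A =
      drho (k + ℓ + 2) !![0, Complex.I; Complex.I, 0] (Φ A) := by
  refine hΦ.lieDeriv_unitary hA (u := fun s => !![(Real.cos s : ℂ), (Real.sin s : ℂ) * Complex.I;
    (Real.sin s : ℂ) * Complex.I, (Real.cos s : ℂ)]) ?_ ?_ ?_
  · simp [Matrix.one_fin_two]
  · have hc : HasDerivAt (fun s : ℝ => (Real.cos s : ℂ)) 0 0 := by
      simpa using (Real.hasDerivAt_cos 0).ofReal_comp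
    have hs : HasDerivAt (fun s : ℝ => (Real.sin s : ℂ) * Complex.I) Complex.I 0 := by
      simpa using (Real.hasDerivAt_sin 0).ofReal_comp.mul_const Complex.I
    intro i j
    fin_cases i <;> fin_cases j <;> simp only [Fin.zero_eta, Fin.mk_one, Matrix.of_apply,
      Matrix.cons_val', Matrix.cons_val_zero, Matrix.cons_val_one, Matrix.cons_val_fin_one]
    exacts [hc, hs, hs, hc]
  · intro s
    have h : (Real.cos s : ℂ) ^ 2 + (Real.sin s : ℂ) ^ 2 = 1 := by
      exact_mod_cast Real.cos_sq_add_sin_sq s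
    have hI := Complex.I_mul_I
    rw [Matrix.mem_specialUnitaryGroup_iff, Matrix.mem_unitaryGroup_iff]
    constructor
    · ext i j
      fin_cases i <;> fin_cases j <;>
        simp [Matrix.mul_apply, Matrix.star_apply, Fin.sum_univ_two, ← Complex.cos_conj, ← Complex.sin_conj] <;>
        push_cast at h <;> first | ring1 | linear_combination h - Complex.sin s ^ 2 * hI
    · rw [Matrix.det_fin_two_of]
      linear_combination h - (Real.sin s : ℂ) ^ 2 * hI

lemma lieDeriv_torus :
    lieDeriv !![Complex.I, 0; 0, -Complex.I] Φ A =
      drho (k + ℓ + 2) !![Complex.I, 0; 0, -Complex.I] (Φ A) := by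
  have hd : ∀ c : ℂ, HasDerivAt (fun s : ℝ => Complex.exp (s * c)) c 0 := by
    intro c
    have h1 : HasDerivAt (fun s : ℝ => (s : ℂ) * c) c 0 := by
      simpa using (Complex.ofRealCLM.hasDerivAt (x := (0 : ℝ))).mul_const c
    simpa using h1.cexp
  refine hΦ.lieDeriv_unitary hA (u := fun s => !![Complex.exp (s * Complex.I), 0;
    0, Complex.exp (s * -Complex.I)]) ?_ ?_ ?_
  · simp [Matrix.one_fin_two]
  · intro i j
    fin_cases i <;> fin_cases j <;> simp only [Fin.zero_eta, Fin.mk_one, Matrix.of_apply,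
      Matrix.cons_val', Matrix.cons_val_zero, Matrix.cons_val_one, Matrix.cons_val_fin_one]
    exacts [hd _, hasDerivAt_const _ _, hasDerivAt_const _ _, hd _]
  · intro s
    have h : Complex.exp (s * Complex.I) * Complex.exp (s * -Complex.I) = 1 := by
      rw [← Complex.exp_add]; simp
    rw [Matrix.mem_specialUnitaryGroup_iff, Matrix.mem_unitaryGroup_iff]
    constructor
    · ext i j
      fin_cases i <;> fin_cases j <;>
        simp [Matrix.mul_apply, Matrix.star_apply, Fin.sum_univ_two, ← Complex.exp_conj,
          ← Complex.exp_add]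
    · rw [Matrix.det_fin_two_of]
      linear_combination h

lemma lieDeriv_one : lieDeriv 1 Φ A = -((k : ℂ) + ℓ) • Φ A := by
  have h1 : HasDerivAt (fun s : ℝ => (1 : ℂ) + s) 1 0 := by
    simpa using (Complex.ofRealCLM.hasDerivAt (x := (0 : ℝ))).const_add 1
  have hz : HasDerivAt (fun s : ℝ => ((1 : ℂ) + s) ^ (-(k : ℤ) + -(ℓ : ℤ)))
      (-((k : ℂ) + ℓ)) 0 := by
    have h2 := (hasDerivAt_zpow (-(k : ℤ) + -(ℓ : ℤ)) ((1 : ℂ) + (0 : ℝ)) (by simp)).comp (0 : ℝ) h1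
    refine h2.congr_deriv ?_
    simp
    ring
  refine lieDeriv_eq_of_curve (differentiableAt_of_smooth hΦ.smooth hA)
    (u := fun s => ((1 : ℂ) + s) • 1) (by simp) ?_ (hz.smul_const (Φ A)) ?_
  · intro i j
    simp only [Matrix.smul_apply, smul_eq_mul]
    simpa using h1.mul_const ((1 : Matrix (Fin 2) (Fin 2) ℂ) i j)
  · intro s hs
    have hne : (1 : ℂ) + s ≠ 0 := by
      intro h
      apply hs
      have : ((1 + s : ℝ) : ℂ) = 0 := by push_cast; exact h
      have := Complex.ofReal_eq_zero.1 this
      linarith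
    have h3 := hΦ.central A hA _ hne
    have h4 : conj ((1 : ℂ) + s) = 1 + s := by simp
    rw [h4, ← zpow_add₀ hne] at h3
    rw [← h3, Matrix.mul_smul, mul_one]
    rfl

lemma lieDeriv_diag :
    lieDeriv !![1, 0; 0, -1] Φ A =
      (2 : ℂ) • lieDeriv !![1, 0; 0, 0] Φ A + ((k : ℂ) + ℓ) • Φ A := by
  have e : (!![1, 0; 0, -1] : Matrix (Fin 2) (Fin 2) ℂ) = (2 : ℝ) • !![1, 0; 0, 0] - 1 := by
    ext i j
    fin_cases i <;> fin_cases j <;> simp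
    norm_num
  rw [e, lieDeriv_sub_left, lieDeriv_smul_left, hΦ.lieDeriv_one hA]
  have : (2 : ℝ) • lieDeriv !![1, 0; 0, 0] Φ A = (2 : ℂ) • lieDeriv !![1, 0; 0, 0] Φ A := by
    ext n; simp
  rw [this]
  module

/-- The operator `½ (k + ℓ) + ½ ε dρ(H)`. -/
def _root_.Bianchi.torusWeight (k ℓ : ℕ) (ε : ℂ) : V (k + ℓ + 2) →ₗ[ℂ] V (k + ℓ + 2) :=
  (((k : ℂ) + ℓ) / 2) • LinearMap.id + (ε / 2) • drho (k + ℓ + 2) !![1, 0; 0, -1]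

/-- The difference of the action of `F` and the raising operator of opposite type. -/
def _root_.Bianchi.lowering (k ℓ : ℕ) (ε : ℂ) : V (k + ℓ + 2) →ₗ[ℂ] V (k + ℓ + 2) :=
  (1 / 2 : ℂ) • (drho (k + ℓ + 2) !![0, -1; 1, 0] + ε • drho (k + ℓ + 2) !![0, 1; 1, 0])

omit hΦ hA in
lemma _root_.Bianchi.drho_smul {N : ℕ} (c : ℂ) (X : Matrix (Fin 2) (Fin 2) ℂ) :
    drho N (c • X) = c • drho N X := by
  ext P n
  simp only [LinearMap.coe_comp, Function.comp_apply, LinearMap.smul_apply, Pi.smul_apply, drho_apply,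
    Matrix.smul_apply, smul_eq_mul]
  ring

lemma lieComp_diag (ε : ℂ) : lieComp ε !![1, 0; 0, -1] Φ A =
    lieDeriv !![1, 0; 0, 0] Φ A + torusWeight k ℓ ε (Φ A) := by
  have e : Complex.I • (!![1, 0; 0, -1] : Matrix (Fin 2) (Fin 2) ℂ) =
      !![Complex.I, 0; 0, -Complex.I] := by simp
  rw [lieComp, hΦ.lieDeriv_diag hA, e, hΦ.lieDeriv_torus hA, ← e, drho_smul, torusWeight]
  simp only [LinearMap.add_apply, LinearMap.smul_apply, LinearMap.id_apply]
  match_scalars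
  · ring
  · ring
  · linear_combination (-(ε / 2)) * Complex.I_mul_I

/-- Write `F = E - R` and `i F = R' - i E` with `R`, `R'` in `su₂`. The sign of `E` differs in the
two relations, so what remains of `F` is the operator `E` of the opposite component `-ε`. -/
lemma lieComp_lower (ε : ℂ) : lieComp ε !![0, 0; 1, 0] Φ A =
    lieComp (-ε) !![0, 1; 0, 0] Φ A + lowering k ℓ ε (Φ A) := by
  have e1 : (!![0, 0; 1, 0] : Matrix (Fin 2) (Fin 2) ℂ) = !![0, 1; 0, 0] - !![0, 1; -1, 0] := by
    simp
  have e2 : Complex.I • (!![0, 0; 1, 0] : Matrix (Fin 2) (Fin 2) ℂ) =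
      !![0, Complex.I; Complex.I, 0] - Complex.I • !![0, 1; 0, 0] := by simp
  have e3 : (!![0, -1; 1, 0] : Matrix (Fin 2) (Fin 2) ℂ) = (-1 : ℂ) • !![0, 1; -1, 0] := by simp
  have e4 : (!![0, Complex.I; Complex.I, 0] : Matrix (Fin 2) (Fin 2) ℂ) =
      Complex.I • !![0, 1; 1, 0] := by simp
  rw [lieComp, lieComp, e2, e1, lieDeriv_sub_left, lieDeriv_sub_left, hΦ.lieDeriv_rotation hA,
    hΦ.lieDeriv_rotation' hA, lowering, e3, e4, drho_smul, drho_smul]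
  simp only [LinearMap.add_apply, LinearMap.smul_apply]
  match_scalars
  · ring
  · ring
  · linear_combination (-(ε / 2)) * Complex.I_mul_I
  · ring

lemma lieComp_diag_diag (ε : ℂ) :
    lieComp ε !![1, 0; 0, -1] (lieComp ε !![1, 0; 0, -1] Φ) A =
      lieDeriv !![1, 0; 0, 0] (lieDeriv !![1, 0; 0, 0] Φ) A +
        (2 : ℂ) • torusWeight k ℓ ε (lieDeriv !![1, 0; 0, 0] Φ A) +
        torusWeight k ℓ ε (torusWeight k ℓ ε (Φ A)) := by
  have hd := differentiableAt_of_smooth hΦ.smooth hA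
  have hde := differentiableAt_of_smooth (lieDeriv_smooth hΦ.smooth !![1, 0; 0, 0]) hA
  have hT : ∀ T : V (k + ℓ + 2) →ₗ[ℂ] V (k + ℓ + 2), DifferentiableAt ℝ (fun B => T (Φ B)) A :=
    fun T => (LinearMap.toContinuousLinearMap (T.restrictScalars ℝ)).differentiableAt.comp A hd
  have e : Complex.I • (!![1, 0; 0, -1] : Matrix (Fin 2) (Fin 2) ℂ) =
      !![Complex.I, 0; 0, -Complex.I] := by simp
  have c1 : lieDeriv !![Complex.I, 0; 0, -Complex.I] (lieDeriv !![1, 0; 0, 0] Φ) A =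
      drho (k + ℓ + 2) !![Complex.I, 0; 0, -Complex.I] (lieDeriv !![1, 0; 0, 0] Φ A) := by
    have h0 : (!![Complex.I, 0; 0, -Complex.I] * !![1, 0; 0, 0] -
      !![1, 0; 0, 0] * !![Complex.I, 0; 0, -Complex.I] : Matrix (Fin 2) (Fin 2) ℂ) = (0 : ℝ) • 1 := by
      ext i j
      fin_cases i <;> fin_cases j <;> simp
    rw [lieDeriv_comm hΦ.smooth hA, h0, lieDeriv_smul_left, zero_smul, add_zero,
      lieDeriv_congr (fun B hB => hΦ.lieDeriv_torus hB) hA, lieDeriv_map _ hd]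
  have c2 : lieDeriv !![1, 0; 0, -1] (lieDeriv !![1, 0; 0, 0] Φ) A =
      (2 : ℂ) • lieDeriv !![1, 0; 0, 0] (lieDeriv !![1, 0; 0, 0] Φ) A +
        ((k : ℂ) + ℓ) • lieDeriv !![1, 0; 0, 0] Φ A := by
    have h0 : (!![1, 0; 0, -1] * !![1, 0; 0, 0] -
      !![1, 0; 0, 0] * !![1, 0; 0, -1] : Matrix (Fin 2) (Fin 2) ℂ) = (0 : ℝ) • 1 := by
      ext i j
      fin_cases i <;> fin_cases j <;> simp
    rw [lieDeriv_comm hΦ.smooth hA, h0, lieDeriv_smul_left, zero_smul, add_zero,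
      lieDeriv_congr (fun B hB => hΦ.lieDeriv_diag hB) hA,
      lieDeriv_add (hde.fun_const_smul _) (hd.fun_const_smul _), lieDeriv_smul _ hde,
      lieDeriv_smul _ hd]
  have hdt : DifferentiableAt ℝ (fun B => torusWeight k ℓ ε (Φ B)) A := hT _
  rw [lieComp_congr (fun B hB => hΦ.lieComp_diag hB ε) hA, lieComp_add hde hdt,
    lieComp_map _ hd, hΦ.lieComp_diag hA, lieComp, e, c1, c2, ← e, drho_smul, map_add]
  simp only [torusWeight, LinearMap.add_apply, LinearMap.smul_apply, LinearMap.id_apply, map_add,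
    map_smul]
  match_scalars
  · ring
  · ring
  · linear_combination (-(ε / 2)) * Complex.I_mul_I
  · ring
  · ring
  · ring

/-- The Casimir operator in Iwasawa coordinates. -/
theorem two_smul_casimir {ε : ℂ} (hε : ε * ε = 1) : (2 : ℂ) • casimir ε Φ A =
    lieDeriv !![1, 0; 0, 0] (lieDeriv !![1, 0; 0, 0] Φ) A +
      (2 : ℂ) • torusWeight k ℓ ε (lieDeriv !![1, 0; 0, 0] Φ A) +
      torusWeight k ℓ ε (torusWeight k ℓ ε (Φ A)) -
      (2 : ℂ) • (lieDeriv !![1, 0; 0, 0] Φ A + torusWeight k ℓ ε (Φ A)) +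
      (lieDeriv !![0, 1; 0, 0] (lieDeriv !![0, 1; 0, 0] Φ) A +
        lieDeriv !![0, Complex.I; 0, 0] (lieDeriv !![0, Complex.I; 0, 0] Φ) A) +
      (4 : ℂ) • lowering k ℓ ε ((1 / 2 : ℂ) • (lieDeriv !![0, 1; 0, 0] Φ A -
        (ε * Complex.I) • lieDeriv !![0, Complex.I; 0, 0] Φ A)) := by
  have hd := differentiableAt_of_smooth hΦ.smooth hA
  have hde := differentiableAt_of_smooth (lieComp_smooth hΦ.smooth (-ε) !![0, 1; 0, 0]) hA
  have hT : DifferentiableAt ℝ (fun B => lowering k ℓ ε (Φ B)) A :=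
    (LinearMap.toContinuousLinearMap ((lowering k ℓ ε).restrictScalars ℝ)).differentiableAt.comp A hd
  have e : Complex.I • (!![0, 1; 0, 0] : Matrix (Fin 2) (Fin 2) ℂ) = !![0, Complex.I; 0, 0] := by simp
  have b : (!![0, 0; 1, 0] * !![0, 1; 0, 0] - !![0, 1; 0, 0] * !![0, 0; 1, 0] :
      Matrix (Fin 2) (Fin 2) ℂ) = -!![1, 0; 0, -1] := by simp
  have n : lieComp ε (-!![1, 0; 0, -1]) Φ A = -lieComp ε !![1, 0; 0, -1] Φ A := by
    simp only [lieComp, smul_neg, lieDeriv_neg_left]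
    module
  -- The product of the operators `E` of opposite components is a quarter of the Laplacian in the
  -- unipotent variable, just as `∂` times its conjugate is.
  have c : lieComp ε !![0, 1; 0, 0] (lieComp (-ε) !![0, 1; 0, 0] Φ) A = (1 / 4 : ℂ) •
      (lieDeriv !![0, 1; 0, 0] (lieDeriv !![0, 1; 0, 0] Φ) A +
        lieDeriv !![0, Complex.I; 0, 0] (lieDeriv !![0, Complex.I; 0, 0] Φ) A) := by
    have h0 : (!![0, 1; 0, 0] * !![0, Complex.I; 0, 0] -
      !![0, Complex.I; 0, 0] * !![0, 1; 0, 0] : Matrix (Fin 2) (Fin 2) ℂ) = (0 : ℝ) • 1 := by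
      simp
    rw [lieComp_lieComp hΦ.smooth hA, e, lieDeriv_comm hΦ.smooth hA !![0, 1; 0, 0]
      !![0, Complex.I; 0, 0], h0, lieDeriv_smul_left, zero_smul, add_zero,
      show ε * -ε = -1 by linear_combination -hε]
    module
  -- `F E = E F - H` puts every lower triangular operator next to `Φ`, where equivariance replaces
  -- it.
  rw [casimir, lieComp_comm hΦ.smooth hA hε !![0, 0; 1, 0] !![0, 1; 0, 0], b, n,
    hΦ.lieComp_diag_diag hA, hΦ.lieComp_diag hA,
    lieComp_congr (fun B hB => hΦ.lieComp_lower hB ε) hA, lieComp_add hde hT, lieComp_map _ hd, c,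
    show lieComp ε !![0, 1; 0, 0] Φ A = (1 / 2 : ℂ) • (lieDeriv !![0, 1; 0, 0] Φ A -
        (ε * Complex.I) • lieDeriv !![0, Complex.I; 0, 0] Φ A) by rw [lieComp, e]]
  module

end IsArchimedeanForm

end

section

/-! ### Periodic functions of several real variables -/

section periodic

variable {ι : Type*} [Fintype ι] {E : Type*} [NormedAddCommGroup E]

/-- The function on the torus attached to a periodic function. -/
def torusLift (h : (ι → ℝ) → E) (y : UnitAddTorus ι) : E :=
  h fun i => (AddCircle.equivIoc 1 0 (y i)).1

/-- Invariance under integral translations. -/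
def IsIntegralPeriodic (h : (ι → ℝ) → E) : Prop :=
  ∀ (x : ι → ℝ) (m : ι → ℤ), h (x + fun i => (m i : ℝ)) = h x

omit [Fintype ι] [NormedAddCommGroup E] in
lemma torusLift_coe {h : (ι → ℝ) → E} (hp : IsIntegralPeriodic h) (x : ι → ℝ) :
    torusLift h (fun i => (x i : UnitAddCircle)) = h x := by
  have h1 : ∀ i, ∃ m : ℤ, (AddCircle.equivIoc 1 0 (x i : UnitAddCircle)).1 = x i + m := by
    intro i
    have e : ((AddCircle.equivIoc 1 0 (x i : UnitAddCircle)).1 : UnitAddCircle) = (x i : UnitAddCircle) :=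
      AddCircle.coe_equivIoc
    rw [← sub_eq_zero, ← AddCircle.coe_sub, AddCircle.coe_eq_zero_iff] at e
    obtain ⟨m, hm⟩ := e
    exact ⟨m, by rw [zsmul_eq_mul, mul_one] at hm; linarith⟩
  choose m hm using h1
  rw [torusLift, ← hp x m]
  congr 1
  funext i
  exact hm i

lemma setIntegral_Ioc_eq [NormedSpace ℝ E] {h : (ι → ℝ) → E} (hp : IsIntegralPeriodic h)
    (a b : ι → ℝ) : ∫ x in {x : ι → ℝ | ∀ i, x i ∈ Set.Ioc (a i) (a i + 1)}, h x =
      ∫ x in {x : ι → ℝ | ∀ i, x i ∈ Set.Ioc (b i) (b i + 1)}, h x := by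
  have e := (UnitAddTorus.integral_preimage (torusLift h) a).symm.trans
    (UnitAddTorus.integral_preimage (torusLift h) b)
  simpa only [torusLift_coe hp] using e

lemma setIntegral_Icc_eq [NormedSpace ℝ E] (h : (ι → ℝ) → E) :
    ∫ x in Set.Icc (0 : ι → ℝ) 1, h x =
      ∫ x in {x : ι → ℝ | ∀ i, x i ∈ Set.Ioc ((0 : ι → ℝ) i) ((0 : ι → ℝ) i + 1)}, h x := by
  have e : {x : ι → ℝ | ∀ i, x i ∈ Set.Ioc ((0 : ι → ℝ) i) ((0 : ι → ℝ) i + 1)} =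
      Set.pi Set.univ fun i => Set.Ioc ((0 : ι → ℝ) i) ((1 : ι → ℝ) i) := by
    ext x
    simp
  rw [e, MeasureTheory.volume_pi, MeasureTheory.setIntegral_congr_set
    MeasureTheory.Measure.univ_pi_Ioc_ae_eq_Icc]

lemma setIntegral_Icc_translate [NormedSpace ℝ E] {h : (ι → ℝ) → E} (hp : IsIntegralPeriodic h)
    (c : ι → ℝ) : ∫ x in Set.Icc (0 : ι → ℝ) 1, h (x + c) = ∫ x in Set.Icc (0 : ι → ℝ) 1, h x := by
  have h1 := (MeasureTheory.measurePreserving_add_right MeasureTheory.volume c).setIntegral_preimage_emb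
    (measurableEmbedding_addRight c) h {x : ι → ℝ | ∀ i, x i ∈ Set.Ioc (c i) (c i + 1)}
  have e : (fun x => x + c) ⁻¹' {x : ι → ℝ | ∀ i, x i ∈ Set.Ioc (c i) (c i + 1)} =
      {x : ι → ℝ | ∀ i, x i ∈ Set.Ioc ((0 : ι → ℝ) i) ((0 : ι → ℝ) i + 1)} := by
    ext x
    simp only [Set.mem_preimage, Set.mem_ofPred_eq, Pi.add_apply, Set.mem_Ioc, Pi.zero_apply]
    refine forall_congr' fun i => ?_
    constructor <;> rintro ⟨h1, h2⟩ <;> constructor <;> linarith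
  rw [e] at h1
  rw [setIntegral_Icc_eq, setIntegral_Icc_eq, h1, setIntegral_Ioc_eq hp]

omit [Fintype ι] in
lemma isOpenQuotientMap_torus : IsOpenQuotientMap (fun (x : ι → ℝ) (i : ι) => (x i : UnitAddCircle)) :=
  IsOpenQuotientMap.piMap fun _ => QuotientAddGroup.isOpenQuotientMap_mk

omit [Fintype ι] in
lemma continuous_torusLift {h : (ι → ℝ) → E} (hp : IsIntegralPeriodic h) (hc : Continuous h) :
    Continuous (torusLift h) := by
  refine (isOpenQuotientMap_torus (ι := ι)).isQuotientMap.continuous_iff.2 ?_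
  refine hc.congr fun x => ?_
  exact (torusLift_coe hp x).symm

lemma mFourier_coe (m : ι → ℤ) (x : ι → ℝ) : UnitAddTorus.mFourier m (fun i => (x i : UnitAddCircle)) =
    Complex.exp (2 * Real.pi * Complex.I * ∑ i, (m i : ℂ) * x i) := by
  simp only [UnitAddTorus.mFourier, ContinuousMap.coe_mk, fourier_coe_apply]
  rw [← Complex.exp_sum, Finset.mul_sum]
  refine congrArg _ (Finset.sum_congr rfl fun i _ => ?_)
  push_cast
  ring

/-- Pointwise convergence of a multiple Fourier series with summable coefficients. -/
theorem hasSum_fourier_of_summable {h : (ι → ℝ) → ℂ} (hp : IsIntegralPeriodic h) (hc : Continuous h)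
    {c : (ι → ℤ) → ℂ} (hs : Summable c)
    (hcoef : ∀ m, ∫ x in Set.Icc (0 : ι → ℝ) 1,
      h x * Complex.exp (-(2 * Real.pi * Complex.I * ∑ i, (m i : ℂ) * x i)) = c m) (x : ι → ℝ) :
    HasSum (fun m => c m * Complex.exp (2 * Real.pi * Complex.I * ∑ i, (m i : ℂ) * x i)) (h x) := by
  have e : UnitAddTorus.mFourierCoeff (⟨torusLift h, continuous_torusLift hp hc⟩ : C(UnitAddTorus ι, ℂ)) = c := by
    funext m
    rw [UnitAddTorus.mFourierCoeff_eq_integral _ _ 0, ← hcoef m, setIntegral_Icc_eq]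
    refine MeasureTheory.integral_congr_ae (Filter.Eventually.of_forall fun x => ?_)
    simp only [ContinuousMap.coe_mk, torusLift_coe hp, smul_eq_mul]
    rw [mul_comm, mFourier_coe]
    congr 2
    simp
  have := UnitAddTorus.hasSum_mFourier_series_apply_of_summable
    (f := (⟨torusLift h, continuous_torusLift hp hc⟩ : C(UnitAddTorus ι, ℂ))) (by rw [e]; exact hs)
    (fun i => (x i : UnitAddCircle))
  rw [e] at this
  simpa only [smul_eq_mul, mFourier_coe, ContinuousMap.coe_mk, torusLift_coe hp] using this

lemma integral_Icc_exp (m : ι → ℤ) : ∫ x in Set.Icc (0 : ι → ℝ) 1,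
    Complex.exp (2 * Real.pi * Complex.I * ∑ i, (m i : ℂ) * x i) = if m = 0 then 1 else 0 := by
  have hp : IsIntegralPeriodic fun x : ι → ℝ =>
      Complex.exp (2 * Real.pi * Complex.I * ∑ i, (m i : ℂ) * x i) := by
    intro x n
    simp only [Pi.add_apply]
    refine Complex.exp_eq_exp_iff_exists_int.2 ⟨∑ i, m i * n i, ?_⟩
    push_cast
    simp only [mul_add, Finset.sum_add_distrib]
    ring
  split_ifs with h0
  · subst h0
    simp [MeasureTheory.Measure.real, Real.volume_Icc_pi]
  · obtain ⟨i, hi⟩ := Function.ne_iff.1 h0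
    have hm : (m i : ℂ) ≠ 0 := by exact_mod_cast hi
    -- Translation by half a period of the `i`-th factor changes the sign of the integrand but not
    -- the integral.
    have h1 := setIntegral_Icc_translate hp (Pi.single i (1 / (2 * (m i : ℝ))))
    have e : ∀ x : ι → ℝ, ∑ j, (m j : ℂ) * (((x + Pi.single i (1 / (2 * (m i : ℝ))) : ι → ℝ) j : ℝ) : ℂ) =
        (∑ j, (m j : ℂ) * x j) + 1 / 2 := by
      intro x
      simp only [Pi.add_apply, Complex.ofReal_add, mul_add, Finset.sum_add_distrib]
      congr 1
      rw [Finset.sum_eq_single i]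
      · rw [Pi.single_eq_same]
        push_cast
        field_simp
      · intro j _ hj
        rw [Pi.single_eq_of_ne hj]
        simp
      · simp
    simp only [e] at h1
    have e2 : ∀ x : ι → ℝ, Complex.exp (2 * Real.pi * Complex.I * ((∑ j, (m j : ℂ) * x j) + 1 / 2)) =
        -1 * Complex.exp (2 * Real.pi * Complex.I * (∑ j, (m j : ℂ) * x j)) := by
      intro x
      rw [mul_add, Complex.exp_add, show 2 * (Real.pi : ℂ) * Complex.I * (1 / 2) = Real.pi * Complex.I by ring,
        Complex.exp_pi_mul_I, mul_comm]
    simp only [e2] at h1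
    rw [MeasureTheory.integral_const_mul] at h1
    have h2 : (2 : ℂ) * ∫ x in Set.Icc (0 : ι → ℝ) 1,
      Complex.exp (2 * Real.pi * Complex.I * ∑ i, (m i : ℂ) * x i) = 0 := by linear_combination -h1
    simpa using h2

end periodic

end

section

/-! ### Averages over unipotent translations -/

/-- The additive character `w ↦ exp (2 π i (w + conj w))` of `ℂ`. -/
def addChar (w : ℂ) : ℂ := Complex.exp (2 * Real.pi * Complex.I * (w + conj w))

lemma addChar_add (w z : ℂ) : addChar (w + z) = addChar w * addChar z := by
  rw [addChar, addChar, addChar, ← Complex.exp_add, map_add]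
  congr 1
  ring

lemma norm_addChar (w : ℂ) : ‖addChar w‖ = 1 := by
  rw [addChar, Complex.add_conj, show 2 * (Real.pi : ℂ) * Complex.I * ((2 * w.re : ℝ) : ℂ) =
    ((2 * Real.pi * (2 * w.re) : ℝ) : ℂ) * Complex.I by push_cast; ring, Complex.norm_exp_ofReal_mul_I]

lemma addChar_eq_one {w : ℂ} {n : ℤ} (h : w + conj w = n) : addChar w = 1 := by
  rw [addChar, h, mul_comm, Complex.exp_int_mul_two_pi_mul_I]

@[fun_prop] lemma continuous_addChar : Continuous addChar := by
  unfold addChar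
  fun_prop

/-- Left multiplication by the unipotent matrix `(1 w; 0 1)`. -/
def unipotentMul (w : ℂ) : (Fin 2 → Fin 2 → ℂ) →L[ℝ] (Fin 2 → Fin 2 → ℂ) :=
  LinearMap.toContinuousLinearMap
    { toFun := fun A => Matrix.of.symm (!![1, w; 0, 1] * Matrix.of A)
      map_add' := fun A B => by rw [← Matrix.of_add_of, mul_add]; rfl
      map_smul' := fun c A => by rw [← Matrix.smul_of, Matrix.mul_smul]; rfl }

@[simp] lemma unipotentMul_apply (w : ℂ) (A : Fin 2 → Fin 2 → ℂ) :
    unipotentMul w A = Matrix.of.symm (!![1, w; 0, 1] * Matrix.of A) := rfl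

lemma unipotentMul_mem {A : Fin 2 → Fin 2 → ℂ} (hA : A ∈ invertibleMatrices) (w : ℂ) :
    unipotentMul w A ∈ invertibleMatrices := by
  have : (Matrix.of A).det ≠ 0 := hA
  rw [invertibleMatrices, Set.mem_ofPred_eq, unipotentMul_apply, Equiv.apply_symm_apply, Matrix.det_mul,
    Matrix.det_fin_two_of]
  simpa using this

lemma unipotentMul_mulRight (w : ℂ) (X : Matrix (Fin 2) (Fin 2) ℂ) (A : Fin 2 → Fin 2 → ℂ) :
    unipotentMul w (mulRight X A) = mulRight X (unipotentMul w A) := by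
  simp only [unipotentMul_apply, mulRight_apply, Equiv.apply_symm_apply, Matrix.mul_assoc]

lemma unipotentMul_add (w z : ℂ) (A : Fin 2 → Fin 2 → ℂ) :
    unipotentMul w (unipotentMul z A) = unipotentMul (w + z) A := by
  simp only [unipotentMul_apply, Equiv.apply_symm_apply, ← Matrix.mul_assoc]
  congr 2
  ext i j
  fin_cases i <;> fin_cases j <;> simp [Matrix.mul_apply, Fin.sum_univ_two, add_comm]

/-- The map is affine in `w`; subtracting its value at `0` makes it linear on a finite dimensional
space. -/
lemma continuous_unipotentMul : Continuous fun w : ℂ => unipotentMul w := by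
  refine LinearMap.continuous_of_finiteDimensional
    (f := (⟨⟨fun w => unipotentMul w - unipotentMul 0, ?_⟩, ?_⟩ :
      ℂ →ₗ[ℝ] ((Fin 2 → Fin 2 → ℂ) →L[ℝ] (Fin 2 → Fin 2 → ℂ)))) |>.add_const (unipotentMul 0)
      |>.congr fun w => ?_
  · intro w z
    ext A i j
    fin_cases i <;> simp [add_mul]
  · intro c w
    ext A i j
    fin_cases i <;> simp [mul_assoc]
  · simp

section average

variable {ι : Type*} [Fintype ι] {N : ℕ} {Ψ : (Fin 2 → Fin 2 → ℂ) → V N} {A : Fin 2 → Fin 2 → ℂ}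

/-- The mean value of `z ↦ addChar (-α z) • Ψ ((1 z; 0 1) A)` over a period parallelogram. -/
def unipotentAverage (ω : ι → ℂ) (α : ℂ) (Ψ : (Fin 2 → Fin 2 → ℂ) → V N)
    (A : Fin 2 → Fin 2 → ℂ) : V N :=
  ∫ x in Set.Icc (0 : ι → ℝ) 1, addChar (-α * ∑ i, (x i : ℂ) * ω i) •
    Ψ (unipotentMul (∑ i, (x i : ℂ) * ω i) A)

variable (ω : ι → ℂ) (α : ℂ)

omit [Fintype ι] in
lemma continuous_translate {z χ : (ι → ℝ) → ℂ} (hz : Continuous z) (hχ : Continuous χ)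
    (h : ContinuousOn Ψ invertibleMatrices) (hA : A ∈ invertibleMatrices) :
    Continuous fun x => χ x • Ψ (unipotentMul (z x) A) :=
  hχ.smul (h.comp_continuous ((continuous_unipotentMul.comp hz).clm_apply continuous_const)
    fun _ => unipotentMul_mem hA _)

/-- Differentiation under the integral; the derivative is dominated by a constant on the compact
product of a small closed ball around `A` with the unit cube. -/
lemma hasFDerivAt_integral_translate {z χ : (ι → ℝ) → ℂ} (hz : Continuous z) (hχ : Continuous χ)
    (h : ContDiffOn ℝ (⊤ : ℕ∞) Ψ invertibleMatrices) (hA : A ∈ invertibleMatrices) :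
    MeasureTheory.IntegrableOn (fun x : ι → ℝ => χ x •
      (fderiv ℝ Ψ (unipotentMul (z x) A)).comp (unipotentMul (z x))) (Set.Icc 0 1) ∧
    HasFDerivAt (fun B => ∫ x in Set.Icc (0 : ι → ℝ) 1, χ x • Ψ (unipotentMul (z x) B))
      (∫ x in Set.Icc (0 : ι → ℝ) 1, χ x •
        (fderiv ℝ Ψ (unipotentMul (z x) A)).comp (unipotentMul (z x))) A := by
  have hcont : Continuous fun p : (Fin 2 → Fin 2 → ℂ) × (ι → ℝ) => unipotentMul (z p.2) p.1 :=
    (continuous_unipotentMul.comp (hz.comp continuous_snd)).clm_apply continuous_fst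
  have hdc : ContinuousOn (fderiv ℝ Ψ) invertibleMatrices :=
    (h.fderiv_of_isOpen isOpen_invertibleMatrices (m := (⊤ : ℕ∞)) (by simp)).continuousOn
  have hF'c : ContinuousOn (fun p : (Fin 2 → Fin 2 → ℂ) × (ι → ℝ) => χ p.2 •
      (fderiv ℝ Ψ (unipotentMul (z p.2) p.1)).comp (unipotentMul (z p.2)))
      (invertibleMatrices ×ˢ Set.univ) := by
    refine ContinuousOn.smul (hχ.comp continuous_snd).continuousOn (ContinuousOn.clm_comp ?_ ?_)
    · exact hdc.comp hcont.continuousOn fun p hp => unipotentMul_mem hp.1 _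
    · exact (continuous_unipotentMul.comp (hz.comp continuous_snd)).continuousOn
  have hF'A : Continuous fun x => χ x •
      (fderiv ℝ Ψ (unipotentMul (z x) A)).comp (unipotentMul (z x)) :=
    hF'c.comp_continuous (continuous_const.prodMk continuous_id) fun x => ⟨hA, trivial⟩
  obtain ⟨r, hr, hrs⟩ := Metric.nhds_basis_closedBall.mem_iff.1 (isOpen_invertibleMatrices.mem_nhds hA)
  have hK : IsCompact (Metric.closedBall A r ×ˢ Set.Icc (0 : ι → ℝ) 1) :=
    (isCompact_closedBall A r).prod isCompact_Icc
  obtain ⟨C, hC⟩ := hK.exists_bound_of_continuousOn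
    (hF'c.mono (Set.prod_mono hrs (Set.subset_univ _)))
  refine ⟨hF'A.continuousOn.integrableOn_compact isCompact_Icc, ?_⟩
  refine hasFDerivAt_integral_of_dominated_of_fderiv_le (bound := fun _ => C)
    (F := fun B x => χ x • Ψ (unipotentMul (z x) B))
    (F' := fun B x => χ x • (fderiv ℝ Ψ (unipotentMul (z x) B)).comp (unipotentMul (z x)))
    (Metric.closedBall_mem_nhds A hr) ?_ ?_ ?_ ?_ ?_ ?_
  · filter_upwards [isOpen_invertibleMatrices.mem_nhds hA] with B hB
    exact (continuous_translate hz hχ h.continuousOn hB).aestronglyMeasurable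
  · exact (continuous_translate hz hχ h.continuousOn hA).continuousOn.integrableOn_compact isCompact_Icc
  · exact hF'A.aestronglyMeasurable
  · refine (MeasureTheory.ae_restrict_iff' measurableSet_Icc).2 (Filter.Eventually.of_forall ?_)
    intro x hx B hB
    exact hC (B, x) ⟨hB, hx⟩
  · exact MeasureTheory.integrableOn_const (by rw [Real.volume_Icc_pi]; simp)
  · refine Filter.Eventually.of_forall fun x B hB => ?_
    have hd : DifferentiableAt ℝ Ψ (unipotentMul (z x) B) :=
      differentiableAt_of_smooth h (unipotentMul_mem (hrs hB) _)
    exact HasFDerivAt.const_smul (hd.hasFDerivAt.comp B (unipotentMul (z x)).hasFDerivAt) (χ x)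

lemma hasFDerivAt_unipotentAverage (h : ContDiffOn ℝ (⊤ : ℕ∞) Ψ invertibleMatrices)
    (hA : A ∈ invertibleMatrices) :
    MeasureTheory.IntegrableOn (fun x : ι → ℝ => addChar (-α * ∑ i, (x i : ℂ) * ω i) •
      (fderiv ℝ Ψ (unipotentMul (∑ i, (x i : ℂ) * ω i) A)).comp
        (unipotentMul (∑ i, (x i : ℂ) * ω i))) (Set.Icc 0 1) ∧
    HasFDerivAt (unipotentAverage ω α Ψ) (∫ x in Set.Icc (0 : ι → ℝ) 1,
      addChar (-α * ∑ i, (x i : ℂ) * ω i) •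
        (fderiv ℝ Ψ (unipotentMul (∑ i, (x i : ℂ) * ω i) A)).comp
          (unipotentMul (∑ i, (x i : ℂ) * ω i))) A := by
  have hz : Continuous fun x : ι → ℝ => ∑ i, (x i : ℂ) * ω i := by fun_prop
  exact hasFDerivAt_integral_translate hz (continuous_addChar.comp (hz.const_mul (-α))) h hA

lemma differentiableAt_unipotentAverage (h : ContDiffOn ℝ (⊤ : ℕ∞) Ψ invertibleMatrices)
    (hA : A ∈ invertibleMatrices) : DifferentiableAt ℝ (unipotentAverage ω α Ψ) A :=
  (hasFDerivAt_unipotentAverage ω α h hA).2.differentiableAt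

/-- Left multiplication by unipotents commutes with the right translations defining `lieDeriv`, so
averaging passes through it. -/
lemma lieDeriv_unipotentAverage (h : ContDiffOn ℝ (⊤ : ℕ∞) Ψ invertibleMatrices)
    (hA : A ∈ invertibleMatrices) (X : Matrix (Fin 2) (Fin 2) ℂ) :
    lieDeriv X (unipotentAverage ω α Ψ) A = unipotentAverage ω α (lieDeriv X Ψ) A := by
  obtain ⟨hi, hd⟩ := hasFDerivAt_unipotentAverage ω α h hA
  rw [lieDeriv_apply, hd.fderiv, ContinuousLinearMap.integral_apply hi]
  refine MeasureTheory.integral_congr_ae (Filter.Eventually.of_forall fun x => ?_)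
  simp only [smul_apply, ContinuousLinearMap.comp_apply, unipotentMul_mulRight]
  rfl

lemma integrableOn_unipotentAverage (h : ContinuousOn Ψ invertibleMatrices)
    (hA : A ∈ invertibleMatrices) :
    MeasureTheory.IntegrableOn (fun x : ι → ℝ => addChar (-α * ∑ i, (x i : ℂ) * ω i) •
      Ψ (unipotentMul (∑ i, (x i : ℂ) * ω i) A)) (Set.Icc 0 1) := by
  have hz : Continuous fun x : ι → ℝ => ∑ i, (x i : ℂ) * ω i := by fun_prop
  exact (continuous_translate hz (continuous_addChar.comp (hz.const_mul (-α))) h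
    hA).continuousOn.integrableOn_compact isCompact_Icc

lemma unipotentAverage_add {Ψ' : (Fin 2 → Fin 2 → ℂ) → V N} (h : ContinuousOn Ψ invertibleMatrices)
    (h' : ContinuousOn Ψ' invertibleMatrices) (hA : A ∈ invertibleMatrices) :
    unipotentAverage ω α (fun B => Ψ B + Ψ' B) A =
      unipotentAverage ω α Ψ A + unipotentAverage ω α Ψ' A := by
  rw [unipotentAverage, unipotentAverage, unipotentAverage, ← MeasureTheory.integral_add
    (integrableOn_unipotentAverage ω α h hA) (integrableOn_unipotentAverage ω α h' hA)]
  simp only [smul_add]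

lemma unipotentAverage_map (T : V N →ₗ[ℂ] V N) (h : ContinuousOn Ψ invertibleMatrices)
    (hA : A ∈ invertibleMatrices) :
    unipotentAverage ω α (fun B => T (Ψ B)) A = T (unipotentAverage ω α Ψ A) := by
  have := (LinearMap.toContinuousLinearMap T).integral_comp_comm
    (integrableOn_unipotentAverage ω α h hA)
  simp only [LinearMap.coe_toContinuousLinearMap', map_smul] at this
  exact this

lemma unipotentAverage_congr {Ψ' : (Fin 2 → Fin 2 → ℂ) → V N}
    (h : ∀ B ∈ invertibleMatrices, Ψ B = Ψ' B) (hA : A ∈ invertibleMatrices) :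
    unipotentAverage ω α Ψ A = unipotentAverage ω α Ψ' A := by
  simp only [unipotentAverage, h _ (unipotentMul_mem hA _)]

variable {ω α}

/-- In the coordinates of `ω` the integrand is periodic under integral translations, both `Ψ` and
the character being so. Shifting the cube by the coordinates of `w` therefore changes nothing, and
the value of the character at `w` comes out. -/
lemma unipotentAverage_unipotentMul (hω : Submodule.span ℝ (Set.range ω) = ⊤)
    (hper : ∀ i, ∀ B ∈ invertibleMatrices, Ψ (unipotentMul (ω i) B) = Ψ B)
    (hα : ∀ i, ∃ n : ℤ, α * ω i + conj (α * ω i) = n) (hA : A ∈ invertibleMatrices) (w : ℂ) :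
    unipotentAverage ω α Ψ (unipotentMul w A) = addChar (α * w) • unipotentAverage ω α Ψ A := by
  have hw : w ∈ Submodule.span ℝ (Set.range ω) := hω ▸ Submodule.mem_top
  obtain ⟨c, rfl⟩ := (Submodule.mem_span_range_iff_exists_fun ℝ).1 hw
  set z : (ι → ℝ) → ℂ := fun x => ∑ i, (x i : ℂ) * ω i with hz
  have hzadd : ∀ x y, z (x + y) = z x + z y := by
    intro x y
    simp [hz, add_mul, Finset.sum_add_distrib]
  set h : (ι → ℝ) → V N := fun x => addChar (-α * z x) • Ψ (unipotentMul (z x) A) with hh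
  have hP : ∀ (m : ι → ℤ), (∀ B ∈ invertibleMatrices, Ψ (unipotentMul (z fun i => (m i : ℝ)) B) = Ψ B) ∧
      addChar (-α * z fun i => (m i : ℝ)) = 1 := by
    intro m
    constructor
    -- The periods form a group, so it suffices that the generators `ω i` belong to it.
    · let P : AddSubgroup ℂ :=
        { carrier := {p | ∀ B ∈ invertibleMatrices, Ψ (unipotentMul p B) = Ψ B}
          zero_mem' := fun B _ => by
            congr 1
            rw [unipotentMul_apply, ← Matrix.one_fin_two, one_mul]
            rfl
          add_mem' := fun {a b} ha hb B hB => by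
            rw [← unipotentMul_add, ha _ (unipotentMul_mem hB _), hb _ hB]
          neg_mem' := fun {a} ha B hB => by
            rw [← ha _ (unipotentMul_mem hB _), unipotentMul_add, add_neg_cancel]
            congr 1
            rw [unipotentMul_apply, ← Matrix.one_fin_two, one_mul]
            rfl }
      have : (z fun i => (m i : ℝ)) ∈ P := by
        refine P.sum_mem fun i _ => ?_
        have : ((m i : ℝ) : ℂ) * ω i = m i • ω i := by simp
        rw [this]
        exact P.zsmul_mem (fun B hB => hper i B hB) _
      exact this
    · choose n hn using hα
      refine addChar_eq_one (n := -∑ i, m i * n i) ?_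
      simp only [hz]
      push_cast
      rw [Finset.mul_sum, map_sum, ← Finset.sum_add_distrib, ← Finset.sum_neg_distrib]
      refine Finset.sum_congr rfl fun i _ => ?_
      rw [← hn i]
      simp only [map_mul, map_neg, map_intCast]
      ring
  have hp : IsIntegralPeriodic h := by
    intro x m
    simp only [hh]
    rw [add_comm x, hzadd, ← unipotentMul_add, (hP m).1 _ (unipotentMul_mem hA _), mul_add,
      addChar_add, (hP m).2, one_mul]
  have ew : ∑ i, c i • ω i = z c := by simp [hz]
  rw [ew]
  have key := setIntegral_Icc_translate hp c
  rw [unipotentAverage, unipotentAverage, ← key, ← MeasureTheory.integral_smul]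
  refine MeasureTheory.integral_congr_ae (Filter.Eventually.of_forall fun x => ?_)
  simp only [hh]
  rw [smul_smul, hzadd, ← addChar_add, unipotentMul_add]
  congr 2
  ring

end average

end

section

/-! ### Fourier coefficients are multiples of the Whittaker function -/

/-- The matrix `(t z; 0 1)`. -/
def borel (z : ℂ) (t : ℝ) : Fin 2 → Fin 2 → ℂ := Matrix.of.symm !![(t : ℂ), z; 0, 1]

lemma borel_mem (z : ℂ) {t : ℝ} (ht : 0 < t) : borel z t ∈ invertibleMatrices := by
  rw [invertibleMatrices, Set.mem_ofPred_eq, borel, Equiv.apply_symm_apply, Matrix.det_fin_two_of]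
  simpa using ht.ne'

lemma unipotentMul_borel (w z : ℂ) (t : ℝ) : unipotentMul w (borel z t) = borel (z + w) t := by
  simp only [unipotentMul_apply, borel, Equiv.apply_symm_apply]
  congr 1
  ext i j
  fin_cases i <;> fin_cases j <;> simp

section derivatives

variable {N : ℕ} {Ψ : (Fin 2 → Fin 2 → ℂ) → V N}

/-- Right multiplication of `borel z t` by `(1 s c; 0 1)` is left multiplication by `(1 s c t; 0
1)`, so the derivative can be read off from the left equivariance, with `c` scaled by `t`. -/
lemma lieDeriv_unipotent {α z : ℂ} {t : ℝ} (hd : DifferentiableAt ℝ Ψ (borel z t))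
    (h : ∀ w, Ψ (unipotentMul w (borel z t)) = addChar (α * w) • Ψ (borel z t)) (c : ℂ) :
    lieDeriv !![0, c; 0, 0] Ψ (borel z t) =
      (2 * Real.pi * Complex.I * (α * (c * t) + conj (α * (c * t)))) • Ψ (borel z t) := by
  have h1 : HasDerivAt (fun s : ℝ => borel (z + s * (c * t)) t) (mulRight !![0, c; 0, 0] (borel z t)) 0 := by
    rw [hasDerivAt_pi]
    intro i
    rw [hasDerivAt_pi]
    intro j
    have hs : HasDerivAt (fun s : ℝ => (s : ℂ) * (c * t)) (t * c) 0 := by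
      refine ((Complex.ofRealCLM.hasDerivAt (x := (0 : ℝ))).mul_const (c * (t : ℂ))).congr_deriv ?_
      simp [mul_comm]
    fin_cases i <;> fin_cases j <;> simp [borel, hasDerivAt_const]
    exact hs
  have h2 : HasFDerivAt Ψ (fderiv ℝ Ψ (borel z t)) (borel (z + (0 : ℝ) * (c * t)) t) := by
    simpa using hd.hasFDerivAt
  have h3 := h2.comp_hasDerivAt (0 : ℝ) h1
  have h4 : HasDerivAt (fun s : ℝ => addChar (α * (s * (c * t))))
      (2 * Real.pi * Complex.I * (α * (c * t) + conj (α * (c * t)))) 0 := by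
    have e : ∀ s : ℝ, addChar (α * (s * (c * t))) =
        Complex.exp (s * (2 * Real.pi * Complex.I * (α * (c * t) + conj (α * (c * t))))) := by
      intro s
      rw [addChar]
      congr 1
      simp only [map_mul, Complex.conj_ofReal]
      ring
    simp only [e]
    have := ((Complex.ofRealCLM.hasDerivAt (x := (0 : ℝ))).mul_const
      (2 * Real.pi * Complex.I * (α * (c * t) + conj (α * (c * t))))).cexp
    simpa using this
  refine h3.unique ((h4.smul_const (Ψ (borel z t))).congr_of_eventuallyEq
    (Filter.Eventually.of_forall fun s => ?_))
  simp only [Function.comp_apply]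
  rw [← unipotentMul_borel, h]

lemma hasDerivAt_borel {z : ℂ} {t : ℝ} (ht : 0 < t) (hd : DifferentiableAt ℝ Ψ (borel z t)) :
    HasDerivAt (fun s => Ψ (borel z s)) ((1 / t : ℂ) • lieDeriv !![1, 0; 0, 0] Ψ (borel z t)) t := by
  have h1 : HasDerivAt (fun s : ℝ => borel z s) ((1 / t : ℝ) • mulRight !![1, 0; 0, 0] (borel z t)) t := by
    rw [hasDerivAt_pi]
    intro i
    rw [hasDerivAt_pi]
    intro j
    have hs : HasDerivAt (fun s : ℝ => (s : ℂ)) 1 t := Complex.ofRealCLM.hasDerivAt (x := t)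
    have ht' : (t : ℂ) ≠ 0 := by exact_mod_cast ht.ne'
    fin_cases i <;> fin_cases j <;> simp [borel, hasDerivAt_const, ht']
    exact hs
  have h3 := hd.hasFDerivAt.comp_hasDerivAt t h1
  refine h3.congr_deriv ?_
  rw [map_smul, ← lieDeriv_apply]
  ext n
  simp

end derivatives

lemma drho_diag_apply {N : ℕ} (a d : ℂ) (P : V N) (n : Fin (N + 1)) :
    drho N !![a, 0; 0, d] P n = (((N : ℂ) - (n : ℕ)) * a + (n : ℕ) * d) * P n := by
  simp [drho_apply]

lemma torusWeight_apply (k ℓ : ℕ) (ε : ℂ) (P : V (k + ℓ + 2)) (n : Fin (k + ℓ + 2 + 1)) :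
    torusWeight k ℓ ε P n = (((k : ℂ) + ℓ) / 2 + ε / 2 * ((k : ℂ) + ℓ + 2 - 2 * (n : ℕ))) * P n := by
  simp only [torusWeight, LinearMap.add_apply, LinearMap.smul_apply, LinearMap.id_apply,
    Pi.add_apply, Pi.smul_apply, drho_diag_apply, smul_eq_mul]
  push_cast
  ring

/-- `lowering` couples neighbouring components. For `ε = 1` it brings component `n + 1` to place
`n`, hence nothing to the last place, where the Casimir equation is decoupled. For `ε = -1` it
brings component `n` to place `n + 1`, so the other Casimir equation at `n + 1` determines component
`n`. -/
lemma lowering_one_last (k ℓ : ℕ) (P : V (k + ℓ + 2)) :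
    lowering k ℓ 1 P (Fin.last _) = 0 := by
  simp only [lowering, LinearMap.add_apply, LinearMap.smul_apply, Pi.add_apply, Pi.smul_apply,
    drho_apply, smul_eq_mul]
  simp [V.comp]

lemma lowering_neg_one_succ (k ℓ : ℕ) (P : V (k + ℓ + 2)) (n : Fin (k + ℓ + 2)) :
    lowering k ℓ (-1) P n.succ = ((k : ℂ) + ℓ + 2 - (n : ℕ)) * P n.castSucc := by
  have h1 : V.comp P (((n.succ : Fin (k + ℓ + 2 + 1)) : ℕ) - 1) = P n.castSucc := by
    rw [V.comp, dif_pos (by simp)]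
    rfl
  simp only [lowering, LinearMap.add_apply, LinearMap.smul_apply, Pi.add_apply, Pi.smul_apply,
    drho_apply, smul_eq_mul, h1]
  simp
  ring

variable {ι : Type*} [Fintype ι] {k ℓ : ℕ} {Φ : (Fin 2 → Fin 2 → ℂ) → V (k + ℓ + 2)}
  {ω : ι → ℂ} {α : ℂ}

lemma unipotentAverage_borel {N : ℕ} {Ψ : (Fin 2 → Fin 2 → ℂ) → V N}
    (h : ContinuousOn Ψ invertibleMatrices) {t : ℝ} (ht : 0 < t) (n : Fin (N + 1)) :
    unipotentAverage ω α Ψ (borel 0 t) n =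
      latticeMean ω fun z => addChar (-α * z) * Ψ (borel z t) n := by
  have := (ContinuousLinearMap.proj (R := ℂ) (φ := fun _ : Fin (N + 1) => ℂ) n).integral_comp_comm
    (integrableOn_unipotentAverage ω α h (borel_mem 0 ht))
  rw [unipotentAverage]
  simp only [ContinuousLinearMap.proj_apply, Pi.smul_apply, smul_eq_mul, unipotentMul_borel,
    zero_add] at this ⊢
  exact this.symm

/-- The bound is uniform in `α` because the characters have absolute value one; this uniformity is
what bounds the Fourier coefficients polynomially. -/
lemma IsArchimedeanForm.norm_unipotentAverage_le (hΦ : IsArchimedeanForm k ℓ Φ) (ω : ι → ℂ) :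
    ∃ (B : ℝ) (M : ℕ), 0 ≤ B ∧ ∀ (α : ℂ) (t : ℝ), 0 < t →
      ‖unipotentAverage ω α Φ (borel 0 t)‖ ≤ B * (t + t⁻¹ + 1) ^ M := by
  obtain ⟨C, M, hC⟩ := hΦ.growth
  refine ⟨|C| * (∑ i, ‖ω i‖ + 1) ^ M, M, by positivity, fun α t ht => ?_⟩
  have h1 : ∀ x ∈ Set.Icc (0 : ι → ℝ) 1, ‖addChar (-α * ∑ i, (x i : ℂ) * ω i) •
      Φ (unipotentMul (∑ i, (x i : ℂ) * ω i) (borel 0 t))‖ ≤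
        |C| * (∑ i, ‖ω i‖ + 1) ^ M * (t + t⁻¹ + 1) ^ M := by
    intro x hx
    rw [norm_smul, norm_addChar, one_mul, unipotentMul_borel, zero_add]
    refine (hC _ (borel_mem _ ht)).trans ?_
    rw [mul_assoc, ← mul_pow]
    refine mul_le_mul (le_abs_self C) (pow_le_pow_left₀ (by positivity) ?_ M) (by positivity)
      (abs_nonneg C)
    have hz : ‖∑ i, (x i : ℂ) * ω i‖ ≤ ∑ i, ‖ω i‖ := by
      refine (norm_sum_le _ _).trans (Finset.sum_le_sum fun i _ => ?_)
      rw [norm_mul, Complex.norm_real, Real.norm_of_nonneg (hx.1 i)]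
      exact mul_le_of_le_one_left (norm_nonneg _) (hx.2 i)
    have hS : 0 ≤ ∑ i, ‖ω i‖ := by positivity
    have ht' : 0 < t⁻¹ := by positivity
    simp only [borel, Fin.sum_univ_two, Equiv.apply_symm_apply, Matrix.det_fin_two_of,
      Matrix.of_symm_apply, Matrix.of_apply, Matrix.cons_val', Matrix.cons_val_zero,
      Matrix.cons_val_one, Matrix.cons_val_fin_one, norm_zero, norm_one, mul_one, mul_zero, sub_zero,
      norm_inv, Complex.norm_real, Real.norm_of_nonneg ht.le]
    nlinarith
  have h2 := MeasureTheory.norm_setIntegral_le_of_norm_le_const (μ := MeasureTheory.volume)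
    (s := Set.Icc (0 : ι → ℝ) 1) (by rw [Real.volume_Icc_pi]; simp) h1
  refine h2.trans (le_of_eq ?_)
  simp [MeasureTheory.Measure.real, Real.volume_Icc_pi]

/-- `two_smul_casimir` holds at every translate and involves only derivatives and constant
endomorphisms, all of which commute with the average. -/
lemma IsArchimedeanForm.casimir_unipotentAverage (hΦ : IsArchimedeanForm k ℓ Φ) {ε μ : ℂ}
    (hε : ε * ε = 1) (hμ : ∀ A ∈ invertibleMatrices, casimir ε Φ A = μ • Φ A)
    {A : Fin 2 → Fin 2 → ℂ} (hA : A ∈ invertibleMatrices) :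
    lieDeriv !![1, 0; 0, 0] (lieDeriv !![1, 0; 0, 0] (unipotentAverage ω α Φ)) A +
      ((2 : ℂ) • (torusWeight k ℓ ε - 1)) (lieDeriv !![1, 0; 0, 0] (unipotentAverage ω α Φ) A) +
      (torusWeight k ℓ ε * torusWeight k ℓ ε - (2 : ℂ) • torusWeight k ℓ ε - (2 * μ) • 1)
        (unipotentAverage ω α Φ A) +
      lieDeriv !![0, 1; 0, 0] (lieDeriv !![0, 1; 0, 0] (unipotentAverage ω α Φ)) A +
      lieDeriv !![0, Complex.I; 0, 0] (lieDeriv !![0, Complex.I; 0, 0] (unipotentAverage ω α Φ)) A +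
      ((2 : ℂ) • lowering k ℓ ε) (lieDeriv !![0, 1; 0, 0] (unipotentAverage ω α Φ) A) +
      ((-2 * ε * Complex.I) • lowering k ℓ ε)
        (lieDeriv !![0, Complex.I; 0, 0] (unipotentAverage ω α Φ) A) = 0 := by
  have s0 := hΦ.smooth
  have sm := fun X => lieDeriv_smooth s0 X
  have sm2 := fun X => lieDeriv_smooth (sm X) X
  have cT : ∀ (T : V (k + ℓ + 2) →ₗ[ℂ] V (k + ℓ + 2)) {Ψ : (Fin 2 → Fin 2 → ℂ) → V (k + ℓ + 2)},
      ContDiffOn ℝ (⊤ : ℕ∞) Ψ invertibleMatrices → ContinuousOn (fun B => T (Ψ B)) invertibleMatrices :=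
    fun T Ψ h => (LinearMap.toContinuousLinearMap T).continuous.comp_continuousOn h.continuousOn
  have e2 : ∀ X, lieDeriv X (lieDeriv X (unipotentAverage ω α Φ)) A =
      unipotentAverage ω α (lieDeriv X (lieDeriv X Φ)) A := by
    intro X
    rw [lieDeriv_congr (fun B hB => lieDeriv_unipotentAverage ω α s0 hB X) hA,
      lieDeriv_unipotentAverage ω α (sm X) hA]
  rw [e2, e2, e2, lieDeriv_unipotentAverage ω α s0 hA, lieDeriv_unipotentAverage ω α s0 hA,
    lieDeriv_unipotentAverage ω α s0 hA,
    ← unipotentAverage_map ω α _ (sm _).continuousOn hA,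
    ← unipotentAverage_map ω α _ s0.continuousOn hA,
    ← unipotentAverage_map ω α _ (sm _).continuousOn hA,
    ← unipotentAverage_map ω α _ (sm _).continuousOn hA]
  have c1 := (sm2 !![1, 0; 0, 0]).continuousOn.fun_add
    (cT ((2 : ℂ) • (torusWeight k ℓ ε - 1)) (sm !![1, 0; 0, 0]))
  have c2 := c1.fun_add (cT (torusWeight k ℓ ε * torusWeight k ℓ ε - (2 : ℂ) • torusWeight k ℓ ε -
    (2 * μ) • 1) s0)
  have c3 := c2.fun_add (sm2 !![0, 1; 0, 0]).continuousOn
  have c4 := c3.fun_add (sm2 !![0, Complex.I; 0, 0]).continuousOn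
  have c5 := c4.fun_add (cT ((2 : ℂ) • lowering k ℓ ε) (sm !![0, 1; 0, 0]))
  rw [← unipotentAverage_add ω α (sm2 _).continuousOn (cT _ (sm _)) hA,
    ← unipotentAverage_add ω α c1 (cT _ s0) hA,
    ← unipotentAverage_add ω α c2 (sm2 _).continuousOn hA,
    ← unipotentAverage_add ω α c3 (sm2 _).continuousOn hA,
    ← unipotentAverage_add ω α c4 (cT _ (sm _)) hA,
    ← unipotentAverage_add ω α c5 (cT _ (sm _)) hA]
  rw [unipotentAverage_congr (Ψ' := fun _ => 0) ω α (fun B hB => ?_) hA]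
  · simp [unipotentAverage]
  · have h1 := hΦ.two_smul_casimir hB hε
    rw [hμ B hB, map_smul (lowering k ℓ ε), map_sub (lowering k ℓ ε),
      map_smul (lowering k ℓ ε)] at h1
    funext n
    have h2 := congrFun h1 n
    simp only [LinearMap.sub_apply, LinearMap.smul_apply, Module.End.mul_apply,
      Module.End.one_apply, Pi.add_apply, Pi.sub_apply, Pi.smul_apply, smul_eq_mul,
      Pi.zero_apply] at h2 ⊢
    linear_combination -h2

end

/-! ### The differential system for a Fourier coefficient and its solution -/

section

lemma whittaker_ofReal_mul (k ℓ : ℕ) (α : ℂ) {t : ℝ} (ht : 0 < t) (n : Fin (k + ℓ + 2 + 1)) :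
    whittaker k ℓ (α * t) n = ((k + ℓ + 2).choose n : ℂ) *
      (α / (Complex.I * ‖α‖)) ^ ((ℓ : ℤ) + 1 - (n : ℕ)) *
        (besselK ((n : ℕ) - ℓ - 1) (4 * Real.pi * ‖α‖ * t) : ℂ) := by
  have ht' : (t : ℂ) ≠ 0 := by exact_mod_cast ht.ne'
  have e : α * t / (Complex.I * ‖α * t‖) = α / (Complex.I * ‖α‖) := by
    rw [norm_mul, Complex.norm_real, Real.norm_of_nonneg ht.le, Complex.ofReal_mul, ← mul_assoc,
      mul_div_mul_right _ _ ht']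
  rw [whittaker, e, norm_mul, Complex.norm_real, Real.norm_of_nonneg ht.le]
  ring_nf

section system

variable {k ℓ : ℕ} {α : ℂ} {g g1 g2 : ℝ → V (k + ℓ + 2)}

/-- Inserting `y = D t² K_ν`, the quadratic terms cancel by the Bessel equation and there remains `2
m D t² (θ K_ν + ν K_ν)` with `θ = t d/dt`; by the recurrence this is a multiple of `K_{ν-1}`, which
determines the coupling term `x`. -/
lemma whittaker_step (hα : α ≠ 0) {D : ℂ} {ν m : ℝ} {y y1 y2 x : ℝ → ℂ}
    (h : ∀ t, 0 < t → HasDerivAt y (y1 t / t) t) (h1 : ∀ t, 0 < t → HasDerivAt y1 (y2 t / t) t)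
    (hy : ∀ t, 0 < t → y t = D * t ^ 2 * besselK ν (4 * Real.pi * ‖α‖ * t))
    (hs : ∀ t : ℝ, 0 < t → y2 t + 2 * (m - 2) * y1 t + ((m - 2) ^ 2 - (m - ν) ^ 2 -
      (4 * Real.pi * ‖α‖ * t : ℝ) ^ 2) * y t + x t = 0) {t : ℝ} (ht : 0 < t) :
    x t = 2 * m * (4 * Real.pi * ‖α‖ * t) * D * t ^ 2 *
      besselK (ν - 1) (4 * Real.pi * ‖α‖ * t) := by
  set c : ℝ := 4 * Real.pi * ‖α‖ with hc
  have hc0 : 0 < c := by have := norm_pos_iff.2 hα; positivity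
  set κ : ℝ → ℝ := fun t => besselK ν (c * t) with hκ
  set κ1 : ℝ → ℝ := fun t => -ν * besselK ν (c * t) - c * t * besselK (ν - 1) (c * t) with hκ1
  have d0 : ∀ t, 0 < t → HasDerivAt (fun t => (κ t : ℂ)) ((κ1 t / t : ℝ) : ℂ) t :=
    fun t ht => (hasDerivAt_besselK_scaled' hc0 ht ν).ofReal_comp
  have d1 : ∀ t, 0 < t → HasDerivAt (fun t => (κ1 t : ℂ))
      ((((c * t) ^ 2 + ν ^ 2) * κ t / t : ℝ) : ℂ) t :=
    fun t ht => (hasDerivAt_besselK_scaled_two hc0 ht ν).ofReal_comp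
  have dsq : ∀ t : ℝ, HasDerivAt (fun t : ℝ => D * (t : ℂ) ^ 2) (D * (2 * t)) t := by
    intro t
    have := ((Complex.ofRealCLM.hasDerivAt (x := t)).pow 2).const_mul D
    simpa using this
  have hy1 : ∀ t, 0 < t → y1 t = D * t ^ 2 * (2 * κ t + κ1 t) := by
    intro t ht
    have ht' : (t : ℂ) ≠ 0 := by exact_mod_cast ht.ne'
    have e : HasDerivAt y (D * (2 * t) * κ t + D * t ^ 2 * ((κ1 t / t : ℝ) : ℂ)) t :=
      ((dsq t).mul (d0 t ht)).congr_of_eventuallyEq (by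
        filter_upwards [Ioi_mem_nhds ht] with s hs using hy s hs)
    have := (h t ht).unique e
    rw [div_eq_iff ht'] at this
    rw [this]
    push_cast
    field_simp
  have hy2 : y2 t = D * t ^ 2 * (4 * κ t + 4 * κ1 t + ((c * t) ^ 2 + ν ^ 2) * κ t) := by
    have ht' : (t : ℂ) ≠ 0 := by exact_mod_cast ht.ne'
    have e : HasDerivAt y1 (D * (2 * t) * (2 * κ t + κ1 t) + D * t ^ 2 *
        (2 * ((κ1 t / t : ℝ) : ℂ) + ((((c * t) ^ 2 + ν ^ 2) * κ t / t : ℝ) : ℂ))) t :=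
      ((dsq t).mul (((d0 t ht).const_mul 2).add (d1 t ht))).congr_of_eventuallyEq (by
        filter_upwards [Ioi_mem_nhds ht] with s hs using hy1 s hs)
    have := (h1 t ht).unique e
    rw [div_eq_iff ht'] at this
    rw [this]
    push_cast
    field_simp
    ring
  have := hs t ht
  rw [hy1 t ht, hy2, hy t ht] at this
  have ek : (κ1 t : ℂ) = -ν * besselK ν (c * t) - c * t * besselK (ν - 1) (c * t) := by
    simp [hκ1]
  have ek0 : (κ t : ℂ) = besselK ν (c * t) := rfl
  rw [ek, ek0] at this
  have e2 : (4 * Real.pi * ‖α‖ * t : ℂ) = c * t := by rw [hc]; push_cast; ring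
  rw [e2]
  push_cast at this
  linear_combination this

/-- Downward induction on the component. After division by `t²` the top one satisfies the Bessel
equation of order `k + 1`, and its growth leaves only `K_{k+1}`. Each further component is the
coupling term in the equation of its successor, computed by `whittaker_step`. -/
theorem exists_eq_whittaker_of_system (hα : α ≠ 0)
    (h : ∀ t : ℝ, 0 < t → HasDerivAt g ((1 / t : ℂ) • g1 t) t)
    (h1 : ∀ t : ℝ, 0 < t → HasDerivAt g1 ((1 / t : ℂ) • g2 t) t)
    (hlast : ∀ t : ℝ, 0 < t → g2 t (Fin.last _) - 4 * g1 t (Fin.last _) +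
      (3 - (k ^ 2 + 2 * k) - (4 * Real.pi * ‖α‖ * t : ℝ) ^ 2) * g t (Fin.last _) = 0)
    (hsucc : ∀ t : ℝ, 0 < t → ∀ n : Fin (k + ℓ + 2),
      g2 t n.succ + 2 * ((n : ℕ) - 1) * g1 t n.succ + (((n : ℕ) - 1) ^ 2 - (ℓ + 1) ^ 2 -
        (4 * Real.pi * ‖α‖ * t : ℝ) ^ 2) * g t n.succ +
        8 * Real.pi * Complex.I * t * conj α * (k + ℓ + 2 - (n : ℕ)) * g t n.castSucc = 0)
    {B : ℝ} {M : ℕ} (hb : ∀ t, 1 ≤ t → ‖g t (Fin.last _)‖ ≤ B * t ^ M) :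
    ∃ C : ℂ, ∀ t : ℝ, 0 < t → ∀ n, g t n = C * t ^ 2 * whittaker k ℓ (α * t) n := by
  have hα0 : 0 < ‖α‖ := norm_pos_iff.2 hα
  have hc0 : 0 < 4 * Real.pi * ‖α‖ := by positivity
  have hg : ∀ n, ∀ t, 0 < t → HasDerivAt (fun s => g s n) (g1 t n / t) t := fun n t ht =>
    (hasDerivAt_pi.1 (h t ht) n).congr_deriv (by simp [div_eq_inv_mul])
  have hg1 : ∀ n, ∀ t, 0 < t → HasDerivAt (fun s => g1 s n) (g2 t n / t) t := fun n t ht =>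
    (hasDerivAt_pi.1 (h1 t ht) n).congr_deriv (by simp [div_eq_inv_mul])
  set ζ : ℂ := α / (Complex.I * ‖α‖) with hζ
  have hζ0 : ζ ≠ 0 := div_ne_zero hα (mul_ne_zero Complex.I_ne_zero (by exact_mod_cast hα0.ne'))
  obtain ⟨C, hC⟩ : ∃ C : ℂ, ∀ t, 0 < t → g t (Fin.last _) / (t : ℂ) ^ 2 =
      C * besselK (k + 1) (4 * Real.pi * ‖α‖ * t) := by
    refine eq_const_mul_besselK hc0
      (y1 := fun t => (g1 t (Fin.last _) - 2 * g t (Fin.last _)) / (t : ℂ) ^ 2) (fun t ht => ?_)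
      (fun t ht => ?_) (B := B) (M := M) (fun t ht => ?_)
    · have ht' : (t : ℂ) ≠ 0 := by exact_mod_cast ht.ne'
      have hp : HasDerivAt (fun t : ℝ => (t : ℂ) ^ 2) (2 * t) t := by
        simpa using (Complex.ofRealCLM.hasDerivAt (x := t)).fun_pow 2
      refine ((hg _ t ht).fun_div hp (pow_ne_zero 2 ht')).congr_deriv ?_
      field_simp
    · have ht' : (t : ℂ) ≠ 0 := by exact_mod_cast ht.ne'
      have hp : HasDerivAt (fun t : ℝ => (t : ℂ) ^ 2) (2 * t) t := by
        simpa using (Complex.ofRealCLM.hasDerivAt (x := t)).fun_pow 2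
      refine (((hg1 _ t ht).fun_sub ((hg _ t ht).const_mul 2)).fun_div hp
        (pow_ne_zero 2 ht')).congr_deriv ?_
      have := hlast t ht
      push_cast at this ⊢
      field_simp
      linear_combination this
    · rw [norm_div, norm_pow, Complex.norm_real, Real.norm_of_nonneg (by linarith)]
      refine (div_le_self (norm_nonneg _) (one_le_pow₀ ht)).trans (hb t ht)
  -- At the top component `n = k + ℓ + 2` the Whittaker vector carries the phase `ζ ^ (ℓ + 1 - n) =
  -- ζ ^ (-(k + 1))`, which this factor compensates.
  refine ⟨C * ζ ^ ((k : ℤ) + 1), ?_⟩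
  suffices H : ∀ n : Fin (k + ℓ + 2 + 1), ∀ t : ℝ, 0 < t →
      g t n = C * ζ ^ ((k : ℤ) + 1) * t ^ 2 * whittaker k ℓ (α * t) n from fun t ht n => H n t ht
  intro n
  induction n using Fin.reverseInduction with
  | last =>
    intro t ht
    have ht' : (t : ℂ) ≠ 0 := by exact_mod_cast ht.ne'
    rw [whittaker_ofReal_mul k ℓ α ht, ← hζ]
    have := hC t ht
    rw [div_eq_iff (pow_ne_zero 2 ht')] at this
    rw [this]
    have e1 : ζ ^ ((k : ℤ) + 1) * ζ ^ ((ℓ : ℤ) + 1 - ((Fin.last (k + ℓ + 2) : Fin _) : ℕ)) = 1 := by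
      rw [← zpow_add₀ hζ0, Fin.val_last]
      push_cast
      rw [show (k : ℤ) + 1 + (ℓ + 1 - (k + ℓ + 2)) = 0 by ring, zpow_zero]
    have e2 : (((Fin.last (k + ℓ + 2) : Fin _) : ℕ) : ℝ) - ℓ - 1 = k + 1 := by
      rw [Fin.val_last]; push_cast; ring
    rw [e2, Fin.val_last, Nat.choose_self, Nat.cast_one]
    rw [Fin.val_last] at e1
    linear_combination (-C * (besselK (k + 1) (4 * Real.pi * ‖α‖ * t)) * t ^ 2) * e1
  | cast n ih =>
    intro t ht
    have ht' : (t : ℂ) ≠ 0 := by exact_mod_cast ht.ne'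
    have hn : (n : ℕ) < k + ℓ + 2 := n.2
    have key := whittaker_step (y := fun t => g t n.succ) (y1 := fun t => g1 t n.succ)
      (y2 := fun t => g2 t n.succ) hα (m := (n : ℕ) + 1)
      (ν := ((n : ℕ) + 1 : ℕ) - ℓ - 1)
      (D := C * ζ ^ ((k : ℤ) + 1) * (((k + ℓ + 2).choose ((n : ℕ) + 1) : ℂ) *
        ζ ^ ((ℓ : ℤ) + 1 - ((n : ℕ) + 1 : ℕ))))
      (x := fun t => 8 * Real.pi * Complex.I * t * conj α * (k + ℓ + 2 - (n : ℕ)) * g t n.castSucc)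
      (hg _) (hg1 _) (fun t ht => by
        rw [ih t ht, whittaker_ofReal_mul k ℓ α ht, ← hζ, Fin.val_succ]; ring)
      (fun t ht => by
        have := hsucc t ht n
        push_cast at this ⊢
        linear_combination this) ht
    rw [whittaker_ofReal_mul k ℓ α ht, ← hζ]
    simp only [Fin.val_castSucc] at key ⊢
    have e1 : (((n : ℕ) + 1 : ℕ) - ℓ - 1 - 1 : ℝ) = (n : ℕ) - ℓ - 1 := by push_cast; ring
    rw [e1] at key
    have e2 : ζ ^ ((ℓ : ℤ) + 1 - (n : ℕ)) = ζ * ζ ^ ((ℓ : ℤ) + 1 - ((n : ℕ) + 1 : ℕ)) := by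
      rw [← zpow_one_add₀ hζ0]
      congr 1
      push_cast
      ring
    have e3 : ((k + ℓ + 2).choose ((n : ℕ) + 1) : ℂ) * ((n : ℕ) + 1) =
        (k + ℓ + 2).choose n * (k + ℓ + 2 - (n : ℕ)) := by
      have := Nat.choose_succ_right_eq (k + ℓ + 2) n
      rw [← @Nat.cast_inj ℂ] at this
      push_cast [Nat.cast_sub hn.le] at this
      exact this
    have e4 : ζ * (Complex.I * conj α) = ‖α‖ := by
      rw [hζ, div_mul_eq_mul_div, div_eq_iff (mul_ne_zero Complex.I_ne_zero
        (by exact_mod_cast hα0.ne'))]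
      have := Complex.mul_conj' α
      linear_combination Complex.I * this
    have hN : (k + ℓ + 2 - (n : ℕ) : ℂ) ≠ 0 := by
      rw [sub_ne_zero]
      exact_mod_cast hn.ne'
    have hca : conj α ≠ 0 := by simpa using hα
    have hnz : (8 * Real.pi * Complex.I * t * conj α * (k + ℓ + 2 - (n : ℕ)) : ℂ) ≠ 0 := by
      have : (Real.pi : ℂ) ≠ 0 := by exact_mod_cast Real.pi_ne_zero
      refine mul_ne_zero (mul_ne_zero (mul_ne_zero (mul_ne_zero (mul_ne_zero ?_ this) Complex.I_ne_zero) ht') hca) hN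
      norm_num
    -- The coupling coefficient is nonzero because `α ≠ 0` and `n < k + ℓ + 2`; the rest is the
    -- ratio of consecutive binomial coefficients and `ζ · i · conj α = ‖α‖`.
    apply mul_left_cancel₀ hnz
    rw [key, e2]
    push_cast at e3 ⊢
    rw [← e4]
    linear_combination (8 * Real.pi * (ζ * (Complex.I * conj α)) * t * C * ζ ^ ((k : ℤ) + 1) *
      ζ ^ ((ℓ : ℤ) + 1 - ((n : ℤ) + 1)) * t ^ 2 *
      besselK ((n : ℕ) - ℓ - 1) (4 * Real.pi * ‖α‖ * t)) * e3

end system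

section periodic

variable {ι : Type*} [Fintype ι] {N : ℕ} {Ψ : (Fin 2 → Fin 2 → ℂ) → V N} {ω : ι → ℂ} {α : ℂ}

lemma lieDeriv_unipotentMul (w : ℂ) (c : ℂ) (h : ContDiffOn ℝ (⊤ : ℕ∞) Ψ invertibleMatrices)
    (hw : ∀ B ∈ invertibleMatrices, Ψ (unipotentMul w B) = c • Ψ B) {A : Fin 2 → Fin 2 → ℂ}
    (hA : A ∈ invertibleMatrices) (X : Matrix (Fin 2) (Fin 2) ℂ) :
    lieDeriv X Ψ (unipotentMul w A) = c • lieDeriv X Ψ A := by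
  have hd := differentiableAt_of_smooth h (unipotentMul_mem hA w)
  rw [← lieDeriv_smul c (differentiableAt_of_smooth h hA), ← lieDeriv_congr hw hA]
  have hc : HasFDerivAt (fun B => Ψ (unipotentMul w B))
      ((fderiv ℝ Ψ (unipotentMul w A)).comp (unipotentMul w)) A :=
    hd.hasFDerivAt.comp A (unipotentMul w).hasFDerivAt
  rw [lieDeriv_apply, lieDeriv_apply, hc.fderiv, ContinuousLinearMap.comp_apply,
    unipotentMul_mulRight]

variable {k ℓ : ℕ} {Φ : (Fin 2 → Fin 2 → ℂ) → V (k + ℓ + 2)}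

/-- On the average the unipotent derivatives act by scalars, so the Casimir equations become
ordinary differential equations on the ray `borel 0 t`. -/
theorem IsArchimedeanForm.exists_unipotentAverage_eq (hΦ : IsArchimedeanForm k ℓ Φ)
    (hω : Submodule.span ℝ (Set.range ω) = ⊤)
    (hper : ∀ i, ∀ B ∈ invertibleMatrices, Φ (unipotentMul (ω i) B) = Φ B)
    (hαω : ∀ i, ∃ n : ℤ, α * ω i + conj (α * ω i) = n) (hα : α ≠ 0) :
    ∃ C : ℂ, ∀ t : ℝ, 0 < t → ∀ n, unipotentAverage ω α Φ (borel 0 t) n =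
      C * t ^ 2 * whittaker k ℓ (α * t) n := by
  have s0 := hΦ.smooth
  set φ := unipotentAverage ω α Φ with hφ
  have sX := fun X => lieDeriv_smooth s0 X
  have eX : ∀ X, ∀ B ∈ invertibleMatrices, lieDeriv X φ B = unipotentAverage ω α (lieDeriv X Φ) B :=
    fun X B hB => lieDeriv_unipotentAverage ω α s0 hB X
  have d0 : ∀ B ∈ invertibleMatrices, DifferentiableAt ℝ φ B :=
    fun B hB => differentiableAt_unipotentAverage ω α s0 hB
  have d1 : ∀ X, ∀ B ∈ invertibleMatrices, DifferentiableAt ℝ (lieDeriv X φ) B := fun X B hB =>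
    (differentiableAt_unipotentAverage ω α (sX X) hB).congr_of_eventuallyEq (by
      filter_upwards [isOpen_invertibleMatrices.mem_nhds hB] with B' hB' using eX X B' hB')
  have p0 : ∀ w, ∀ B ∈ invertibleMatrices, φ (unipotentMul w B) = addChar (α * w) • φ B :=
    fun w B hB => unipotentAverage_unipotentMul hω hper hαω hB w
  have p1 : ∀ X w, ∀ B ∈ invertibleMatrices,
      lieDeriv X φ (unipotentMul w B) = addChar (α * w) • lieDeriv X φ B := by
    intro X w B hB
    rw [eX X _ (unipotentMul_mem hB w), eX X B hB]
    refine unipotentAverage_unipotentMul hω (fun i B hB => ?_) hαω hB w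
    have := lieDeriv_unipotentMul (ω i) 1 s0 (fun B hB => by rw [hper i B hB, one_smul]) hB X
    rwa [one_smul] at this
  have u0 : ∀ t : ℝ, 0 < t → ∀ c : ℂ, lieDeriv !![0, c; 0, 0] φ (borel 0 t) =
      (2 * Real.pi * Complex.I * (α * (c * t) + conj (α * (c * t)))) • φ (borel 0 t) :=
    fun t ht c => lieDeriv_unipotent (d0 _ (borel_mem 0 ht)) (fun w => p0 w _ (borel_mem 0 ht)) c
  have u1 : ∀ t : ℝ, 0 < t → ∀ c : ℂ,
      lieDeriv !![0, c; 0, 0] (lieDeriv !![0, c; 0, 0] φ) (borel 0 t) =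
      (2 * Real.pi * Complex.I * (α * (c * t) + conj (α * (c * t)))) ^ 2 • φ (borel 0 t) := by
    intro t ht c
    rw [lieDeriv_unipotent (d1 _ _ (borel_mem 0 ht)) (fun w => p1 _ w _ (borel_mem 0 ht)) c,
      u0 t ht c, smul_smul, sq]
  -- The directions `1` and `i` together contribute `(2 π i t)² ((α + conj α)² + (i α + conj (i
  -- α))²) = -(4 π ‖α‖ t)²`, the inhomogeneity of the Bessel equation.
  have cas : ∀ (ε μ : ℂ), ε * ε = 1 →
      (∀ A ∈ invertibleMatrices, casimir ε Φ A = μ • Φ A) → ∀ t : ℝ, 0 < t → ∀ n,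
      lieDeriv !![1, 0; 0, 0] (lieDeriv !![1, 0; 0, 0] φ) (borel 0 t) n +
        2 * (((k : ℂ) + ℓ) / 2 + ε / 2 * ((k : ℂ) + ℓ + 2 - 2 * (n : ℕ)) - 1) *
          lieDeriv !![1, 0; 0, 0] φ (borel 0 t) n +
        ((((k : ℂ) + ℓ) / 2 + ε / 2 * ((k : ℂ) + ℓ + 2 - 2 * (n : ℕ)) - 1) ^ 2 - 1 - 2 * μ -
          (4 * Real.pi * ‖α‖ * t : ℝ) ^ 2) * φ (borel 0 t) n +
        4 * Real.pi * Complex.I * t * ((1 + ε) * α + (1 - ε) * conj α) *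
          lowering k ℓ ε (φ (borel 0 t)) n = 0 := by
    intro ε μ hε hμ t ht n
    have := congrFun (hΦ.casimir_unipotentAverage (ω := ω) (α := α) hε hμ (borel_mem 0 ht)) n
    rw [← hφ, u1 t ht, u1 t ht, u0 t ht, u0 t ht] at this
    simp only [Pi.add_apply, LinearMap.smul_apply, LinearMap.sub_apply, Module.End.one_apply,
      Module.End.mul_apply, Pi.smul_apply, Pi.sub_apply, smul_eq_mul, torusWeight_apply,
      map_smul, Pi.zero_apply, map_mul, Complex.conj_I, Complex.conj_ofReal, map_one] at this
    have hn : (‖α‖ : ℂ) ^ 2 = α * conj α := (Complex.mul_conj' α).symm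
    push_cast
    linear_combination this - 16 * Real.pi ^ 2 * t ^ 2 * φ (borel 0 t) n * hn +
      (4 * Real.pi * t * ε * Complex.I * (α - conj α) * lowering k ℓ ε (φ (borel 0 t)) n +
        Real.pi ^ 2 * t ^ 2 * φ (borel 0 t) n * (-4 * (α ^ 2 + conj α ^ 2) * Complex.I ^ 2 +
          8 * α * conj α * (Complex.I ^ 2 - 2))) * Complex.I_sq
  obtain ⟨B, M, hB, hbd⟩ := hΦ.norm_unipotentAverage_le ω
  refine exists_eq_whittaker_of_system hα
    (g1 := fun t => lieDeriv !![1, 0; 0, 0] φ (borel 0 t))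
    (g2 := fun t => lieDeriv !![1, 0; 0, 0] (lieDeriv !![1, 0; 0, 0] φ) (borel 0 t))
    (fun t ht => hasDerivAt_borel ht (d0 _ (borel_mem 0 ht)))
    (fun t ht => hasDerivAt_borel ht (d1 _ _ (borel_mem 0 ht))) (fun t ht => ?_)
    (fun t ht n => ?_) (B := B * 3 ^ M) (M := M) (fun t ht => ?_)
  · have := cas 1 _ (by ring) hΦ.casimir_id t ht (Fin.last _)
    rw [lowering_one_last, Fin.val_last] at this
    push_cast at this ⊢
    linear_combination this
  · have := cas (-1) _ (by ring) hΦ.casimir_conj t ht n.succ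
    rw [lowering_neg_one_succ, Fin.val_succ] at this
    push_cast at this ⊢
    linear_combination this
  · refine (norm_le_pi_norm _ _).trans ((hbd α t (by linarith)).trans ?_)
    rw [mul_assoc, ← mul_pow]
    have : t⁻¹ ≤ 1 := inv_le_one_of_one_le₀ ht
    have : 0 ≤ t⁻¹ := by positivity
    exact mul_le_mul_of_nonneg_left (pow_le_pow_left₀ (by positivity) (by linarith) M) hB

end periodic

end

section

/-! ### Polynomial bounds for the Whittaker function -/

/-- Use `cosh u ≥ e ^ u / 2` and `exp (-y) ≤ P! y ^ (-P)`; the condition `|ν| < P` keeps the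
integrand integrable. The bound holds for all `x > 0` at once, which avoids separating small and
large arguments. -/
lemma besselK_le_inv_pow (ν : ℝ) {P : ℕ} (hP : |ν| < P) :
    ∃ B : ℝ, 0 ≤ B ∧ ∀ x, 0 < x → besselK ν x ≤ B * x⁻¹ ^ P := by
  have hi : MeasureTheory.IntegrableOn (fun u : ℝ => (2 : ℝ) ^ P * Real.exp (-(P - |ν|) * u))
      (Set.Ioi 0) := (exp_neg_integrableOn_Ioi 0 (by linarith)).const_mul _
  refine ⟨P.factorial * ∫ u in Set.Ioi (0 : ℝ), (2 : ℝ) ^ P * Real.exp (-(P - |ν|) * u), ?_,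
    fun x hx => ?_⟩
  · exact mul_nonneg (by positivity) (MeasureTheory.integral_nonneg fun u => by positivity)
  have h : besselK ν x ≤ ∫ u in Set.Ioi (0 : ℝ),
      (P.factorial * x⁻¹ ^ P) * ((2 : ℝ) ^ P * Real.exp (-(P - |ν|) * u)) := by
    refine MeasureTheory.setIntegral_mono_on (integrableOn_besselK hx ν) (hi.const_mul _)
      measurableSet_Ioi fun u hu => ?_
    have hu' : (0 : ℝ) ≤ u := le_of_lt hu
    have h1 := cosh_mul_le_exp ν u hu'
    have hc : Real.exp u / 2 ≤ Real.cosh u := by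
      rw [Real.cosh_eq]; have := Real.exp_pos (-u); linarith
    have hy : 0 < x * (Real.exp u / 2) := by positivity
    have h2 : Real.exp (-x * Real.cosh u) ≤ P.factorial * (x * (Real.exp u / 2))⁻¹ ^ P := by
      have h3 := Real.pow_div_factorial_le_exp _ hy.le P
      have h4 : Real.exp (-x * Real.cosh u) ≤ Real.exp (-(x * (Real.exp u / 2))) := by
        apply Real.exp_le_exp.2
        nlinarith
      refine h4.trans ?_
      rw [Real.exp_neg, inv_pow, ← div_eq_mul_inv]
      rw [inv_le_comm₀ (Real.exp_pos _) (by positivity), inv_div]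
      exact h3
    calc Real.exp (-x * Real.cosh u) * Real.cosh (ν * u)
        ≤ (P.factorial * (x * (Real.exp u / 2))⁻¹ ^ P) * Real.exp (|ν| * u) :=
          mul_le_mul h2 h1 (Real.cosh_pos _).le (by positivity)
      _ = _ := by
          have e : Real.exp (-(P - |ν|) * u) = (Real.exp u ^ P)⁻¹ * Real.exp (|ν| * u) := by
            rw [← Real.exp_nat_mul, ← Real.exp_neg, ← Real.exp_add]
            ring_nf
          rw [e, mul_inv, inv_div, mul_pow, div_pow]
          have := (Real.exp_pos u).ne'
          field_simp
  rw [MeasureTheory.integral_const_mul] at h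
  calc besselK ν x ≤ _ := h
    _ = _ := by ring

lemma norm_div_I_mul_norm {s : ℂ} (hs : s ≠ 0) : ‖s / (Complex.I * ‖s‖)‖ = 1 := by
  rw [norm_div, norm_mul, Complex.norm_I, one_mul, Complex.norm_real, norm_norm,
    div_self (norm_ne_zero_iff.2 hs)]

lemma norm_whittaker_le (k ℓ : ℕ) (n : Fin (k + ℓ + 2 + 1)) {P : ℕ} (hP : k + ℓ + 2 < P) :
    ∃ B : ℝ, 0 ≤ B ∧ ∀ s : ℂ, s ≠ 0 → ‖whittaker k ℓ s n‖ ≤ B * ‖s‖⁻¹ ^ P := by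
  have hν : |((n : ℕ) : ℝ) - ℓ - 1| < P := by
    have h1 : ((n : ℕ) : ℝ) ≤ k + ℓ + 2 := by exact_mod_cast Nat.lt_succ_iff.1 n.2
    have h2 : ((k : ℝ) + ℓ + 2) < P := by exact_mod_cast hP
    have h3 : (0 : ℝ) ≤ (n : ℕ) := by positivity
    have h4 : (0 : ℝ) ≤ k := by positivity
    have h5 : (0 : ℝ) ≤ ℓ := by positivity
    rw [abs_lt]
    constructor <;> linarith
  obtain ⟨B, hB, h⟩ := besselK_le_inv_pow _ hν
  refine ⟨(k + ℓ + 2).choose n * (B * (4 * Real.pi)⁻¹ ^ P), by positivity, fun s hs => ?_⟩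
  have hs' := norm_pos_iff.2 hs
  rw [whittaker, norm_mul, norm_mul, norm_zpow, norm_div_I_mul_norm hs, one_zpow, mul_one,
    Complex.norm_natCast, Complex.norm_real, Real.norm_of_nonneg (besselK_nonneg _ _)]
  have hpos : 0 < 4 * Real.pi * ‖s‖ := by positivity
  calc _ ≤ ((k + ℓ + 2).choose n : ℝ) * (B * (4 * Real.pi * ‖s‖)⁻¹ ^ P) :=
        mul_le_mul_of_nonneg_left (h _ hpos) (Nat.cast_nonneg _)
    _ = _ := by rw [mul_inv, mul_pow]; ring

/-- At `n = ℓ + 1` the phase is trivial and the Bessel order is zero, so the component depends on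
`‖s‖` only and never vanishes for `s ≠ 0`; this is where Fourier coefficients are read off. -/
lemma whittaker_middle (k ℓ : ℕ) (s : ℂ) (hn : ℓ + 1 < k + ℓ + 2 + 1) :
    whittaker k ℓ s ⟨ℓ + 1, hn⟩ =
      ((k + ℓ + 2).choose (ℓ + 1) : ℂ) * (besselK 0 (4 * Real.pi * ‖s‖) : ℂ) := by
  simp [whittaker]

/-! ### Fourier expansions -/

/-- The frequencies `α a` are parametrized by `ι → ℤ` by means of the trace pairing with `ω`. -/
structure IsDualPair {ι A : Type*} (ω : ι → ℂ) (α : A → ℂ) (e : A ≃ (ι → ℤ)) : Prop where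
  span : Submodule.span ℝ (Set.range ω) = ⊤
  pair : ∀ a i, α a * ω i + conj (α a * ω i) = e a i

namespace IsDualPair

variable {ι A : Type*} [Fintype ι] {ω : ι → ℂ} {α : A → ℂ} {e : A ≃ (ι → ℤ)}
  (h : IsDualPair ω α e)
include h

omit [Fintype ι] in
lemma injective : Function.Injective α := by
  intro a b hab
  refine e.injective (funext fun i => ?_)
  have h1 := h.pair a i
  rw [hab, h.pair b i] at h1
  exact_mod_cast h1.symm

lemma eq_zero_iff (a : A) : α a = 0 ↔ e a = 0 := by
  constructor
  · intro h0
    funext i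
    have := h.pair a i
    rw [h0, zero_mul, map_zero, add_zero] at this
    exact_mod_cast this.symm
  · intro h0
    have key : ∀ z : ℂ, (α a * z).re = 0 := by
      intro z
      have hz : z ∈ Submodule.span ℝ (Set.range ω) := h.span ▸ Submodule.mem_top
      obtain ⟨c, rfl⟩ := (Submodule.mem_span_range_iff_exists_fun ℝ).1 hz
      rw [Finset.mul_sum, Complex.re_sum]
      refine Finset.sum_eq_zero fun i _ => ?_
      have h1 := h.pair a i
      rw [h0, Complex.add_conj] at h1
      have h2 : (α a * ω i).re = 0 := by
        have : (2 * (α a * ω i).re) = 0 := by rw [Pi.zero_apply] at h1; exact_mod_cast h1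
        linarith
      rw [mul_smul_comm, Complex.real_smul, Complex.re_ofReal_mul, h2, mul_zero]
    have h1 := key (conj (α a))
    rw [Complex.mul_conj, Complex.ofReal_re] at h1
    exact Complex.normSq_eq_zero.1 h1

lemma exists_norm_le : ∃ S : ℝ, 1 ≤ S ∧ ∀ a, ‖e a‖ ≤ S * ‖α a‖ := by
  refine ⟨2 * ∑ i, ‖ω i‖ + 1, by have : 0 ≤ ∑ i, ‖ω i‖ := by positivity
                                 linarith, fun a => ?_⟩
  refine (pi_norm_le_iff_of_nonneg (by positivity)).2 fun i => ?_
  have h1 : ‖e a i‖ = ‖((e a i : ℤ) : ℂ)‖ := by rw [Complex.norm_intCast, Int.norm_eq_abs]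
  rw [h1, ← h.pair a i]
  refine (norm_add_le _ _).trans ?_
  rw [Complex.norm_conj, norm_mul]
  have h2 : ‖ω i‖ ≤ ∑ i, ‖ω i‖ := Finset.single_le_sum (f := fun i => ‖ω i‖) (fun _ _ => norm_nonneg _) (Finset.mem_univ i)
  nlinarith [norm_nonneg (α a)]

lemma exists_one_le : ∃ S : ℝ, 1 ≤ S ∧ ∀ a, α a ≠ 0 → 1 ≤ S * ‖α a‖ := by
  obtain ⟨S, hS, hb⟩ := h.exists_norm_le
  refine ⟨S, hS, fun a ha => le_trans ?_ (hb a)⟩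
  have h0 : e a ≠ 0 := fun h0 => ha ((h.eq_zero_iff a).2 h0)
  obtain ⟨i, hi⟩ := Function.ne_iff.1 h0
  refine le_trans ?_ (norm_le_pi_norm (e a) i)
  rw [Int.norm_eq_abs]
  exact_mod_cast Int.one_le_abs hi

/-- `‖e a‖ ≤ S ‖α a‖` compares the sum with the one over the lattice `ℤ ^ ι`, which converges for
exponents larger than the rank. -/
lemma summable_inv_pow {P : ℕ} (hP : Fintype.card ι < P) : Summable fun a => ‖α a‖⁻¹ ^ P := by
  obtain ⟨S, hS, hb⟩ := h.exists_norm_le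
  let b := Pi.basisFun ℝ ι
  let L := Submodule.span ℤ (Set.range b)
  have hr : Module.finrank ℤ L = Fintype.card ι := by
    rw [ZLattice.rank ℝ L, Module.finrank_fintype_fun_eq_card]
  have h1 := ZLattice.summable_norm_pow_inv L P (by rw [hr]; exact hP)
  let f : A → L := fun a => ⟨fun i => (e a i : ℝ), by
    rw [Module.Basis.mem_span_iff_repr_mem]
    intro i
    exact ⟨e a i, by simp [b]⟩⟩
  have hf : Function.Injective f := by
    intro a a' haa
    refine e.injective (funext fun i => ?_)
    have : ((e a i : ℤ) : ℝ) = e a' i := congrFun (congrArg Subtype.val haa) i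
    exact_mod_cast this
  have h2 := (h1.comp_injective hf).mul_left (S ^ P)
  refine Summable.of_nonneg_of_le (fun a => by positivity) (fun a => ?_) h2
  have hn : ‖f a‖ = ‖e a‖ := by
    change ‖fun i => (e a i : ℝ)‖ = _
    rw [Pi.norm_def, Pi.norm_def]
    rfl
  simp only [Function.comp_apply, hn]
  by_cases h0 : e a = 0
  -- For the zero frequency both sides vanish, since `0⁻¹ = 0` and `P ≠ 0`.
  · rw [(h.eq_zero_iff a).2 h0, h0]
    simp [zero_pow (by omega : P ≠ 0)]
  · rw [← mul_pow]
    refine pow_le_pow_left₀ (by positivity) ?_ P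
    have hp : 0 < ‖e a‖ := norm_pos_iff.2 h0
    have hq : 0 < ‖α a‖ := norm_pos_iff.2 fun h' => h0 ((h.eq_zero_iff a).1 h')
    rw [← div_eq_mul_inv, le_div_iff₀ hp, inv_mul_le_iff₀ hq, mul_comm]
    exact hb a

end IsDualPair

end

/-! ### Fourier expansions of archimedean forms -/

section

variable {ι A : Type*} [Fintype ι] {ω : ι → ℂ} {α : A → ℂ} {e : A ≃ (ι → ℤ)}
  {k ℓ : ℕ} {Φ : (Fin 2 → Fin 2 → ℂ) → V (k + ℓ + 2)}

/-- `C` is the family of nonconstant Fourier coefficients of `Φ`. -/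
structure IsCoefficientFamily (ω : ι → ℂ) (α : A → ℂ) (Φ : (Fin 2 → Fin 2 → ℂ) → V (k + ℓ + 2))
    (C : A → ℂ) : Prop where
  zero : ∀ a, α a = 0 → C a = 0
  bound : ∃ (B : ℝ) (M : ℕ), 0 ≤ B ∧ ∀ a, ‖C a‖ ≤ B * ‖α a‖ ^ M
  coeff : ∀ a, α a ≠ 0 → ∀ (t : ℝ) (_ : 0 < t) (n : Fin (k + ℓ + 2 + 1)),
    latticeMean ω (fun z => addChar (-α a * z) * Φ (borel z t) n) =
      C a * t ^ 2 * whittaker k ℓ (α a * t) n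

/-- The coefficients come from `exists_unipotentAverage_eq`. For the polynomial bound the average is
evaluated at a height where the middle Whittaker component is a fixed positive number. -/
theorem IsArchimedeanForm.exists_isCoefficientFamily (hΦ : IsArchimedeanForm k ℓ Φ)
    (hper : ∀ i, ∀ B ∈ invertibleMatrices, Φ (unipotentMul (ω i) B) = Φ B)
    (h : IsDualPair ω α e) : ∃ C : A → ℂ, IsCoefficientFamily ω α Φ C := by
  have key : ∀ a, ∃ C : ℂ, α a ≠ 0 → ∀ t : ℝ, 0 < t → ∀ n,
      unipotentAverage ω (α a) Φ (borel 0 t) n = C * t ^ 2 * whittaker k ℓ (α a * t) n := by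
    intro a
    by_cases h0 : α a = 0
    · exact ⟨0, fun h => absurd h0 h⟩
    · obtain ⟨C, hC⟩ := hΦ.exists_unipotentAverage_eq h.span hper (fun i => ⟨_, h.pair a i⟩) h0
      exact ⟨C, fun _ => hC⟩
  choose C hC using key
  refine ⟨fun a => if α a = 0 then 0 else C a, ⟨fun a ha => if_pos ha, ?_, fun a ha t ht n => ?_⟩⟩
  · obtain ⟨B, M, hB, hbd⟩ := hΦ.norm_unipotentAverage_le ω
    obtain ⟨S, hS, hS1⟩ := h.exists_one_le
    have hch : 0 < ((k + ℓ + 2).choose (ℓ + 1) : ℝ) :=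
      by exact_mod_cast Nat.choose_pos (by omega)
    have hK : 0 < besselK 0 (4 * Real.pi) := besselK_pos (by positivity) 0
    set κ := ((k + ℓ + 2).choose (ℓ + 1) : ℝ) * besselK 0 (4 * Real.pi) with hκ
    have hκ0 : 0 < κ := mul_pos hch hK
    refine ⟨B * (S * S + 1 + S) ^ M / κ, M + 2, by positivity, fun a => ?_⟩
    by_cases h0 : α a = 0
    · rw [if_pos h0, norm_zero]
      positivity
    rw [if_neg h0]
    have hp : 0 < ‖α a‖ := norm_pos_iff.2 h0
    -- At the height `‖α a‖⁻¹` the Whittaker function is evaluated on the unit circle.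
    have h1 := hbd (α a) ‖α a‖⁻¹ (inv_pos.2 hp)
    have h2 := (norm_le_pi_norm _ (⟨ℓ + 1, by omega⟩ : Fin (k + ℓ + 2 + 1))).trans h1
    rw [hC a h0 _ (inv_pos.2 hp), whittaker_middle] at h2
    have e1 : ‖α a * (‖α a‖⁻¹ : ℝ)‖ = 1 := by
      rw [norm_mul, Complex.norm_real, norm_inv, norm_norm, mul_inv_cancel₀ hp.ne']
    rw [e1, mul_one, norm_mul, norm_mul, norm_pow, Complex.norm_real, norm_inv, norm_norm, inv_inv,
      norm_mul, Complex.norm_natCast, Complex.norm_real, Real.norm_of_nonneg hK.le, ← hκ] at h2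
    have h3 : ‖α a‖⁻¹ + ‖α a‖ + 1 ≤ (S * S + 1 + S) * ‖α a‖ := by
      have h4 := hS1 a h0
      have h5 : ‖α a‖⁻¹ ≤ S := by rw [inv_le_iff_one_le_mul₀ hp]; exact h4
      nlinarith
    rw [div_mul_eq_mul_div, le_div_iff₀ hκ0]
    have h7 : B * (‖α a‖⁻¹ + ‖α a‖ + 1) ^ M ≤ B * ((S * S + 1 + S) * ‖α a‖) ^ M :=
      mul_le_mul_of_nonneg_left (pow_le_pow_left₀ (by positivity) h3 M) hB
    calc ‖C a‖ * κ = (‖C a‖ * ‖α a‖⁻¹ ^ 2 * κ) * ‖α a‖ ^ 2 := by field_simp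
      _ ≤ (B * ((S * S + 1 + S) * ‖α a‖) ^ M) * ‖α a‖ ^ 2 :=
          mul_le_mul_of_nonneg_right (h2.trans h7) (by positivity)
      _ = _ := by rw [mul_pow, pow_add]; ring
  · rw [if_neg ha, ← hC a ha t ht n, unipotentAverage_borel hΦ.smooth.continuousOn ht]

namespace IsCoefficientFamily

variable {C : A → ℂ} (hC : IsCoefficientFamily ω α Φ C)
include hC

/-- The terms of the Fourier expansion decay rapidly. -/
lemma exists_bound (h : IsDualPair ω α e) (n : Fin (k + ℓ + 2 + 1)) :
    ∃ P₀ : ℕ, ∀ P ≥ P₀, ∃ (B : ℝ) (b : A → ℝ), 0 ≤ B ∧ Summable b ∧ ∀ a, 0 ≤ b a ∧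
      ∀ t : ℝ, 0 < t → ‖C a * t ^ 2 * whittaker k ℓ (α a * t) n‖ ≤ B * (t ^ 2 * t⁻¹ ^ P) * b a := by
  obtain ⟨B, M, hB, hb⟩ := hC.bound
  -- The exponent must exceed `k + ℓ + 2` for the Whittaker bound, and after losing `M` to the
  -- coefficients it must still exceed `card ι` for summability over the frequencies.
  refine ⟨M + Fintype.card ι + k + ℓ + 3, fun P hP => ?_⟩
  obtain ⟨B', hB', hb'⟩ := norm_whittaker_le k ℓ n (P := P) (by omega)
  refine ⟨B * B', fun a => ‖α a‖⁻¹ ^ (P - M), by positivity, h.summable_inv_pow (by omega),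
    fun a => ⟨by positivity, fun t ht => ?_⟩⟩
  by_cases h0 : α a = 0
  · rw [hC.zero a h0]
    simp only [zero_mul, norm_zero]
    positivity
  have hp : 0 < ‖α a‖ := norm_pos_iff.2 h0
  have ht' : (t : ℂ) ≠ 0 := by exact_mod_cast ht.ne'
  have h1 := hb' _ (mul_ne_zero h0 ht')
  rw [norm_mul, norm_mul, norm_pow, Complex.norm_real, Real.norm_of_nonneg ht.le]
  rw [norm_mul (α a), Complex.norm_real, Real.norm_of_nonneg ht.le] at h1
  have e2 : ‖α a‖⁻¹ ^ P = ‖α a‖⁻¹ ^ (P - M) * ‖α a‖⁻¹ ^ M := by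
    rw [← pow_add]; congr 1; omega
  have e3 : ‖α a‖ ^ M * ‖α a‖⁻¹ ^ M = 1 := by
    rw [← mul_pow, mul_inv_cancel₀ hp.ne', one_pow]
  calc ‖C a‖ * t ^ 2 * ‖whittaker k ℓ (α a * t) n‖
      ≤ (B * ‖α a‖ ^ M) * t ^ 2 * (B' * (‖α a‖ * t)⁻¹ ^ P) := by
        have := hb a
        gcongr
    _ = B * B' * (t ^ 2 * t⁻¹ ^ P) * ‖α a‖⁻¹ ^ (P - M) * (‖α a‖ ^ M * ‖α a‖⁻¹ ^ M) := by
        rw [mul_inv, mul_pow, e2]; ring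
    _ = _ := by rw [e3, mul_one]

/-- The coefficients are absolutely summable by `exists_bound`, so the Fourier series converges
pointwise to the function; `h0` says that the coefficient of frequency zero vanishes. -/
theorem hasSum (hΦ : IsArchimedeanForm k ℓ Φ)
    (hper : ∀ i, ∀ B ∈ invertibleMatrices, Φ (unipotentMul (ω i) B) = Φ B)
    (h : IsDualPair ω α e) {n : Fin (k + ℓ + 2 + 1)} {t : ℝ} (ht : 0 < t)
    (h0 : latticeMean ω (fun z => Φ (borel z t) n) = 0) (z : ℂ) :
    HasSum (fun a => C a * t ^ 2 * whittaker k ℓ (α a * t) n * addChar (α a * z))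
      (Φ (borel z t) n) := by
  obtain ⟨x, rfl⟩ := (Submodule.mem_span_range_iff_exists_fun ℝ).1
    (h.span ▸ Submodule.mem_top : z ∈ Submodule.span ℝ (Set.range ω))
  have ec : ∀ x : ι → ℝ, ∀ a, α a * ∑ i, (x i : ℂ) * ω i + conj (α a * ∑ i, (x i : ℂ) * ω i) =
      ∑ i, (e a i : ℂ) * x i := by
    intro x a
    rw [Finset.mul_sum, map_sum, ← Finset.sum_add_distrib]
    refine Finset.sum_congr rfl fun i _ => ?_
    rw [← h.pair a i]
    simp only [map_mul, Complex.conj_ofReal]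
    ring
  have hp : IsIntegralPeriodic fun x : ι → ℝ => Φ (borel (∑ i, (x i : ℂ) * ω i) t) n := by
    intro x m
    have : ∀ w, Φ (borel (w + ∑ i, ((m i : ℝ) : ℂ) * ω i) t) = Φ (borel w t) := by
      let Q : AddSubgroup ℂ :=
        { carrier := {p | ∀ w, Φ (borel (w + p) t) = Φ (borel w t)}
          zero_mem' := fun w => by rw [add_zero]
          add_mem' := fun {a b} ha hb w => by rw [← add_assoc, hb, ha]
          neg_mem' := fun {a} ha w => by rw [← ha (w + -a), neg_add_cancel_right] }
      refine Q.sum_mem fun i _ => ?_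
      have : ((m i : ℝ) : ℂ) * ω i = m i • ω i := by simp
      rw [this]
      exact Q.zsmul_mem (fun w => by rw [← unipotentMul_borel, hper i _ (borel_mem _ ht)]) _
    simp only [Pi.add_apply, Complex.ofReal_add, add_mul, Finset.sum_add_distrib]
    rw [this]
  have hcont : Continuous fun x : ι → ℝ => Φ (borel (∑ i, (x i : ℂ) * ω i) t) n := by
    refine (continuous_apply n).comp (hΦ.smooth.continuousOn.comp_continuous ?_ fun x =>
      borel_mem _ ht)
    have : ∀ x : ι → ℝ, borel (∑ i, (x i : ℂ) * ω i) t =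
      unipotentMul (∑ i, (x i : ℂ) * ω i) (borel 0 t) := fun x => by rw [unipotentMul_borel, zero_add]
    simp only [this]
    exact (continuous_unipotentMul.comp (by fun_prop)).clm_apply continuous_const
  obtain ⟨P₀, hP⟩ := hC.exists_bound h n
  obtain ⟨B, b, hB, hb, hbb⟩ := hP P₀ le_rfl
  have hs : Summable fun a => C a * t ^ 2 * whittaker k ℓ (α a * t) n :=
    Summable.of_norm_bounded (hb.mul_left _) fun a => (hbb a).2 t ht
  have hs' := (e.symm.summable_iff).2 hs
  have key := hasSum_fourier_of_summable hp hcont hs' (fun m => ?_) x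
  · rw [← e.hasSum_iff] at key
    have e1 : ∑ i, x i • ω i = ∑ i, (x i : ℂ) * ω i := by simp
    rw [e1]
    refine key.congr_fun fun a => ?_
    simp only [Function.comp_apply, Equiv.symm_apply_apply, addChar, ec]
  · obtain ⟨a, rfl⟩ := e.surjective m
    simp only [Function.comp_apply, Equiv.symm_apply_apply]
    by_cases h1 : α a = 0
    · rw [hC.zero a h1, zero_mul, zero_mul, (h.eq_zero_iff a).1 h1]
      simpa [latticeMean] using h0
    · rw [← hC.coeff a h1 t ht n, latticeMean]
      refine MeasureTheory.integral_congr_ae (Filter.Eventually.of_forall fun x => ?_)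
      simp only
      rw [mul_comm, addChar]
      congr 2
      have := ec x a
      rw [← this]
      simp only [map_mul, map_neg, neg_mul]
      ring

/-- Every term decays like an arbitrary power of `t⁻¹`, uniformly in a summable sense, and there is
no constant term. The exponent `P₀ + P + 2` absorbs the factor `t ^ 2`. -/
theorem norm_le_inv_pow (hΦ : IsArchimedeanForm k ℓ Φ)
    (hper : ∀ i, ∀ B ∈ invertibleMatrices, Φ (unipotentMul (ω i) B) = Φ B)
    (h : IsDualPair ω α e) {n : Fin (k + ℓ + 2 + 1)}
    (h0 : ∀ t : ℝ, 0 < t → latticeMean ω (fun z => Φ (borel z t) n) = 0) (P : ℕ) :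
    ∃ B : ℝ, 0 ≤ B ∧ ∀ (z : ℂ) (t : ℝ), 1 ≤ t → ‖Φ (borel z t) n‖ ≤ B * t⁻¹ ^ P := by
  obtain ⟨P₀, hP⟩ := hC.exists_bound h n
  obtain ⟨B, b, hB, hb, hbb⟩ := hP (P₀ + P + 2) (by omega)
  refine ⟨B * ∑' a, b a, mul_nonneg hB (tsum_nonneg fun a => (hbb a).1), fun z t ht => ?_⟩
  have ht0 : 0 < t := by linarith
  have h1 := hC.hasSum hΦ hper h ht0 (h0 t ht0) z
  have h2 : ‖Φ (borel z t) n‖ ≤ ∑' a, B * (t ^ 2 * t⁻¹ ^ (P₀ + P + 2)) * b a := by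
    rw [← h1.tsum_eq]
    refine tsum_of_norm_bounded (hb.mul_left _).hasSum fun a => ?_
    rw [norm_mul, norm_addChar, mul_one]
    exact (hbb a).2 t ht0
  refine h2.trans ?_
  rw [tsum_mul_left]
  have h3 : t ^ 2 * t⁻¹ ^ (P₀ + P + 2) ≤ t⁻¹ ^ P := by
    have e1 : t ^ 2 * t⁻¹ ^ (P₀ + P + 2) = t⁻¹ ^ (P₀ + P) * (t * t⁻¹) ^ 2 := by ring
    rw [e1, mul_inv_cancel₀ ht0.ne', one_pow, mul_one]
    exact pow_le_pow_of_le_one (by positivity) (inv_le_one_of_one_le₀ ht) (by omega)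
  have h4 : 0 ≤ ∑' a, b a := tsum_nonneg fun a => (hbb a).1
  calc B * (t ^ 2 * t⁻¹ ^ (P₀ + P + 2)) * ∑' a, b a ≤ B * t⁻¹ ^ P * ∑' a, b a := by gcongr
    _ = _ := by ring

/-- The Fourier coefficient may be computed with any basis of a lattice of periods. -/
theorem latticeMean_eq (hΦ : IsArchimedeanForm k ℓ Φ)
    (hper : ∀ i, ∀ B ∈ invertibleMatrices, Φ (unipotentMul (ω i) B) = Φ B)
    (h : IsDualPair ω α e) {n : Fin (k + ℓ + 2 + 1)} {t : ℝ} (ht : 0 < t)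
    (h0 : latticeMean ω (fun z => Φ (borel z t) n) = 0) {κ : Type*} [Fintype κ] {ω' : κ → ℂ}
    (hω' : Submodule.span ℝ (Set.range ω') = ⊤)
    (hint : ∀ a i, ∃ m : ℤ, α a * ω' i + conj (α a * ω' i) = m) (a : A) :
    latticeMean ω' (fun z => addChar (-α a * z) * Φ (borel z t) n) =
      C a * t ^ 2 * whittaker k ℓ (α a * t) n := by
  choose m hm using hint
  have : Countable A := e.injective.countable
  have ec : ∀ (x : κ → ℝ) a', addChar (-α a * ∑ i, (x i : ℂ) * ω' i) *
      addChar (α a' * ∑ i, (x i : ℂ) * ω' i) =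
      Complex.exp (2 * Real.pi * Complex.I * ∑ i, ((m a' i - m a i : ℤ) : ℂ) * x i) := by
    intro x a'
    rw [← addChar_add, addChar]
    congr 2
    rw [← add_mul, Finset.mul_sum, map_sum, ← Finset.sum_add_distrib]
    refine Finset.sum_congr rfl fun i _ => ?_
    push_cast
    rw [← hm a i, ← hm a' i]
    simp only [map_mul, map_add, map_neg, Complex.conj_ofReal]
    ring
  obtain ⟨P₀, hP⟩ := hC.exists_bound h n
  obtain ⟨B, b, hB, hb, hbb⟩ := hP P₀ le_rfl
  set c : A → ℂ := fun a' => C a' * t ^ 2 * whittaker k ℓ (α a' * t) n with hc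
  have hsum : ∀ x : κ → ℝ, HasSum (fun a' => c a' *
      Complex.exp (2 * Real.pi * Complex.I * ∑ i, ((m a' i - m a i : ℤ) : ℂ) * x i))
      (addChar (-α a * ∑ i, (x i : ℂ) * ω' i) * Φ (borel (∑ i, (x i : ℂ) * ω' i) t) n) := by
    intro x
    refine ((hC.hasSum hΦ hper h ht h0 (∑ i, (x i : ℂ) * ω' i)).mul_left
      (addChar (-α a * ∑ i, (x i : ℂ) * ω' i))).congr_fun fun a' => ?_
    rw [← ec]
    ring
  have hnorm : ∀ a' (x : κ → ℝ), ‖c a' *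
      Complex.exp (2 * Real.pi * Complex.I * ∑ i, ((m a' i - m a i : ℤ) : ℂ) * x i)‖ = ‖c a'‖ := by
    intro a' x
    rw [norm_mul, ← ec, norm_mul (addChar _), norm_addChar, norm_addChar, one_mul, mul_one]
  have hcs : Summable fun a' => ‖c a'‖ :=
    Summable.of_nonneg_of_le (fun _ => norm_nonneg _) (fun a' => (hbb a').2 t ht) (hb.mul_left _)
  have hcontc : ∀ a', Continuous fun x : κ → ℝ => c a' *
      Complex.exp (2 * Real.pi * Complex.I * ∑ i, ((m a' i - m a i : ℤ) : ℂ) * x i) := by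
    intro a'
    fun_prop
  -- The expansion is integrated term by term over the new cell. All frequencies pair integrally
  -- with `ω'`, so orthogonality isolates the term `a`.
  have key := MeasureTheory.hasSum_integral_of_summable_integral_norm
    (μ := MeasureTheory.volume.restrict (Set.Icc (0 : κ → ℝ) 1))
    (F := fun a' x => c a' *
      Complex.exp (2 * Real.pi * Complex.I * ∑ i, ((m a' i - m a i : ℤ) : ℂ) * x i))
    (fun a' => (hcontc a').continuousOn.integrableOn_compact isCompact_Icc) (by
      simp only [hnorm]
      refine hcs.congr fun a' => ?_
      simp [MeasureTheory.Measure.real, Real.volume_Icc_pi])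
  have e1 : ∀ x : κ → ℝ, ∑' a', c a' *
      Complex.exp (2 * Real.pi * Complex.I * ∑ i, ((m a' i - m a i : ℤ) : ℂ) * x i) =
      addChar (-α a * ∑ i, (x i : ℂ) * ω' i) * Φ (borel (∑ i, (x i : ℂ) * ω' i) t) n :=
    fun x => (hsum x).tsum_eq
  simp only [e1] at key
  have e2 : ∀ a', (∫ x in Set.Icc (0 : κ → ℝ) 1, c a' *
      Complex.exp (2 * Real.pi * Complex.I * ∑ i, ((m a' i - m a i : ℤ) : ℂ) * x i)) =
      if a' = a then c a else 0 := by
    intro a'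
    rw [MeasureTheory.integral_const_mul, integral_Icc_exp (fun i => m a' i - m a i)]
    by_cases haa : a' = a
    · subst haa
      rw [if_pos (by funext i; simp), if_pos rfl, mul_one]
    · rw [if_neg, if_neg haa, mul_zero]
      intro hz
      apply haa
      apply h.injective
      have key : ∀ z : ℂ, ((α a' - α a) * z).re = 0 := by
        intro z
        obtain ⟨x, rfl⟩ := (Submodule.mem_span_range_iff_exists_fun ℝ).1
          (hω' ▸ Submodule.mem_top : z ∈ Submodule.span ℝ (Set.range ω'))
        rw [Finset.mul_sum, Complex.re_sum]
        refine Finset.sum_eq_zero fun i _ => ?_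
        have h2 : ((α a' - α a) * ω' i).re = 0 := by
          have h3 := congrFun hz i
          have h4 : (α a' - α a) * ω' i + conj ((α a' - α a) * ω' i) = 0 := by
            have h5 : (m a' i : ℂ) - m a i = 0 := by exact_mod_cast h3
            rw [← hm, ← hm] at h5
            rw [← h5]
            simp only [map_mul, map_sub]
            ring
          rw [Complex.add_conj] at h4
          have : (2 * ((α a' - α a) * ω' i).re) = 0 := by exact_mod_cast h4
          linarith
        rw [mul_smul_comm, Complex.real_smul, Complex.re_ofReal_mul, h2, mul_zero]
      have h1 := key (conj (α a' - α a))
      rw [Complex.mul_conj, Complex.ofReal_re] at h1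
      exact sub_eq_zero.1 (Complex.normSq_eq_zero.1 h1)
  simp only [e2] at key
  exact key.unique (hasSum_ite_eq a (c a))

end IsCoefficientFamily

end

section

/-! ### Trace, norm and different of an imaginary quadratic field -/

section imaginaryQuadratic

variable {K : Type*} [Field K] [NumberField K] [NumberField.IsTotallyComplex K] (τ : K →+* ℂ)

lemma conjugate_ne : ComplexEmbedding.conjugate τ ≠ τ := fun h =>
  IsTotallyComplex.complexEmbedding_not_isReal τ h

lemma exists_im_ne_zero : ∃ x : K, (τ x).im ≠ 0 := by
  by_contra! h
  refine conjugate_ne τ (RingHom.ext fun x => ?_)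
  rw [ComplexEmbedding.conjugate_coe_eq]
  exact Complex.conj_eq_iff_im.2 (h x)

lemma univ_embeddings (hK : Module.finrank ℚ K = 2) :
    (Finset.univ : Finset (K →+* ℂ)) = {τ, ComplexEmbedding.conjugate τ} := by
  symm
  apply Finset.eq_univ_of_card
  rw [Finset.card_pair (conjugate_ne τ).symm, Embeddings.card, hK]

lemma trace_eq (hK : Module.finrank ℚ K = 2) (x : K) :
    ((Algebra.trace ℚ K x : ℚ) : ℂ) = τ x + conj (τ x) := by
  have h := trace_eq_sum_embeddings (K := ℚ) (L := K) (E := ℂ) (x := x)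
  rw [eq_ratCast] at h
  rw [h, ← Fintype.sum_equiv (RingHom.equivRatAlgHom K ℂ) (fun f => f x) (fun f => f x)
    (fun _ => rfl), univ_embeddings τ hK, Finset.sum_pair (conjugate_ne τ).symm,
    ComplexEmbedding.conjugate_coe_eq]

lemma norm_eq (hK : Module.finrank ℚ K = 2) (x : K) :
    ((Algebra.norm ℚ x : ℚ) : ℝ) = ‖τ x‖ ^ 2 := by
  have h := Algebra.norm_eq_prod_embeddings (K := ℚ) (L := K) ℂ x
  rw [eq_ratCast] at h
  have h2 : ((Algebra.norm ℚ x : ℚ) : ℂ) = τ x * conj (τ x) := by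
    rw [h, ← Fintype.prod_equiv (RingHom.equivRatAlgHom K ℂ) (fun f => f x) (fun f => f x)
      (fun _ => rfl), univ_embeddings τ hK, Finset.prod_pair (conjugate_ne τ).symm,
      ComplexEmbedding.conjugate_coe_eq]
  rw [Complex.mul_conj'] at h2
  exact_mod_cast h2

lemma span_range_eq_top {ι : Type*} (b : Module.Basis ι ℚ K) :
    Submodule.span ℝ (Set.range fun i => τ (b i)) = ⊤ := by
  have h1 : ∀ x : K, τ x ∈ Submodule.span ℝ (Set.range fun i => τ (b i)) := by
    intro x
    rw [← b.linearCombination_repr x, Finsupp.linearCombination_apply, Finsupp.sum, map_sum]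
    refine Submodule.sum_mem _ fun i _ => ?_
    have : τ (b.repr x i • b i) = ((b.repr x i : ℚ) : ℝ) • τ (b i) := by
      rw [Algebra.smul_def, map_mul, eq_ratCast, map_ratCast, Complex.real_smul]
      norm_cast
    rw [this]
    exact Submodule.smul_mem _ _ (Submodule.subset_span ⟨i, rfl⟩)
  obtain ⟨x, hx⟩ := exists_im_ne_zero τ
  refine Submodule.eq_top_iff'.2 fun w => ?_
  have e : w = (w.re - w.im / (τ x).im * (τ x).re) • τ 1 + (w.im / (τ x).im) • τ x := by
    rw [map_one]
    apply Complex.ext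
    · simp
    · simp [hx]
  rw [e]
  exact Submodule.add_mem _ (Submodule.smul_mem _ _ (h1 1)) (Submodule.smul_mem _ _ (h1 x))

/-- The dual of a fractional ideal under the trace form. -/
abbrev traceDual (J : FractionalIdeal (𝓞 K)⁰ K) : Type _ := {a : K // a ∈ FractionalIdeal.dual ℤ ℚ J}

/-- The coordinates of `a` are the traces of `a * b i`. Nondegeneracy of the trace form gives
injectivity, its dual basis surjectivity, and the trace is `z + conj z` under `τ`. -/
lemma exists_isDualPair (hK : Module.finrank ℚ K = 2) (J : (FractionalIdeal (𝓞 K)⁰ K)ˣ) :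
    ∃ e : traceDual J.1 ≃ (Module.Free.ChooseBasisIndex ℤ J → ℤ),
      IsDualPair (fun i => τ (basisOfFractionalIdeal K J i)) (fun a : traceDual J.1 => τ a) e := by
  set b := basisOfFractionalIdeal K J with hb
  have hJ : J.1 ≠ 0 := J.ne_zero
  have hmem : ∀ i, b i ∈ J.1 := fun i =>
    (mem_span_basisOfFractionalIdeal K).1 (Submodule.subset_span ⟨i, rfl⟩)
  have h1 : ∀ (a : traceDual J.1) i, ∃ m : ℤ, (m : ℚ) = Algebra.trace ℚ K (a * b i) := by
    intro a i
    obtain ⟨m, hm⟩ := (FractionalIdeal.mem_dual hJ).1 a.2 (b i) (hmem i)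
    exact ⟨m, by rw [← Algebra.traceForm_apply, ← hm]; rfl⟩
  choose f hf using h1
  have hnd := traceForm_nondegenerate ℚ K
  have hbij : Function.Bijective f := by
    constructor
    · intro a a' haa
      apply Subtype.ext
      have : ∀ x, Algebra.traceForm ℚ K (a - a') x = 0 := by
        intro x
        have hl : Algebra.traceForm ℚ K (a - a') = 0 := by
          refine b.ext fun i => ?_
          rw [Algebra.traceForm_apply, sub_mul, map_sub, ← hf, ← hf, haa, sub_self]
          rfl
        rw [hl]; rfl
      exact sub_eq_zero.1 (hnd.1 _ this)
    · intro m
      set b' := (Algebra.traceForm ℚ K).dualBasis hnd b with hb'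
      have hm : ∀ i, Algebra.trace ℚ K ((∑ j, (m j : ℚ) • b' j) * b i) = m i := by
        intro i
        rw [Finset.sum_mul, map_sum]
        simp only [smul_mul_assoc, map_smul]
        have : ∀ j, Algebra.trace ℚ K (b' j * b i) = if i = j then 1 else 0 := fun j => by
          rw [← Algebra.traceForm_apply]
          exact LinearMap.BilinForm.apply_dualBasis_left hnd b j i
        simp [this]
      have hdual : ∑ j, (m j : ℚ) • b' j ∈ FractionalIdeal.dual ℤ ℚ J.1 := by
        refine (FractionalIdeal.mem_dual hJ).2 fun y hy => ?_
        have hy' := (mem_span_basisOfFractionalIdeal K).2 (show y ∈ (J : Set K) from hy)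
        obtain ⟨c, rfl⟩ := (Submodule.mem_span_range_iff_exists_fun ℤ).1 hy'
        refine ⟨∑ i, c i * m i, ?_⟩
        rw [Algebra.traceForm_apply, Finset.mul_sum, map_sum, map_sum]
        refine Finset.sum_congr rfl fun i _ => ?_
        rw [mul_smul_comm, map_zsmul, hm]
        simp
      refine ⟨⟨_, hdual⟩, ?_⟩
      · funext i
        have := hf ⟨∑ j, (m j : ℚ) • b' j, hdual⟩ i
        rw [hm] at this
        exact_mod_cast this
  refine ⟨Equiv.ofBijective f hbij, span_range_eq_top τ b, fun a i => ?_⟩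
  rw [← map_mul, ← trace_eq τ hK, ← hf]
  simp

variable {τ}

/-- The discriminant of the pair `1, x` is `(x - conj x)²`; it is also the square of an integral
determinant times the field discriminant `δ²`. Comparing square roots gives `m`. -/
lemma isIntegral_conj_sub (hK : Module.finrank ℚ K = 2) {δ : 𝓞 K}
    (hδ : δ ^ 2 = (NumberField.discr K : 𝓞 K)) (x : 𝓞 K) :
    ∃ m : ℤ, τ x - conj (τ x) = m * τ δ := by
  have hcard : Fintype.card (Module.Free.ChooseBasisIndex ℤ (𝓞 K)) = 2 := by
    rw [← Module.finrank_eq_card_chooseBasisIndex, RingOfIntegers.rank, hK]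
  let ε := Fintype.equivFinOfCardEq hcard
  let b := (RingOfIntegers.basis K).reindex ε
  let v : Fin 2 → 𝓞 K := ![1, x]
  let P : Matrix (Fin 2) (Fin 2) ℤ := fun i j => b.repr (v i) j
  have hv : v = (P.map (algebraMap ℤ (𝓞 K))).mulVec b := by
    funext i
    rw [← b.sum_repr (v i), Matrix.mulVec, dotProduct]
    refine Finset.sum_congr rfl fun j _ => ?_
    rw [zsmul_eq_mul]
    rfl
  have h1 : Algebra.discr ℤ v = P.det ^ 2 * NumberField.discr K := by
    rw [hv, Algebra.discr_of_matrix_mulVec, NumberField.discr_eq_discr K b]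
  have hT : ∀ y : 𝓞 K, ((Algebra.trace ℤ (𝓞 K) y : ℤ) : ℂ) = τ y + conj (τ y) := by
    intro y
    rw [← trace_eq τ hK]
    have := Algebra.trace_localization ℤ (S := 𝓞 K) ℤ⁰ (Rₘ := ℚ) (Sₘ := K) y
    rw [this]
    simp
  have h2 : ((Algebra.discr ℤ v : ℤ) : ℂ) = (τ x - conj (τ x)) ^ 2 := by
    rw [Algebra.discr_def, Matrix.det_fin_two]
    simp only [Algebra.traceMatrix_apply, Algebra.traceForm_apply]
    push_cast
    rw [hT, hT, hT, hT]
    simp [v]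
    ring
  have h3 : (τ x - conj (τ x)) ^ 2 = (P.det * τ δ) ^ 2 := by
    rw [← h2, h1, mul_pow, ← map_pow, ← map_pow, hδ]
    simp
  rcases sq_eq_sq_iff_eq_or_eq_neg.1 h3 with h | h
  · exact ⟨P.det, h⟩
  · exact ⟨-P.det, by rw [h]; push_cast; ring⟩

lemma delta_ne_zero {δ : 𝓞 K} (hδ : δ ^ 2 = (NumberField.discr K : 𝓞 K)) : δ ≠ 0 := by
  rintro rfl
  have : ((NumberField.discr K : ℤ) : 𝓞 K) = 0 := by rw [← hδ]; ring
  exact NumberField.discr_ne_zero K (by exact_mod_cast this)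

lemma norm_delta_sq (τ : K →+* ℂ) {δ : 𝓞 K} (hδ : δ ^ 2 = (NumberField.discr K : 𝓞 K)) :
    ‖τ δ‖ ^ 2 = (NumberField.discr K).natAbs := by
  have h : (τ δ) ^ 2 = (NumberField.discr K : ℂ) := by
    rw [← map_pow, ← map_pow, hδ]
    simp
  rw [← norm_pow, h, Complex.norm_intCast, Nat.cast_natAbs, Int.cast_abs]

/-- The conjugate is `δ` or `-δ`. If `δ` were real, then `x - conj x = m δ` would be both real and
purely imaginary for every integer `x`, and `K` would be real. -/
theorem conj_delta (τ : K →+* ℂ) (hK : Module.finrank ℚ K = 2) {δ : 𝓞 K}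
    (hδ : δ ^ 2 = (NumberField.discr K : 𝓞 K)) : conj (τ δ) = -τ δ := by
  have h : (τ δ) ^ 2 = (NumberField.discr K : ℂ) := by
    rw [← map_pow, ← map_pow, hδ]
    simp
  have h2 : (conj (τ δ)) ^ 2 = (τ δ) ^ 2 := by rw [← map_pow, h, map_intCast]
  rcases sq_eq_sq_iff_eq_or_eq_neg.1 h2 with h3 | h3
  · exfalso
    have hδ0 : τ δ ≠ 0 := by
      simpa using delta_ne_zero hδ
    obtain ⟨x, hx⟩ := exists_im_ne_zero τ
    obtain ⟨a, d, hd, rfl⟩ := IsFractionRing.div_surjective (A := 𝓞 K) x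
    have real : ∀ y : 𝓞 K, (τ y).im = 0 := by
      intro y
      obtain ⟨m, hm⟩ := isIntegral_conj_sub (τ := τ) hK hδ y
      have h4 := congrArg Complex.re hm
      have h5 := congrArg Complex.im hm
      have h6 := Complex.conj_eq_iff_im.1 h3
      have e : ((m : ℂ) * τ δ).im = 0 := by
        rw [← Complex.ofReal_intCast, Complex.im_ofReal_mul, h6, mul_zero]
      rw [e] at h5
      simp at h5
      linarith
    apply hx
    have e : ∀ y : 𝓞 K, τ y = ((τ y).re : ℂ) := fun y => by
      apply Complex.ext <;> simp [real y]
    rw [map_div₀, e a, e d, ← Complex.ofReal_div, Complex.ofReal_im]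
  · exact h3

/-- By `isIntegral_conj_sub` the trace of `x / δ` is an integer for integral `x`, so the different
is contained in `(δ)`; both ideals have norm `|discr K|`. -/
theorem span_delta_eq (τ : K →+* ℂ) (hK : Module.finrank ℚ K = 2) {δ : 𝓞 K}
    (hδ : δ ^ 2 = (NumberField.discr K : 𝓞 K)) : Ideal.span {δ} = differentIdeal ℤ (𝓞 K) := by
  have hδ0 := delta_ne_zero hδ
  have hτδ : τ δ ≠ 0 := by simpa using hδ0
  have hsp : (Ideal.span {δ} : Ideal (𝓞 K)) ≠ ⊥ := by simpa using hδ0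
  have hle : differentIdeal ℤ (𝓞 K) ≤ Ideal.span {δ} := by
    rw [differentialIdeal_le_iff (K := ℚ) (L := K) hsp]
    rintro _ ⟨y, hy, rfl⟩
    have hy' : y ∈ ((Ideal.span {δ} : Ideal (𝓞 K)) : FractionalIdeal (𝓞 K)⁰ K)⁻¹ := hy
    rw [FractionalIdeal.coeIdeal_span_singleton, FractionalIdeal.spanSingleton_inv,
      FractionalIdeal.mem_spanSingleton] at hy'
    obtain ⟨x, rfl⟩ := hy'
    obtain ⟨m, hm⟩ := isIntegral_conj_sub (τ := τ) hK hδ x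
    refine Submodule.mem_one.2 ⟨m, ?_⟩
    have h1 := trace_eq τ hK (x • (δ : K)⁻¹)
    have h2 : τ (x • (δ : K)⁻¹) = τ x / τ δ := by
      rw [Algebra.smul_def, map_mul, map_inv₀, div_eq_mul_inv]
    rw [h2, map_div₀, conj_delta τ hK hδ, div_neg, ← sub_eq_add_neg, ← sub_div, hm,
      mul_div_cancel_right₀ _ hτδ] at h1
    rw [LinearMap.restrictScalars_apply, eq_intCast]
    exact_mod_cast h1.symm
  obtain ⟨c, hc⟩ := Ideal.dvd_iff_le.2 hle
  have hN : Ideal.absNorm (Ideal.span {δ}) = (NumberField.discr K).natAbs := by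
    rw [Ideal.absNorm_span_singleton]
    have h1 := norm_eq τ hK (δ : K)
    rw [norm_delta_sq τ hδ, ← Algebra.coe_norm_int] at h1
    rw [Nat.cast_natAbs] at h1
    have h2 : Algebra.norm ℤ δ = |NumberField.discr K| := by exact_mod_cast h1
    rw [h2, Int.natAbs_abs]
  have hc1 : Ideal.absNorm c = 1 := by
    have h1 := NumberField.absNorm_differentIdeal K (𝓞 K)
    rw [hc, map_mul, hN] at h1
    exact Nat.eq_of_mul_eq_mul_left (Int.natAbs_pos.2 (NumberField.discr_ne_zero K))
      (by rw [h1, mul_one])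
  rw [hc, Ideal.absNorm_eq_one_iff.1 hc1, Ideal.mul_top]

theorem dual_eq (hK : Module.finrank ℚ K = 2) {δ : 𝓞 K}
    (hδ : δ ^ 2 = (NumberField.discr K : 𝓞 K)) (J : FractionalIdeal (𝓞 K)⁰ K) :
    FractionalIdeal.dual ℤ ℚ J = (FractionalIdeal.spanSingleton (𝓞 K)⁰ (δ : K))⁻¹ * J⁻¹ := by
  obtain ⟨τ⟩ : Nonempty (K →+* ℂ) := inferInstance
  rw [FractionalIdeal.dual_eq_mul_inv, ← FractionalIdeal.coeIdeal_span_singleton,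
    span_delta_eq τ hK hδ, coeIdeal_differentIdeal ℤ ℚ, inv_inv]

end imaginaryQuadratic

end

section

/-! ### The representation on homogeneous polynomials -/

section rho

variable {N : ℕ} (P : V N)

lemma rho_smul (c : ℂ) (γ : Matrix (Fin 2) (Fin 2) ℂ) : rho N (c • γ) P = c ^ N • rho N γ P := by
  funext n
  simp only [rho, Pi.smul_apply, smul_eq_mul, Matrix.smul_apply]
  rw [← Polynomial.coeff_C_mul, Finset.mul_sum]
  congr 1
  refine Finset.sum_congr rfl fun m _ => ?_
  have e1 : Polynomial.C (c * γ 0 0) - Polynomial.C (c * γ 0 1) * Polynomial.X =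
      Polynomial.C c * (Polynomial.C (γ 0 0) - Polynomial.C (γ 0 1) * Polynomial.X) := by
    simp only [map_mul]; ring
  have e2 : -Polynomial.C (c * γ 1 0) + Polynomial.C (c * γ 1 1) * Polynomial.X =
      Polynomial.C c * (-Polynomial.C (γ 1 0) + Polynomial.C (γ 1 1) * Polynomial.X) := by
    simp only [map_mul]; ring
  rw [e1, e2, mul_pow, mul_pow, Polynomial.C_pow]
  have e3 : (Polynomial.C c : Polynomial ℂ) ^ N =
      Polynomial.C c ^ (N - (m : ℕ)) * Polynomial.C c ^ (m : ℕ) := by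
    rw [← pow_add]; congr 1; omega
  rw [e3]
  ring

lemma rho_diag (a d : ℂ) (n : Fin (N + 1)) :
    rho N !![a, 0; 0, d] P n = a ^ (N - (n : ℕ)) * d ^ (n : ℕ) * P n := by
  simp only [rho, Matrix.of_apply, Matrix.cons_val', Matrix.cons_val_zero, Matrix.cons_val_one,
    Matrix.cons_val_fin_one, map_zero, zero_mul, sub_zero, neg_zero, zero_add]
  rw [Polynomial.finsetSum_coeff, Finset.sum_eq_single n]
  · rw [mul_pow, ← Polynomial.C_pow, ← Polynomial.C_pow, ← mul_assoc, ← Polynomial.C_mul,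
      ← Polynomial.C_mul, Polynomial.coeff_C_mul_X_pow, if_pos rfl]
    ring
  · intro m _ hm
    rw [mul_pow, ← Polynomial.C_pow, ← Polynomial.C_pow, ← mul_assoc, ← Polynomial.C_mul,
      ← Polynomial.C_mul, Polynomial.coeff_C_mul_X_pow, if_neg fun h => hm (Fin.ext h.symm)]
  · simp

lemma rho_antidiag (b c : ℂ) (n : Fin (N + 1)) :
    rho N !![0, b; c, 0] P n = (-b) ^ (n : ℕ) * (-c) ^ (N - (n : ℕ)) * P n.rev := by
  simp only [rho, Matrix.of_apply, Matrix.cons_val', Matrix.cons_val_zero, Matrix.cons_val_one,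
    Matrix.cons_val_fin_one, map_zero, zero_mul, zero_sub, add_zero, ← neg_mul, ← map_neg]
  have hn : (n : ℕ) ≤ N := Nat.lt_succ_iff.1 n.2
  have hrev : ((n.rev : Fin _) : ℕ) = N - n := by rw [Fin.val_rev]; omega
  rw [Polynomial.finsetSum_coeff, Finset.sum_eq_single n.rev]
  · rw [hrev, Nat.sub_sub_self hn, mul_pow, ← Polynomial.C_pow, ← Polynomial.C_pow, mul_assoc,
      mul_right_comm, ← mul_assoc, ← mul_assoc, ← Polynomial.C_mul,
      ← Polynomial.C_mul, Polynomial.coeff_C_mul_X_pow, if_pos rfl]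
    ring
  · intro m _ hm
    have : (n : ℕ) ≠ N - (m : ℕ) := by
      intro h
      apply hm
      apply Fin.ext
      have := m.2
      omega
    rw [mul_pow, ← Polynomial.C_pow, ← Polynomial.C_pow, mul_assoc, mul_right_comm,
      ← mul_assoc, ← mul_assoc, ← Polynomial.C_mul,
      ← Polynomial.C_mul, Polynomial.coeff_C_mul_X_pow, if_neg this]
  · simp

lemma rho_one : rho N 1 P = P := by
  funext n
  rw [Matrix.one_fin_two, rho_diag]
  simp

end rho

/-! ### Functions on the general linear group -/

lemma extend_apply {N : ℕ} (Φ : GL (Fin 2) ℂ → V N) (g : GL (Fin 2) ℂ) :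
    extend Φ (Matrix.of.symm (g : Matrix (Fin 2) (Fin 2) ℂ)) = Φ g := by
  have h : (Matrix.of (Matrix.of.symm (g : Matrix (Fin 2) (Fin 2) ℂ))).det ≠ 0 := by
    rw [Equiv.apply_symm_apply]
    exact g.det_ne_zero
  rw [extend, dif_pos h]
  congr 1
  exact Units.ext rfl

lemma exists_eq_of_mem {A : Fin 2 → Fin 2 → ℂ} (hA : A ∈ invertibleMatrices) :
    ∃ g : GL (Fin 2) ℂ, A = Matrix.of.symm (g : Matrix (Fin 2) (Fin 2) ℂ) :=
  ⟨Matrix.GeneralLinearGroup.mkOfDetNeZero (Matrix.of A) hA, rfl⟩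

/-- The upper triangular unipotent matrix `(1 b; 0 1)`. -/
def upper {R : Type*} [CommRing R] (b : R) : GL (Fin 2) R :=
  Matrix.GeneralLinearGroup.mk'' !![1, b; 0, 1] (by simp)

lemma coe_upper {R : Type*} [CommRing R] (b : R) :
    ((upper b : GL (Fin 2) R) : Matrix (Fin 2) (Fin 2) R) = !![1, b; 0, 1] := rfl

lemma coe_diagOne {R : Type*} [CommRing R] (b : Rˣ) :
    ((diagOne b : GL (Fin 2) R) : Matrix (Fin 2) (Fin 2) R) = !![(b : R), 0; 0, 1] := rfl

lemma map_upper {R S : Type*} [CommRing R] [CommRing S] (f : R →+* S) (b : R) :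
    Matrix.GeneralLinearGroup.map f (upper b) = upper (f b) := by
  apply Units.ext
  ext i j
  fin_cases i <;> fin_cases j <;> simp [coe_upper]

lemma upper_mul_upper_neg {R : Type*} [CommRing R] (b : R) : upper b * upper (-b) = 1 := by
  apply Units.ext
  rw [Units.val_mul, coe_upper, coe_upper, Units.val_one, Matrix.one_fin_two]
  ext i j
  fin_cases i <;> fin_cases j <;> simp

section modularForm

variable {K : Type*} [Field K] [NumberField K] {τ : K →+* ℂ} {𝔫 : Ideal (𝓞 K)} {k ℓ : ℕ}
  {φ : ℂˣ × (Af K)ˣ →* ℂˣ} {F : GL (Fin 2) ℂ → GL (Fin 2) (Af K) → V (k + ℓ + 2)}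

lemma localIdele_one (v : HeightOneSpectrum (𝓞 K)) : localIdele v 1 = 1 := by
  apply Units.ext
  refine FiniteAdeleRing.ext K fun w => ?_
  change ((Pi.mulSingle v 1 : ∀ v : HeightOneSpectrum (𝓞 K), (v.adicCompletion K)ˣ) w : w.adicCompletion K) = 1
  rw [Pi.mulSingle_one]
  rfl

lemma localIdele_apply_self (v : HeightOneSpectrum (𝓞 K)) (x : (v.adicCompletion K)ˣ) :
    ((localIdele v x : (Af K)ˣ) : Af K) v = x := by
  change ((Pi.mulSingle v x : ∀ v : HeightOneSpectrum (𝓞 K), (v.adicCompletion K)ˣ) v : v.adicCompletion K) = x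
  rw [Pi.mulSingle_eq_same]

lemma localIdele_apply_of_ne {v w : HeightOneSpectrum (𝓞 K)} (h : w ≠ v) (x : (v.adicCompletion K)ˣ) :
    ((localIdele v x : (Af K)ˣ) : Af K) w = 1 := by
  change ((Pi.mulSingle v x : ∀ v : HeightOneSpectrum (𝓞 K), (v.adicCompletion K)ˣ) w : w.adicCompletion K) = 1
  rw [Pi.mulSingle_eq_of_ne h]
  rfl

lemma count_nonneg (v : HeightOneSpectrum (𝓞 K)) (𝔤 : Ideal (𝓞 K)) :
    0 ≤ FractionalIdeal.count K v (𝔤 : FractionalIdeal (𝓞 K)⁰ K) :=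
  FractionalIdeal.count_coe_nonneg K v 𝔤

lemma exp_neg_count_le_one (v : HeightOneSpectrum (𝓞 K)) (𝔤 : Ideal (𝓞 K)) :
    WithZero.exp (-FractionalIdeal.count K v (𝔤 : FractionalIdeal (𝓞 K)⁰ K)) ≤ 1 := by
  rw [← WithZero.exp_zero, WithZero.exp_le_exp]
  exact neg_nonpos.2 (count_nonneg v 𝔤)

lemma TrivialOn.atPlace_eq_one {ψ : ℂˣ × (Af K)ˣ →* ℂˣ} {𝔤 : Ideal (𝓞 K)} (h : TrivialOn ψ 𝔤)
    {v : HeightOneSpectrum (𝓞 K)} {x : v.adicCompletion K} (h1 : Valued.v x = 1)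
    (hx : Valued.v (x - 1) ≤
      WithZero.exp (-FractionalIdeal.count K v (𝔤 : FractionalIdeal (𝓞 K)⁰ K))) :
    atPlace ψ v x = 1 := by
  have h0 : x ≠ 0 := by
    rintro rfl
    simp at h1
  rw [atPlace, dif_neg h0, h, Units.val_one]
  intro w
  by_cases hw : w = v
  · subst hw
    rw [localIdele_apply_self]
    exact ⟨h1, hx⟩
  · rw [localIdele_apply_of_ne hw]
    simp

lemma atPlace_one (ψ : ℂˣ × (Af K)ˣ →* ℂˣ) (v : HeightOneSpectrum (𝓞 K)) : atPlace ψ v 1 = 1 := by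
  have : (Units.mk0 (1 : v.adicCompletion K) one_ne_zero) = 1 := Units.ext rfl
  rw [atPlace, dif_neg one_ne_zero, this, localIdele_one, ← Prod.one_eq_mk, map_one, Units.val_one]

lemma atIdeal_one (ψ : ℂˣ × (Af K)ˣ →* ℂˣ) (𝔤 : Ideal (𝓞 K)) : atIdeal ψ 𝔤 1 = 1 :=
  finprod_mem_eq_one_of_forall_eq_one fun v _ => atPlace_one ψ v

lemma one_mem_K0 : (1 : GL (Fin 2) (Af K)) ∈ K0 𝔫 := by
  intro v
  refine ⟨fun i j => ?_, ?_, ?_⟩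
  · rw [Units.val_one, Matrix.one_apply]
    split_ifs
    · exact (map_one (Valued.v (R := v.adicCompletion K))).le
    · exact (map_zero (Valued.v (R := v.adicCompletion K))).le.trans zero_le_one
  · rw [map_one]
    exact map_one _
  · rw [Units.val_one, Matrix.one_apply_ne (by simp)]
    exact (map_zero (Valued.v (R := v.adicCompletion K))).le.trans zero_le

namespace IsBianchiModularForm

variable (hF : IsBianchiModularForm τ 𝔫 k ℓ φ F)
include hF

theorem isArchimedeanForm (hφ : IsHeckeCharacter τ φ (-k) (-ℓ)) (x : GL (Fin 2) (Af K)) :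
    IsArchimedeanForm k ℓ (extend fun g => F g x) where
  smooth := hF.smooth x
  casimir_id := hF.casimir_id x
  casimir_conj := hF.casimir_conj x
  unitary := by
    rintro A hA u hu
    obtain ⟨g, rfl⟩ := exists_eq_of_mem hA
    have hdet : u.det = 1 := (Matrix.mem_specialUnitaryGroup_iff.1 hu).2
    let u' : GL (Fin 2) ℂ := Matrix.GeneralLinearGroup.mkOfDetNeZero u (by rw [hdet]; exact one_ne_zero)
    have hu' : (u' : Matrix (Fin 2) (Fin 2) ℂ) = u := rfl
    have h1 := hF.right_equivariant u' 1 hu one_mem_K0 g x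
    rw [mul_one] at h1
    have h2 : ((1 : GL (Fin 2) (Af K)) 1 1 : Af K) = 1 := by
      rw [Units.val_one, Matrix.one_apply_eq]
    rw [h2, atIdeal_one, one_smul] at h1
    rw [Equiv.apply_symm_apply, ← hu', ← Units.val_mul, extend_apply, extend_apply, h1]
  central := by
    intro A hA z hz
    obtain ⟨g, rfl⟩ := exists_eq_of_mem hA
    have h1 := hF.central (Units.mk0 z hz) 1 g x
    rw [map_one, one_mul, hφ.infinity_type] at h1
    have h2 : z • (Matrix.of.symm (g : Matrix (Fin 2) (Fin 2) ℂ)) = Matrix.of.symm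
        ((Matrix.GeneralLinearGroup.scalar (Fin 2) (Units.mk0 z hz) * g : GL (Fin 2) ℂ) :
          Matrix (Fin 2) (Fin 2) ℂ) := by
      rw [Units.val_mul]
      funext i j
      simp
    rw [h2, extend_apply, extend_apply, h1]
    rfl
  growth := by
    obtain ⟨C, M, h⟩ := hF.moderate_growth x
    refine ⟨C, M, fun A hA => ?_⟩
    obtain ⟨g, rfl⟩ := exists_eq_of_mem hA
    rw [extend_apply]
    exact h g

/-- Right translates under which the adelic variable is unchanged give periods. -/
lemma extend_unipotentMul (x : GL (Fin 2) (Af K)) (b : K)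
    (hy : x⁻¹ * upper (algebraMap K (Af K) (-b)) * x ∈ K0 𝔫)
    (h1 : atIdeal φ 𝔫 ((x⁻¹ * upper (algebraMap K (Af K) (-b)) * x : GL (Fin 2) (Af K)) 1 1) = 1)
    {A : Fin 2 → Fin 2 → ℂ} (hA : A ∈ invertibleMatrices) :
    extend (fun g => F g x) (unipotentMul (τ b) A) = extend (fun g => F g x) A := by
  obtain ⟨g, rfl⟩ := exists_eq_of_mem hA
  have e1 : unipotentMul (τ b) (Matrix.of.symm (g : Matrix (Fin 2) (Fin 2) ℂ)) =
      Matrix.of.symm ((upper (τ b) * g : GL (Fin 2) ℂ) : Matrix (Fin 2) (Fin 2) ℂ) := by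
    rw [unipotentMul_apply, Units.val_mul, coe_upper, Equiv.apply_symm_apply]
  -- Left invariance removes the rational unipotent on the left, applied to both variables, and the
  -- equivariance under `K0 𝔫` removes the factor on the right.
  have e2 : x = upper (algebraMap K (Af K) b) *
      (x * (x⁻¹ * upper (algebraMap K (Af K) (-b)) * x)) := by
    rw [mul_assoc, mul_inv_cancel_left, ← mul_assoc, map_neg, upper_mul_upper_neg, one_mul]
  rw [e1, extend_apply, extend_apply]
  conv_lhs => rw [e2]
  rw [← map_upper, ← map_upper (algebraMap K (Af K)) b, hF.left_invariant]
  have h2 := hF.right_equivariant 1 _ (one_mem _) hy g x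
  rw [mul_one, h1, one_smul, Units.val_one, rho_one] at h2
  exact h2

end IsBianchiModularForm

end modularForm

end

section

/-! ### Fractional ideals and valuations -/

section counts

variable {K : Type*} [Field K] [NumberField K]

open FractionalIdeal in
lemma le_one_of_count_nonneg {J : FractionalIdeal (𝓞 K)⁰ K} (hJ : J ≠ 0)
    (h : ∀ v : HeightOneSpectrum (𝓞 K), 0 ≤ count K v J) : J ≤ 1 := by
  rw [← finprod_heightOneSpectrum_factorization' K hJ]
  refine finprod_induction (p := fun I : FractionalIdeal (𝓞 K)⁰ K => I ≤ 1) le_rfl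
    (fun I I' hI hI' => ?_) (fun v => ?_)
  · calc I * I' ≤ 1 * 1 := mul_le_mul' hI hI'
      _ = 1 := one_mul 1
  · obtain ⟨n, hn⟩ := Int.eq_ofNat_of_zero_le (h v)
    rw [hn, zpow_natCast, ← coeIdeal_pow]
    exact coeIdeal_le_one

open FractionalIdeal in
lemma le_iff_count_le {J J' : FractionalIdeal (𝓞 K)⁰ K} (hJ : J ≠ 0) (hJ' : J' ≠ 0) :
    J ≤ J' ↔ ∀ v : HeightOneSpectrum (𝓞 K), count K v J' ≤ count K v J := by
  refine ⟨fun h v => count_mono K v hJ h, fun h => ?_⟩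
  have h1 : J * J'⁻¹ ≤ 1 := by
    refine le_one_of_count_nonneg (mul_ne_zero hJ (inv_ne_zero hJ')) fun v => ?_
    rw [count_mul K v hJ (inv_ne_zero hJ'), count_inv]
    have := h v
    omega
  calc J = J * J'⁻¹ * J' := by rw [mul_assoc, inv_mul_cancel₀ hJ', mul_one]
    _ ≤ 1 * J' := mul_le_mul' h1 le_rfl
    _ = J' := one_mul _

lemma mem_iff_count_le {J : FractionalIdeal (𝓞 K)⁰ K} (hJ : J ≠ 0) {x : K} (hx : x ≠ 0) :
    x ∈ J ↔ ∀ v : HeightOneSpectrum (𝓞 K), FractionalIdeal.count K v J ≤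
      FractionalIdeal.count K v (FractionalIdeal.spanSingleton (𝓞 K)⁰ x) := by
  rw [← FractionalIdeal.spanSingleton_le_iff_mem,
    le_iff_count_le (FractionalIdeal.spanSingleton_ne_zero_iff.2 hx) hJ]

lemma valued_eq_exp_neg_count (v : HeightOneSpectrum (𝓞 K)) {x : K} (hx : x ≠ 0) :
    Valued.v (x : v.adicCompletion K) =
      WithZero.exp (-FractionalIdeal.count K v (FractionalIdeal.spanSingleton (𝓞 K)⁰ x)) := by
  rw [valuedAdicCompletion_eq_valuation']
  obtain ⟨a, d, hd, rfl⟩ := IsFractionRing.div_surjective (A := 𝓞 K) x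
  have hd0 : d ≠ 0 := nonZeroDivisors.ne_zero hd
  have ha0 : a ≠ 0 := by rintro rfl; simp at hx
  have e : FractionalIdeal.spanSingleton (𝓞 K)⁰ (algebraMap (𝓞 K) K a / algebraMap (𝓞 K) K d) =
      FractionalIdeal.spanSingleton (𝓞 K)⁰ (algebraMap (𝓞 K) K d)⁻¹ * (Ideal.span {a} : Ideal (𝓞 K)) := by
    rw [FractionalIdeal.coeIdeal_span_singleton, FractionalIdeal.spanSingleton_mul_spanSingleton,
      div_eq_inv_mul]
  rw [FractionalIdeal.count_well_defined K v (FractionalIdeal.spanSingleton_ne_zero_iff.2 hx) e,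
    map_div₀, valuation_of_algebraMap, valuation_of_algebraMap, intValuation_if_neg _ ha0,
    intValuation_if_neg _ hd0, ← WithZero.exp_sub]
  congr 1
  ring

lemma valued_le_of_mem (v : HeightOneSpectrum (𝓞 K)) {J : FractionalIdeal (𝓞 K)⁰ K} (hJ : J ≠ 0)
    {x : K} (hx : x ∈ J) :
    Valued.v (x : v.adicCompletion K) ≤ WithZero.exp (-FractionalIdeal.count K v J) := by
  by_cases h0 : x = 0
  · subst h0
    rw [adicCompletion.coe_zero, map_zero]
    exact zero_le
  · rw [valued_eq_exp_neg_count v h0, WithZero.exp_le_exp]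
    exact neg_le_neg ((mem_iff_count_le hJ h0).1 hx v)

lemma mem_of_valued_le {J : FractionalIdeal (𝓞 K)⁰ K} (hJ : J ≠ 0) {x : K}
    (h : ∀ v : HeightOneSpectrum (𝓞 K), Valued.v (x : v.adicCompletion K) ≤
      WithZero.exp (-FractionalIdeal.count K v J)) : x ∈ J := by
  by_cases h0 : x = 0
  · subst h0
    exact J.zero_mem
  · refine (mem_iff_count_le hJ h0).2 fun v => ?_
    have := h v
    rw [valued_eq_exp_neg_count v h0, WithZero.exp_le_exp] at this
    omega

lemma valued_uniformizer (v : HeightOneSpectrum (𝓞 K)) :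
    Valued.v (uniformizer v : v.adicCompletion K) = WithZero.exp (-1 : ℤ) :=
  (exists_uniformizer v).choose_spec

lemma valued_ideleOf (v : HeightOneSpectrum (𝓞 K)) (J : FractionalIdeal (𝓞 K)⁰ K) :
    Valued.v ((ideleOf J : Af K) v) = WithZero.exp (-FractionalIdeal.count K v J) := by
  change Valued.v ((uniformizer v ^ FractionalIdeal.count K v J : (v.adicCompletion K)ˣ) :
    v.adicCompletion K) = _
  rw [Units.val_zpow_eq_zpow_val, map_zpow₀, valued_uniformizer,
    ← WithZero.exp_zsmul]
  congr 1
  simp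

lemma af_mul_apply (x y : Af K) (v : HeightOneSpectrum (𝓞 K)) : (x * y) v = x v * y v := rfl

lemma af_add_apply (x y : Af K) (v : HeightOneSpectrum (𝓞 K)) : (x + y) v = x v + y v := rfl

lemma af_sub_apply (x y : Af K) (v : HeightOneSpectrum (𝓞 K)) : (x - y) v = x v - y v := rfl

lemma af_one_apply (v : HeightOneSpectrum (𝓞 K)) : (1 : Af K) v = 1 := rfl

lemma af_algebraMap_apply (x : K) (v : HeightOneSpectrum (𝓞 K)) :
    (algebraMap K (Af K) x) v = (x : v.adicCompletion K) := rfl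

lemma valued_inv_apply (x : (Af K)ˣ) (v : HeightOneSpectrum (𝓞 K)) :
    Valued.v (((x⁻¹ : (Af K)ˣ) : Af K) v) = (Valued.v ((x : Af K) v))⁻¹ := by
  have h : ((x⁻¹ : (Af K)ˣ) : Af K) v * (x : Af K) v = 1 := by
    rw [← af_mul_apply, Units.inv_mul, af_one_apply]
  refine eq_inv_of_mul_eq_one_left ?_
  rw [← map_mul, h, map_one]

/-- A common denominator for a finite adele, relative to a nonzero ideal. -/
lemma exists_ne_zero_mul_le (x : Af K) {𝔤 : Ideal (𝓞 K)} (h𝔤 : 𝔤 ≠ ⊥) :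
    ∃ c : 𝓞 K, c ≠ 0 ∧ ∀ v : HeightOneSpectrum (𝓞 K),
      Valued.v ((algebraMap K (Af K) (c : K) * x) v) ≤
        WithZero.exp (-FractionalIdeal.count K v (𝔤 : FractionalIdeal (𝓞 K)⁰ K)) := by
  have hfin : {v : HeightOneSpectrum (𝓞 K) | ¬ x v ∈ v.adicCompletionIntegers K}.Finite := x.2
  have hex : ∀ v : HeightOneSpectrum (𝓞 K), ∃ n : ℕ,
      Valued.v (x v) ≤ WithZero.exp (n : ℤ) ∧ (x v ∈ v.adicCompletionIntegers K → n = 0) := by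
    intro v
    by_cases hv : x v ∈ v.adicCompletionIntegers K
    · exact ⟨0, by simpa using (mem_adicCompletionIntegers (𝓞 K) K v).1 hv, fun _ => rfl⟩
    · by_cases h0 : Valued.v (x v) = 0
      · exact ⟨0, by rw [h0]; exact zero_le, fun h => absurd h hv⟩
      · refine ⟨(WithZero.log (Valued.v (x v))).toNat, ?_, fun h => absurd h hv⟩
        rw [← WithZero.log_le_iff_le_exp h0]
        exact Int.self_le_toNat _
  choose n hn hn0 using hex
  -- Only finitely many places carry a pole; any nonzero element of the product of the corresponding
  -- prime powers with `𝔤` clears them all.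
  obtain ⟨c, hc, hc0⟩ : ∃ c ∈ (∏ v ∈ hfin.toFinset, v.asIdeal ^ n v) * 𝔤, c ≠ 0 :=
    Submodule.exists_mem_ne_zero_of_ne_bot (mul_ne_zero (Finset.prod_ne_zero_iff.2
      fun v _ => pow_ne_zero _ v.ne_bot) h𝔤)
  refine ⟨c, hc0, fun v => ?_⟩
  have hcK : (c : K) ≠ 0 := by simpa using hc0
  have hpc : ((v.asIdeal ^ n v * 𝔤 : Ideal (𝓞 K)) : FractionalIdeal (𝓞 K)⁰ K) ≠ 0 :=
    FractionalIdeal.coeIdeal_ne_zero.2 (mul_ne_zero (pow_ne_zero _ v.ne_bot) h𝔤)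
  have h1 : (c : K) ∈ ((v.asIdeal ^ n v * 𝔤 : Ideal (𝓞 K)) : FractionalIdeal (𝓞 K)⁰ K) := by
    refine FractionalIdeal.mem_coeIdeal_of_mem (𝓞 K)⁰ ?_
    have hdvd : v.asIdeal ^ n v ∣ ∏ v ∈ hfin.toFinset, v.asIdeal ^ n v := by
      by_cases hv : v ∈ hfin.toFinset
      · exact Finset.dvd_prod_of_mem (fun v : HeightOneSpectrum (𝓞 K) => v.asIdeal ^ n v) hv
      · rw [hn0 v (by_contra fun h => hv (hfin.mem_toFinset.2 h)), pow_zero]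
        exact one_dvd _
    exact Ideal.le_of_dvd (mul_dvd_mul_right hdvd 𝔤) hc
  have h2 := valued_le_of_mem v hpc h1
  rw [FractionalIdeal.coeIdeal_mul, FractionalIdeal.count_mul K v
    (FractionalIdeal.coeIdeal_ne_zero.2 (pow_ne_zero _ v.ne_bot))
    (FractionalIdeal.coeIdeal_ne_zero.2 h𝔤), FractionalIdeal.coeIdeal_pow,
    FractionalIdeal.count_pow, FractionalIdeal.count_self] at h2
  rw [af_mul_apply, map_mul, af_algebraMap_apply]
  calc _ ≤ WithZero.exp (-((n v : ℤ) * 1 + FractionalIdeal.count K v (𝔤 : FractionalIdeal (𝓞 K)⁰ K))) *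
        WithZero.exp (n v : ℤ) := mul_le_mul' h2 (hn v)
    _ = _ := by
        rw [← WithZero.exp_add]
        congr 1
        ring

end counts

end

section

/-! ### Periods and cusps -/

lemma rho_smul_right {N : ℕ} (γ : Matrix (Fin 2) (Fin 2) ℂ) (c : ℂ) (P : V N) :
    rho N γ (c • P) = c • rho N γ P := by
  funext n
  simp only [rho, Pi.smul_apply, smul_eq_mul]
  rw [← Polynomial.coeff_C_mul, Finset.mul_sum]
  congr 1
  refine Finset.sum_congr rfl fun m _ => ?_
  rw [map_mul]
  ring

lemma descent_apply {K : Type*} [Field K] [NumberField K] {N : ℕ}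
    (F : GL (Fin 2) ℂ → GL (Fin 2) (Af K) → V N) (J : Ideal (𝓞 K)) (z : ℂ) (t : ℝ) :
    descent F J z t = (t : ℂ)⁻¹ •
      extend (fun g => F g (diagOne (ideleOf (J : FractionalIdeal (𝓞 K)⁰ K)))) (borel z t) := rfl

lemma latticeMean_const_mul {ι : Type*} [Fintype ι] (ω : ι → ℂ) (c : ℂ) (g : ℂ → ℂ) :
    latticeMean ω (fun z => c * g z) = c * latticeMean ω g :=
  MeasureTheory.integral_const_mul c _

section modularForm

variable {K : Type*} [Field K] [NumberField K] {τ : K →+* ℂ} {𝔫 : Ideal (𝓞 K)} {k ℓ : ℕ}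
  {φ : ℂˣ × (Af K)ˣ →* ℂˣ} {F : GL (Fin 2) ℂ → GL (Fin 2) (Af K) → V (k + ℓ + 2)}

/-- The conjugate of a unipotent is `1` plus `c` times a matrix independent of `c`, so that making
`c` small brings it into any congruence subgroup. -/
lemma conj_upper_apply (x : GL (Fin 2) (Af K)) (c : Af K) (i j : Fin 2) :
    (x⁻¹ * upper c * x : GL (Fin 2) (Af K)) i j =
      (1 : Matrix (Fin 2) (Fin 2) (Af K)) i j + c * ((x⁻¹ : GL (Fin 2) (Af K)) i 0 * x 1 j) := by
  have h : (upper c : Matrix (Fin 2) (Fin 2) (Af K)) = 1 + c • !![0, 1; 0, 0] := by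
    rw [coe_upper, Matrix.one_fin_two]
    ext i j
    fin_cases i <;> fin_cases j <;> simp
  rw [Units.val_mul, Units.val_mul, h, Matrix.mul_add, Matrix.add_mul, mul_one, Units.inv_mul,
    Matrix.add_apply, Matrix.mul_smul, Matrix.smul_mul, Matrix.smul_apply, smul_eq_mul]
  congr 2
  simp [Matrix.mul_apply, Fin.sum_univ_two]

lemma det_conj_upper (x : GL (Fin 2) (Af K)) (c : Af K) :
    (x⁻¹ * upper c * x : GL (Fin 2) (Af K)).det = 1 := by
  have h : (upper c : GL (Fin 2) (Af K)).det = 1 := by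
    apply Units.ext
    rw [Matrix.GeneralLinearGroup.val_det_apply, coe_upper]
    simp
  rw [map_mul, map_mul, h, mul_one, map_inv, inv_mul_cancel]

namespace IsBianchiModularForm

variable (hF : IsBianchiModularForm τ 𝔫 k ℓ φ F)
include hF

/-- Conjugation by `diag (t_J, 1)` divides the unipotent entry by `t_J`, which makes it integral
exactly because `b ∈ J`. -/
lemma periodic_ideleOf {J : FractionalIdeal (𝓞 K)⁰ K} (hJ : J ≠ 0) {b : K} (hb : b ∈ J)
    {A : Fin 2 → Fin 2 → ℂ} (hA : A ∈ invertibleMatrices) :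
    extend (fun g => F g (diagOne (ideleOf J))) (unipotentMul (τ b) A) =
      extend (fun g => F g (diagOne (ideleOf J))) A := by
  set x : GL (Fin 2) (Af K) := diagOne (ideleOf J) with hx
  have hy : x⁻¹ * upper (algebraMap K (Af K) (-b)) * x =
      upper (((ideleOf J)⁻¹ : (Af K)ˣ) * algebraMap K (Af K) (-b)) := by
    rw [mul_assoc, inv_mul_eq_iff_eq_mul]
    apply Units.ext
    rw [Units.val_mul, Units.val_mul, hx, coe_diagOne, coe_upper, coe_upper]
    generalize algebraMap K (Af K) (-b) = c
    ext i j
    fin_cases i <;> fin_cases j <;> simp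
  refine hF.extend_unipotentMul x b ?_ ?_ hA
  · rw [hy]
    intro v
    refine ⟨fun i j => ?_, ?_, ?_⟩
    · have h1 : Valued.v ((((ideleOf J)⁻¹ : (Af K)ˣ) * algebraMap K (Af K) (-b) : Af K) v) ≤ 1 := by
        rw [af_mul_apply, map_mul, valued_inv_apply, valued_ideleOf, af_algebraMap_apply]
        have := valued_le_of_mem v hJ (Submodule.neg_mem (J : Submodule (𝓞 K) K) hb)
        calc _ ≤ (WithZero.exp (-FractionalIdeal.count K v J))⁻¹ *
              WithZero.exp (-FractionalIdeal.count K v J) := mul_le_mul' le_rfl this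
          _ = 1 := inv_mul_cancel₀ WithZero.exp_ne_zero
      fin_cases i <;> fin_cases j
      · exact (map_one (Valued.v (R := v.adicCompletion K))).le
      · exact h1
      · exact (map_zero (Valued.v (R := v.adicCompletion K))).le.trans zero_le_one
      · exact (map_one (Valued.v (R := v.adicCompletion K))).le
    · rw [← hy, det_conj_upper]
      exact map_one _
    · exact (map_zero (Valued.v (R := v.adicCompletion K))).le.trans zero_le
  · rw [hy]
    exact atIdeal_one φ 𝔫

/-- For a general `x`, as needed at cusps other than `∞`, some lattice of periods suffices. The
conjugated unipotent has to be congruent to `1` modulo `𝔫`, so that the character `φ` at the level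
is trivial on its lower right entry. -/
lemma exists_periodic (h𝔫 : 𝔫 ≠ ⊥) (hφ : TrivialOn φ 𝔫) (x : GL (Fin 2) (Af K)) :
    ∃ J : FractionalIdeal (𝓞 K)⁰ K, J ≠ 0 ∧ ∀ b ∈ J, ∀ A ∈ invertibleMatrices,
      extend (fun g => F g x) (unipotentMul (τ b) A) = extend (fun g => F g x) A := by
  have hc : ∀ p : Fin 2 × Fin 2, ∃ c : 𝓞 K, c ≠ 0 ∧ ∀ v : HeightOneSpectrum (𝓞 K),
      Valued.v ((algebraMap K (Af K) (c : K) * ((x⁻¹ : GL (Fin 2) (Af K)) p.1 0 * x 1 p.2)) v) ≤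
        WithZero.exp (-FractionalIdeal.count K v (𝔫 : FractionalIdeal (𝓞 K)⁰ K)) :=
    fun p => exists_ne_zero_mul_le _ h𝔫
  choose c hc0 hc using hc
  have hint : ∀ (d : 𝓞 K) (v : HeightOneSpectrum (𝓞 K)), Valued.v (((d : K)) : v.adicCompletion K) ≤ 1 := by
    intro d v
    rw [valuedAdicCompletion_eq_valuation']
    exact v.valuation_le_one d
  have hP : ∏ p, c p ≠ 0 := Finset.prod_ne_zero_iff.2 fun p _ => hc0 p
  -- The product of the denominators of all four matrix entries serves every entry simultaneously.
  refine ⟨(Ideal.span {∏ p, c p} : Ideal (𝓞 K)), FractionalIdeal.coeIdeal_ne_zero.2 (by simpa using hP),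
    fun b hb A hA => ?_⟩
  obtain ⟨b', hb', rfl⟩ := (FractionalIdeal.mem_coeIdeal _).1 hb
  obtain ⟨d, rfl⟩ := Ideal.mem_span_singleton'.1 hb'
  have hle : ∀ (i j : Fin 2) (v : HeightOneSpectrum (𝓞 K)),
      Valued.v ((algebraMap K (Af K) (-algebraMap (𝓞 K) K (d * ∏ p, c p)) *
        ((x⁻¹ : GL (Fin 2) (Af K)) i 0 * x 1 j)) v) ≤
        WithZero.exp (-FractionalIdeal.count K v (𝔫 : FractionalIdeal (𝓞 K)⁰ K)) := by
    intro i j v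
    have e : -algebraMap (𝓞 K) K (d * ∏ p, c p) =
        algebraMap (𝓞 K) K (-d * ∏ p ∈ Finset.univ.erase (i, j), c p) * (c (i, j) : K) := by
      rw [← map_mul, ← map_neg]
      congr 1
      rw [← Finset.mul_prod_erase Finset.univ c (Finset.mem_univ (i, j))]
      ring
    rw [e, map_mul, mul_assoc, af_mul_apply, map_mul, af_algebraMap_apply]
    exact (mul_le_mul' (hint _ v) (hc (i, j) v)).trans (one_mul _).le
  have hone : ∀ (i j : Fin 2) (v : HeightOneSpectrum (𝓞 K)),
      Valued.v (((1 : Matrix (Fin 2) (Fin 2) (Af K)) i j) v) ≤ 1 := by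
    intro i j v
    rw [Matrix.one_apply]
    split_ifs
    · exact (map_one (Valued.v (R := v.adicCompletion K))).le
    · exact (map_zero (Valued.v (R := v.adicCompletion K))).le.trans zero_le_one
  refine hF.extend_unipotentMul x _ (fun v => ⟨fun i j => ?_, ?_, ?_⟩) ?_ hA
  · rw [conj_upper_apply, af_add_apply]
    exact (Valuation.map_add _ _ _).trans (max_le (hone i j v)
      ((hle i j v).trans (exp_neg_count_le_one v 𝔫)))
  · rw [det_conj_upper]
    exact map_one _
  · rw [conj_upper_apply, Matrix.one_apply_ne (by simp), zero_add]
    exact hle 1 0 v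
  · refine finprod_mem_eq_one_of_forall_eq_one fun v hv => ?_
    rw [conj_upper_apply, Matrix.one_apply_eq]
    have hlt : WithZero.exp (-FractionalIdeal.count K v (𝔫 : FractionalIdeal (𝓞 K)⁰ K)) < 1 := by
      rw [← WithZero.exp_zero, WithZero.exp_lt_exp, neg_lt_zero]
      obtain ⟨𝔠, h𝔠⟩ := hv
      have h𝔠0 : 𝔠 ≠ ⊥ := by rintro rfl; exact h𝔫 (by rw [h𝔠, Ideal.mul_bot])
      rw [h𝔠, FractionalIdeal.coeIdeal_mul, FractionalIdeal.count_mul K v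
        (FractionalIdeal.coeIdeal_ne_zero.2 v.ne_bot) (FractionalIdeal.coeIdeal_ne_zero.2 h𝔠0),
        FractionalIdeal.count_self]
      have := count_nonneg v 𝔠
      omega
    refine hφ.atPlace_eq_one ?_ ?_
    · rw [af_add_apply, Valuation.map_add_eq_of_lt_left]
      · exact map_one _
      · exact (hle 1 1 v).trans_lt (hlt.trans_eq (map_one (Valued.v (R := v.adicCompletion K))).symm)
    · rw [af_add_apply, af_one_apply, add_sub_cancel_left]
      exact hle 1 1 v

end IsBianchiModularForm

end modularForm

end

section

/-! ### Quasi-vanishing and decay at the cusps -/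

lemma V.comp_eq {N : ℕ} (P : V N) {n : ℕ} (hn : n < N + 1) : P.comp n = P ⟨n, hn⟩ := dif_pos hn

lemma V.comp_smul {N : ℕ} (c : ℂ) (P : V N) (n : ℕ) : (c • P).comp n = c * P.comp n := by
  unfold V.comp
  split_ifs <;> simp

/-- The matrix `(a -1; 1 0)`, which maps `∞` to `a`. -/
def toCusp {R : Type*} [CommRing R] (a : R) : GL (Fin 2) R :=
  Matrix.GeneralLinearGroup.mk'' !![a, -1; 1, 0] (by simp)

lemma coe_toCusp {R : Type*} [CommRing R] (a : R) :
    ((toCusp a : GL (Fin 2) R) : Matrix (Fin 2) (Fin 2) R) = !![a, -1; 1, 0] := rfl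

lemma map_toCusp {R S : Type*} [CommRing R] [CommRing S] (f : R →+* S) (a : R) :
    Matrix.GeneralLinearGroup.map f (toCusp a) = toCusp (f a) := by
  apply Units.ext
  ext i j
  fin_cases i <;> fin_cases j <;> simp [coe_toCusp]

lemma toCusp_smul_infty {K : Type*} [Field K] (a : K) :
    toCusp a • (OnePoint.infty : OnePoint K) = (a : OnePoint K) := by
  rw [OnePoint.smul_infty_eq_ite]
  simp [coe_toCusp]

lemma det_toCusp (a : ℂ) : ((toCusp a).det : ℂ) = 1 := by
  rw [Matrix.GeneralLinearGroup.val_det_apply, coe_toCusp]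
  simp

/-- The matrix has determinant one, so the weight factors are trivial, and the inverse of the
automorphy factor is its conjugate transpose divided by `‖z‖² + t²`. -/
lemma slash_toCusp (k ℓ : ℕ) (f : ℂ → ℝ → V (k + ℓ + 2)) (a z : ℂ) {t : ℝ} (ht : 0 < t) :
    slash k ℓ f (toCusp a) z t =
      rho (k + ℓ + 2) (((‖z‖ ^ 2 + t ^ 2 : ℝ) : ℂ)⁻¹ • !![conj z, -(t : ℂ); (t : ℂ), z])
        (f (a - conj z / (‖z‖ ^ 2 + t ^ 2 : ℝ)) (t / (‖z‖ ^ 2 + t ^ 2))) := by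
  have hr : ((‖z‖ ^ 2 + t ^ 2 : ℝ) : ℂ) ≠ 0 := by
    have : 0 < ‖z‖ ^ 2 + t ^ 2 := by positivity
    exact_mod_cast this.ne'
  have hn : z * conj z = ((‖z‖ ^ 2 : ℝ) : ℂ) := by rw [Complex.mul_conj']; norm_cast
  have hinv : (!![z, (t : ℂ); -(t : ℂ), conj z])⁻¹ =
      ((‖z‖ ^ 2 + t ^ 2 : ℝ) : ℂ)⁻¹ • !![conj z, -(t : ℂ); (t : ℂ), z] := by
    refine Matrix.inv_eq_right_inv ?_
    rw [Matrix.mul_smul, Matrix.one_fin_two]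
    ext i j
    fin_cases i <;> fin_cases j <;> simp <;> push_cast at hr hn ⊢
    · field_simp
      linear_combination hn
    · right; ring
    · right; ring
    · field_simp
      linear_combination hn
  have e00 : (toCusp a : GL (Fin 2) ℂ) 0 0 = a := rfl
  have e01 : (toCusp a : GL (Fin 2) ℂ) 0 1 = -1 := rfl
  have e10 : (toCusp a : GL (Fin 2) ℂ) 1 0 = 1 := rfl
  have e11 : (toCusp a : GL (Fin 2) ℂ) 1 1 = 0 := rfl
  have er : ‖(1 : ℂ) * z + 0‖ ^ 2 + ‖(1 : ℂ) * t‖ ^ 2 = ‖z‖ ^ 2 + t ^ 2 := by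
    rw [one_mul, add_zero, one_mul, Complex.norm_real, Real.norm_of_nonneg ht.le]
  have ez : ((a * z + -1) * conj (1 * z + 0) + a * conj 1 * (t : ℂ) ^ 2) / ((‖z‖ ^ 2 + t ^ 2 : ℝ) : ℂ) =
      a - conj z / ((‖z‖ ^ 2 + t ^ 2 : ℝ) : ℂ) := by
    rw [eq_sub_iff_add_eq, ← add_div, div_eq_iff hr, one_mul, add_zero, map_one]
    push_cast at hn ⊢
    linear_combination a * hn
  have et : ‖a * 0 - -1 * 1‖ * t / (‖z‖ ^ 2 + t ^ 2) = t / (‖z‖ ^ 2 + t ^ 2) := by simp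
  unfold slash
  simp only [e00, e01, e10, e11, det_toCusp, er, ez, et]
  rw [← hinv]
  simp

lemma slash_one (k ℓ : ℕ) (f : ℂ → ℝ → V (k + ℓ + 2)) (z : ℂ) (t : ℝ) :
    slash k ℓ f 1 z t = f z t := by
  unfold slash
  have h : (!![1, 0; 0, 1] : Matrix (Fin 2) (Fin 2) ℂ) = 1 := Matrix.one_fin_two.symm
  simp [h, rho_one]

/-- Iwasawa decomposition: `toCusp a * borel z t` is `√r` times a Borel matrix times an element of
`SU₂`, where `r = ‖z‖² + t²`. The centre contributes `√r ^ (-(k + ℓ))` while `rho` is homogeneous of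
degree `k + ℓ + 2`; the difference is the factor `r⁻¹`. -/
lemma IsArchimedeanForm.rho_borel {k ℓ : ℕ} {Φ : (Fin 2 → Fin 2 → ℂ) → V (k + ℓ + 2)}
    (hΦ : IsArchimedeanForm k ℓ Φ) (a z : ℂ) {t : ℝ} (ht : 0 < t) :
    rho (k + ℓ + 2) (((‖z‖ ^ 2 + t ^ 2 : ℝ) : ℂ)⁻¹ • !![conj z, -(t : ℂ); (t : ℂ), z])
        (Φ (borel (a - conj z / (‖z‖ ^ 2 + t ^ 2 : ℝ)) (t / (‖z‖ ^ 2 + t ^ 2)))) =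
      ((‖z‖ ^ 2 + t ^ 2 : ℝ) : ℂ)⁻¹ •
        Φ (Matrix.of.symm ((toCusp a : Matrix (Fin 2) (Fin 2) ℂ) * Matrix.of (borel z t))) := by
  set r : ℝ := ‖z‖ ^ 2 + t ^ 2 with hr
  have hr0 : 0 < r := by positivity
  have hs0 : 0 < Real.sqrt r := Real.sqrt_pos.2 hr0
  have hrC : (r : ℂ) ≠ 0 := by exact_mod_cast hr0.ne'
  have hsC : (Real.sqrt r : ℂ) ≠ 0 := by exact_mod_cast hs0.ne'
  have hss : (Real.sqrt r : ℂ) * Real.sqrt r = r := by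
    exact_mod_cast Real.mul_self_sqrt hr0.le
  have hn : z * conj z + (t : ℂ) ^ 2 = r := by
    rw [Complex.mul_conj', hr]; push_cast; rfl
  set M : Matrix (Fin 2) (Fin 2) ℂ := !![conj z, -(t : ℂ); (t : ℂ), z] with hM
  set u : Matrix (Fin 2) (Fin 2) ℂ := (Real.sqrt r : ℂ)⁻¹ • M with hu
  have huS : u ∈ Matrix.specialUnitaryGroup (Fin 2) ℂ := by
    rw [Matrix.mem_specialUnitaryGroup_iff, Matrix.mem_unitaryGroup_iff]
    constructor
    · rw [hu, star_smul, Matrix.smul_mul, Matrix.mul_smul, smul_smul]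
      have : M * star M = (r : ℂ) • 1 := by
        rw [← hn, hM, Matrix.one_fin_two]
        ext i j
        fin_cases i <;> fin_cases j <;> simp [Matrix.mul_apply, Fin.sum_univ_two, Matrix.star_apply] <;> ring
      rw [this, smul_smul]
      have : (Real.sqrt r : ℂ)⁻¹ * star (Real.sqrt r : ℂ)⁻¹ * r = 1 := by
        rw [star_inv₀, Complex.star_def, Complex.conj_ofReal, ← mul_inv, hss, inv_mul_cancel₀ hrC]
      rw [this, one_smul]
    · rw [hu, Matrix.det_smul, hM, Matrix.det_fin_two_of, Fintype.card_fin, inv_pow, pow_two, hss]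
      have : conj z * z - -(t : ℂ) * t = r := by rw [← hn]; ring
      rw [this, inv_mul_cancel₀ hrC]
  have hb : borel (a - conj z / r) (t / r) ∈ invertibleMatrices := borel_mem _ (by positivity)
  have h1 := hΦ.unitary _ hb u huS
  have hmem : Matrix.of.symm (Matrix.of (borel (a - conj z / r) (t / r)) * u) ∈ invertibleMatrices := by
    change Matrix.det _ ≠ 0
    rw [Equiv.apply_symm_apply, Matrix.det_mul, (Matrix.mem_specialUnitaryGroup_iff.1 huS).2, mul_one]
    exact hb
  have h2 := hΦ.central _ hmem _ hsC
  have e : (Real.sqrt r : ℂ) • Matrix.of.symm (Matrix.of (borel (a - conj z / r) (t / r)) * u) =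
      Matrix.of.symm ((toCusp a : Matrix (Fin 2) (Fin 2) ℂ) * Matrix.of (borel z t)) := by
    have e1 : (Real.sqrt r : ℂ) • (Matrix.of (borel (a - conj z / r) (t / r)) * u) =
        (toCusp a : Matrix (Fin 2) (Fin 2) ℂ) * Matrix.of (borel z t) := by
      rw [hu, Matrix.mul_smul, smul_smul, mul_inv_cancel₀ hsC, one_smul, hM, coe_toCusp]
      simp only [borel, Equiv.apply_symm_apply]
      ext i j
      fin_cases i <;> fin_cases j <;> simp
      · field_simp; ring
      · field_simp; linear_combination (-1 : ℂ) * hn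
    rw [← e1]
    rfl
  rw [e, h1, hu, rho_smul] at h2
  rw [h2, rho_smul, smul_smul, smul_smul]
  congr 1
  rw [Complex.conj_ofReal, zpow_neg, zpow_neg, zpow_natCast, zpow_natCast]
  have h3 : ((r : ℂ))⁻¹ ^ (k + ℓ + 2) = (Real.sqrt r : ℂ)⁻¹ ^ (k + ℓ + 2) * (Real.sqrt r : ℂ)⁻¹ ^ (k + ℓ + 2) := by
    rw [← mul_pow, ← mul_inv, hss]
  rw [h3, ← hss]
  simp only [inv_pow, pow_add, mul_inv]
  field_simp

section modularForm

variable {K : Type*} [Field K] [NumberField K] {τ : K →+* ℂ} {𝔫 : Ideal (𝓞 K)} {k ℓ : ℕ}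
  {φ : ℂˣ × (Af K)ˣ →* ℂˣ} {F : GL (Fin 2) ℂ → GL (Fin 2) (Af K) → V (k + ℓ + 2)}

namespace IsBianchiModularForm

variable (hF : IsBianchiModularForm τ 𝔫 k ℓ φ F)
include hF

lemma extend_mul_left (γ : GL (Fin 2) K) (x : GL (Fin 2) (Af K)) {A : Fin 2 → Fin 2 → ℂ}
    (hA : A ∈ invertibleMatrices) :
    extend (fun g => F g x) (Matrix.of.symm
      ((Matrix.GeneralLinearGroup.map τ γ : Matrix (Fin 2) (Fin 2) ℂ) * Matrix.of A)) =
    extend (fun g => F g ((Matrix.GeneralLinearGroup.map (algebraMap K (Af K)) γ)⁻¹ * x)) A := by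
  obtain ⟨g, rfl⟩ := exists_eq_of_mem hA
  rw [Equiv.apply_symm_apply, ← Units.val_mul, extend_apply, extend_apply]
  conv_lhs => rw [← mul_inv_cancel_left (Matrix.GeneralLinearGroup.map (algebraMap K (Af K)) γ) x]
  rw [hF.left_invariant]

/-- Slashing amounts to translating the finite adelic variable, so the function at the cusp `a` is
again an archimedean form, to which the Fourier theory applies. -/
lemma slash_descent (hφ : IsHeckeCharacter τ φ (-k) (-ℓ)) (J : Ideal (𝓞 K)) (a : K) (z : ℂ) {t : ℝ}
    (ht : 0 < t) :
    slash k ℓ (descent F J) (toCusp (τ a)) z t = (t : ℂ)⁻¹ •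
      extend (fun g => F g ((toCusp (algebraMap K (Af K) a))⁻¹ *
        diagOne (ideleOf (J : FractionalIdeal (𝓞 K)⁰ K)))) (borel z t) := by
  have hr0 : 0 < ‖z‖ ^ 2 + t ^ 2 := by positivity
  have h := hF.extend_mul_left (toCusp a) (diagOne (ideleOf (J : FractionalIdeal (𝓞 K)⁰ K)))
    (borel_mem z ht)
  rw [map_toCusp, map_toCusp] at h
  rw [slash_toCusp _ _ _ _ _ ht, descent_apply, rho_smul_right,
    (hF.isArchimedeanForm hφ _).rho_borel _ _ ht, smul_smul, ← h]
  congr 1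
  have h1 : (t : ℂ) ≠ 0 := by exact_mod_cast ht.ne'
  have h2 : ((‖z‖ ^ 2 + t ^ 2 : ℝ) : ℂ) ≠ 0 := by exact_mod_cast hr0.ne'
  rw [Complex.ofReal_div, inv_div, div_eq_mul_inv, mul_right_comm, mul_inv_cancel₀ h2, one_mul]

end IsBianchiModularForm

end modularForm

end

/-! ### Lattices of periods and decay at the cusps -/

section

section periods

variable {K : Type*} [Field K] [NumberField K] [NumberField.IsTotallyComplex K] (τ : K →+* ℂ)

/-- A real basis of `ℂ` of elements of `J`, with the dual lattice. -/
lemma exists_isDualPair_fin_two (hK : Module.finrank ℚ K = 2) {J : FractionalIdeal (𝓞 K)⁰ K}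
    (hJ : J ≠ 0) :
    ∃ (ω : Fin 2 → ℂ) (e : traceDual J ≃ (Fin 2 → ℤ)),
      IsDualPair ω (fun a : traceDual J => τ a) e ∧ (∀ i, ∃ b ∈ J, ω i = τ b) ∧
        LinearIndependent ℝ ω := by
  obtain ⟨e, he⟩ := exists_isDualPair τ hK (Units.mk0 J hJ)
  have hcard : Fintype.card (Module.Free.ChooseBasisIndex ℤ (Units.mk0 J hJ)) = 2 := by
    rw [← Module.finrank_eq_card_basis (basisOfFractionalIdeal K (Units.mk0 J hJ)), hK]
  let ε := Fintype.equivFinOfCardEq hcard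
  let ω : Fin 2 → ℂ := fun i => τ (basisOfFractionalIdeal K (Units.mk0 J hJ) (ε.symm i))
  have hspan : Submodule.span ℝ (Set.range ω) = ⊤ := by
    rw [← he.span]
    congr 1
    exact ε.symm.surjective.range_comp (fun i => τ (basisOfFractionalIdeal K (Units.mk0 J hJ) i))
  refine ⟨ω, e.trans (Equiv.arrowCongr ε (Equiv.refl ℤ)), ⟨hspan, fun a i => ?_⟩, fun i => ?_, ?_⟩
  · exact he.pair a (ε.symm i)
  · exact ⟨_, (mem_span_basisOfFractionalIdeal K).1 (Submodule.subset_span ⟨ε.symm i, rfl⟩), rfl⟩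
  · exact linearIndependent_of_top_le_span_of_card_eq_finrank hspan.ge (by simp)

end periods

section modularForm

variable {K : Type*} [Field K] [NumberField K] [NumberField.IsTotallyComplex K]
  {τ : K →+* ℂ} {𝔫 : Ideal (𝓞 K)} {k ℓ : ℕ}
  {φ : ℂˣ × (Af K)ˣ →* ℂˣ} {F : GL (Fin 2) ℂ → GL (Fin 2) (Af K) → V (k + ℓ + 2)}

namespace IsBianchiModularForm

variable (hF : IsBianchiModularForm τ 𝔫 k ℓ φ F)
include hF

lemma latticeMean_eq_zero {J : Ideal (𝓞 K)} (hJ : J ≠ ⊥)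
    (hq : QuasiVanishesAt τ k ℓ (descent F J) OnePoint.infty) {ω : Fin 2 → ℂ}
    (hω : ∀ i, ∃ b ∈ (J : FractionalIdeal (𝓞 K)⁰ K), ω i = τ b) (hli : LinearIndependent ℝ ω)
    {n : Fin (k + ℓ + 2 + 1)} (h1 : 1 ≤ (n : ℕ)) (h2 : (n : ℕ) ≤ k + ℓ + 1) {t : ℝ} (ht : 0 < t) :
    latticeMean ω (fun z =>
      extend (fun g => F g (diagOne (ideleOf (J : FractionalIdeal (𝓞 K)⁰ K)))) (borel z t) n) = 0 := by
  have hJ' : (J : FractionalIdeal (𝓞 K)⁰ K) ≠ 0 := FractionalIdeal.coeIdeal_ne_zero.2 hJ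
  have key : ∀ z, (slash k ℓ (descent F J) (Matrix.GeneralLinearGroup.map τ 1) z t).comp n =
      (t : ℂ)⁻¹ * extend (fun g => F g (diagOne (ideleOf (J : FractionalIdeal (𝓞 K)⁰ K))))
        (borel z t) n := by
    intro z
    rw [map_one, slash_one, descent_apply, V.comp_smul, V.comp_eq _ n.2]
  have h := hq 1 (one_smul _ _) n h1 h2 t ht ω hli (fun i z => by
    obtain ⟨b, hb, hb'⟩ := hω i
    beta_reduce
    rw [key, key, hb', ← unipotentMul_borel, hF.periodic_ideleOf hJ' hb (borel_mem z ht)])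
  simp only [key] at h
  rw [latticeMean_const_mul] at h
  refine (mul_eq_zero.1 h).resolve_left ?_
  exact inv_ne_zero (by exact_mod_cast ht.ne')

/-- Over `z = 0` the matrix `toCusp a` exchanges the heights `t` and `t⁻¹`, and its antidiagonal
automorphy factor exchanges the components `n` and `k + ℓ + 2 - n`. Decay above `a` as `t → 0` is
therefore decay at infinity of a component of the translate, whose constant term vanishes by
quasi-vanishing at `a`. -/
theorem norm_descent_le (hφ : IsHeckeCharacter τ φ (-k) (-ℓ)) (hK : Module.finrank ℚ K = 2)
    (h𝔫 : 𝔫 ≠ ⊥) (hφ𝔫 : TrivialOn φ 𝔫) (J : Ideal (𝓞 K)) {a : K}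
    (hq : QuasiVanishesAt τ k ℓ (descent F J) (a : OnePoint K)) {n : ℕ}
    (h1 : 1 ≤ n) (h2 : n ≤ k + ℓ + 1) (P : ℕ) :
    ∃ B : ℝ, ∀ t : ℝ, 0 < t → t ≤ 1 → ‖(descent F J (τ a) t).comp n‖ ≤ B * t ^ P := by
  set x := (toCusp (algebraMap K (Af K) a))⁻¹ * diagOne (ideleOf (J : FractionalIdeal (𝓞 K)⁰ K))
    with hx
  set Φ : (Fin 2 → Fin 2 → ℂ) → V (k + ℓ + 2) := extend (fun g => F g x) with hΦdef
  have hΦ : IsArchimedeanForm k ℓ Φ := hF.isArchimedeanForm hφ x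
  obtain ⟨L, hL, hper⟩ := hF.exists_periodic h𝔫 hφ𝔫 x
  obtain ⟨ω, e, he, hω, hli⟩ := exists_isDualPair_fin_two τ hK hL
  have hper' : ∀ i, ∀ A ∈ invertibleMatrices, Φ (unipotentMul (ω i) A) = Φ A := by
    intro i A hA
    obtain ⟨b, hb, hb'⟩ := hω i
    rw [hb']
    exact hper b hb A hA
  have hs : ∀ z, ∀ t : ℝ, 0 < t →
      slash k ℓ (descent F J) (Matrix.GeneralLinearGroup.map τ (toCusp a)) z t =
        (t : ℂ)⁻¹ • Φ (borel z t) := by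
    intro z t ht
    rw [map_toCusp, hF.slash_descent hφ J a z ht]
  -- The range `1 ≤ n ≤ k + ℓ + 1` is stable under this reflection, so quasi-vanishing covers the
  -- component `m` too.
  set m : Fin (k + ℓ + 2 + 1) := ⟨k + ℓ + 2 - n, by omega⟩ with hm
  have h0 : ∀ t : ℝ, 0 < t → latticeMean ω (fun z => Φ (borel z t) m) = 0 := by
    intro t ht
    have key : ∀ z, (slash k ℓ (descent F J) (Matrix.GeneralLinearGroup.map τ (toCusp a)) z t).comp m =
        (t : ℂ)⁻¹ * Φ (borel z t) m := by
      intro z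
      rw [hs z t ht, V.comp_smul, V.comp_eq _ m.2]
    have h := hq (toCusp a) (toCusp_smul_infty a) m (by simp [hm]; omega) (by simp [hm]; omega) t ht ω
      hli (fun i z => by beta_reduce; rw [key, key, ← unipotentMul_borel, hper' i _ (borel_mem z ht)])
    simp only [key] at h
    rw [latticeMean_const_mul] at h
    refine (mul_eq_zero.1 h).resolve_left ?_
    exact inv_ne_zero (by exact_mod_cast ht.ne')
  obtain ⟨C, hC⟩ := hΦ.exists_isCoefficientFamily hper' he
  -- The extra `k + ℓ + 2` pays for the factor `t ^ (k + ℓ + 2)` produced by `rho` on antidiagonal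
  -- matrices.
  obtain ⟨B, hB, hb⟩ := hC.norm_le_inv_pow hΦ hper' he h0 (P + (k + ℓ + 2))
  refine ⟨B, fun t ht ht1 => ?_⟩
  have hti : 0 < t⁻¹ := inv_pos.2 ht
  have h3 := hs 0 t⁻¹ hti
  rw [map_toCusp, slash_toCusp _ _ _ _ _ hti] at h3
  have h4 : t⁻¹ / (‖(0 : ℂ)‖ ^ 2 + t⁻¹ ^ 2) = t := by
    rw [norm_zero]; field_simp; ring
  have h5 : (((‖(0 : ℂ)‖ ^ 2 + t⁻¹ ^ 2 : ℝ) : ℂ))⁻¹ = (t : ℂ) ^ 2 := by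
    simp
  have h6 : ((t : ℂ) ^ 2) • !![conj (0 : ℂ), -((t⁻¹ : ℝ) : ℂ); ((t⁻¹ : ℝ) : ℂ), (0 : ℂ)] =
      !![0, -(t : ℂ); (t : ℂ), 0] := by
    have : (t : ℂ) ≠ 0 := by exact_mod_cast ht.ne'
    ext i j
    fin_cases i <;> fin_cases j <;> simp <;> field_simp
  rw [h4, h5, h6, map_zero, zero_div, sub_zero] at h3
  have h7 := congrFun h3 m
  rw [rho_antidiag, Pi.smul_apply, smul_eq_mul] at h7
  have h8 : m.rev = ⟨n, by omega⟩ := by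
    apply Fin.ext
    rw [Fin.val_rev, hm]
    simp only
    omega
  have h9 := congrArg norm h7
  rw [h8, norm_mul, norm_mul, norm_pow, norm_pow, neg_neg, norm_neg, Complex.norm_real,
    Real.norm_of_nonneg ht.le, ← pow_add, norm_mul, Complex.ofReal_inv, inv_inv, Complex.norm_real,
    Real.norm_of_nonneg ht.le] at h9
  have h10 : (m : ℕ) + (k + ℓ + 2 - (m : ℕ)) = k + ℓ + 2 := by
    have := m.2; omega
  rw [h10] at h9
  rw [V.comp_eq _ (by omega : n < k + ℓ + 2 + 1)]
  have h11 := hb 0 t⁻¹ ((one_le_inv₀ ht).2 ht1)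
  rw [inv_inv] at h11
  have hpos : 0 < t ^ (k + ℓ + 2) := by positivity
  refine le_of_mul_le_mul_left ?_ hpos
  rw [h9]
  calc t * ‖Φ (borel 0 t⁻¹) m‖ ≤ 1 * (B * t ^ (P + (k + ℓ + 2))) :=
        mul_le_mul ht1 h11 (norm_nonneg _) zero_le_one
    _ = _ := by rw [pow_add]; ring

end IsBianchiModularForm

end modularForm

end

section

/-! ### The Fourier coefficients of a Bianchi modular form -/

/-- Choose `η` with `η² = α / ‖α‖`. The two matrices then differ by the central element `η` and
`diag (η, η⁻¹)` in `SU₂`, which together act on the component `ℓ + 1` by `η ^ (-k) η ^ ℓ η ^ (k + 1)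
η ^ (-(ℓ + 1)) = 1`. -/
lemma IsArchimedeanForm.middle_diag {k ℓ : ℕ} {Φ : (Fin 2 → Fin 2 → ℂ) → V (k + ℓ + 2)}
    (hΦ : IsArchimedeanForm k ℓ Φ) {α : ℂ} (hα : α ≠ 0) (w : ℂ) (hn : ℓ + 1 < k + ℓ + 2 + 1) :
    Φ (Matrix.of.symm !![α, w; 0, 1]) ⟨ℓ + 1, hn⟩ = Φ (borel w ‖α‖) ⟨ℓ + 1, hn⟩ := by
  have hp : 0 < ‖α‖ := norm_pos_iff.2 hα
  have hpC : (‖α‖ : ℂ) ≠ 0 := by exact_mod_cast hp.ne'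
  obtain ⟨η, hη⟩ := IsAlgClosed.exists_pow_nat_eq (α / ‖α‖) (n := 2) (by norm_num)
  have hη1 : ‖η‖ = 1 := by
    have h1 : ‖η‖ ^ 2 = 1 := by
      rw [← norm_pow, hη, norm_div, Complex.norm_real, norm_norm, div_self hp.ne']
    exact (pow_eq_one_iff_of_nonneg (norm_nonneg _) two_ne_zero).1 h1
  have hη0 : η ≠ 0 := by
    rintro rfl
    simp at hη1
  have hc : conj η = η⁻¹ := by
    rw [eq_comm, inv_eq_of_mul_eq_one_right]
    rw [Complex.mul_conj', hη1]
    simp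
  have huS : !![η, 0; 0, η⁻¹] ∈ Matrix.specialUnitaryGroup (Fin 2) ℂ := by
    rw [Matrix.mem_specialUnitaryGroup_iff, Matrix.mem_unitaryGroup_iff]
    constructor
    · rw [Matrix.one_fin_two]
      ext i j
      fin_cases i <;> fin_cases j <;> simp [Matrix.mul_apply, Fin.sum_univ_two, Matrix.star_apply, hc, hη0]
    · simp [hη0]
  have h1 := hΦ.unitary _ (borel_mem w hp) _ huS
  have hmem : Matrix.of.symm (Matrix.of (borel w ‖α‖) * !![η, 0; 0, η⁻¹]) ∈ invertibleMatrices := by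
    change Matrix.det _ ≠ 0
    rw [Equiv.apply_symm_apply, Matrix.det_mul, (Matrix.mem_specialUnitaryGroup_iff.1 huS).2, mul_one]
    exact borel_mem w hp
  have h2 := hΦ.central _ hmem η hη0
  have e : η • Matrix.of.symm (Matrix.of (borel w ‖α‖) * !![η, 0; 0, η⁻¹]) =
      Matrix.of.symm !![α, w; 0, 1] := by
    have e1 : η • (Matrix.of (borel w ‖α‖) * !![η, 0; 0, η⁻¹]) = !![α, w; 0, 1] := by
      have hα' : α = η ^ 2 * ‖α‖ := by rw [hη, div_mul_cancel₀ _ hpC]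
      simp only [borel, Equiv.apply_symm_apply]
      ext i j
      fin_cases i <;> fin_cases j <;> simp
      · conv_rhs => rw [hα']
        ring
      · field_simp
      · field_simp
    rw [← e1]
    rfl
  rw [e, h1] at h2
  rw [h2, Pi.smul_apply, rho_diag, smul_eq_mul, hc, ← mul_assoc]
  have e3 : k + ℓ + 2 - (ℓ + 1) = k + 1 := by omega
  simp only [e3]
  have : η ^ (-(k : ℤ)) * η⁻¹ ^ (-(ℓ : ℤ)) * (η ^ (k + 1) * η⁻¹ ^ (ℓ + 1)) = 1 := by
    rw [zpow_neg, zpow_neg, zpow_natCast, zpow_natCast]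
    simp only [inv_pow, pow_succ, inv_inv]
    field_simp
  rw [this, one_mul]

lemma valued_eq_one_of_count {K : Type*} [Field K] [NumberField K] (v : HeightOneSpectrum (𝓞 K))
    {a : K} (ha : a ≠ 0) {J : FractionalIdeal (𝓞 K)⁰ K} (hJ : J ≠ 0) :
    Valued.v ((ideleOf (FractionalIdeal.spanSingleton (𝓞 K)⁰ a * J) : Af K) v) =
      Valued.v (a : v.adicCompletion K) * Valued.v ((ideleOf J : Af K) v) := by
  rw [valued_ideleOf, valued_ideleOf, valued_eq_exp_neg_count v ha,
    FractionalIdeal.count_mul K v (FractionalIdeal.spanSingleton_ne_zero_iff.2 ha) hJ,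
    ← WithZero.exp_add]
  congr 1
  ring

section modularForm

variable {K : Type*} [Field K] [NumberField K]
  {τ : K →+* ℂ} {𝔫 : Ideal (𝓞 K)} {k ℓ : ℕ}
  {φ : ℂˣ × (Af K)ˣ →* ℂˣ} {F : GL (Fin 2) ℂ → GL (Fin 2) (Af K) → V (k + ℓ + 2)}

lemma diagOne_mul {R : Type*} [CommRing R] (x y : Rˣ) : diagOne (x * y) = diagOne x * diagOne y := by
  apply Units.ext
  rw [Units.val_mul, coe_diagOne, coe_diagOne, coe_diagOne]
  ext i j
  fin_cases i <;> fin_cases j <;> simp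

namespace IsBianchiModularForm

variable (hF : IsBianchiModularForm τ 𝔫 k ℓ φ F)
include hF

lemma extend_diagOne_mul_unit (x : (Af K)ˣ) {u : (Af K)ˣ}
    (hu : ∀ v : HeightOneSpectrum (𝓞 K), Valued.v ((u : Af K) v) = 1) {A : Fin 2 → Fin 2 → ℂ}
    (hA : A ∈ invertibleMatrices) :
    extend (fun g => F g (diagOne (x * u))) A = extend (fun g => F g (diagOne x)) A := by
  obtain ⟨g, rfl⟩ := exists_eq_of_mem hA
  rw [extend_apply, extend_apply, diagOne_mul]
  have hmem : diagOne u ∈ K0 𝔫 := by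
    intro v
    refine ⟨fun i j => ?_, ?_, ?_⟩
    · fin_cases i <;> fin_cases j
      · exact (hu v).le
      · exact (map_zero (Valued.v (R := v.adicCompletion K))).le.trans zero_le_one
      · exact (map_zero (Valued.v (R := v.adicCompletion K))).le.trans zero_le_one
      · exact (map_one (Valued.v (R := v.adicCompletion K))).le
    · have : ((diagOne u).det : Af K) = u := by
        rw [Matrix.GeneralLinearGroup.val_det_apply, coe_diagOne]
        simp
      rw [this, hu]
    · exact (map_zero (Valued.v (R := v.adicCompletion K))).le.trans zero_le
  have h := hF.right_equivariant 1 (diagOne u) (one_mem _) hmem g (diagOne x)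
  have h1 : (diagOne u : GL (Fin 2) (Af K)) 1 1 = 1 := rfl
  rw [mul_one, h1, atIdeal_one, one_smul, Units.val_one, rho_one] at h
  exact h

/-- The ideles of `a J` and `a` times that of `J` differ by a unit at every place, which does not
change the form; the principal factor `a` moves to the archimedean side by left invariance. -/
lemma extend_ideleOf_mul {a : K} (ha : a ≠ 0) {J : FractionalIdeal (𝓞 K)⁰ K} (hJ : J ≠ 0)
    {A : Fin 2 → Fin 2 → ℂ} (hA : A ∈ invertibleMatrices) :
    extend (fun g => F g (diagOne (ideleOf J))) A =
      extend (fun g => F g (diagOne (ideleOf (FractionalIdeal.spanSingleton (𝓞 K)⁰ a * J))))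
        (Matrix.of.symm (!![τ a, 0; 0, 1] * Matrix.of A)) := by
  set x := ideleOf J
  set y := ideleOf (FractionalIdeal.spanSingleton (𝓞 K)⁰ a * J) with hy
  set α : (Af K)ˣ := Units.map (algebraMap K (Af K) : K →* Af K) (Units.mk0 a ha) with hα
  set u : (Af K)ˣ := (α * x)⁻¹ * y with hu
  have hαv : ∀ v : HeightOneSpectrum (𝓞 K), (α : Af K) v = (a : v.adicCompletion K) := fun v => rfl
  have hu1 : ∀ v : HeightOneSpectrum (𝓞 K), Valued.v ((u : Af K) v) = 1 := by
    intro v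
    have h0 : (Valued.v ((y : Af K) v)) ≠ 0 := by
      rw [hy, valued_ideleOf]
      exact WithZero.exp_ne_zero
    rw [hu, Units.val_mul, af_mul_apply, map_mul, valued_inv_apply, Units.val_mul, af_mul_apply,
      map_mul, hαv, ← valued_eq_one_of_count v ha hJ, ← hy, inv_mul_cancel₀ h0]
  have hyu : y = α * x * u := by rw [hu, mul_inv_cancel_left]
  have hdiag : Matrix.GeneralLinearGroup.map τ (diagOne (Units.mk0 a ha)) =
      diagOne (Units.map (τ : K →* ℂ) (Units.mk0 a ha)) := by
    apply Units.ext
    ext i j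
    fin_cases i <;> fin_cases j <;> simp [coe_diagOne]
  have hdiag' : Matrix.GeneralLinearGroup.map (algebraMap K (Af K)) (diagOne (Units.mk0 a ha)) =
      diagOne α := by
    apply Units.ext
    ext i j
    fin_cases i <;> fin_cases j <;> simp [coe_diagOne, hα]
  have hmat : ((diagOne (Units.map (τ : K →* ℂ) (Units.mk0 a ha)) : GL (Fin 2) ℂ) :
      Matrix (Fin 2) (Fin 2) ℂ) = !![τ a, 0; 0, 1] := rfl
  have hA' : Matrix.of.symm (!![τ a, 0; 0, 1] * Matrix.of A) ∈ invertibleMatrices := by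
    change Matrix.det _ ≠ 0
    rw [Equiv.apply_symm_apply, Matrix.det_mul]
    refine mul_ne_zero ?_ hA
    simpa using ha
  rw [hyu, hF.extend_diagOne_mul_unit _ hu1 hA']
  have h := hF.extend_mul_left (diagOne (Units.mk0 a ha)) (diagOne (α * x)) hA
  rw [hdiag, hdiag', hmat, diagOne_mul, inv_mul_cancel_left] at h
  rw [diagOne_mul]
  exact h.symm

end IsBianchiModularForm

end modularForm

section imaginaryQuadratic

variable {K : Type*} [Field K] [NumberField K] [NumberField.IsTotallyComplex K]
  {τ : K →+* ℂ} {𝔫 : Ideal (𝓞 K)} {k ℓ : ℕ}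
  {φ : ℂˣ × (Af K)ˣ →* ℂˣ} {F : GL (Fin 2) ℂ → GL (Fin 2) (Af K) → V (k + ℓ + 2)}

/-- The defining integral has frequency `1` over `L = a J`. Substituting `z = τ a * w` turns it into
frequency `a` over `J` at the matrix `(τ(a)⁻¹ w; 0 1)`, which `middle_diag` replaces by height `‖τ
a‖⁻¹`. There the Whittaker component equals that of `W(1)`, and `‖τ a‖⁻² N(L) = N(J)`. -/
theorem IsBianchiModularForm.fourierCoeff_eq (hF : IsBianchiModularForm τ 𝔫 k ℓ φ F)
    (hφ : IsHeckeCharacter τ φ (-k) (-ℓ)) (hK : Module.finrank ℚ K = 2) {𝔇 : Ideal (𝓞 K)}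
    (h𝔇 : 𝔇 ≠ ⊥) {J : FractionalIdeal (𝓞 K)⁰ K} (hJ : J ≠ 0) {ι : Type*} [Fintype ι]
    {ω : ι → ℂ} {e : traceDual J ≃ (ι → ℤ)} (he : IsDualPair ω (fun a : traceDual J => τ a) e)
    (hω : ∀ i, ∃ b ∈ J, ω i = τ b)
    (h0 : ∀ t : ℝ, 0 < t → latticeMean ω (fun z =>
      extend (fun g => F g (diagOne (ideleOf J))) (borel z t) ⟨ℓ + 1, by omega⟩) = 0)
    {C : traceDual J → ℂ}
    (hC : IsCoefficientFamily ω (fun a : traceDual J => τ a)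
      (extend fun g => F g (diagOne (ideleOf J))) C)
    (a : traceDual J) (ha : (a : K) ≠ 0) {𝔞 : Ideal (𝓞 K)}
    (h𝔞 : (𝔞 : FractionalIdeal (𝓞 K)⁰ K) = FractionalIdeal.spanSingleton (𝓞 K)⁰ (a : K) * 𝔇 * J) :
    fourierCoeff τ 𝔇 F 𝔞 = C a * (FractionalIdeal.absNorm J : ℚ) := by
  have h𝔇' : (𝔇 : FractionalIdeal (𝓞 K)⁰ K) ≠ 0 := FractionalIdeal.coeIdeal_ne_zero.2 h𝔇
  set L := (𝔞 : FractionalIdeal (𝓞 K)⁰ K) * (𝔇 : FractionalIdeal (𝓞 K)⁰ K)⁻¹ with hLdef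
  have hL : L = FractionalIdeal.spanSingleton (𝓞 K)⁰ (a : K) * J := by
    rw [hLdef, h𝔞, mul_right_comm, mul_assoc _ (𝔇 : FractionalIdeal (𝓞 K)⁰ K), mul_inv_cancel₀ h𝔇',
      mul_one]
  have hL0 : L ≠ 0 := by
    rw [hL]
    exact mul_ne_zero (FractionalIdeal.spanSingleton_ne_zero_iff.2 ha) hJ
  have hα : τ a ≠ 0 := by simpa using ha
  have hp : 0 < ‖τ a‖ := norm_pos_iff.2 hα
  set Φ : (Fin 2 → Fin 2 → ℂ) → V (k + ℓ + 2) := extend fun g => F g (diagOne (ideleOf J)) with hΦdef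
  have hΦ : IsArchimedeanForm k ℓ Φ := hF.isArchimedeanForm hφ _
  have hper : ∀ i, ∀ A ∈ invertibleMatrices, Φ (unipotentMul (ω i) A) = Φ A := by
    intro i A hA
    obtain ⟨b, hb, hb'⟩ := hω i
    rw [hb']
    exact hF.periodic_ideleOf hJ hb hA
  set b := basisOfFractionalIdeal K (Units.mk0 L hL0) with hb
  have hbL : ∀ i, b i / a ∈ J := by
    intro i
    have h1 : b i ∈ L := (mem_span_basisOfFractionalIdeal K).1 (Submodule.subset_span ⟨i, rfl⟩)
    obtain ⟨y, hy, hy'⟩ := FractionalIdeal.mem_singleton_mul.1 (hL.le h1)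
    rwa [hy', mul_div_cancel_left₀ _ ha]
  have hspan : Submodule.span ℝ (Set.range fun i => τ (b i / a)) = ⊤ := by
    have h1 := span_range_eq_top τ (b.map (LinearEquiv.smulOfNeZero K K ((a : K)⁻¹) (inv_ne_zero ha) |>.restrictScalars ℚ))
    rw [← h1]
    congr 2
    funext i
    rw [Module.Basis.map_apply, div_eq_inv_mul]
    rfl
  have hint : ∀ (a' : traceDual J) i, ∃ m : ℤ, τ a' * τ (b i / a) + conj (τ a' * τ (b i / a)) = m := by
    intro a' i
    obtain ⟨m, hm⟩ := (FractionalIdeal.mem_dual hJ).1 a'.2 _ (hbL i)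
    refine ⟨m, ?_⟩
    rw [← map_mul, ← trace_eq τ hK, ← Algebra.traceForm_apply, ← hm]
    simp
  have hti : 0 < ‖τ a‖⁻¹ := inv_pos.2 hp
  have key := hC.latticeMean_eq hΦ hper he hti (h0 _ hti) hspan hint a
  have hn1 : ‖τ a * ((‖τ a‖⁻¹ : ℝ) : ℂ)‖ = 1 := by
    rw [norm_mul, Complex.norm_real, norm_inv, norm_norm, mul_inv_cancel₀ hp.ne']
  have hw : whittaker k ℓ (τ a * ((‖τ a‖⁻¹ : ℝ) : ℂ)) ⟨ℓ + 1, by omega⟩ =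
      (whittaker k ℓ 1).comp (ℓ + 1) := by
    rw [V.comp_eq _ (by omega), whittaker_middle, whittaker_middle, hn1, norm_one]
  have hw0 : (whittaker k ℓ 1).comp (ℓ + 1) ≠ 0 := by
    rw [V.comp_eq _ (by omega : ℓ + 1 < k + ℓ + 2 + 1), whittaker_middle, norm_one, mul_one]
    refine mul_ne_zero ?_ ?_
    · exact_mod_cast (Nat.choose_pos (by omega)).ne'
    · exact_mod_cast (besselK_pos (by positivity) 0).ne'
  rw [hw] at key
  have hmean : latticeMean (fun i => τ (b i)) (fun z =>
        (extend (fun g => F g (diagOne (ideleOf L))) (Matrix.of.symm !![1, z; 0, 1])).comp (ℓ + 1) *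
          Complex.exp (-(2 * Real.pi * Complex.I * (z + conj z)))) =
      latticeMean (fun i => τ (b i / a)) (fun z => addChar (-τ a * z) *
        Φ (borel z ‖τ a‖⁻¹) ⟨ℓ + 1, by omega⟩) := by
    unfold latticeMean
    refine MeasureTheory.integral_congr_ae (Filter.Eventually.of_forall fun x => ?_)
    have e1 : ∑ i, (x i : ℂ) * τ (b i) = τ a * ∑ i, (x i : ℂ) * τ (b i / a) := by
      rw [Finset.mul_sum]
      refine Finset.sum_congr rfl fun i _ => ?_
      rw [map_div₀]
      field_simp
    simp only [e1]
    generalize ∑ i, (x i : ℂ) * τ (b i / a) = w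
    have hm : Matrix.of.symm !![(τ a)⁻¹, w; 0, 1] ∈ invertibleMatrices := by
      change Matrix.det _ ≠ 0
      rw [Equiv.apply_symm_apply, Matrix.det_fin_two_of]
      simpa using ha
    have e2 := hF.extend_ideleOf_mul ha hJ hm
    have e3 : Matrix.of.symm (!![τ a, 0; 0, 1] * Matrix.of (Matrix.of.symm !![(τ a)⁻¹, w; 0, 1])) =
        Matrix.of.symm !![1, τ a * w; 0, 1] := by
      rw [Equiv.apply_symm_apply]
      congr 1
      ext i j
      fin_cases i <;> fin_cases j <;> simp [hα]
    rw [e3] at e2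
    rw [hL, ← e2, V.comp_eq _ (by omega), ← norm_inv, ← hΦ.middle_diag (inv_ne_zero hα), mul_comm,
      addChar]
    congr 2
    simp only [map_mul, map_neg]
    ring
  have hN : ((FractionalIdeal.absNorm L : ℚ) : ℂ) = (‖τ a‖ : ℂ) ^ 2 * (FractionalIdeal.absNorm J : ℚ) := by
    rw [hL, map_mul, FractionalIdeal.absNorm_span_singleton]
    have h1 := norm_eq τ hK (a : K)
    have h2 : |(Algebra.norm ℚ (a : K))| = Algebra.norm ℚ (a : K) := by
      refine abs_of_nonneg ?_
      have : (0 : ℝ) ≤ (Algebra.norm ℚ (a : K) : ℚ) := by rw [h1]; positivity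
      exact_mod_cast this
    rw [h2]
    push_cast
    congr 1
    exact_mod_cast h1
  have hJ0 : ((FractionalIdeal.absNorm J : ℚ) : ℂ) ≠ 0 := by
    exact_mod_cast FractionalIdeal.absNorm_eq_zero_iff.not.2 hJ
  have hdef : fourierCoeff τ 𝔇 F 𝔞 = latticeMean (fun i => τ (b i)) (fun z =>
        (extend (fun g => F g (diagOne (ideleOf L))) (Matrix.of.symm !![1, z; 0, 1])).comp (ℓ + 1) *
          Complex.exp (-(2 * Real.pi * Complex.I * (z + conj z)))) /
      (((FractionalIdeal.absNorm L)⁻¹ : ℚ) * (whittaker k ℓ 1).comp (ℓ + 1)) := dif_pos hL0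
  rw [hdef, hmean, key]
  have hpC : (‖τ a‖ : ℂ) ≠ 0 := by exact_mod_cast hp.ne'
  rw [Rat.cast_inv, hN]
  push_cast
  field_simp

end imaginaryQuadratic

end

section

/-! ### Local components of idele class characters -/

section characters

variable {K : Type*} [Field K] [NumberField K] {ψ : ℂˣ × (Af K)ˣ →* ℂˣ} {𝔤 : Ideal (𝓞 K)}

lemma localIdele_mul (v : HeightOneSpectrum (𝓞 K)) (x y : (v.adicCompletion K)ˣ) :
    localIdele v (x * y) = localIdele v x * localIdele v y := by
  apply Units.ext
  refine FiniteAdeleRing.ext K fun w => ?_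
  rw [Units.val_mul, af_mul_apply]
  by_cases hw : w = v
  · subst hw
    rw [localIdele_apply_self, localIdele_apply_self, localIdele_apply_self, Units.val_mul]
  · rw [localIdele_apply_of_ne hw, localIdele_apply_of_ne hw, localIdele_apply_of_ne hw, one_mul]

lemma atPlace_ne_zero (ψ : ℂˣ × (Af K)ˣ →* ℂˣ) (v : HeightOneSpectrum (𝓞 K))
    {x : v.adicCompletion K} (hx : x ≠ 0) : atPlace ψ v x ≠ 0 := by
  rw [atPlace, dif_neg hx]
  exact Units.ne_zero _

lemma atPlace_mul (ψ : ℂˣ × (Af K)ˣ →* ℂˣ) (v : HeightOneSpectrum (𝓞 K))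
    (x y : v.adicCompletion K) : atPlace ψ v (x * y) = atPlace ψ v x * atPlace ψ v y := by
  by_cases hx : x = 0
  · rw [hx, zero_mul, atPlace, dif_pos rfl, zero_mul]
  by_cases hy : y = 0
  · rw [hy, mul_zero, atPlace, dif_pos rfl, mul_zero]
  have e : Units.mk0 (x * y) (mul_ne_zero hx hy) = Units.mk0 x hx * Units.mk0 y hy := Units.ext rfl
  rw [atPlace, dif_neg (mul_ne_zero hx hy), atPlace, dif_neg hx, atPlace, dif_neg hy, e,
    localIdele_mul, ← Units.val_mul, ← map_mul, Prod.mk_mul_mk, one_mul]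

lemma finite_dvd (h𝔤 : 𝔤 ≠ ⊥) : {v : HeightOneSpectrum (𝓞 K) | v.asIdeal ∣ 𝔤}.Finite :=
  Ideal.finite_factors h𝔤

lemma atIdeal_eq_prod (ψ : ℂˣ × (Af K)ˣ →* ℂˣ) (h𝔤 : 𝔤 ≠ ⊥) (x : Af K) :
    atIdeal ψ 𝔤 x = ∏ v ∈ (finite_dvd h𝔤).toFinset, atPlace ψ v (x v) := by
  rw [atIdeal]
  exact finprod_mem_eq_finite_toFinset_prod _ (finite_dvd h𝔤)

lemma atIdeal_mul (ψ : ℂˣ × (Af K)ˣ →* ℂˣ) (h𝔤 : 𝔤 ≠ ⊥) (x y : Af K) :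
    atIdeal ψ 𝔤 (x * y) = atIdeal ψ 𝔤 x * atIdeal ψ 𝔤 y := by
  rw [atIdeal_eq_prod ψ h𝔤, atIdeal_eq_prod ψ h𝔤, atIdeal_eq_prod ψ h𝔤, ← Finset.prod_mul_distrib]
  exact Finset.prod_congr rfl fun v _ => atPlace_mul ψ v _ _

lemma atIdeal_ne_zero (ψ : ℂˣ × (Af K)ˣ →* ℂˣ) (h𝔤 : 𝔤 ≠ ⊥) {x : Af K}
    (hx : ∀ v : HeightOneSpectrum (𝓞 K), v.asIdeal ∣ 𝔤 → x v ≠ 0) : atIdeal ψ 𝔤 x ≠ 0 := by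
  rw [atIdeal_eq_prod ψ h𝔤, Finset.prod_ne_zero_iff]
  exact fun v hv => atPlace_ne_zero ψ v (hx v ((finite_dvd h𝔤).mem_toFinset.1 hv))

lemma one_le_count (h𝔤 : 𝔤 ≠ ⊥) {v : HeightOneSpectrum (𝓞 K)} (hv : v.asIdeal ∣ 𝔤) :
    1 ≤ FractionalIdeal.count K v (𝔤 : FractionalIdeal (𝓞 K)⁰ K) := by
  have := FractionalIdeal.count_mono K v (FractionalIdeal.coeIdeal_ne_zero.2 h𝔤)
    ((FractionalIdeal.coeIdeal_le_coeIdeal K).2 (Ideal.le_of_dvd hv))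
  rwa [FractionalIdeal.count_self] at this

lemma count_eq_zero (h𝔤 : 𝔤 ≠ ⊥) {v : HeightOneSpectrum (𝓞 K)} (hv : ¬ v.asIdeal ∣ 𝔤) :
    FractionalIdeal.count K v (𝔤 : FractionalIdeal (𝓞 K)⁰ K) = 0 := by
  by_contra h
  have h1 := count_nonneg v 𝔤
  apply hv
  rw [Ideal.dvd_iff_le, ← FractionalIdeal.coeIdeal_le_coeIdeal K,
    le_iff_count_le (FractionalIdeal.coeIdeal_ne_zero.2 h𝔤) (FractionalIdeal.coeIdeal_ne_zero.2 v.ne_bot)]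
  intro w
  by_cases hw : w = v
  · subst hw
    rw [FractionalIdeal.count_self]
    omega
  · rw [FractionalIdeal.count_maximal_coprime K w (Ne.symm hw)]
    exact count_nonneg w 𝔤

lemma exp_neg_count_lt_one (h𝔤 : 𝔤 ≠ ⊥) {v : HeightOneSpectrum (𝓞 K)} (hv : v.asIdeal ∣ 𝔤) :
    WithZero.exp (-FractionalIdeal.count K v (𝔤 : FractionalIdeal (𝓞 K)⁰ K)) < 1 := by
  rw [← WithZero.exp_zero, WithZero.exp_lt_exp, neg_lt_zero]
  have := one_le_count h𝔤 hv
  omega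

/-- Evaluation of finite adeles at a place. -/
def evalPlace (v : HeightOneSpectrum (𝓞 K)) : Af K →* v.adicCompletion K where
  toFun x := x v
  map_one' := rfl
  map_mul' _ _ := rfl

/-- Removing from `u` its components at the primes dividing `𝔤` leaves a unit idele congruent to `1`
modulo `𝔤`. -/
theorem TrivialOn.eq_atIdeal (h : TrivialOn ψ 𝔤) (h𝔤 : 𝔤 ≠ ⊥) (u : (Af K)ˣ)
    (hu : ∀ v : HeightOneSpectrum (𝓞 K), ¬ v.asIdeal ∣ 𝔤 → Valued.v ((u : Af K) v) = 1) :
    ((ψ (1, u) : ℂˣ) : ℂ) = atIdeal ψ 𝔤 u := by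
  set s := (finite_dvd h𝔤).toFinset with hs
  have hmem : ∀ v, v ∈ s ↔ v.asIdeal ∣ 𝔤 := fun v => (finite_dvd h𝔤).mem_toFinset
  let uv : ∀ v : HeightOneSpectrum (𝓞 K), (v.adicCompletion K)ˣ := fun v => Units.map (evalPlace v) u
  set w : (Af K)ˣ := ∏ v ∈ s, localIdele v (uv v) with hw
  have hwv : ∀ v, (w : Af K) v = if v ∈ s then (u : Af K) v else 1 := by
    intro v
    have h1 : (w : Af K) v = ∏ v' ∈ s, ((localIdele v' (uv v') : (Af K)ˣ) : Af K) v := by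
      change evalPlace v (w : Af K) = _
      rw [hw, Units.coe_prod, map_prod]
      rfl
    rw [h1]
    split_ifs with hv
    · rw [Finset.prod_eq_single_of_mem v hv fun v' _ hv' => localIdele_apply_of_ne (Ne.symm hv') _,
        localIdele_apply_self]
      rfl
    · exact Finset.prod_eq_one fun v' hv' => localIdele_apply_of_ne (by rintro rfl; exact hv hv') _
  have hinv : ∀ v, ((w⁻¹ : (Af K)ˣ) : Af K) v * (w : Af K) v = 1 := fun v => by
    rw [← af_mul_apply, Units.inv_mul, af_one_apply]
  have htriv : ψ (1, w⁻¹ * u) = 1 := by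
    refine h _ fun v => ?_
    rw [Units.val_mul, af_mul_apply]
    by_cases hv : v ∈ s
    · have h1 := hinv v
      rw [hwv, if_pos hv] at h1
      rw [h1, sub_self, map_one, map_zero]
      exact ⟨rfl, zero_le⟩
    · have h1 := hinv v
      rw [hwv, if_neg hv, mul_one] at h1
      rw [h1, one_mul, count_eq_zero h𝔤 fun h' => hv ((hmem v).2 h'), neg_zero, WithZero.exp_zero]
      have h2 := hu v fun h' => hv ((hmem v).2 h')
      exact ⟨h2, (Valuation.map_sub _ _ _).trans (max_le h2.le (map_one _).le)⟩
  have h1 : ψ (1, u) = ψ (1, w) := by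
    have : ((1, u) : ℂˣ × (Af K)ˣ) = (1, w) * (1, w⁻¹ * u) := by
      rw [Prod.mk_mul_mk, one_mul, mul_inv_cancel_left]
    rw [this, map_mul, htriv, mul_one]
  have h2 : ψ (1, w) = ∏ v ∈ s, ψ (1, localIdele v (uv v)) := by
    have := map_prod (ψ.comp (MonoidHom.inr ℂˣ (Af K)ˣ)) (fun v => localIdele v (uv v)) s
    exact this
  rw [h1, h2, Units.coe_prod, atIdeal_eq_prod ψ h𝔤]
  refine Finset.prod_congr rfl fun v _ => ?_
  have h0 : (u : Af K) v ≠ 0 := (uv v).ne_zero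
  rw [atPlace, dif_neg h0]
  congr 3
  exact congrArg _ (Units.ext rfl)

/-- The congruence is multiplicative, a condition on `x / y`, so that it also applies to elements
with poles such as representatives of `𝔣⁻¹ / 𝓞 K`. -/
theorem TrivialOn.atIdeal_congr (h : TrivialOn ψ 𝔤) (h𝔤 : 𝔤 ≠ ⊥) {x y : Af K}
    (hy : ∀ v : HeightOneSpectrum (𝓞 K), v.asIdeal ∣ 𝔤 → y v ≠ 0)
    (hxy : ∀ v : HeightOneSpectrum (𝓞 K), v.asIdeal ∣ 𝔤 → Valued.v (x v - y v) ≤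
      WithZero.exp (-FractionalIdeal.count K v (𝔤 : FractionalIdeal (𝓞 K)⁰ K)) * Valued.v (y v)) :
    atIdeal ψ 𝔤 x = atIdeal ψ 𝔤 y := by
  rw [atIdeal_eq_prod ψ h𝔤, atIdeal_eq_prod ψ h𝔤]
  refine Finset.prod_congr rfl fun v hv => ?_
  have hv' := (finite_dvd h𝔤).mem_toFinset.1 hv
  have hy0 := hy v hv'
  have hyv : Valued.v (y v) ≠ 0 := (Valuation.ne_zero_iff _).2 hy0
  have e : x v / y v - 1 = (x v - y v) / y v := by rw [sub_div, div_self hy0]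
  have h1 : Valued.v (x v / y v - 1) ≤
      WithZero.exp (-FractionalIdeal.count K v (𝔤 : FractionalIdeal (𝓞 K)⁰ K)) := by
    rw [e, map_div₀]
    exact div_le_of_le_mul₀ zero_le zero_le (hxy v hv')
  have h2 : Valued.v (x v / y v) = 1 := by
    have := Valuation.map_add_eq_of_lt_right (Valued.v (R := v.adicCompletion K)) (x := x v / y v - 1) (y := 1)
      ((h1.trans_lt (exp_neg_count_lt_one h𝔤 hv')).trans_eq (map_one _).symm)
    rwa [sub_add_cancel, map_one (Valued.v (R := v.adicCompletion K))] at this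
  have h3 := h.atPlace_eq_one h2 h1
  rw [← mul_div_cancel₀ (x v) hy0, atPlace_mul, h3, mul_one]

lemma _root_.Valued.isOpen_setOf_sub_lt {R Γ₀ : Type*} [CommRing R]
    [LinearOrderedCommGroupWithZero Γ₀] [Valued R Γ₀] (c x : R) :
    IsOpen {y : R | Valued.v (y - c) < Valued.v x} := by
  have h : {y : R | Valued.v (y - c) < Valued.v x} =
      (fun y => y - c) ⁻¹' {y | Valued.v.restrict y < Valued.v.restrict x} := by
    ext y
    rw [Set.mem_preimage, Set.mem_ofPred_eq, Set.mem_ofPred_eq, Valuation.restrict_lt_iff]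
  rw [h]
  exact (Valued.isOpen_ball R _).preimage (continuous_id.sub continuous_const)

lemma exists_integer_approx_at (v : HeightOneSpectrum (𝓞 K)) {u : v.adicCompletion K}
    (hu : Valued.v u ≤ 1) {n : ℤ} (hn : 0 ≤ n) :
    ∃ c : 𝓞 K, Valued.v (((c : K) : v.adicCompletion K) - u) ≤ WithZero.exp (-n) := by
  set γ : WithZero (Multiplicative ℤ) := WithZero.exp (-n) with hγ
  have hγ0 : γ ≠ 0 := WithZero.exp_ne_zero
  have hγ1 : γ ≤ 1 := by
    rw [← WithZero.exp_zero, hγ, WithZero.exp_le_exp]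
    omega
  obtain ⟨x, hx⟩ : ∃ x : K, Valued.v ((x : v.adicCompletion K) - u) < γ := by
    have h1 : Valued.v ((uniformizer v : v.adicCompletion K) ^ n) = γ := by
      rw [map_zpow₀, valued_uniformizer, ← WithZero.exp_zsmul, hγ]
      congr 1
      simp
    have hopen := Valued.isOpen_setOf_sub_lt u ((uniformizer v : v.adicCompletion K) ^ n)
    rw [h1] at hopen
    obtain ⟨x, hx⟩ := (denseRange_algebraMap K v).exists_mem_open hopen ⟨u, by
      rw [Set.mem_ofPred_eq, sub_self, map_zero]; exact zero_lt_iff.2 hγ0⟩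
    exact ⟨x, hx⟩
  have hx1 : v.valuation K x ≤ 1 := by
    rw [← valuedAdicCompletion_eq_valuation', ← sub_add_cancel (x : v.adicCompletion K) u]
    exact (Valuation.map_add _ _ _).trans (max_le (hx.le.trans hγ1) hu)
  obtain ⟨c, hc⟩ := v.exists_valuation_sub_lt_of_integer hx1 (Units.mk0 γ hγ0)
  refine ⟨c, ?_⟩
  have e : (algebraMap (𝓞 K) K c : v.adicCompletion K) =
      ((algebraMap (𝓞 K) K c - x : K) : v.adicCompletion K) + (x : v.adicCompletion K) := by
    rw [← adicCompletion.coe_add, sub_add_cancel]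
  rw [e, add_sub_assoc]
  refine (Valuation.map_add _ _ _).trans (max_le ?_ hx.le)
  rw [valuedAdicCompletion_eq_valuation']
  exact hc.le

/-- Density gives an approximation at each place; the Chinese remainder theorem glues those at the
finitely many primes dividing `𝔤`. -/
lemma exists_integer_approx (h𝔤 : 𝔤 ≠ ⊥) (u : Af K)
    (hu : ∀ v : HeightOneSpectrum (𝓞 K), Valued.v (u v) ≤ 1) :
    ∃ c : 𝓞 K, ∀ v : HeightOneSpectrum (𝓞 K), v.asIdeal ∣ 𝔤 →
      Valued.v (((c : K) : v.adicCompletion K) - u v) ≤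
        WithZero.exp (-FractionalIdeal.count K v (𝔤 : FractionalIdeal (𝓞 K)⁰ K)) := by
  choose c hc using fun v : HeightOneSpectrum (𝓞 K) => exists_integer_approx_at v (hu v) (count_nonneg v 𝔤)
  obtain ⟨y, hy⟩ := IsDedekindDomain.exists_forall_sub_mem_ideal (s := (finite_dvd h𝔤).toFinset)
    (fun v : HeightOneSpectrum (𝓞 K) => v.asIdeal)
    (fun v => (FractionalIdeal.count K v (𝔤 : FractionalIdeal (𝓞 K)⁰ K)).toNat)
    (fun v _ => v.prime) (fun v _ w _ hvw h => hvw (HeightOneSpectrum.ext h)) (fun v => c v)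
  refine ⟨y, fun v hv => ?_⟩
  have h2 := hy v ((finite_dvd h𝔤).mem_toFinset.2 hv)
  have h3 := valued_le_of_mem v (K := K)
    (FractionalIdeal.coeIdeal_ne_zero.2 (pow_ne_zero (FractionalIdeal.count K v (𝔤 : FractionalIdeal (𝓞 K)⁰ K)).toNat v.ne_bot))
    (FractionalIdeal.mem_coeIdeal_of_mem (𝓞 K)⁰ h2)
  rw [FractionalIdeal.coeIdeal_pow, FractionalIdeal.count_pow, FractionalIdeal.count_self, mul_one,
    Int.toNat_of_nonneg (count_nonneg v 𝔤)] at h3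
  have e : ((y : K) : v.adicCompletion K) - u v =
      ((algebraMap (𝓞 K) K (y - c v) : K) : v.adicCompletion K) + (((c v : K) : v.adicCompletion K) - u v) := by
    have : (algebraMap (𝓞 K) K y : v.adicCompletion K) =
        ((algebraMap (𝓞 K) K (y - c v) : K) : v.adicCompletion K) + ((c v : K) : v.adicCompletion K) := by
      rw [← adicCompletion.coe_add, map_sub, sub_add_cancel]
    rw [this]
    ring
  rw [e]
  exact (Valuation.map_add _ _ _).trans (max_le h3 (hc v))

end characters

end

section

/-! ### Conductors and values on principal ideals -/

section characters

variable {K : Type*} [Field K] [NumberField K] {ψ : ℂˣ × (Af K)ˣ →* ℂˣ} {𝔣 𝔤 : Ideal (𝓞 K)}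

/-- A finite part `ψ_𝔣`, as a function on `K`. -/
def finitePart (ψ : ℂˣ × (Af K)ˣ →* ℂˣ) (𝔣 : Ideal (𝓞 K)) (x : K) : ℂ :=
  atIdeal ψ 𝔣 (algebraMap K (Af K) x)

lemma finitePart_mul (ψ : ℂˣ × (Af K)ˣ →* ℂˣ) (h𝔣 : 𝔣 ≠ ⊥) (x y : K) :
    finitePart ψ 𝔣 (x * y) = finitePart ψ 𝔣 x * finitePart ψ 𝔣 y := by
  rw [finitePart, map_mul, atIdeal_mul ψ h𝔣]
  rfl

lemma finitePart_ne_zero (ψ : ℂˣ × (Af K)ˣ →* ℂˣ) (h𝔣 : 𝔣 ≠ ⊥) {x : K}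
    (hx : ∀ v : HeightOneSpectrum (𝓞 K), v.asIdeal ∣ 𝔣 → x ≠ 0) : finitePart ψ 𝔣 x ≠ 0 := by
  refine atIdeal_ne_zero ψ h𝔣 fun v hv h => ?_
  have h1 : Valued.v (x : v.adicCompletion K) = 0 := by
    rw [← af_algebraMap_apply, h, map_zero]
  rw [valued_eq_exp_neg_count v (hx v hv)] at h1
  exact WithZero.exp_ne_zero h1

/-- Minimality of the conductor: `ψ` is nontrivial on some unit idele congruent to `1` modulo the
proper divisor `𝔤`, and a global integer close to it modulo `𝔣` has the same `ψ_𝔣`. This is what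
makes imprimitive Gauss sums vanish. -/
lemma IsConductor.exists_finitePart_ne_one (h : IsConductor ψ 𝔣) {v₀ : HeightOneSpectrum (𝓞 K)}
    (h𝔤 : 𝔣 = v₀.asIdeal * 𝔤) :
    ∃ c : 𝓞 K, (∀ v : HeightOneSpectrum (𝓞 K), v.asIdeal ∣ 𝔣 →
      Valued.v ((c : K) : v.adicCompletion K) = 1 ∧
      Valued.v (((c : K) : v.adicCompletion K) - 1) ≤
        WithZero.exp (-FractionalIdeal.count K v (𝔤 : FractionalIdeal (𝓞 K)⁰ K))) ∧
      finitePart ψ 𝔣 c ≠ 1 := by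
  have h𝔤0 : 𝔤 ≠ ⊥ := by
    rintro rfl
    exact h.1 (by rw [h𝔤, Ideal.mul_bot])
  have hnot : ¬ TrivialOn ψ 𝔤 := by
    intro ht
    have h1 := h.2.2 𝔤 h𝔤0 ht
    rw [h𝔤] at h1
    have h2 : v₀.asIdeal * 𝔤 ∣ 1 * 𝔤 := by rwa [one_mul]
    have h3 := (mul_dvd_mul_iff_right h𝔤0).1 h2
    exact v₀.isPrime.ne_top (Ideal.isUnit_iff.1 (isUnit_of_dvd_one h3))
  rw [TrivialOn] at hnot
  push Not at hnot
  obtain ⟨u, hu, hu1⟩ := hnot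
  obtain ⟨c, hc⟩ := exists_integer_approx h.1 (u : Af K) fun v => (hu v).1.le
  have hle : ∀ v : HeightOneSpectrum (𝓞 K),
      WithZero.exp (-FractionalIdeal.count K v (𝔣 : FractionalIdeal (𝓞 K)⁰ K)) ≤
      WithZero.exp (-FractionalIdeal.count K v (𝔤 : FractionalIdeal (𝓞 K)⁰ K)) := by
    intro v
    rw [WithZero.exp_le_exp, neg_le_neg_iff]
    refine FractionalIdeal.count_mono K v (FractionalIdeal.coeIdeal_ne_zero.2 h.1) ?_
    rw [FractionalIdeal.coeIdeal_le_coeIdeal]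
    exact Ideal.le_of_dvd ⟨v₀.asIdeal, by rw [h𝔤, mul_comm]⟩
  refine ⟨c, fun v hv => ⟨?_, ?_⟩, ?_⟩
  · have := Valuation.map_add_eq_of_lt_right (Valued.v (R := v.adicCompletion K))
      (x := ((c : K) : v.adicCompletion K) - (u : Af K) v) (y := (u : Af K) v)
      (((hc v hv).trans_lt (exp_neg_count_lt_one h.1 hv)).trans_eq (hu v).1.symm)
    rwa [sub_add_cancel, (hu v).1] at this
  · rw [← sub_add_sub_cancel _ ((u : Af K) v)]
    exact (Valuation.map_add _ _ _).trans (max_le ((hc v hv).trans (hle v)) (hu v).2)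
  · have h1 : finitePart ψ 𝔣 c = atIdeal ψ 𝔣 u := by
      refine h.2.1.atIdeal_congr h.1 (fun v _ h0 => ?_) fun v hv => ?_
      · have := (hu v).1
        rw [h0, map_zero] at this
        exact zero_ne_one this
      · rw [(hu v).1, mul_one]
        exact hc v hv
    rw [h1, ← h.2.1.eq_atIdeal h.1 u fun v _ => (hu v).1]
    intro h2
    exact hu1 (Units.ext h2)

lemma atInfinity_eq {τ : K →+* ℂ} {q r : ℤ} (hψ : IsHeckeCharacter τ ψ q r) {z : ℂ} (hz : z ≠ 0) :
    atInfinity ψ z = z ^ q * conj z ^ r := by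
  rw [atInfinity, dif_neg hz, hψ.infinity_type, Units.val_mk0]

/-- The idele of `β J` is `u β` times that of `J`, with `u` a unit idele equal to `β⁻¹` at the
primes of `𝔣`. Triviality on principal ideles evaluates the finite idele `β` by the infinity type,
and `u` contributes `ψ_𝔣(β)⁻¹`. -/
theorem IsHeckeCharacter.ideleOf_mul {τ : K →+* ℂ} {q r : ℤ} (hψ : IsHeckeCharacter τ ψ q r)
    (h𝔣 : 𝔣 ≠ ⊥) (ht : TrivialOn ψ 𝔣) {β : K} (hβ : β ≠ 0) {J : FractionalIdeal (𝓞 K)⁰ K}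
    (hJ : J ≠ 0) (hβ1 : ∀ v : HeightOneSpectrum (𝓞 K), v.asIdeal ∣ 𝔣 →
      Valued.v (β : v.adicCompletion K) = 1)
    (hJ1 : ∀ v : HeightOneSpectrum (𝓞 K), v.asIdeal ∣ 𝔣 → FractionalIdeal.count K v J = 0) :
    ((ψ (1, ideleOf (FractionalIdeal.spanSingleton (𝓞 K)⁰ β * J)) : ℂˣ) : ℂ) =
      (finitePart ψ 𝔣 β)⁻¹ * (τ β ^ q * conj (τ β) ^ r)⁻¹ * (ψ (1, ideleOf J) : ℂˣ) := by
  have hτβ : τ β ≠ 0 := by simpa using hβ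
  set b : (Af K)ˣ := FiniteAdeleRing.unitEmbedding (𝓞 K) K (Units.mk0 β hβ) with hb
  set y := ideleOf (FractionalIdeal.spanSingleton (𝓞 K)⁰ β * J) with hy
  set x := ideleOf J with hx
  set u : (Af K)ˣ := (b * x)⁻¹ * y with hu
  have hbv : ∀ v : HeightOneSpectrum (𝓞 K), (b : Af K) v = (β : v.adicCompletion K) := fun v => rfl
  have hbx : ∀ v : HeightOneSpectrum (𝓞 K), ((b * x : (Af K)ˣ) : Af K) v =
      (β : v.adicCompletion K) * (x : Af K) v := fun v => rfl
  have hu1 : ∀ v : HeightOneSpectrum (𝓞 K), Valued.v ((u : Af K) v) = 1 := by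
    intro v
    have h0 : (Valued.v ((y : Af K) v)) ≠ 0 := by
      rw [hy, valued_ideleOf]
      exact WithZero.exp_ne_zero
    rw [hu, Units.val_mul, af_mul_apply, map_mul, valued_inv_apply, hbx,
      map_mul, ← valued_eq_one_of_count v hβ hJ, ← hy, inv_mul_cancel₀ h0]
  have hcount : ∀ (L : FractionalIdeal (𝓞 K)⁰ K) (v : HeightOneSpectrum (𝓞 K)),
      FractionalIdeal.count K v L = 0 → ((ideleOf L : (Af K)ˣ) : Af K) v = 1 := by
    intro L v h
    change ((uniformizer v ^ FractionalIdeal.count K v L : (v.adicCompletion K)ˣ) :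
      v.adicCompletion K) = 1
    rw [h, zpow_zero, Units.val_one]
  have huβ : atIdeal ψ 𝔣 u * finitePart ψ 𝔣 β = 1 := by
    rw [finitePart, ← atIdeal_mul ψ h𝔣]
    refine finprod_mem_eq_one_of_forall_eq_one fun v hv => ?_
    have h1 : ((u : Af K) * algebraMap K (Af K) β) v = 1 := by
      have h2 : (((b * x)⁻¹ : (Af K)ˣ) : Af K) v * (β : v.adicCompletion K) = 1 := by
        have h3 : (((b * x)⁻¹ : (Af K)ˣ) : Af K) v * ((b * x : (Af K)ˣ) : Af K) v = 1 := by
          rw [← af_mul_apply, Units.inv_mul, af_one_apply]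
        rwa [hbx, hcount J v (hJ1 v hv), mul_one] at h3
      have h4 : FractionalIdeal.count K v (FractionalIdeal.spanSingleton (𝓞 K)⁰ β * J) = 0 := by
        have h5 := hβ1 v hv
        rw [valued_eq_exp_neg_count v hβ, ← WithZero.exp_zero, WithZero.exp_inj] at h5
        rw [FractionalIdeal.count_mul K v (FractionalIdeal.spanSingleton_ne_zero_iff.2 hβ) hJ, hJ1 v hv]
        omega
      rw [af_mul_apply, af_algebraMap_apply, hu, Units.val_mul, af_mul_apply, hy, hcount _ v h4, mul_one]
      exact h2
    rw [h1, atPlace_one]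
  have hψb : ((ψ (1, b) : ℂˣ) : ℂ) = (τ β ^ q * conj (τ β) ^ r)⁻¹ := by
    have h1 := hψ.trivial_on_principal (Units.mk0 β hβ)
    have e : ((Units.map (τ : K →* ℂ) (Units.mk0 β hβ), b) : ℂˣ × (Af K)ˣ) =
        (Units.map (τ : K →* ℂ) (Units.mk0 β hβ), 1) * (1, b) := by
      rw [Prod.mk_mul_mk, one_mul, mul_one]
    rw [← hb, e, map_mul] at h1
    have h2 := congrArg (Units.val : ℂˣ → ℂ) h1
    rw [Units.val_mul, hψ.infinity_type, Units.val_one] at h2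
    rw [eq_comm, inv_eq_of_mul_eq_one_right]
    exact h2
  have e : ((1, y) : ℂˣ × (Af K)ˣ) = (1, u) * (1, b) * (1, x) := by
    rw [Prod.mk_mul_mk, Prod.mk_mul_mk, one_mul, one_mul, hu]
    congr 1
    rw [mul_assoc, mul_comm ((b * x)⁻¹ * y), mul_inv_cancel_left]
  rw [e, map_mul, map_mul, Units.val_mul, Units.val_mul, hψb,
    ht.eq_atIdeal h𝔣 u fun v _ => hu1 v, eq_inv_of_mul_eq_one_left huβ]

end characters

end

section

/-! ### Gauss sums -/

section primitive

variable {K : Type*} [Field K] [NumberField K] {𝔣 : Ideal (𝓞 K)}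

lemma mem_iff_valuation_le {J : FractionalIdeal (𝓞 K)⁰ K} (hJ : J ≠ 0) {x : K} :
    x ∈ J ↔ ∀ v : HeightOneSpectrum (𝓞 K),
      v.valuation K x ≤ WithZero.exp (-FractionalIdeal.count K v J) := by
  refine ⟨fun h v => ?_, fun h => mem_of_valued_le hJ fun v => ?_⟩
  · rw [← valuedAdicCompletion_eq_valuation']
    exact valued_le_of_mem v hJ h
  · rw [valuedAdicCompletion_eq_valuation']
    exact h v

lemma one_ideal_ne_zero : (1 : FractionalIdeal (𝓞 K)⁰ K) ≠ 0 := one_ne_zero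

lemma mem_one_iff {x : K} : x ∈ (1 : FractionalIdeal (𝓞 K)⁰ K) ↔
    ∀ v : HeightOneSpectrum (𝓞 K), v.valuation K x ≤ 1 := by
  rw [mem_iff_valuation_le one_ideal_ne_zero]
  simp [FractionalIdeal.count_one]

lemma mem_intSubgroup {x : K} : x ∈ intSubgroup K ↔ x ∈ (1 : FractionalIdeal (𝓞 K)⁰ K) := by
  rw [FractionalIdeal.mem_one_iff]
  rfl

lemma mk_eq_mk {x y : K} : (QuotientAddGroup.mk x : K ⧸ intSubgroup K) = QuotientAddGroup.mk y ↔
    ∀ v : HeightOneSpectrum (𝓞 K), v.valuation K (x - y) ≤ 1 := by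
  rw [← mem_one_iff, ← mem_intSubgroup, eq_comm, QuotientAddGroup.eq, neg_add_eq_sub]

lemma valuation_mul_le (v : HeightOneSpectrum (𝓞 K)) {x y : K} {m n p : ℤ}
    (hx : v.valuation K x ≤ WithZero.exp m) (hy : v.valuation K y ≤ WithZero.exp n)
    (h : m + n ≤ p) : v.valuation K (x * y) ≤ WithZero.exp p := by
  rw [map_mul]
  refine (mul_le_mul' hx hy).trans ?_
  rw [← WithZero.exp_add, WithZero.exp_le_exp]
  exact h

lemma valuation_eq_exp (v : HeightOneSpectrum (𝓞 K)) {x : K} (hx : x ≠ 0) :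
    v.valuation K x =
      WithZero.exp (-FractionalIdeal.count K v (FractionalIdeal.spanSingleton (𝓞 K)⁰ x)) := by
  rw [← valuedAdicCompletion_eq_valuation', valued_eq_exp_neg_count v hx]

/-- `b` generates `𝔣⁻¹ / 𝓞 K`. -/
def IsPrimitive (𝔣 : Ideal (𝓞 K)) (b : K) : Prop := ∀ v : HeightOneSpectrum (𝓞 K),
  v.valuation K b ≤ WithZero.exp (FractionalIdeal.count K v (𝔣 : FractionalIdeal (𝓞 K)⁰ K)) ∧
  (v.asIdeal ∣ 𝔣 → v.valuation K b =
    WithZero.exp (FractionalIdeal.count K v (𝔣 : FractionalIdeal (𝓞 K)⁰ K)))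

/-- Being the unit ideal means being integral and contained in no prime; in this local form all
later manipulations of classes are comparisons of valuations. -/
lemma isPrimitive_iff (h𝔣 : 𝔣 ≠ ⊥) (b : K) :
    FractionalIdeal.spanSingleton (𝓞 K)⁰ b * (𝔣 : FractionalIdeal (𝓞 K)⁰ K) +
      (𝔣 : FractionalIdeal (𝓞 K)⁰ K) = 1 ↔ IsPrimitive 𝔣 b := by
  have h𝔣' : (𝔣 : FractionalIdeal (𝓞 K)⁰ K) ≠ 0 := FractionalIdeal.coeIdeal_ne_zero.2 h𝔣
  have hcount : ∀ {b : K}, b ≠ 0 → ∀ v : HeightOneSpectrum (𝓞 K), FractionalIdeal.count K v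
      (FractionalIdeal.spanSingleton (𝓞 K)⁰ b * (𝔣 : FractionalIdeal (𝓞 K)⁰ K)) =
      FractionalIdeal.count K v (FractionalIdeal.spanSingleton (𝓞 K)⁰ b) +
        FractionalIdeal.count K v (𝔣 : FractionalIdeal (𝓞 K)⁰ K) := fun hb v =>
    FractionalIdeal.count_mul K v (FractionalIdeal.spanSingleton_ne_zero_iff.2 hb) h𝔣'
  have hprod : ∀ {b : K}, b ≠ 0 →
      FractionalIdeal.spanSingleton (𝓞 K)⁰ b * (𝔣 : FractionalIdeal (𝓞 K)⁰ K) ≠ 0 := fun hb =>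
    mul_ne_zero (FractionalIdeal.spanSingleton_ne_zero_iff.2 hb) h𝔣'
  rw [← FractionalIdeal.sup_eq_add]
  constructor
  · intro h
    have h1 : b ≠ 0 → ∀ v : HeightOneSpectrum (𝓞 K), 0 ≤
        FractionalIdeal.count K v (FractionalIdeal.spanSingleton (𝓞 K)⁰ b) +
        FractionalIdeal.count K v (𝔣 : FractionalIdeal (𝓞 K)⁰ K) := by
      intro hb v
      rw [← hcount hb, ← FractionalIdeal.count_one K v]
      exact (le_iff_count_le (hprod hb) one_ideal_ne_zero).1 (le_sup_left.trans h.le) v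
    have hle : ∀ v : HeightOneSpectrum (𝓞 K), v.valuation K b ≤
        WithZero.exp (FractionalIdeal.count K v (𝔣 : FractionalIdeal (𝓞 K)⁰ K)) := by
      intro v
      by_cases hb : b = 0
      · rw [hb, map_zero]
        exact zero_le
      · rw [valuation_eq_exp v hb, WithZero.exp_le_exp]
        have := h1 hb v
        omega
    refine fun v => ⟨hle v, fun hv => le_antisymm (hle v) (le_of_not_gt fun hlt => ?_)⟩
    have h2 : FractionalIdeal.spanSingleton (𝓞 K)⁰ b * (𝔣 : FractionalIdeal (𝓞 K)⁰ K) ≤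
        (v.asIdeal : FractionalIdeal (𝓞 K)⁰ K) := by
      by_cases hb : b = 0
      · rw [hb, FractionalIdeal.spanSingleton_zero, zero_mul]
        exact FractionalIdeal.zero_le _
      · refine (le_iff_count_le (hprod hb) (FractionalIdeal.coeIdeal_ne_zero.2 v.ne_bot)).2 fun w => ?_
        rw [hcount hb]
        by_cases hw : w = v
        · subst hw
          rw [FractionalIdeal.count_self]
          rw [valuation_eq_exp _ hb, WithZero.exp_lt_exp] at hlt
          omega
        · rw [FractionalIdeal.count_maximal_coprime K w (Ne.symm hw)]
          exact h1 hb w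
    have h3 : (1 : FractionalIdeal (𝓞 K)⁰ K) ≤ (v.asIdeal : FractionalIdeal (𝓞 K)⁰ K) := by
      rw [← h]
      exact sup_le h2 ((FractionalIdeal.coeIdeal_le_coeIdeal K).2 (Ideal.le_of_dvd hv))
    rw [← FractionalIdeal.coeIdeal_top, FractionalIdeal.coeIdeal_le_coeIdeal, top_le_iff] at h3
    exact v.isPrime.ne_top h3
  · intro h
    refine le_antisymm (sup_le ?_ FractionalIdeal.coeIdeal_le_one) ?_
    · by_cases hb : b = 0
      · rw [hb, FractionalIdeal.spanSingleton_zero, zero_mul]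
        exact FractionalIdeal.zero_le _
      · refine (le_iff_count_le (hprod hb) one_ideal_ne_zero).2 fun v => ?_
        have := (h v).1
        rw [valuation_eq_exp _ hb, WithZero.exp_le_exp] at this
        rw [hcount hb, FractionalIdeal.count_one]
        omega
    · have hJ : FractionalIdeal.spanSingleton (𝓞 K)⁰ b * (𝔣 : FractionalIdeal (𝓞 K)⁰ K) ⊔
          (𝔣 : FractionalIdeal (𝓞 K)⁰ K) ≠ 0 := fun h0 => h𝔣' (le_antisymm
            (le_sup_right.trans h0.le) (FractionalIdeal.zero_le _))
      refine (le_iff_count_le one_ideal_ne_zero hJ).2 fun v => ?_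
      rw [FractionalIdeal.count_one]
      by_cases hv : v.asIdeal ∣ 𝔣
      · have h1 := (h v).2 hv
        have hb : b ≠ 0 := by
          rintro rfl
          rw [map_zero] at h1
          exact WithZero.exp_ne_zero h1.symm
        rw [valuation_eq_exp _ hb, WithZero.exp_inj] at h1
        refine (FractionalIdeal.count_mono K v (hprod hb) le_sup_left).trans ?_
        rw [hcount hb]
        omega
      · refine (FractionalIdeal.count_mono K v h𝔣' le_sup_right).trans ?_
        rw [count_eq_zero h𝔣 hv]

lemma exists_isPrimitive (h𝔣 : 𝔣 ≠ ⊥) : ∃ b : K, IsPrimitive 𝔣 b := by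
  have h𝔣' : (𝔣 : FractionalIdeal (𝓞 K)⁰ K) ≠ 0 := FractionalIdeal.coeIdeal_ne_zero.2 h𝔣
  obtain ⟨b, hb⟩ := IsDedekindDomain.exists_add_spanSingleton_mul_eq
    (FractionalIdeal.coeIdeal_le_one (I := 𝔣) (S := (𝓞 K)⁰) (P := K)) h𝔣' h𝔣'
  exact ⟨b, (isPrimitive_iff h𝔣 b).1 (by rw [add_comm, hb])⟩

lemma IsPrimitive.congr (h𝔣 : 𝔣 ≠ ⊥) {b b' : K} (h : IsPrimitive 𝔣 b)
    (hb : ∀ v : HeightOneSpectrum (𝓞 K), v.valuation K (b' - b) ≤ 1) : IsPrimitive 𝔣 b' := by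
  intro v
  have h1 : (1 : WithZero (Multiplicative ℤ)) ≤
      WithZero.exp (FractionalIdeal.count K v (𝔣 : FractionalIdeal (𝓞 K)⁰ K)) := by
    rw [← WithZero.exp_zero, WithZero.exp_le_exp]
    exact count_nonneg v 𝔣
  constructor
  · rw [← sub_add_cancel b' b]
    exact (Valuation.map_add _ _ _).trans (max_le ((hb v).trans h1) (h v).1)
  · intro hv
    have h2 : (1 : WithZero (Multiplicative ℤ)) <
        WithZero.exp (FractionalIdeal.count K v (𝔣 : FractionalIdeal (𝓞 K)⁰ K)) := by
      rw [← WithZero.exp_zero, WithZero.exp_lt_exp]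
      have := one_le_count h𝔣 hv
      omega
    have h3 := Valuation.map_add_eq_of_lt_right (v.valuation K) (x := b' - b) (y := b)
      ((hb v).trans_lt (h2.trans_eq ((h v).2 hv).symm))
    rw [sub_add_cancel] at h3
    rw [h3, (h v).2 hv]

lemma mk_mem_primClasses (h𝔣 : 𝔣 ≠ ⊥) {b : K} :
    (QuotientAddGroup.mk b : K ⧸ intSubgroup K) ∈ primClasses 𝔣 ↔ IsPrimitive 𝔣 b := by
  constructor
  · rintro ⟨a, hab, ha⟩
    exact ((isPrimitive_iff h𝔣 a).1 ha).congr h𝔣 (mk_eq_mk.1 hab.symm)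
  · exact fun h => ⟨b, rfl, (isPrimitive_iff h𝔣 b).2 h⟩

/-- For a nonzero `f` in `𝔣` every class is that of `y / f` with `y` integral, and it depends only
on `y` modulo `f`. -/
lemma finite_primClasses (h𝔣 : 𝔣 ≠ ⊥) : (primClasses 𝔣 : Set (K ⧸ intSubgroup K)).Finite := by
  obtain ⟨f, hf, hf0⟩ := Submodule.exists_mem_ne_zero_of_ne_bot h𝔣
  have hfK : (f : K) ≠ 0 := by simpa using hf0
  have hfin : Finite (𝓞 K ⧸ Ideal.span {f}) :=
    (Ideal.span {f}).finiteQuotientOfFreeOfNeBot (by simpa using hf0)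
  let g : 𝓞 K →+ K ⧸ intSubgroup K := (QuotientAddGroup.mk' (intSubgroup K)).comp
    ((AddMonoidHom.mulRight (f : K)⁻¹).comp (algebraMap (𝓞 K) K).toAddMonoidHom)
  have hg : ∀ y y' : 𝓞 K, y - y' ∈ Ideal.span {f} → g y = g y' := by
    intro y y' h
    obtain ⟨c, hc⟩ := Ideal.mem_span_singleton'.1 h
    rw [← sub_eq_zero, ← map_sub, ← hc]
    refine (QuotientAddGroup.eq_zero_iff _).2 ⟨c, ?_⟩
    change (c : K) = algebraMap (𝓞 K) K (c * f) * (f : K)⁻¹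
    rw [map_mul, mul_inv_cancel_right₀ hfK]
  refine (Set.finite_range fun y : 𝓞 K ⧸ Ideal.span {f} => g (Quotient.out y)).subset fun x hx => ?_
  obtain ⟨b, rfl⟩ := QuotientAddGroup.mk_surjective x
  have hb := (mk_mem_primClasses h𝔣).1 hx
  have h1 : b * f ∈ (1 : FractionalIdeal (𝓞 K)⁰ K) := by
    refine mem_one_iff.2 fun v => ?_
    rw [← WithZero.exp_zero]
    refine valuation_mul_le v (hb v).1 ((mem_iff_valuation_le
      (FractionalIdeal.coeIdeal_ne_zero.2 h𝔣)).1 (FractionalIdeal.mem_coeIdeal_of_mem _ hf) v) ?_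
    omega
  obtain ⟨y, hy⟩ := (FractionalIdeal.mem_one_iff _).1 h1
  refine ⟨Ideal.Quotient.mk _ y, ?_⟩
  have h2 : g (Quotient.out (Ideal.Quotient.mk (Ideal.span {f}) y)) = g y :=
    hg _ _ (Ideal.Quotient.eq.1 (Ideal.Quotient.mk_out _))
  refine h2.trans ?_
  change QuotientAddGroup.mk (algebraMap (𝓞 K) K y * (f : K)⁻¹) = _
  rw [hy, mul_inv_cancel_right₀ hfK]

variable {ψ : ℂˣ × (Af K)ˣ →* ℂˣ}

lemma IsPrimitive.finitePart_congr (h𝔣 : 𝔣 ≠ ⊥) (hψ : TrivialOn ψ 𝔣) {b b' : K}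
    (h : IsPrimitive 𝔣 b) (hb : ∀ v : HeightOneSpectrum (𝓞 K), v.valuation K (b' - b) ≤ 1) :
    finitePart ψ 𝔣 b' = finitePart ψ 𝔣 b := by
  have h1 : ∀ v : HeightOneSpectrum (𝓞 K), v.asIdeal ∣ 𝔣 →
      Valued.v (b : v.adicCompletion K) =
        WithZero.exp (FractionalIdeal.count K v (𝔣 : FractionalIdeal (𝓞 K)⁰ K)) := fun v hv => by
    rw [valuedAdicCompletion_eq_valuation', (h v).2 hv]
  refine hψ.atIdeal_congr h𝔣 (fun v hv h0 => ?_) fun v hv => ?_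
  · have h2 := h1 v hv
    rw [← af_algebraMap_apply, h0, map_zero] at h2
    exact WithZero.exp_ne_zero h2.symm
  · rw [← af_sub_apply, ← map_sub, af_algebraMap_apply, af_algebraMap_apply, h1 v hv,
      ← WithZero.exp_add, neg_add_cancel, WithZero.exp_zero, valuedAdicCompletion_eq_valuation']
    exact hb v

lemma IsPrimitive.finitePart_ne_zero (h𝔣 : 𝔣 ≠ ⊥) {b : K} (h : IsPrimitive 𝔣 b) :
    finitePart ψ 𝔣 b ≠ 0 := by
  refine Bianchi.finitePart_ne_zero ψ h𝔣 fun v hv h0 => ?_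
  have h1 := (h v).2 hv
  rw [h0, map_zero] at h1
  exact WithZero.exp_ne_zero h1.symm

lemma IsPrimitive.mul (h𝔣 : 𝔣 ≠ ⊥) {b γ : K} (h : IsPrimitive 𝔣 b)
    (hγ : ∀ v : HeightOneSpectrum (𝓞 K), v.asIdeal ∣ 𝔣 → v.valuation K γ = 1)
    (hb : ∀ v : HeightOneSpectrum (𝓞 K), ¬ v.asIdeal ∣ 𝔣 → v.valuation K (γ * b) ≤ 1) :
    IsPrimitive 𝔣 (γ * b) := by
  intro v
  by_cases hv : v.asIdeal ∣ 𝔣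
  · rw [map_mul, hγ v hv, one_mul]
    exact h v
  · refine ⟨?_, fun h => absurd h hv⟩
    rw [count_eq_zero h𝔣 hv, WithZero.exp_zero]
    exact hb v hv

end primitive

section gaussSum

variable {K : Type*} [Field K] [NumberField K] [NumberField.IsTotallyComplex K]

/-- The additive character `y ↦ exp (2 π i Tr (y / δ))` of `K`. -/
def traceChar (δ : 𝓞 K) (y : K) : ℂ :=
  Complex.exp (2 * Real.pi * Complex.I * (Algebra.trace ℚ K (y / (δ : K)) : ℚ))

variable {δ : 𝓞 K} {𝔣 : Ideal (𝓞 K)} {ψ : ℂˣ × (Af K)ˣ →* ℂˣ}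

lemma traceChar_add (x y : K) : traceChar δ (x + y) = traceChar δ x * traceChar δ y := by
  rw [traceChar, traceChar, traceChar, ← Complex.exp_add, add_div, map_add]
  push_cast
  congr 1
  ring

lemma traceChar_eq_addChar (τ : K →+* ℂ) (hK : Module.finrank ℚ K = 2) (y : K) :
    traceChar δ y = addChar (τ (y / (δ : K))) := by
  rw [traceChar, addChar, trace_eq τ hK]

/-- `δ` generates the different, so division by `δ` identifies `𝓞 K` with its trace dual. Hence
`traceChar δ` detects integrality. -/
lemma mem_one_iff_dual (hK : Module.finrank ℚ K = 2) (hδ : δ ^ 2 = (NumberField.discr K : 𝓞 K))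
    (y : K) : y ∈ (1 : FractionalIdeal (𝓞 K)⁰ K) ↔
      y / (δ : K) ∈ FractionalIdeal.dual ℤ ℚ (1 : FractionalIdeal (𝓞 K)⁰ K) := by
  have hδK : (δ : K) ≠ 0 := by simpa using delta_ne_zero hδ
  rw [dual_eq hK hδ, inv_one, mul_one, FractionalIdeal.spanSingleton_inv,
    FractionalIdeal.mem_spanSingleton, FractionalIdeal.mem_one_iff]
  constructor
  · rintro ⟨z, rfl⟩
    exact ⟨z, by rw [Algebra.smul_def, div_eq_mul_inv]⟩
  · rintro ⟨z, hz⟩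
    refine ⟨z, ?_⟩
    rw [Algebra.smul_def, div_eq_mul_inv] at hz
    exact mul_right_cancel₀ (inv_ne_zero hδK) hz

lemma traceChar_eq_one (hK : Module.finrank ℚ K = 2) (hδ : δ ^ 2 = (NumberField.discr K : 𝓞 K))
    {y : K} (hy : ∀ v : HeightOneSpectrum (𝓞 K), v.valuation K y ≤ 1) : traceChar δ y = 1 := by
  have h1 := (mem_one_iff_dual hK hδ y).1 (mem_one_iff.2 hy)
  obtain ⟨m, hm⟩ := (FractionalIdeal.mem_dual one_ideal_ne_zero).1 h1 1 (FractionalIdeal.one_mem_one _)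
  rw [Algebra.traceForm_apply, mul_one] at hm
  rw [traceChar, ← hm, mul_comm]
  simp

lemma traceChar_congr (hK : Module.finrank ℚ K = 2) (hδ : δ ^ 2 = (NumberField.discr K : 𝓞 K))
    {x y : K} (hy : ∀ v : HeightOneSpectrum (𝓞 K), v.valuation K (x - y) ≤ 1) :
    traceChar δ x = traceChar δ y := by
  rw [← sub_add_cancel x y, traceChar_add, traceChar_eq_one hK hδ hy, one_mul]

lemma mem_one_of_traceChar (hK : Module.finrank ℚ K = 2)
    (hδ : δ ^ 2 = (NumberField.discr K : 𝓞 K)) {y : K}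
    (hy : ∀ β : 𝓞 K, traceChar δ (β * y) = 1) : y ∈ (1 : FractionalIdeal (𝓞 K)⁰ K) := by
  refine (mem_one_iff_dual hK hδ y).2 ((FractionalIdeal.mem_dual one_ideal_ne_zero).2 fun x hx => ?_)
  obtain ⟨β, rfl⟩ := (FractionalIdeal.mem_one_iff _).1 hx
  obtain ⟨m, hm⟩ := Complex.exp_eq_one_iff.1 (hy β)
  refine ⟨m, ?_⟩
  have h1 : ((Algebra.trace ℚ K (β * y / (δ : K)) : ℚ) : ℂ) = m := by
    have h2 : (2 * (Real.pi : ℂ) * Complex.I) ≠ 0 := Complex.two_pi_I_ne_zero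
    refine mul_left_cancel₀ h2 ?_
    rw [hm]
    ring
  have h3 : Algebra.trace ℚ K (β * y / (δ : K)) = m := by exact_mod_cast h1
  rw [Algebra.traceForm_apply, div_mul_eq_mul_div, mul_comm y, h3]
  rfl

variable {s : Finset (K ⧸ intSubgroup K)} {J : FractionalIdeal (𝓞 K)⁰ K}
  {a : (K ⧸ intSubgroup K) → K}

/-- Multiplication by an element that is a unit at `𝔣` permutes the primitive classes: it is
injective on a finite set. Both cases of the Gauss sum evaluation are instances of this reindexing.
-/
lemma sum_mk_mul (h𝔣 : 𝔣 ≠ ⊥) (hs : ∀ x, x ∈ s ↔ x ∈ primClasses 𝔣)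
    (ha : ∀ x ∈ s, QuotientAddGroup.mk (a x) = x) {γ : K}
    (hγ : ∀ v : HeightOneSpectrum (𝓞 K), v.asIdeal ∣ 𝔣 → v.valuation K γ = 1)
    (hγa : ∀ x ∈ s, ∀ v : HeightOneSpectrum (𝓞 K), ¬ v.asIdeal ∣ 𝔣 → v.valuation K (γ * a x) ≤ 1)
    (G : K ⧸ intSubgroup K → ℂ) :
    ∑ x ∈ s, G (QuotientAddGroup.mk (γ * a x)) = ∑ x ∈ s, G x := by
  have hprim : ∀ x ∈ s, IsPrimitive 𝔣 (a x) := fun x hx =>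
    (mk_mem_primClasses h𝔣).1 (by rw [ha x hx]; exact (hs x).1 hx)
  have hmaps : ∀ x ∈ s, (QuotientAddGroup.mk (γ * a x) : K ⧸ intSubgroup K) ∈ s := fun x hx =>
    (hs _).2 ((mk_mem_primClasses h𝔣).2 ((hprim x hx).mul h𝔣 hγ (hγa x hx)))
  have hinj : Set.InjOn (fun x => (QuotientAddGroup.mk (γ * a x) : K ⧸ intSubgroup K)) s := by
    intro x hx y hy hxy
    rw [← ha x hx, ← ha y hy]
    refine mk_eq_mk.2 fun v => ?_
    by_cases hv : v.asIdeal ∣ 𝔣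
    · have h1 := mk_eq_mk.1 hxy v
      rwa [← mul_sub, map_mul, hγ v hv, one_mul] at h1
    · have h1 := (hprim x hx v).1
      have h2 := (hprim y hy v).1
      rw [count_eq_zero h𝔣 hv, WithZero.exp_zero] at h1 h2
      exact (Valuation.map_sub _ _ _).trans (max_le h1 h2)
  exact Finset.sum_nbij _ hmaps hinj
    (Finset.surjOn_of_injOn_of_card_le _ hmaps hinj le_rfl) fun _ _ => rfl

/-- The sum `∑ ψ_𝔣 (b) exp (2 π i Tr (b / δ))` over the classes in `s`. -/
def finiteGaussSum (δ : 𝓞 K) (ψ : ℂˣ × (Af K)ˣ →* ℂˣ) (𝔣 : Ideal (𝓞 K))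
    (s : Finset (K ⧸ intSubgroup K)) : ℂ :=
  ∑ x ∈ s, finitePart ψ 𝔣 (Quotient.out x) * traceChar δ (Quotient.out x)

/-- If `β` is a unit at `𝔣`, reindex by `b ↦ β b`. Otherwise some prime `v₀` of `𝔣` divides `β`;
reindexing by an integer `c` congruent to `1` modulo `𝔣 / v₀` does not change the additive
characters but multiplies the sum by `ψ_𝔣(c) ≠ 1`, so the sum is zero. Representatives in `𝔣⁻¹ J`
compensate for `β` being only in `J⁻¹`. -/
theorem sum_finitePart_mul_traceChar (hK : Module.finrank ℚ K = 2)
    (hδ : δ ^ 2 = (NumberField.discr K : 𝓞 K)) (h𝔣 : IsConductor ψ 𝔣)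
    (hs : ∀ x, x ∈ s ↔ x ∈ primClasses 𝔣) (hJ0 : J ≠ 0)
    (hJ : ∀ v : HeightOneSpectrum (𝓞 K), v.asIdeal ∣ 𝔣 → FractionalIdeal.count K v J = 0)
    (ha : ∀ x ∈ s, QuotientAddGroup.mk (a x) = x)
    (haJ : ∀ x ∈ s, a x ∈ (𝔣 : FractionalIdeal (𝓞 K)⁰ K)⁻¹ * J) {β : K} (hβ : β ∈ J⁻¹) :
    ∑ x ∈ s, finitePart ψ 𝔣 (a x) * traceChar δ (β * a x) =
      if ∀ v : HeightOneSpectrum (𝓞 K), v.asIdeal ∣ 𝔣 → v.valuation K β = 1 then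
        (finitePart ψ 𝔣 β)⁻¹ * finiteGaussSum δ ψ 𝔣 s else 0 := by
  have h𝔣' : (𝔣 : FractionalIdeal (𝓞 K)⁰ K) ≠ 0 := FractionalIdeal.coeIdeal_ne_zero.2 h𝔣.1
  have hprim : ∀ x ∈ s, IsPrimitive 𝔣 (a x) := fun x hx =>
    (mk_mem_primClasses h𝔣.1).1 (by rw [ha x hx]; exact (hs x).1 hx)
  have hav : ∀ x ∈ s, ∀ v : HeightOneSpectrum (𝓞 K), v.valuation K (a x) ≤ WithZero.exp
      (FractionalIdeal.count K v (𝔣 : FractionalIdeal (𝓞 K)⁰ K) - FractionalIdeal.count K v J) := by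
    intro x hx v
    have h1 := (mem_iff_valuation_le (mul_ne_zero (inv_ne_zero h𝔣') hJ0)).1 (haJ x hx) v
    rwa [FractionalIdeal.count_mul K v (inv_ne_zero h𝔣') hJ0, FractionalIdeal.count_inv, neg_add,
      neg_neg, ← sub_eq_add_neg] at h1
  have hβv : ∀ v : HeightOneSpectrum (𝓞 K), v.valuation K β ≤
      WithZero.exp (FractionalIdeal.count K v J) := by
    intro v
    have h1 := (mem_iff_valuation_le (inv_ne_zero hJ0)).1 hβ v
    rwa [FractionalIdeal.count_inv, neg_neg] at h1
  split_ifs with hβ1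
  · have key := sum_mk_mul h𝔣.1 hs ha hβ1 (fun x hx v hv => by
      rw [← WithZero.exp_zero]
      refine valuation_mul_le v (hβv v) (hav x hx v) ?_
      rw [count_eq_zero h𝔣.1 hv]
      omega) fun x => finitePart ψ 𝔣 (Quotient.out x) * traceChar δ (Quotient.out x)
    rw [finiteGaussSum, ← key, Finset.mul_sum]
    refine Finset.sum_congr rfl fun x hx => ?_
    have hp : IsPrimitive 𝔣 (β * a x) := (hprim x hx).mul h𝔣.1 hβ1 fun v hv => by
      rw [← WithZero.exp_zero]
      refine valuation_mul_le v (hβv v) (hav x hx v) ?_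
      rw [count_eq_zero h𝔣.1 hv]
      omega
    have hout := mk_eq_mk.1 (QuotientAddGroup.out_eq' (QuotientAddGroup.mk (β * a x) : K ⧸ intSubgroup K))
    have hβ0 : finitePart ψ 𝔣 β ≠ 0 := Bianchi.finitePart_ne_zero ψ h𝔣.1 fun v hv h0 => by
      have h1 := hβ1 v hv
      rw [h0, map_zero] at h1
      exact zero_ne_one h1
    rw [hp.finitePart_congr h𝔣.1 h𝔣.2.1 hout, traceChar_congr hK hδ hout, finitePart_mul ψ h𝔣.1]
    field_simp
  · push Not at hβ1
    obtain ⟨v₀, hv₀, hβv₀⟩ := hβ1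
    obtain ⟨𝔤, h𝔤⟩ := hv₀
    have h𝔤0 : 𝔤 ≠ ⊥ := by
      rintro rfl
      exact h𝔣.1 (by rw [h𝔤, Ideal.mul_bot])
    obtain ⟨c, hc, hc1⟩ := h𝔣.exists_finitePart_ne_one h𝔤
    have hcint : ∀ v : HeightOneSpectrum (𝓞 K), v.valuation K (c : K) ≤ 1 := fun v => v.valuation_le_one c
    have hcsub : ∀ v : HeightOneSpectrum (𝓞 K), v.asIdeal ∣ 𝔣 → v.valuation K ((c : K) - 1) ≤
        WithZero.exp (-FractionalIdeal.count K v (𝔤 : FractionalIdeal (𝓞 K)⁰ K)) := by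
      intro v hv
      rw [← valuedAdicCompletion_eq_valuation']
      have h1 := (hc v hv).2
      rwa [← af_one_apply, ← map_one (algebraMap K (Af K)), ← af_algebraMap_apply, ← af_sub_apply,
        ← map_sub, af_algebraMap_apply] at h1
    have hc1v : ∀ v : HeightOneSpectrum (𝓞 K), v.asIdeal ∣ 𝔣 → v.valuation K (c : K) = 1 := by
      intro v hv
      rw [← valuedAdicCompletion_eq_valuation']
      exact (hc v hv).1
    have hca : ∀ x ∈ s, ∀ v : HeightOneSpectrum (𝓞 K), v.valuation K (c * a x) ≤ WithZero.exp
        (FractionalIdeal.count K v (𝔣 : FractionalIdeal (𝓞 K)⁰ K) - FractionalIdeal.count K v J) := by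
      intro x hx v
      refine valuation_mul_le v ((hcint v).trans_eq WithZero.exp_zero.symm) (hav x hx v) ?_
      omega
    have hca1 : ∀ x ∈ s, ∀ v : HeightOneSpectrum (𝓞 K), ¬ v.asIdeal ∣ 𝔣 →
        v.valuation K (c * a x) ≤ 1 := by
      intro x hx v hv
      rw [← WithZero.exp_zero]
      refine valuation_mul_le v ((hcint v).trans_eq WithZero.exp_zero.symm) (hprim x hx v).1 ?_
      rw [count_eq_zero h𝔣.1 hv]
      omega
    have key := sum_mk_mul h𝔣.1 hs ha hc1v hca1 fun x =>
      finitePart ψ 𝔣 (a x) * traceChar δ (β * a x)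
    have hterm : ∀ x ∈ s, finitePart ψ 𝔣 (a (QuotientAddGroup.mk (c * a x))) *
        traceChar δ (β * a (QuotientAddGroup.mk (c * a x))) =
        finitePart ψ 𝔣 c * (finitePart ψ 𝔣 (a x) * traceChar δ (β * a x)) := by
      intro x hx
      have hp : IsPrimitive 𝔣 (c * a x) := (hprim x hx).mul h𝔣.1 hc1v (hca1 x hx)
      have hmem := (hs _).2 ((mk_mem_primClasses h𝔣.1).2 hp)
      have hdiff := mk_eq_mk.1 (ha _ hmem)
      -- Two representatives of one class, both in `J` away from `𝔣`, differ by an element of `J`,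
      -- and `β ∈ J⁻¹` makes the product integral.
      have h1 : traceChar δ (β * a (QuotientAddGroup.mk (c * a x))) = traceChar δ (β * (c * a x)) := by
        refine traceChar_congr hK hδ fun v => ?_
        rw [← mul_sub, ← WithZero.exp_zero]
        refine valuation_mul_le v (n := -FractionalIdeal.count K v J) (hβv v) ?_ (by omega)
        by_cases hv : v.asIdeal ∣ 𝔣
        · rw [hJ v hv, neg_zero, WithZero.exp_zero]
          exact hdiff v
        · have h2 := hav _ hmem v
          have h3 := hca x hx v
          rw [count_eq_zero h𝔣.1 hv, zero_sub] at h2 h3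
          exact (Valuation.map_sub _ _ _).trans (max_le h2 h3)
      -- `c - 1` cancels the denominator of `a x` except for one factor `v₀`, and that factor is
      -- supplied by `β`.
      have h2 : traceChar δ (β * (c * a x)) = traceChar δ (β * a x) := by
        refine traceChar_congr hK hδ fun v => ?_
        have e : β * (c * a x) - β * a x = β * ((c - 1) * a x) := by ring
        rw [e, ← WithZero.exp_zero]
        by_cases hv : v.asIdeal ∣ 𝔣
        · have h3 : v.valuation K (((c : K) - 1) * a x) ≤ WithZero.exp
              (FractionalIdeal.count K v (𝔣 : FractionalIdeal (𝓞 K)⁰ K) -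
                FractionalIdeal.count K v (𝔤 : FractionalIdeal (𝓞 K)⁰ K)) := by
            refine valuation_mul_le v (hcsub v hv) (hprim x hx v).1 ?_
            omega
          have hcount : FractionalIdeal.count K v (𝔣 : FractionalIdeal (𝓞 K)⁰ K) =
              FractionalIdeal.count K v (v₀.asIdeal : FractionalIdeal (𝓞 K)⁰ K) +
                FractionalIdeal.count K v (𝔤 : FractionalIdeal (𝓞 K)⁰ K) := by
            rw [h𝔤, FractionalIdeal.coeIdeal_mul, FractionalIdeal.count_mul K v
              (FractionalIdeal.coeIdeal_ne_zero.2 v₀.ne_bot) (FractionalIdeal.coeIdeal_ne_zero.2 h𝔤0)]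
          rw [hcount, add_sub_cancel_right] at h3
          have h4 := hβv v
          rw [hJ v hv] at h4
          by_cases hvv : v = v₀
          · subst hvv
            rw [FractionalIdeal.count_self] at h3
            have h5 : v.valuation K β ≤ WithZero.exp (-1 : ℤ) := by
              by_cases hβ0 : β = 0
              · rw [hβ0, map_zero]
                exact zero_le
              · rw [valuation_eq_exp v hβ0, WithZero.exp_le_exp] at h4 ⊢
                rw [valuation_eq_exp v hβ0, ← WithZero.exp_zero, Ne, WithZero.exp_inj] at hβv₀
                omega
            exact valuation_mul_le v h5 h3 (by omega)
          · rw [FractionalIdeal.count_maximal_coprime K v (Ne.symm hvv)] at h3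
            exact valuation_mul_le v h4 h3 (by omega)
        · refine valuation_mul_le v (n := -FractionalIdeal.count K v J) (hβv v) ?_ (by omega)
          refine valuation_mul_le v (m := 0) ?_ (hav x hx v) ?_
          · rw [WithZero.exp_zero]
            exact (Valuation.map_sub _ _ _).trans (max_le (hcint v) (map_one _).le)
          · rw [count_eq_zero h𝔣.1 hv]
            omega
      rw [hp.finitePart_congr h𝔣.1 h𝔣.2.1 hdiff, h1, h2, finitePart_mul ψ h𝔣.1, mul_assoc]
    rw [Finset.sum_congr rfl hterm, ← Finset.mul_sum] at key
    set T := ∑ x ∈ s, finitePart ψ 𝔣 (a x) * traceChar δ (β * a x)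
    have h1 : (finitePart ψ 𝔣 c - 1) * T = 0 := by rw [sub_mul, key, one_mul, sub_self]
    exact (mul_eq_zero.1 h1).resolve_left (sub_ne_zero.2 hc1)

/-- If the sum were zero, all sums twisted by integers `β` would vanish. That is a linear relation
with nonzero coefficients `ψ_𝔣(b)` between the characters `β ↦ traceChar δ (β b)` of `𝓞 K`, which
are distinct for distinct classes, against the independence of characters. -/
theorem finiteGaussSum_ne_zero (hK : Module.finrank ℚ K = 2)
    (hδ : δ ^ 2 = (NumberField.discr K : 𝓞 K)) (h𝔣 : IsConductor ψ 𝔣)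
    (hs : ∀ x, x ∈ s ↔ x ∈ primClasses 𝔣) : finiteGaussSum δ ψ 𝔣 s ≠ 0 := by
  intro h0
  have hout : ∀ x ∈ s, (QuotientAddGroup.mk (Quotient.out x) : K ⧸ intSubgroup K) = x :=
    fun x _ => QuotientAddGroup.out_eq' x
  have hprim : ∀ x ∈ s, IsPrimitive 𝔣 (Quotient.out x) := fun x hx =>
    (mk_mem_primClasses h𝔣.1).1 (by rw [hout x hx]; exact (hs x).1 hx)
  have h𝔣' : (𝔣 : FractionalIdeal (𝓞 K)⁰ K) ≠ 0 := FractionalIdeal.coeIdeal_ne_zero.2 h𝔣.1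
  have hsum : ∀ β : 𝓞 K, ∑ x ∈ s, finitePart ψ 𝔣 (Quotient.out x) * traceChar δ (β * Quotient.out x) = 0 := by
    intro β
    have h1 := sum_finitePart_mul_traceChar hK hδ h𝔣 hs one_ne_zero
      (fun v _ => FractionalIdeal.count_one K v) hout (fun x hx => by
        rw [mul_one]
        refine (mem_iff_valuation_le (inv_ne_zero h𝔣')).2 fun v => ?_
        rw [FractionalIdeal.count_inv, neg_neg]
        exact (hprim x hx v).1) (β := β) (by
        rw [inv_one]
        exact (FractionalIdeal.mem_one_iff _).2 ⟨β, rfl⟩)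
    rw [h1, h0, mul_zero, ite_self]
  let f : s → (Multiplicative (𝓞 K) →* ℂ) := fun x =>
    { toFun := fun β => traceChar δ ((β.toAdd : K) * Quotient.out x.1)
      map_one' := by simp [traceChar]
      map_mul' := fun β γ => by
        have h : ((β * γ).toAdd : K) = (β.toAdd : K) + (γ.toAdd : K) := map_add (algebraMap (𝓞 K) K) _ _
        rw [h, add_mul, traceChar_add] }
  have hf : Function.Injective f := by
    intro x y hxy
    apply Subtype.ext
    rw [← hout x x.2, ← hout y y.2]
    refine mk_eq_mk.2 (mem_one_iff.1 (mem_one_of_traceChar hK hδ fun β => ?_))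
    have h1 : traceChar δ (β * Quotient.out x.1) = traceChar δ (β * Quotient.out y.1) :=
      DFunLike.congr_fun hxy (Multiplicative.ofAdd β)
    have h2 := traceChar_add (δ := δ) (β * (Quotient.out x.1 - Quotient.out y.1)) (β * Quotient.out y.1)
    rw [← mul_add, sub_add_cancel, h1] at h2
    exact (mul_eq_right₀ (Complex.exp_ne_zero _)).1 h2.symm
  have hli := (linearIndependent_monoidHom (Multiplicative (𝓞 K)) ℂ).comp f hf
  rw [Fintype.linearIndependent_iff] at hli
  obtain ⟨b, hb⟩ := exists_isPrimitive (K := K) h𝔣.1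
  have hbs := (hs _).2 ((mk_mem_primClasses h𝔣.1).2 hb)
  have h1 := hli (fun x => finitePart ψ 𝔣 (Quotient.out x.1)) (by
    funext β
    have h2 := hsum β.toAdd
    rw [← Finset.sum_coe_sort] at h2
    rw [Finset.sum_apply]
    exact h2) ⟨_, hbs⟩
  exact (hprim _ hbs).finitePart_ne_zero h𝔣.1 h1

lemma gaussSum_eq (τ : K →+* ℂ) (hs : ∀ x, x ∈ s ↔ x ∈ primClasses 𝔣) :
    gaussSum τ δ ψ 𝔣 = atInfinity ψ (τ δ) * finiteGaussSum δ ψ 𝔣 s := by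
  have h : (primClasses 𝔣 : Set (K ⧸ intSubgroup K)) = ↑s := by
    ext x
    exact (hs x).symm
  rw [gaussSum, finiteGaussSum, h, finsum_mem_coe_finset]
  rfl

end gaussSum

end

section

/-! ### Mellin transforms -/

/-- Continuous functions on `(0, ∞)` that decay faster than any power at `0` and at `∞`. -/
structure IsRapidlyDecreasing (f : ℝ → ℂ) : Prop where
  continuousOn : ContinuousOn f (Set.Ioi 0)
  zero : ∀ P : ℕ, ∃ B : ℝ, ∀ t : ℝ, 0 < t → t ≤ 1 → ‖f t‖ ≤ B * t ^ P
  infty : ∀ P : ℕ, ∃ B : ℝ, ∀ t : ℝ, 1 ≤ t → ‖f t‖ ≤ B * t⁻¹ ^ P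

namespace IsRapidlyDecreasing

variable {f : ℝ → ℂ} (hf : IsRapidlyDecreasing f)
include hf

lemma isBigO_atTop (P : ℕ) : f =O[Filter.atTop] fun t => t ^ (-(P : ℝ)) := by
  obtain ⟨B, hB⟩ := hf.infty P
  refine Asymptotics.IsBigO.of_bound B ?_
  filter_upwards [Filter.eventually_ge_atTop 1] with t ht
  rw [Real.rpow_neg (by linarith), Real.rpow_natCast, ← inv_pow, Real.norm_of_nonneg (by positivity)]
  exact hB t ht

lemma isBigO_zero (P : ℕ) : f =O[nhdsWithin 0 (Set.Ioi 0)] fun t => t ^ (-(-(P : ℝ))) := by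
  obtain ⟨B, hB⟩ := hf.zero P
  refine Asymptotics.IsBigO.of_bound B ?_
  filter_upwards [Ioc_mem_nhdsGT (zero_lt_one' ℝ)] with t ht
  rw [neg_neg, Real.rpow_natCast, Real.norm_of_nonneg (pow_nonneg ht.1.le P)]
  exact hB t ht.1 ht.2

lemma locallyIntegrableOn : MeasureTheory.LocallyIntegrableOn f (Set.Ioi 0) :=
  hf.continuousOn.locallyIntegrableOn measurableSet_Ioi

theorem mellinConvergent (s : ℂ) : MellinConvergent f s := by
  obtain ⟨P, hP⟩ := exists_nat_gt |s.re|
  rw [abs_lt] at hP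
  exact mellinConvergent_of_isBigO_rpow hf.locallyIntegrableOn (hf.isBigO_atTop P) hP.2
    (hf.isBigO_zero P) hP.1

theorem differentiable_mellin : Differentiable ℂ (mellin f) := by
  intro s
  obtain ⟨P, hP⟩ := exists_nat_gt |s.re|
  rw [abs_lt] at hP
  exact mellin_differentiableAt_of_isBigO_rpow hf.locallyIntegrableOn (hf.isBigO_atTop P) hP.2
    (hf.isBigO_zero P) hP.1

end IsRapidlyDecreasing

lemma mellin_finsetSum {X : Type*} (s : Finset X) (c : X → ℂ) {f : X → ℝ → ℂ}
    (hf : ∀ x ∈ s, IsRapidlyDecreasing (f x)) (w : ℂ) :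
    mellin (fun t => ∑ x ∈ s, c x * f x t) w = ∑ x ∈ s, c x * mellin (f x) w := by
  have h1 : ∀ x ∈ s, MellinConvergent (fun t => c x * f x t) w := fun x hx =>
    ((hf x hx).mellinConvergent w).const_smul (c x)
  simp only [mellin, Finset.smul_sum]
  rw [MeasureTheory.integral_finsetSum s h1]
  refine Finset.sum_congr rfl fun x _ => ?_
  rw [← MeasureTheory.integral_const_mul]
  refine MeasureTheory.integral_congr_ae (Filter.Eventually.of_forall fun t => ?_)
  simp only [smul_eq_mul]
  ring

section unfolding

variable {ι A : Type*} [Fintype ι] {ω : ι → ℂ} {α : A → ℂ} {e : A ≃ (ι → ℤ)}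
  {k ℓ : ℕ} {Φ : (Fin 2 → Fin 2 → ℂ) → V (k + ℓ + 2)} {C : A → ℂ}

lemma cpow_ofReal_norm {t : ℝ} (ht : 0 < t) (w : ℂ) : ‖(t : ℂ) ^ w‖ = t ^ w.re :=
  Complex.norm_cpow_eq_rpow_re_of_pos ht w

lemma integral_norm_besselK_mul (ν : ℝ) (w : ℂ) {b : ℝ} (hb : 0 < b) :
    ∫ t in Set.Ioi (0 : ℝ), ‖(t : ℂ) ^ w * (besselK ν (b * t) : ℂ)‖ =
      b ^ (-(w.re + 1)) * ∫ t in Set.Ioi (0 : ℝ), ‖(t : ℂ) ^ w * (besselK ν t : ℂ)‖ := by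
  have h1 := MeasureTheory.integral_comp_mul_left_Ioi
    (fun t : ℝ => ‖(t : ℂ) ^ w * (besselK ν t : ℂ)‖) 0 hb
  rw [mul_zero, smul_eq_mul] at h1
  have h2 : ∫ t in Set.Ioi (0 : ℝ), ‖((b * t : ℝ) : ℂ) ^ w * (besselK ν (b * t) : ℂ)‖ =
      b ^ w.re * ∫ t in Set.Ioi (0 : ℝ), ‖(t : ℂ) ^ w * (besselK ν (b * t) : ℂ)‖ := by
    rw [← MeasureTheory.integral_const_mul]
    refine MeasureTheory.setIntegral_congr_fun measurableSet_Ioi fun t ht => ?_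
    have ht' : 0 < t := ht
    rw [norm_mul, norm_mul, cpow_ofReal_norm (mul_pos hb ht'), cpow_ofReal_norm ht',
      Real.mul_rpow hb.le ht'.le, mul_assoc]
  rw [h2] at h1
  have h3 : b ^ w.re ≠ 0 := (Real.rpow_pos_of_pos hb _).ne'
  refine mul_left_cancel₀ h3 ?_
  rw [h1, ← mul_assoc, ← Real.rpow_add hb]
  congr 1
  rw [← Real.rpow_neg_one]
  congr 1
  ring

/-- The expansion is integrated term by term, and scaling by `4 π ‖α a‖` reduces each term to the
Mellin transform of one Bessel function. The factors `t ^ (w - 1)`, `t⁻¹` and `t ^ 2` combine to `t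
^ w`, which shifts the Mellin variable to `w + 1`. -/
theorem IsCoefficientFamily.hasSum_mellin (hC : IsCoefficientFamily ω α Φ C)
    (hΦ : IsArchimedeanForm k ℓ Φ)
    (hper : ∀ i, ∀ B ∈ invertibleMatrices, Φ (unipotentMul (ω i) B) = Φ B)
    (h : IsDualPair ω α e) {n : Fin (k + ℓ + 2 + 1)}
    (h0 : ∀ t : ℝ, 0 < t → latticeMean ω (fun z => Φ (borel z t) n) = 0)
    {X : Type*} (s : Finset X) (c z : X → ℂ) {ν : ℝ} (hν : ν = (n : ℕ) - ℓ - 1) :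
    ∃ σ : ℝ, ∀ w : ℂ, σ < w.re →
      HasSum (fun a => C a * (∑ x ∈ s, c x * addChar (α a * z x)) *
          (((k + ℓ + 2).choose n : ℂ) * (α a / (Complex.I * ‖α a‖)) ^ ((ℓ : ℤ) + 1 - (n : ℕ))) *
          (((4 * Real.pi * ‖α a‖ : ℝ) : ℂ) ^ (-(w + 1)) *
            (2 ^ (w - 1) * Complex.Gamma ((w + 1 - ν) / 2) * Complex.Gamma ((w + 1 + ν) / 2))))
        (mellin (fun t => ∑ x ∈ s, c x * ((t : ℂ)⁻¹ * Φ (borel (z x) t) n)) w) := by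
  obtain ⟨B, M, hB, hb⟩ := hC.bound
  obtain ⟨S, hS, hS1⟩ := h.exists_one_le
  have : Countable A := e.injective.countable
  set P := Fintype.card ι + 1 with hP
  -- `|ν|` is needed for convergence at `t = 0`, `M` for the growth of the coefficients and `P` for
  -- summability over the frequencies.
  refine ⟨|ν| + M + P, fun w hw => ?_⟩
  have hνw : |ν| < (w + 1).re := by
    rw [Complex.add_re, Complex.one_re]
    have : (0 : ℝ) ≤ (M : ℝ) + P := by positivity
    linarith
  obtain ⟨hK1, hK2⟩ := mellin_besselK hνw
  rw [add_sub_cancel_right] at hK1 hK2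
  set κ : A → ℂ := fun a => C a * (∑ x ∈ s, c x * addChar (α a * z x)) *
          (((k + ℓ + 2).choose n : ℂ) * (α a / (Complex.I * ‖α a‖)) ^ ((ℓ : ℤ) + 1 - (n : ℕ))) with hκ
  set f : A → ℝ → ℂ := fun a t => κ a * ((t : ℂ) ^ w * (besselK ν (4 * Real.pi * ‖α a‖ * t) : ℂ)) with hf
  have hκ0 : ∀ a, α a = 0 → κ a = 0 := by
    intro a ha
    simp [hκ, hC.zero a ha]
  have hpos : ∀ a, α a ≠ 0 → 0 < 4 * Real.pi * ‖α a‖ := fun a ha => by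
    have := norm_pos_iff.2 ha
    positivity
  have hK1' : MellinConvergent (fun t => (besselK ν t : ℂ)) (w + 1) := by
    rw [MellinConvergent, add_sub_cancel_right]
    exact hK1
  have hint : ∀ a, MeasureTheory.IntegrableOn (f a) (Set.Ioi 0) := by
    intro a
    by_cases ha : α a = 0
    · simp only [hf, hκ0 a ha, zero_mul]
      exact MeasureTheory.integrableOn_zero
    · have h1 := (MellinConvergent.comp_mul_left (f := fun t => (besselK ν t : ℂ)) (s := w + 1) (hpos a ha)).2 hK1'
      rw [MellinConvergent, add_sub_cancel_right] at h1
      exact h1.const_mul (κ a)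
  have hval : ∀ a, ∫ t in Set.Ioi (0 : ℝ), f a t = κ a * (((4 * Real.pi * ‖α a‖ : ℝ) : ℂ) ^ (-(w + 1)) *
      (2 ^ (w - 1) * Complex.Gamma ((w + 1 - ν) / 2) * Complex.Gamma ((w + 1 + ν) / 2))) := by
    intro a
    by_cases ha : α a = 0
    · simp [hf, hκ0 a ha]
    · have h1 := mellin_comp_mul_left (fun t => (besselK ν t : ℂ)) (w + 1) (hpos a ha)
      rw [mellin, mellin, add_sub_cancel_right] at h1
      simp only [hf]
      rw [MeasureTheory.integral_const_mul]
      congr 1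
      refine h1.trans ?_
      rw [smul_eq_mul]
      congr 1
      refine hK2.trans ?_
      congr 3
      ring
  set D := ∑ x ∈ s, ‖c x‖ with hD
  have hD0 : 0 ≤ D := Finset.sum_nonneg fun _ _ => norm_nonneg _
  have hκb : ∀ a, α a ≠ 0 → ‖κ a‖ ≤ B * ‖α a‖ ^ M * D * (k + ℓ + 2).choose n := by
    intro a ha
    simp only [hκ]
    rw [norm_mul, norm_mul, norm_mul, norm_zpow, norm_div_I_mul_norm ha, one_zpow, mul_one,
      Complex.norm_natCast]
    have h1 : ‖∑ x ∈ s, c x * addChar (α a * z x)‖ ≤ D := by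
      refine norm_sum_le_of_le s fun x _ => ?_
      rw [norm_mul, norm_addChar, mul_one]
    have h2 := hb a
    gcongr
  set R := w.re + 1 with hR
  have hRP : (M : ℝ) + P ≤ R := by
    have := abs_nonneg ν
    linarith
  set κ₀ := ∫ t in Set.Ioi (0 : ℝ), ‖(t : ℂ) ^ w * (besselK ν t : ℂ)‖ with hκ₀
  have hκ₀0 : 0 ≤ κ₀ := MeasureTheory.integral_nonneg fun _ => norm_nonneg _
  have hnorm : ∀ a, ∫ t in Set.Ioi (0 : ℝ), ‖f a t‖ ≤
      (B * D * (k + ℓ + 2).choose n * κ₀ * ((4 * Real.pi)⁻¹ ^ R * S ^ (R - M - P))) * ‖α a‖⁻¹ ^ P := by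
    intro a
    by_cases ha : α a = 0
    · simp only [hf, hκ0 a ha, zero_mul, norm_zero, MeasureTheory.integral_zero]
      have : (0 : ℝ) ≤ S ^ (R - M - P) := Real.rpow_nonneg (by linarith) _
      have : (0 : ℝ) ≤ (4 * Real.pi)⁻¹ ^ R := Real.rpow_nonneg (by positivity) _
      positivity
    · have hp : 0 < ‖α a‖ := norm_pos_iff.2 ha
      simp only [hf, norm_mul (κ a)]
      rw [MeasureTheory.integral_const_mul, integral_norm_besselK_mul ν w (hpos a ha), ← hκ₀, ← hR]
      have h1 : (4 * Real.pi * ‖α a‖) ^ (-R) = (4 * Real.pi)⁻¹ ^ R * ‖α a‖⁻¹ ^ R := by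
        rw [Real.mul_rpow (by positivity) hp.le, Real.rpow_neg (by positivity), Real.rpow_neg hp.le,
          Real.inv_rpow (by positivity), Real.inv_rpow hp.le]
      -- Nonzero frequencies are bounded away from zero, so the surplus exponent is absorbed in a
      -- power of `S`.
      have h2 : ‖α a‖⁻¹ ^ R ≤ S ^ (R - M - P) * ‖α a‖⁻¹ ^ (M + P) := by
        have e1 : ‖α a‖⁻¹ ^ R = ‖α a‖⁻¹ ^ (R - M - P) * ‖α a‖⁻¹ ^ (M + P) := by
          rw [← Real.rpow_natCast, ← Real.rpow_add (inv_pos.2 hp)]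
          congr 1
          push_cast
          ring
        rw [e1]
        refine mul_le_mul_of_nonneg_right (Real.rpow_le_rpow (by positivity) ?_ (by linarith)) (by positivity)
        rw [inv_le_iff_one_le_mul₀ hp]
        exact hS1 a ha
      rw [h1]
      have h3 : (0 : ℝ) ≤ (4 * Real.pi)⁻¹ ^ R := Real.rpow_nonneg (by positivity) _
      calc ‖κ a‖ * ((4 * Real.pi)⁻¹ ^ R * ‖α a‖⁻¹ ^ R * κ₀)
          ≤ (B * ‖α a‖ ^ M * D * (k + ℓ + 2).choose n) *
            ((4 * Real.pi)⁻¹ ^ R * (S ^ (R - M - P) * ‖α a‖⁻¹ ^ (M + P)) * κ₀) := by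
            refine mul_le_mul (hκb a ha) (mul_le_mul_of_nonneg_right
              (mul_le_mul_of_nonneg_left h2 h3) hκ₀0) (by positivity) (by positivity)
        _ = (B * D * (k + ℓ + 2).choose n * κ₀ * ((4 * Real.pi)⁻¹ ^ R * S ^ (R - M - P))) *
            ‖α a‖⁻¹ ^ P * (‖α a‖ ^ M * ‖α a‖⁻¹ ^ M) := by rw [pow_add]; ring
        _ = _ := by rw [← mul_pow, mul_inv_cancel₀ hp.ne', one_pow, mul_one]
  have hsum : Summable fun a => ∫ t in Set.Ioi (0 : ℝ), ‖f a t‖ :=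
    Summable.of_nonneg_of_le (fun a => MeasureTheory.integral_nonneg fun _ => norm_nonneg _) hnorm
      ((h.summable_inv_pow (P := P) (by omega)).mul_left _)
  have key := MeasureTheory.hasSum_integral_of_summable_integral_norm hint hsum
  simp only [hval] at key
  have hm : mellin (fun t => ∑ x ∈ s, c x * ((t : ℂ)⁻¹ * Φ (borel (z x) t) n)) w =
      ∫ t in Set.Ioi (0 : ℝ), ∑' a, f a t := by
    refine MeasureTheory.setIntegral_congr_fun measurableSet_Ioi fun t (ht : 0 < t) => ?_
    have ht' : (t : ℂ) ≠ 0 := Complex.ofReal_ne_zero.2 ht.ne'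
    have h1 := (hasSum_sum fun x (_ : x ∈ s) =>
      (((hC.hasSum hΦ hper h ht (h0 t ht) (z x)).mul_left ((t : ℂ)⁻¹)).mul_left (c x))).mul_left
        ((t : ℂ) ^ (w - 1))
    refine (HasSum.tsum_eq (h1.congr_fun fun a => ?_)).symm
    have e1 : (t : ℂ) ^ w = (t : ℂ) ^ (w - 1) * ((t : ℂ)⁻¹ * t ^ 2) := by
      rw [Complex.cpow_sub _ _ ht', Complex.cpow_one]
      field_simp
    simp only [hf, hκ]
    rw [e1, hν, Finset.mul_sum, Finset.mul_sum, Finset.sum_mul, Finset.sum_mul]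
    refine Finset.sum_congr rfl fun x _ => ?_
    rw [whittaker_ofReal_mul k ℓ (α a) ht]
    ring
  rw [hm]
  exact key

end unfolding

end

section

/-! ### The integrals along vertical geodesics -/

variable {K : Type*} [Field K] [NumberField K]

lemma infty_mem_cusps (J 𝔪 : Ideal (𝓞 K)) : (OnePoint.infty : OnePoint K) ∈ cusps J 𝔪 := by
  refine ⟨1, ⟨by simp, ?_, ?_, ?_, ?_⟩, Or.inl (one_smul _ _).symm⟩
  · simp
  · simp
  · simpa using FractionalIdeal.zero_mem _
  · simp

lemma IsArchimedeanForm.continuousOn_borel {k ℓ : ℕ} {Φ : (Fin 2 → Fin 2 → ℂ) → V (k + ℓ + 2)}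
    (hΦ : IsArchimedeanForm k ℓ Φ) (z : ℂ) (n : Fin (k + ℓ + 2 + 1)) :
    ContinuousOn (fun t : ℝ => Φ (borel z t) n) (Set.Ioi 0) := by
  refine (continuous_apply n).comp_continuousOn
    (hΦ.smooth.continuousOn.comp (Continuous.continuousOn ?_) fun t ht => borel_mem z ht)
  refine continuous_pi fun i => continuous_pi fun j => ?_
  fin_cases i <;> fin_cases j <;> simp [borel] <;> fun_prop

variable [IsTotallyComplex K] {τ : K →+* ℂ} {𝔫 : Ideal (𝓞 K)} {k ℓ : ℕ}
  {φ : ℂˣ × (Af K)ˣ →* ℂˣ} {F : GL (Fin 2) ℂ → GL (Fin 2) (Af K) → V (k + ℓ + 2)}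

/-- Decay at infinity comes from the expansion at the cusp `∞`, decay at zero from the expansion at
the cusp `a`. -/
theorem IsBianchiModularForm.isRapidlyDecreasing_descent (hF : IsBianchiModularForm τ 𝔫 k ℓ φ F)
    (hφ : IsHeckeCharacter τ φ (-k) (-ℓ)) (hK : Module.finrank ℚ K = 2)
    (h𝔫 : 𝔫 ≠ ⊥) (hφ𝔫 : TrivialOn φ 𝔫) {J : Ideal (𝓞 K)} (hJ : J ≠ ⊥)
    (hinf : QuasiVanishesAt τ k ℓ (descent F J) OnePoint.infty) {a : K}
    (hq : QuasiVanishesAt τ k ℓ (descent F J) (a : OnePoint K)) {n : ℕ}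
    (h1 : 1 ≤ n) (h2 : n ≤ k + ℓ + 1) :
    IsRapidlyDecreasing fun t => (descent F J (τ a) t).comp n := by
  have hΦ := hF.isArchimedeanForm hφ (diagOne (ideleOf (J : FractionalIdeal (𝓞 K)⁰ K)))
  have hJ' : (J : FractionalIdeal (𝓞 K)⁰ K) ≠ 0 := FractionalIdeal.coeIdeal_ne_zero.2 hJ
  obtain ⟨ω, e, he, hω, hli⟩ := exists_isDualPair_fin_two τ hK hJ'
  have hper : ∀ i, ∀ B ∈ invertibleMatrices,
      extend (fun g => F g (diagOne (ideleOf (J : FractionalIdeal (𝓞 K)⁰ K)))) (unipotentMul (ω i) B) =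
        extend (fun g => F g (diagOne (ideleOf (J : FractionalIdeal (𝓞 K)⁰ K)))) B := by
    intro i B hB
    obtain ⟨b, hb, hb'⟩ := hω i
    rw [hb', hF.periodic_ideleOf hJ' hb hB]
  obtain ⟨C, hC⟩ := hΦ.exists_isCoefficientFamily hper he
  have hn : n < k + ℓ + 2 + 1 := by omega
  have hd : ∀ t : ℝ, (descent F J (τ a) t).comp n = (t : ℂ)⁻¹ *
      extend (fun g => F g (diagOne (ideleOf (J : FractionalIdeal (𝓞 K)⁰ K)))) (borel (τ a) t) ⟨n, hn⟩ := by
    intro t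
    rw [descent_apply, V.comp_smul, V.comp_eq _ hn]
  refine ⟨?_, hF.norm_descent_le hφ hK h𝔫 hφ𝔫 J hq h1 h2, fun P => ?_⟩
  · simp only [hd]
    refine ContinuousOn.mul ?_ (hΦ.continuousOn_borel _ _)
    exact ContinuousOn.inv₀ (by fun_prop) fun t ht => Complex.ofReal_ne_zero.2 (ne_of_gt ht)
  · obtain ⟨B, hB, hb⟩ := hC.norm_le_inv_pow hΦ hper he (n := ⟨n, hn⟩)
      (fun t ht => hF.latticeMean_eq_zero hJ hinf hω hli h1 h2 ht) P
    refine ⟨B, fun t ht => ?_⟩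
    rw [hd, norm_mul, norm_inv, Complex.norm_real, Real.norm_of_nonneg (by linarith)]
    calc t⁻¹ * _ ≤ 1 * (B * t⁻¹ ^ P) := mul_le_mul (inv_le_one_of_one_le₀ ht) (hb _ t ht)
          (norm_nonneg _) zero_le_one
      _ = _ := one_mul _

/-! ### The factor relating the Dirichlet series to Mellin transforms -/

lemma zpow_div_I_mul_norm {α : ℂ} (hα : α ≠ 0) (q r : ℕ) :
    (α / (Complex.I * ‖α‖)) ^ ((r : ℤ) - q) * ((‖α‖ : ℂ) ^ (q + r))⁻¹ =
      Complex.I ^ ((q : ℤ) - r) * (α ^ q * conj α ^ r)⁻¹ := by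
  have hn : (‖α‖ : ℂ) ≠ 0 := by simpa using hα
  have hc : conj α ≠ 0 := by simpa using hα
  have h1 : α * conj α = (‖α‖ : ℂ) ^ 2 := by
    rw [Complex.mul_conj, Complex.normSq_eq_norm_sq]; push_cast; rfl
  have hI := Complex.I_ne_zero
  rw [div_zpow, mul_zpow, zpow_sub₀ hα, zpow_sub₀ hI, zpow_sub₀ hn, zpow_sub₀ hI]
  simp only [zpow_natCast]
  field_simp
  calc _ = (α * conj α) ^ r * (‖α‖ : ℂ) ^ q := by ring
    _ = _ := by rw [h1]; ring

lemma dirichletTerm_eq {α : ℂ} (hα : α ≠ 0) (q r : ℕ) {s : ℂ} (hs : 0 < s.re) :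
    (α ^ q * conj α ^ r)⁻¹ * ((‖α‖ ^ 2 : ℝ) : ℂ) ^ (-s) =
      4 * Complex.I ^ ((r : ℤ) - q) * (2 * Real.pi : ℂ) ^ (q + r + 2 * s) *
        (Complex.Gamma (s + q))⁻¹ * (Complex.Gamma (s + r))⁻¹ *
      ((α / (Complex.I * ‖α‖)) ^ ((r : ℤ) - q) * (((4 * Real.pi * ‖α‖ : ℝ) : ℂ) ^ (-(q + r + 2 * s)) *
        (2 ^ (q + r + 2 * s - 2) * Complex.Gamma (s + r) * Complex.Gamma (s + q)))) := by
  have hg : ∀ m : ℕ, Complex.Gamma (s + m) ≠ 0 := fun m =>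
    Complex.Gamma_ne_zero_of_re_pos (by simp; positivity)
  have hp : 0 < ‖α‖ := norm_pos_iff.2 hα
  have hn : (‖α‖ : ℂ) ≠ 0 := by simpa using hα
  have hpi := Real.pi_pos
  have e1 : ((4 * Real.pi * ‖α‖ : ℝ) : ℂ) ^ (-((q : ℂ) + r + 2 * s)) =
      2 ^ (-((q : ℂ) + r + 2 * s)) * ((2 * Real.pi : ℂ) ^ (-((q : ℂ) + r + 2 * s)) *
        (((‖α‖ : ℂ) ^ (q + r))⁻¹ * ((‖α‖ ^ 2 : ℝ) : ℂ) ^ (-s))) := by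
    have e2 : ((4 * Real.pi * ‖α‖ : ℝ) : ℂ) =
        ((2 : ℝ) : ℂ) * (((2 * Real.pi : ℝ) : ℂ) * ((‖α‖ : ℝ) : ℂ)) := by
      push_cast; ring
    rw [e2, ← Complex.ofReal_mul (2 * Real.pi), Complex.mul_cpow_ofReal_nonneg (by norm_num) (by positivity),
      Complex.ofReal_mul (2 * Real.pi), Complex.mul_cpow_ofReal_nonneg (by positivity) hp.le, sq,
      Complex.ofReal_mul ‖α‖, Complex.mul_cpow_ofReal_nonneg hp.le hp.le,
      ← Complex.cpow_natCast, ← Complex.cpow_neg, ← Complex.cpow_add _ _ hn, ← Complex.cpow_add _ _ hn]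
    push_cast
    congr 3
    ring
  have h2 : (2 : ℂ) ^ ((q : ℂ) + r + 2 * s) ≠ 0 := by simp [Complex.cpow_eq_zero_iff]
  have h2pi : (2 * Real.pi : ℂ) ^ ((q : ℂ) + r + 2 * s) ≠ 0 := by
    simp [Complex.cpow_eq_zero_iff, hpi.ne']
  have e3 : (2 : ℂ) ^ ((q : ℂ) + r + 2 * s - 2) = 2 ^ ((q : ℂ) + r + 2 * s) / 4 := by
    rw [Complex.cpow_sub _ _ two_ne_zero]
    norm_num
  have hI : Complex.I ^ ((r : ℤ) - q) * Complex.I ^ ((q : ℤ) - r) = 1 := by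
    rw [← zpow_add₀ Complex.I_ne_zero]
    simp
  have key := zpow_div_I_mul_norm hα q r
  have := hg q
  have := hg r
  rw [e1, e3, Complex.cpow_neg 2, Complex.cpow_neg (2 * Real.pi : ℂ)]
  calc _ = Complex.I ^ ((r : ℤ) - q) * ((α / (Complex.I * ‖α‖)) ^ ((r : ℤ) - q) * ((‖α‖ : ℂ) ^ (q + r))⁻¹) *
        ((‖α‖ ^ 2 : ℝ) : ℂ) ^ (-s) := by
        rw [key, ← mul_assoc, hI, one_mul]
    _ = _ := by field_simp

end

section

/-! ### Dirichlet series over one ideal class -/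

variable {K : Type*} [Field K] [NumberField K] {𝔣 𝔞 J : Ideal (𝓞 K)}

lemma isCoprime_iff_not_dvd (h𝔣 : 𝔣 ≠ ⊥) : IsCoprime 𝔞 𝔣 ↔
    ∀ v : HeightOneSpectrum (𝓞 K), v.asIdeal ∣ 𝔣 → ¬ v.asIdeal ∣ 𝔞 := by
  rw [Ideal.isCoprime_iff_sup_eq]
  refine ⟨fun h v h1 h2 => v.isPrime.ne_top (top_le_iff.1 (h ▸ sup_le (Ideal.le_of_dvd h2)
    (Ideal.le_of_dvd h1))), fun h => ?_⟩
  by_contra hne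
  obtain ⟨M, hM, hle⟩ := Ideal.exists_le_maximal _ hne
  have hM0 : M ≠ ⊥ := fun h0 => h𝔣 (le_bot_iff.1 (h0 ▸ le_sup_right.trans hle))
  exact h ⟨M, hM.isPrime, hM0⟩ (Ideal.dvd_iff_le.2 (le_sup_right.trans hle))
    (Ideal.dvd_iff_le.2 (le_sup_left.trans hle))

lemma count_eq_zero_of_isCoprime (h𝔣 : 𝔣 ≠ ⊥) (hJ : J ≠ ⊥) (h : IsCoprime 𝔣 J)
    (v : HeightOneSpectrum (𝓞 K)) (hv : v.asIdeal ∣ 𝔣) :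
    FractionalIdeal.count K v (J : FractionalIdeal (𝓞 K)⁰ K) = 0 :=
  count_eq_zero hJ ((isCoprime_iff_not_dvd h𝔣).1 h.symm v hv)

lemma isCoprime_iff_valuation (h𝔣 : 𝔣 ≠ ⊥) (hJ : J ≠ ⊥) (h : IsCoprime 𝔣 J) {β : K} (hβ : β ≠ 0)
    (h𝔞 : (𝔞 : FractionalIdeal (𝓞 K)⁰ K) = FractionalIdeal.spanSingleton (𝓞 K)⁰ β * J) :
    IsCoprime 𝔞 𝔣 ↔ ∀ v : HeightOneSpectrum (𝓞 K), v.asIdeal ∣ 𝔣 → v.valuation K β = 1 := by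
  have hs : FractionalIdeal.spanSingleton (𝓞 K)⁰ β ≠ 0 :=
    FractionalIdeal.spanSingleton_ne_zero_iff.2 hβ
  have hJ' : (J : FractionalIdeal (𝓞 K)⁰ K) ≠ 0 := FractionalIdeal.coeIdeal_ne_zero.2 hJ
  have h𝔞0 : 𝔞 ≠ ⊥ := FractionalIdeal.coeIdeal_ne_zero.1 (h𝔞 ▸ mul_ne_zero hs hJ')
  rw [isCoprime_iff_not_dvd h𝔣]
  refine forall₂_congr fun v hv => ?_
  have hc : FractionalIdeal.count K v (𝔞 : FractionalIdeal (𝓞 K)⁰ K) =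
      FractionalIdeal.count K v (FractionalIdeal.spanSingleton (𝓞 K)⁰ β) := by
    rw [h𝔞, FractionalIdeal.count_mul K v hs hJ', count_eq_zero_of_isCoprime h𝔣 hJ h v hv, add_zero]
  rw [valuation_eq_exp v hβ, ← hc]
  constructor
  · intro hd
    rw [count_eq_zero h𝔞0 hd]
    simp
  · intro he hd
    have := one_le_count h𝔞0 hd
    have h2 : -FractionalIdeal.count K v (𝔞 : FractionalIdeal (𝓞 K)⁰ K) = 0 := by
      simpa using he
    omega

variable [IsTotallyComplex K] {τ : K →+* ℂ}

lemma absNorm_eq (hK : Module.finrank ℚ K = 2) {β : K}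
    (h𝔞 : (𝔞 : FractionalIdeal (𝓞 K)⁰ K) = FractionalIdeal.spanSingleton (𝓞 K)⁰ β * J) :
    (Ideal.absNorm 𝔞 : ℝ) = ‖τ β‖ ^ 2 * Ideal.absNorm J := by
  have h := congrArg FractionalIdeal.absNorm h𝔞
  rw [map_mul, FractionalIdeal.coeIdeal_absNorm, FractionalIdeal.coeIdeal_absNorm,
    FractionalIdeal.absNorm_span_singleton] at h
  have h2 := congrArg (Rat.cast : ℚ → ℝ) h
  push_cast at h2
  rw [h2, norm_eq τ hK, abs_of_nonneg (by positivity)]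

variable {𝔫 : Ideal (𝓞 K)} {k ℓ : ℕ} {φ ψ : ℂˣ × (Af K)ˣ →* ℂˣ}
  {F : GL (Fin 2) ℂ → GL (Fin 2) (Af K) → V (k + ℓ + 2)}

/-- The factor between the Dirichlet series of a Bianchi modular form, twisted by a character of
infinity type `(q, r)`, and the Mellin transforms of its descents; `D` is the absolute value of the
discriminant and `W` the Gauss sum. -/
def lFactor (k ℓ q r : ℕ) (D W s : ℂ) : ℂ :=
  4 * Complex.I ^ ((r : ℤ) - q) * (2 * Real.pi : ℂ) ^ (q + r + 2 * s) *
    (Complex.Gamma (s + q))⁻¹ * (Complex.Gamma (s + r))⁻¹ *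
      (((k + ℓ + 2).choose (ℓ + 1 + q - r) : ℂ)⁻¹ * D ^ (-s) * W⁻¹)

lemma fourierCoeff_bot (𝔇 : Ideal (𝓞 K)) : fourierCoeff τ 𝔇 F ⊥ = 0 := by
  rw [fourierCoeff]
  simp

/-- Both sides are expressed through `α`, where the ideal is `α δ J`: its coefficient is `C α N(J)`,
its norm is `‖α‖² |discr K| N(J)`, and `ideleOf_mul` gives its character value, whose factor `ψ_𝔣(α
δ)⁻¹` is the one in the twisted Gauss sum of the unfolding. Ideals not prime to `𝔣` contribute zero
to both sides. -/
theorem IsBianchiModularForm.hasSum_traceDual (hF : IsBianchiModularForm τ 𝔫 k ℓ φ F)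
    (hφ : IsHeckeCharacter τ φ (-k) (-ℓ)) (hK : Module.finrank ℚ K = 2) {δ : 𝓞 K}
    (hδ : δ ^ 2 = (NumberField.discr K : 𝓞 K)) (hJ : J ≠ ⊥)
    (hinf : QuasiVanishesAt τ k ℓ (descent F J) OnePoint.infty) {q r : ℕ} (hq : q ≤ k) (hr : r ≤ ℓ)
    (hψ : IsHeckeCharacter τ ψ q r) (h𝔣 : IsConductor ψ 𝔣) (h𝔣J : IsCoprime 𝔣 J)
    {s : Finset (K ⧸ intSubgroup K)} (hs : ∀ x, x ∈ s ↔ x ∈ primClasses 𝔣)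
    {a : (K ⧸ intSubgroup K) → K} (ha : ∀ x ∈ s, QuotientAddGroup.mk (a x) = x)
    (haJ : ∀ x ∈ s, a x ∈ (𝔣 : FractionalIdeal (𝓞 K)⁰ K)⁻¹ * (J : FractionalIdeal (𝓞 K)⁰ K))
    {𝔞 : traceDual (J : FractionalIdeal (𝓞 K)⁰ K) → Ideal (𝓞 K)}
    (h𝔞 : ∀ α, (𝔞 α : FractionalIdeal (𝓞 K)⁰ K) =
      FractionalIdeal.spanSingleton (𝓞 K)⁰ ((α : K) * δ) * J) :
    ∃ σ : ℝ, ∀ w : ℂ, σ < w.re →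
      HasSum (fun α => fourierCoeff τ (Ideal.span {δ}) F (𝔞 α) * onIdeals ψ 𝔣 (𝔞 α) *
          (Ideal.absNorm (𝔞 α) : ℂ) ^ (-w))
        (lFactor k ℓ q r (NumberField.discr K).natAbs (gaussSum τ δ ψ 𝔣) w *
          (((ψ (1, ideleOf (J : FractionalIdeal (𝓞 K)⁰ K)) : ℂˣ) : ℂ) *
            (Ideal.absNorm J : ℂ) ^ (1 - w) *
          mellin (fun t => ∑ x ∈ s, finitePart ψ 𝔣 (a x) *
            (descent F J (τ (a x)) t).comp (ℓ + 1 + q - r)) (q + r + 2 * w - 1))) := by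
  have hΦ := hF.isArchimedeanForm hφ (diagOne (ideleOf (J : FractionalIdeal (𝓞 K)⁰ K)))
  have hJ' : (J : FractionalIdeal (𝓞 K)⁰ K) ≠ 0 := FractionalIdeal.coeIdeal_ne_zero.2 hJ
  obtain ⟨ω, e, he, hω, hli⟩ := exists_isDualPair_fin_two τ hK hJ'
  have hper : ∀ i, ∀ B ∈ invertibleMatrices,
      extend (fun g => F g (diagOne (ideleOf (J : FractionalIdeal (𝓞 K)⁰ K)))) (unipotentMul (ω i) B) =
        extend (fun g => F g (diagOne (ideleOf (J : FractionalIdeal (𝓞 K)⁰ K)))) B := by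
    intro i B hB
    obtain ⟨b, hb, hb'⟩ := hω i
    rw [hb', hF.periodic_ideleOf hJ' hb hB]
  obtain ⟨C, hC⟩ := hΦ.exists_isCoefficientFamily hper he
  have hn : ℓ + 1 + q - r < k + ℓ + 2 + 1 := by omega
  obtain ⟨σ, hσ⟩ := hC.hasSum_mellin hΦ hper he (n := ⟨ℓ + 1 + q - r, hn⟩)
    (fun t ht => hF.latticeMean_eq_zero hJ hinf hω hli (by simp; omega) (by simp; omega) ht) s
    (fun x => finitePart ψ 𝔣 (a x)) (fun x => τ (a x)) (ν := (q : ℝ) - r) (by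
      simp only
      rw [Nat.cast_sub (by omega)]
      push_cast
      ring)
  -- Positivity of `re w` is needed for `dirichletTerm_eq`; with `re w > σ + 1` it places the Mellin
  -- variable `q + r + 2 w - 1` to the right of `σ`.
  refine ⟨max 0 (σ + 1), fun w hw => ?_⟩
  have hw0 : 0 < w.re := (le_max_left _ _).trans_lt hw
  have hw1 : σ < ((q : ℂ) + r + 2 * w - 1).re := by
    have : σ + 1 < w.re := (le_max_right _ _).trans_lt hw
    simp
    have : (0 : ℝ) ≤ q := by positivity
    have : (0 : ℝ) ≤ r := by positivity
    linarith
  have hd : ∀ (x : K) (t : ℝ), (descent F J (τ x) t).comp (ℓ + 1 + q - r) = (t : ℂ)⁻¹ *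
      extend (fun g => F g (diagOne (ideleOf (J : FractionalIdeal (𝓞 K)⁰ K)))) (borel (τ x) t)
        ⟨ℓ + 1 + q - r, hn⟩ := by
    intro x t
    rw [descent_apply, V.comp_smul, V.comp_eq _ hn]
  simp only [hd]
  rw [← mul_assoc (lFactor _ _ _ _ _ _ _)]
  refine ((hσ _ hw1).mul_left _).congr_fun fun α => ?_
  -- `α = 0` corresponds to the zero ideal, whose Fourier coefficient is zero by convention, as is
  -- `C α`.
  by_cases hα : (α : K) = 0
  · have hbot : 𝔞 α = ⊥ := by
      have := h𝔞 α
      rw [hα, zero_mul, FractionalIdeal.spanSingleton_zero, zero_mul] at this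
      exact FractionalIdeal.coeIdeal_eq_zero.1 this
    rw [hbot, fourierCoeff_bot, hC.zero α (by simp [hα])]
    simp
  have hδ0 : (δ : K) ≠ 0 := by
    simpa using delta_ne_zero hδ
  have hβ : (α : K) * δ ≠ 0 := mul_ne_zero hα hδ0
  have h𝔇 : Ideal.span {δ} ≠ ⊥ := by simpa using delta_ne_zero hδ
  have h𝔞' : (𝔞 α : FractionalIdeal (𝓞 K)⁰ K) = FractionalIdeal.spanSingleton (𝓞 K)⁰ (α : K) *
      (Ideal.span {δ} : Ideal (𝓞 K)) * J := by
    rw [h𝔞 α, FractionalIdeal.coeIdeal_span_singleton, FractionalIdeal.spanSingleton_mul_spanSingleton]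
  have E1 := hF.fourierCoeff_eq hφ hK h𝔇 hJ' he hω
    (fun t ht => hF.latticeMean_eq_zero hJ hinf hω hli (by simp) (by simp) ht) hC α hα h𝔞'
  rw [FractionalIdeal.coeIdeal_absNorm] at E1
  have hinv : (α : K) * δ ∈ (J : FractionalIdeal (𝓞 K)⁰ K)⁻¹ := by
    rw [FractionalIdeal.mem_inv_iff hJ']
    intro y hy
    have h1 : (α : K) * δ * y ∈ (𝔞 α : FractionalIdeal (𝓞 K)⁰ K) := by
      rw [h𝔞 α]
      exact FractionalIdeal.mul_mem_mul (FractionalIdeal.mem_spanSingleton_self _ _) hy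
    exact FractionalIdeal.coeIdeal_le_one h1
  have hcount := count_eq_zero_of_isCoprime h𝔣.1 hJ h𝔣J
  have E2 : ∑ x ∈ s, finitePart ψ 𝔣 (a x) * addChar (τ α * τ (a x)) =
      if ∀ v : HeightOneSpectrum (𝓞 K), v.asIdeal ∣ 𝔣 → v.valuation K ((α : K) * δ) = 1 then
        (finitePart ψ 𝔣 ((α : K) * δ))⁻¹ * finiteGaussSum δ ψ 𝔣 s else 0 := by
    rw [← sum_finitePart_mul_traceChar hK hδ h𝔣 hs hJ' hcount ha haJ hinv]
    refine Finset.sum_congr rfl fun x _ => ?_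
    rw [traceChar_eq_addChar τ hK, ← map_mul]
    congr 3
    field_simp
  have hcop := isCoprime_iff_valuation h𝔣.1 hJ h𝔣J hβ (h𝔞 α)
  rw [E1, E2, onIdeals]
  by_cases hunit : ∀ v : HeightOneSpectrum (𝓞 K), v.asIdeal ∣ 𝔣 → v.valuation K ((α : K) * δ) = 1
  swap
  · rw [if_neg hunit, if_neg (hcop.not.2 hunit)]
    simp
  rw [if_pos hunit, if_pos (hcop.2 hunit), h𝔞 α, hψ.ideleOf_mul h𝔣.1 h𝔣.2.1 hβ hJ'
    (fun v hv => by rw [valuedAdicCompletion_eq_valuation', hunit v hv]) hcount, gaussSum_eq τ hs]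
  have hτα : τ α ≠ 0 := by simpa using hα
  have hτδ : τ δ ≠ 0 := by simpa using hδ0
  have hNJ : (Ideal.absNorm J : ℂ) ≠ 0 := by
    exact_mod_cast (Ideal.absNorm_eq_zero_iff.not.2 hJ)
  have E3 : (Ideal.absNorm (𝔞 α) : ℂ) ^ (-w) = ((‖τ α‖ ^ 2 : ℝ) : ℂ) ^ (-w) *
      (((NumberField.discr K).natAbs : ℂ) ^ (-w) * (Ideal.absNorm J : ℂ) ^ (-w)) := by
    have e1 : (Ideal.absNorm (𝔞 α) : ℂ) = ((‖τ α‖ ^ 2 : ℝ) : ℂ) *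
        ((((NumberField.discr K).natAbs : ℝ) : ℂ) * ((Ideal.absNorm J : ℝ) : ℂ)) := by
      have := absNorm_eq (τ := τ) hK (h𝔞 α)
      rw [map_mul, norm_mul, mul_pow, norm_delta_sq τ hδ] at this
      rw [← Complex.ofReal_natCast, this]
      push_cast
      ring
    rw [e1, ← Complex.ofReal_mul (((NumberField.discr K).natAbs : ℝ)),
      Complex.mul_cpow_ofReal_nonneg (by positivity) (by positivity), Complex.ofReal_mul,
      Complex.mul_cpow_ofReal_nonneg (by positivity) (by positivity)]
    simp only [Complex.ofReal_natCast]
  have E4 := dirichletTerm_eq hτα q r hw0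
  have E5 : (Ideal.absNorm J : ℂ) ^ (1 - w) = Ideal.absNorm J * (Ideal.absNorm J : ℂ) ^ (-w) := by
    rw [sub_eq_add_neg, Complex.cpow_add _ _ hNJ, Complex.cpow_one]
  have E6 : ((ℓ : ℤ) + 1 - ((ℓ + 1 + q - r : ℕ) : ℤ)) = (r : ℤ) - q := by omega
  have hS := finiteGaussSum_ne_zero hK hδ h𝔣 hs
  have hb : ((k + ℓ + 2).choose (ℓ + 1 + q - r) : ℂ) ≠ 0 := by
    exact_mod_cast (Nat.choose_pos (by omega)).ne'
  simp only
  rw [E3, E5, E6, atInfinity_eq hψ hτδ, lFactor]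
  have e7 : -((q : ℂ) + r + 2 * w - 1 + 1) = -((q : ℂ) + r + 2 * w) := by ring
  have e8 : ((q : ℂ) + r + 2 * w - 1 - 1) = (q : ℂ) + r + 2 * w - 2 := by ring
  have e9 : ((q : ℂ) + r + 2 * w - 1 + 1 - ((q : ℝ) - r : ℝ)) / 2 = w + r := by
    push_cast; ring
  have e10 : ((q : ℂ) + r + 2 * w - 1 + 1 + ((q : ℝ) - r : ℝ)) / 2 = w + q := by
    push_cast; ring
  rw [e7, e8, e9, e10]
  simp only [zpow_natCast, map_mul, Rat.cast_natCast]
  generalize hX : (τ α / (Complex.I * ‖τ α‖)) ^ ((r : ℤ) - q) *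
    (((4 * Real.pi * ‖τ α‖ : ℝ) : ℂ) ^ (-((q : ℂ) + r + 2 * w)) *
        (2 ^ ((q : ℂ) + r + 2 * w - 2) * Complex.Gamma (w + r) * Complex.Gamma (w + q))) = X at E4
  set Y := 4 * Complex.I ^ ((r : ℤ) - q) * (2 * Real.pi : ℂ) ^ ((q : ℂ) + r + 2 * w) *
        (Complex.Gamma (w + q))⁻¹ * (Complex.Gamma (w + r))⁻¹ with hY
  set Dw := ((NumberField.discr K).natAbs : ℂ) ^ (-w)
  set Nw := (Ideal.absNorm J : ℂ) ^ (-w)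
  set P := (ψ (1, ideleOf (J : FractionalIdeal (𝓞 K)⁰ K)) : ℂ)
  set χ := finitePart ψ 𝔣 ((α : K) * δ)
  set S := finiteGaussSum δ ψ 𝔣 s
  set b := ((k + ℓ + 2).choose (ℓ + 1 + q - r) : ℂ)
  -- Only the binomial coefficient `b` and the Gauss sum `S` have to be cancelled; everything else,
  -- including the inverses, is rearranged formally.
  have aux : ∀ c n x p y z d Y b S ζ M G : ℂ, b ≠ 0 → S ≠ 0 →
      c * n * x⁻¹ * p * y * z * d⁻¹ * (Y * (ζ * (M * G))) =
        Y * (b⁻¹ * y * (d * S)⁻¹) * (p * (n * z)) * (c * (x⁻¹ * S) * (b * ζ) * (M * G)) := by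
    intro c n x p y z d Y b S ζ M G hb hS
    rw [mul_inv]
    calc _ = c * n * x⁻¹ * p * y * z * d⁻¹ * (Y * (ζ * (M * G))) * (b⁻¹ * b) * (S⁻¹ * S) := by
          rw [inv_mul_cancel₀ hb, inv_mul_cancel₀ hS, mul_one, mul_one]
      _ = _ := by ring
  calc _ = C α * Ideal.absNorm J * χ⁻¹ * P * Dw * Nw * (τ δ ^ q * conj (τ δ) ^ r)⁻¹ *
        ((τ α ^ q * conj (τ α) ^ r)⁻¹ * ((‖τ α‖ ^ 2 : ℝ) : ℂ) ^ (-w)) := by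
        rw [mul_pow, mul_pow]
        simp only [mul_inv]
        ring
    _ = C α * Ideal.absNorm J * χ⁻¹ * P * Dw * Nw * (τ δ ^ q * conj (τ δ) ^ r)⁻¹ * (Y * X) := by
        rw [E4]
    _ = _ := by
        rw [← hX]
        exact aux _ _ _ _ _ _ _ _ _ _ _ _ _ hb hS

end

section

/-! ### Summation over ideals -/

section

variable {K : Type*} [Field K] [NumberField K] [IsTotallyComplex K]

/-- The norm of a unit is `‖τ u‖² = 1`, and all infinite places come from `τ` or its conjugate, so
every unit is a root of unity. -/
lemma finite_units (τ : K →+* ℂ) (hK : Module.finrank ℚ K = 2) : Finite (𝓞 K)ˣ := by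
  have h : ∀ u : (𝓞 K)ˣ, u ∈ NumberField.Units.torsion K := by
    intro u
    rw [NumberField.Units.mem_torsion]
    have h1 : ‖τ (u : K)‖ = 1 := by
      have h2 := (NumberField.isUnit_iff_norm (K := K) (x := (u : 𝓞 K))).1 u.isUnit
      rw [RingOfIntegers.coe_norm] at h2
      have h3 := norm_eq τ hK ((u : 𝓞 K) : K)
      have h4 : |((Algebra.norm ℚ ((u : 𝓞 K) : K) : ℚ) : ℝ)| = 1 := by exact_mod_cast h2
      rw [h3, abs_of_nonneg (by positivity)] at h4
      exact (pow_eq_one_iff_of_nonneg (norm_nonneg _) two_ne_zero).1 h4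
    intro w
    have h5 : w.embedding ∈ ({τ, ComplexEmbedding.conjugate τ} : Finset (K →+* ℂ)) :=
      univ_embeddings τ hK ▸ Finset.mem_univ _
    rw [← InfinitePlace.norm_embedding_eq]
    rcases Finset.mem_insert.1 h5 with h6 | h6
    · rw [h6, h1]
    · rw [Finset.mem_singleton.1 h6, ComplexEmbedding.conjugate_coe_eq, RCLike.norm_conj, h1]
  exact Finite.of_injective (fun u => (⟨u, h u⟩ : NumberField.Units.torsion K))
    fun u v huv => congrArg Subtype.val huv

end

variable {K : Type*} [Field K] [NumberField K] {𝔫 𝔇 : Ideal (𝓞 K)}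
  {I : ClassGroup (𝓞 K) → Ideal (𝓞 K)}

lemma ClassReps.exists_eq_mul (hI : ClassReps I 𝔫 𝔇) {𝔞 : Ideal (𝓞 K)} (h𝔞 : 𝔞 ≠ ⊥) :
    ∃ (j : ClassGroup (𝓞 K)) (β : K), β ≠ 0 ∧
      (𝔞 : FractionalIdeal (𝓞 K)⁰ K) = FractionalIdeal.spanSingleton (𝓞 K)⁰ β * I j := by
  have h0 := mem_nonZeroDivisors_of_ne_zero h𝔞
  set j := ClassGroup.mk0 ⟨𝔞, h0⟩ with hj
  have hIj := mem_nonZeroDivisors_of_ne_zero (hI.ne_bot j)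
  obtain ⟨x, y, hx, hy, hxy⟩ := ClassGroup.mk0_eq_mk0_iff.1 (hj.symm.trans (hI.class_eq j hIj).symm)
  refine ⟨j, y / x, div_ne_zero (by simpa using hy) (by simpa using hx), ?_⟩
  have h1 := congrArg (fun J : Ideal (𝓞 K) => (J : FractionalIdeal (𝓞 K)⁰ K)) hxy
  simp only [FractionalIdeal.coeIdeal_mul, FractionalIdeal.coeIdeal_span_singleton] at h1
  have hx' : (algebraMap (𝓞 K) K x) ≠ 0 := by simpa using hx
  have h2 : FractionalIdeal.spanSingleton (𝓞 K)⁰ (algebraMap (𝓞 K) K x) ≠ 0 :=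
    FractionalIdeal.spanSingleton_ne_zero_iff.2 hx'
  refine mul_left_cancel₀ h2 (h1.trans ?_)
  rw [← mul_assoc, FractionalIdeal.spanSingleton_mul_spanSingleton]
  congr 2
  field_simp

lemma ClassReps.eq_of_mul_eq (hI : ClassReps I 𝔫 𝔇) {i j : ClassGroup (𝓞 K)} {α β : K}
    (hα : α ≠ 0) (hβ : β ≠ 0)
    (h : FractionalIdeal.spanSingleton (𝓞 K)⁰ α * (I i : FractionalIdeal (𝓞 K)⁰ K) =
      FractionalIdeal.spanSingleton (𝓞 K)⁰ β * I j) : i = j := by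
  obtain ⟨x, y, hy, rfl⟩ := IsFractionRing.div_surjective (𝓞 K) α
  obtain ⟨x', y', hy', rfl⟩ := IsFractionRing.div_surjective (𝓞 K) β
  have hy := nonZeroDivisors.ne_zero hy
  have hy' := nonZeroDivisors.ne_zero hy'
  have hyK : algebraMap (𝓞 K) K y ≠ 0 := by simpa using hy
  have hyK' : algebraMap (𝓞 K) K y' ≠ 0 := by simpa using hy'
  have hx : x ≠ 0 := fun h0 => hα (by simp [h0])
  have hx' : x' ≠ 0 := fun h0 => hβ (by simp [h0])
  rw [← hI.class_eq i (mem_nonZeroDivisors_of_ne_zero (hI.ne_bot i)),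
    ← hI.class_eq j (mem_nonZeroDivisors_of_ne_zero (hI.ne_bot j))]
  refine ClassGroup.mk0_eq_mk0_iff.2 ⟨x * y', x' * y, mul_ne_zero hx hy', mul_ne_zero hx' hy, ?_⟩
  refine FractionalIdeal.coeIdeal_injective (K := K) ?_
  have h1 := congrArg (fun J => FractionalIdeal.spanSingleton (𝓞 K)⁰
    (algebraMap (𝓞 K) K y * algebraMap (𝓞 K) K y') * J) h
  simp only [← mul_assoc, FractionalIdeal.spanSingleton_mul_spanSingleton] at h1
  simp only [FractionalIdeal.coeIdeal_mul, FractionalIdeal.coeIdeal_span_singleton, map_mul]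
  convert h1 using 3
  · field_simp
  · field_simp

/-- The fibre condition is asked only where `g` is nonzero, because the fibre over the zero ideal,
one element for each class, has a different size. -/
lemma hasSum_of_fiber_card {X Y : Type*} {f : X → Y} {g : Y → ℂ} {S : ℂ} {m : ℕ} (hm : m ≠ 0)
    (hf : ∀ y, g y ≠ 0 → Nat.card {x // f x = y} = m) (h : HasSum (fun x => g (f x)) S) :
    HasSum g (S / m) := by
  have h1 : HasSum (fun p : Σ y, {x // f x = y} => g p.1) S := by
    refine ((Equiv.sigmaFiberEquiv f).hasSum_iff (f := fun x => g (f x))).2 h |>.congr_fun fun p => ?_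
    simp [Equiv.sigmaFiberEquiv, p.2.2]
  have h2 : ∀ y, HasSum (fun _ : {x // f x = y} => g y) (m * g y) := by
    intro y
    by_cases hy : g y = 0
    · simp [hy]
    have : Finite {x // f x = y} := Nat.finite_of_card_ne_zero (by rw [hf y hy]; exact hm)
    have := Fintype.ofFinite {x // f x = y}
    convert hasSum_fintype (fun _ : {x // f x = y} => g y) using 1
    rw [Finset.sum_const, Finset.card_univ, ← Nat.card_eq_fintype_card, hf y hy, nsmul_eq_mul]
  have h3 := (h1.sigma h2).mul_left ((m : ℂ)⁻¹)
  have hm' : (m : ℂ) ≠ 0 := by exact_mod_cast hm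
  rw [div_eq_inv_mul]
  exact h3.congr_fun fun y => by rw [inv_mul_cancel_left₀ hm']

lemma hasSum_sigma_of_finite {β : Type*} [Fintype β] {γ : β → Type*} {f : (Σ b, γ b) → ℂ} {S : β → ℂ}
    (h : ∀ b, HasSum (fun c => f ⟨b, c⟩) (S b)) : HasSum f (∑ b, S b) := by
  refine (hasSum_fintype S).sigma_of_hasSum h ?_
  refine Summable.of_norm ((summable_sigma_of_nonneg fun _ => norm_nonneg _).2
    ⟨fun b => (h b).summable.norm, (hasSum_fintype _).summable⟩)

section

variable [IsTotallyComplex K] {δ : 𝓞 K}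

/-- The trace dual of `J` is `(δ J)⁻¹`, so membership of `α` means that `α δ J` is integral. -/
lemma exists_ideal_eq (hK : Module.finrank ℚ K = 2) (hδ : δ ^ 2 = (NumberField.discr K : 𝓞 K))
    {J : Ideal (𝓞 K)} (hJ : J ≠ ⊥) (α : K) :
    α ∈ FractionalIdeal.dual ℤ ℚ (J : FractionalIdeal (𝓞 K)⁰ K) ↔ ∃ 𝔞 : Ideal (𝓞 K),
      (𝔞 : FractionalIdeal (𝓞 K)⁰ K) = FractionalIdeal.spanSingleton (𝓞 K)⁰ (α * δ) * J := by
  have hδ0 : (δ : K) ≠ 0 := by simpa using delta_ne_zero hδ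
  have hJ' : (J : FractionalIdeal (𝓞 K)⁰ K) ≠ 0 := FractionalIdeal.coeIdeal_ne_zero.2 hJ
  have hs : FractionalIdeal.spanSingleton (𝓞 K)⁰ (δ : K) ≠ 0 :=
    FractionalIdeal.spanSingleton_ne_zero_iff.2 hδ0
  rw [dual_eq hK hδ, ← mul_inv, ← FractionalIdeal.spanSingleton_le_iff_mem,
    ← FractionalIdeal.spanSingleton_mul_spanSingleton, mul_assoc]
  have h1 : FractionalIdeal.spanSingleton (𝓞 K)⁰ α ≤ (FractionalIdeal.spanSingleton (𝓞 K)⁰ (δ : K) * J)⁻¹ ↔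
      FractionalIdeal.spanSingleton (𝓞 K)⁰ α * (FractionalIdeal.spanSingleton (𝓞 K)⁰ (δ : K) * J) ≤ 1 := by
    rw [← one_div, FractionalIdeal.le_div_iff_mul_le (mul_ne_zero hs hJ')]
  rw [h1, FractionalIdeal.le_one_iff_exists_coeIdeal]

variable {𝔞 : ∀ j, traceDual (I j : FractionalIdeal (𝓞 K)⁰ K) → Ideal (𝓞 K)}

/-- The class of the ideal determines `j`, and then the generator `α δ` of the quotient by `I j` is
unique up to units: the fibre is a torsor under them. -/
theorem ClassReps.card_fiber (hI : ClassReps I 𝔫 𝔇) (hK : Module.finrank ℚ K = 2)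
    (hδ : δ ^ 2 = (NumberField.discr K : 𝓞 K))
    (h𝔞 : ∀ j α, (𝔞 j α : FractionalIdeal (𝓞 K)⁰ K) =
      FractionalIdeal.spanSingleton (𝓞 K)⁰ ((α : K) * δ) * I j) {𝔟 : Ideal (𝓞 K)} (h𝔟 : 𝔟 ≠ ⊥) :
    Nat.card {p : Σ j, traceDual (I j : FractionalIdeal (𝓞 K)⁰ K) // 𝔞 p.1 p.2 = 𝔟} =
      Nat.card (𝓞 K)ˣ := by
  have hδ0 : (δ : K) ≠ 0 := by simpa using delta_ne_zero hδ
  obtain ⟨j, β, hβ, hβ'⟩ := hI.exists_eq_mul h𝔟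
  have hβδ : β / δ * δ = β := by field_simp
  have hmem : β / δ ∈ FractionalIdeal.dual ℤ ℚ (I j : FractionalIdeal (𝓞 K)⁰ K) :=
    (exists_ideal_eq hK hδ (hI.ne_bot j) _).2 ⟨𝔟, by rw [hβδ, hβ']⟩
  have hu : ∀ u : (𝓞 K)ˣ, ((u : 𝓞 K) : K) * (β / δ) ∈
      FractionalIdeal.dual ℤ ℚ (I j : FractionalIdeal (𝓞 K)⁰ K) := by
    intro u
    have := Submodule.smul_mem (FractionalIdeal.dual ℤ ℚ (I j : FractionalIdeal (𝓞 K)⁰ K)).1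
      (u : 𝓞 K) hmem
    rwa [Algebra.smul_def] at this
  have hmap : ∀ u : (𝓞 K)ˣ, 𝔞 j ⟨((u : 𝓞 K) : K) * (β / δ), hu u⟩ = 𝔟 := by
    intro u
    refine FractionalIdeal.coeIdeal_injective (K := K) ?_
    beta_reduce
    rw [h𝔞, hβ', mul_assoc, hβδ]
    congr 1
    refine FractionalIdeal.spanSingleton_eq_spanSingleton.2 ⟨u⁻¹, ?_⟩
    rw [inv_smul_eq_iff, Units.smul_def, Algebra.smul_def]
  set f : (𝓞 K)ˣ → {p : Σ j, traceDual (I j : FractionalIdeal (𝓞 K)⁰ K) // 𝔞 p.1 p.2 = 𝔟} :=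
    fun u => ⟨⟨j, ⟨((u : 𝓞 K) : K) * (β / δ), hu u⟩⟩, hmap u⟩ with hf
  refine (Nat.card_eq_of_bijective f ⟨?_, ?_⟩).symm
  · intro u v huv
    have h1 := congrArg (fun p => (p.1.2 : K)) huv
    change ((u : 𝓞 K) : K) * (β / δ) = ((v : 𝓞 K) : K) * (β / δ) at h1
    have h2 := mul_right_cancel₀ (div_ne_zero hβ hδ0) h1
    exact Units.ext (RingOfIntegers.coe_injective h2)
  · rintro ⟨⟨i, α, hα⟩, hx⟩
    have h1 := h𝔞 i ⟨α, hα⟩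
    have hα0 : α ≠ 0 := by
      rintro rfl
      refine h𝔟 ?_
      rw [← hx, ← FractionalIdeal.coeIdeal_eq_zero (K := K), h1]
      simp
    rw [show 𝔞 i ⟨α, hα⟩ = 𝔟 from hx, hβ'] at h1
    obtain rfl := hI.eq_of_mul_eq hβ (mul_ne_zero hα0 hδ0) h1
    have h2 := mul_right_cancel₀ (FractionalIdeal.coeIdeal_ne_zero.2 (hI.ne_bot j)) h1
    obtain ⟨u, hu'⟩ := FractionalIdeal.spanSingleton_eq_spanSingleton.1 h2
    refine ⟨u, ?_⟩
    have h3 : ((u : 𝓞 K) : K) * (β / δ) = α := by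
      rw [Units.smul_def, Algebra.smul_def] at hu'
      rw [← mul_div_assoc, div_eq_iff hδ0]
      exact hu'
    simp only [hf, h3]

theorem ClassReps.hasSum_ideals (τ : K →+* ℂ) (hI : ClassReps I 𝔫 𝔇) (hK : Module.finrank ℚ K = 2)
    (hδ : δ ^ 2 = (NumberField.discr K : 𝓞 K))
    (h𝔞 : ∀ j α, (𝔞 j α : FractionalIdeal (𝓞 K)⁰ K) =
      FractionalIdeal.spanSingleton (𝓞 K)⁰ ((α : K) * δ) * I j) {g : Ideal (𝓞 K) → ℂ}
    (hg : g ⊥ = 0) {S : ClassGroup (𝓞 K) → ℂ} (h : ∀ j, HasSum (fun α => g (𝔞 j α)) (S j)) :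
    HasSum (fun 𝔟 : {𝔟 : Ideal (𝓞 K) // 𝔟 ≠ ⊥} => g 𝔟) ((∑ j, S j) / Nat.card (𝓞 K)ˣ) := by
  have hfin := finite_units τ hK
  have h1 : HasSum (fun p : Σ j, traceDual (I j : FractionalIdeal (𝓞 K)⁰ K) => g (𝔞 p.1 p.2)) (∑ j, S j) :=
    hasSum_sigma_of_finite h
  have h2 := hasSum_of_fiber_card (Nat.card_pos (α := (𝓞 K)ˣ)).ne'
    (fun 𝔟 h𝔟 => hI.card_fiber hK hδ h𝔞 fun h0 => h𝔟 (h0 ▸ hg)) h1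
  refine (hasSum_subtype_iff_of_support_subset (s := {𝔟 : Ideal (𝓞 K) | 𝔟 ≠ ⊥}) fun 𝔟 h𝔟 h0 => ?_).2 h2
  exact h𝔟 (h0 ▸ hg)

end

end

section

/-! ### The entire continuation and its value at one -/

lemma differentiable_lFactor (k ℓ q r : ℕ) {D : ℂ} (hD : D ≠ 0) (W : ℂ) :
    Differentiable ℂ (lFactor k ℓ q r D W) := by
  have hpi : (2 * Real.pi : ℂ) ≠ 0 := by simp [Real.pi_ne_zero]
  have hg : ∀ m : ℕ, Differentiable ℂ fun s : ℂ => (Complex.Gamma (s + m))⁻¹ := fun m =>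
    Complex.differentiable_one_div_Gamma.comp (differentiable_id.add_const (m : ℂ))
  have h1 : Differentiable ℂ fun s : ℂ => (2 * Real.pi : ℂ) ^ ((q : ℂ) + r + 2 * s) := fun s =>
    DifferentiableAt.const_cpow (by fun_prop) (Or.inl hpi)
  have h2 : Differentiable ℂ fun s : ℂ => D ^ (-s) := fun s =>
    DifferentiableAt.const_cpow (by fun_prop) (Or.inl hD)
  unfold lFactor
  exact ((((differentiable_const _).mul h1).mul (hg q)).mul (hg r)).mul
    (((differentiable_const _).mul h2).mul (differentiable_const _))

/-- The last factor on the right is the normalization of `mellinCoeff`, split off so that the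
constant of the formula remains. The sign comes from `i ^ (r - q) = (-1) ^ q i ^ (q + r)`. -/
lemma lFactor_one (k : ℕ) {ℓ : ℕ} (q : ℕ) {r : ℕ} (hr : r ≤ ℓ) (D W : ℂ) :
    lFactor k ℓ q r D W 1 = (-1) ^ (ℓ + q + r) * 2 * (2 * Real.pi * Complex.I) ^ (q + r + 2) /
      (D * Complex.Gamma (q + 1) * Complex.Gamma (r + 1) * W) *
        (2 * ((k + ℓ + 2).choose (ℓ + 1 + q - r) : ℂ)⁻¹ * (-1) ^ (ℓ + 1 - r)) := by
  have h1 : (2 * Real.pi : ℂ) ^ ((q : ℂ) + r + 2 * 1) = (2 * Real.pi : ℂ) ^ (q + r + 2) := by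
    rw [← Complex.cpow_natCast]
    congr 1
    push_cast
    ring
  have h2 : Complex.I ^ ((r : ℤ) - q) =
      (-1) ^ (ℓ + q + r) * (-1) ^ (ℓ + 1 - r) * Complex.I ^ (q + r + 2) := by
    obtain ⟨m, rfl⟩ := Nat.exists_eq_add_of_le hr
    have e1 : Complex.I ^ ((r : ℤ) - q) = Complex.I ^ (r + q) * ((-1) ^ q) := by
      rw [show (r : ℤ) - q = ((r + q : ℕ) : ℤ) + (-2 : ℤ) * (q : ℤ) by push_cast; ring,
        zpow_add₀ Complex.I_ne_zero, zpow_natCast, zpow_mul, zpow_natCast]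
      congr 2
      rw [zpow_neg]
      norm_num
    have e2 : r + m + 1 - r = m + 1 := by omega
    rw [e1, e2, pow_add _ (q + r) 2, Complex.I_sq]
    have e3 : ((-1 : ℂ)) ^ (r + m + q + r) * (-1) ^ (m + 1) = -(-1) ^ q := by
      rw [← pow_add, show r + m + q + r + (m + 1) = 2 * (r + m) + (q + 1) by ring, pow_add, pow_mul]
      norm_num [pow_succ]
    rw [e3]
    ring
  rw [lFactor, h1, h2, Complex.cpow_neg_one, mul_pow (2 * Real.pi : ℂ), add_comm 1 (q : ℂ),
    add_comm 1 (r : ℂ)]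
  simp only [div_eq_mul_inv, mul_inv]
  ring

lemma mellin_eq_integral_pow (f : ℝ → ℂ) (m : ℕ) :
    mellin f (m + 1) = ∫ t in Set.Ioi (0 : ℝ), (t : ℂ) ^ m * f t := by
  simp [mellin]

end

end Bianchi

end

/-! ### The integral formula -/

theorem mainTheorem5 {K : Type*} [Field K] [NumberField K] [NumberField.IsTotallyComplex K]
    (hK : Module.finrank ℚ K = 2) (τ : K →+* ℂ)
    (δ : 𝓞 K) (hδ : δ ^ 2 = (NumberField.discr K : 𝓞 K))
    (p : ℕ) (hp : p.Prime) (𝔪 𝔫 : Ideal (𝓞 K)) (h𝔪 : 𝔪 ≠ ⊥)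
    (h𝔪p : IsCoprime 𝔪 (Ideal.span {(p : 𝓞 K)})) (h𝔫 : 𝔫 = Ideal.span {(p : 𝓞 K)} * 𝔪)
    (I : ClassGroup (𝓞 K) → Ideal (𝓞 K)) (hI : Bianchi.ClassReps I 𝔫 (Ideal.span {δ}))
    (k ℓ : ℕ) (φ : ℂˣ × (Bianchi.Af K)ˣ →* ℂˣ) (hφ : Bianchi.IsHeckeCharacter τ φ (-k) (-ℓ))
    (hφ𝔫 : Bianchi.TrivialOn φ 𝔫)
    (F : GL (Fin 2) ℂ → GL (Fin 2) (Bianchi.Af K) → Bianchi.V (k + ℓ + 2))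
    (hF : Bianchi.IsBianchiModularForm τ 𝔫 k ℓ φ F) (hFC : Bianchi.IsCCuspidal τ I 𝔪 k ℓ F)
    (q r : ℕ) (hq : q ≤ k) (hr : r ≤ ℓ)
    (ψ : ℂˣ × (Bianchi.Af K)ˣ →* ℂˣ) (hψ : Bianchi.IsHeckeCharacter τ ψ q r)
    (𝔣 : Ideal (𝓞 K)) (h𝔣 : Bianchi.IsConductor ψ 𝔣) (h𝔣𝔪 : IsCoprime 𝔣 𝔪)
    (h𝔣I : ∀ j, IsCoprime 𝔣 (I j))
    (a : ClassGroup (𝓞 K) → (K ⧸ Bianchi.intSubgroup K) → K)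
    (ha : ∀ j, ∀ x ∈ Bianchi.primClasses 𝔣,
      QuotientAddGroup.mk (a j x) = x ∧
      a j x ∈ (𝔣 : FractionalIdeal (𝓞 K)⁰ K)⁻¹ * (I j : FractionalIdeal (𝓞 K)⁰ K) ∧
      (((a j x : K) : OnePoint K) ∈ Bianchi.cusps (I j) 𝔪 ∨
        Bianchi.QuasiVanishesAt τ k ℓ (Bianchi.descent F (I j)) (a j x : K))) :
    (∀ j, ∀ x ∈ Bianchi.primClasses 𝔣,
      MeasureTheory.IntegrableOn (fun t : ℝ => (t : ℂ) ^ (q + r) *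
        (Bianchi.descent F (I j) (τ (a j x)) t).comp (ℓ + 1 + q - r)) (Set.Ioi 0)) ∧
    ∃ L : ℂ → ℂ, Bianchi.IsLFunction τ (Ideal.span {δ}) F ψ 𝔣 L ∧
      L 1 = (-1) ^ (ℓ + q + r) * 2 * (2 * Real.pi * Complex.I) ^ (q + r + 2) /
          ((NumberField.discr K).natAbs * Nat.card (𝓞 K)ˣ *
            Complex.Gamma (q + 1) * Complex.Gamma (r + 1) * Bianchi.gaussSum τ δ ψ 𝔣) *
        ∑ j : ClassGroup (𝓞 K),
          ((ψ (1, Bianchi.ideleOf (I j : FractionalIdeal (𝓞 K)⁰ K)) : ℂˣ) : ℂ) *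
            ∑ᶠ x ∈ Bianchi.primClasses 𝔣,
              Bianchi.atIdeal ψ 𝔣 (algebraMap K (Bianchi.Af K) (a j x)) *
                Bianchi.mellinCoeff k ℓ (Bianchi.descent F (I j)) q r (τ (a j x)) := by
  open Bianchi in
  have h𝔫0 : 𝔫 ≠ ⊥ := by
    rw [h𝔫]
    exact mul_ne_zero (by simpa using hp.ne_zero) h𝔪
  -- The cusp `∞` always belongs to `C_j`, so the Fourier expansions of the middle components have
  -- no constant term.
  have hinf : ∀ j, QuasiVanishesAt τ k ℓ (descent F (I j)) OnePoint.infty := fun j =>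
    hFC j _ (infty_mem_cusps _ _)
  have hrd : ∀ j, ∀ x ∈ primClasses 𝔣, IsRapidlyDecreasing fun t =>
      (descent F (I j) (τ (a j x)) t).comp (ℓ + 1 + q - r) := fun j x hx =>
    hF.isRapidlyDecreasing_descent hφ hK h𝔫0 hφ𝔫 (hI.ne_bot j) (hinf j)
      ((ha j x hx).2.2.elim (hFC j _) id) (by omega) (by omega)
  refine ⟨fun j x hx => ?_, ?_⟩
  -- The integral is the Mellin integral at the point `q + r + 1`.
  · simpa [MellinConvergent, ← Nat.cast_add, Complex.cpow_natCast] using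
      (hrd j x hx).mellinConvergent (((q + r : ℕ) : ℂ) + 1)
  have hD : ((discr K).natAbs : ℂ) ≠ 0 := by
    simpa using NumberField.discr_ne_zero K
  set s := (finite_primClasses (K := K) h𝔣.1).toFinset with hs
  have hs' : ∀ x, x ∈ s ↔ x ∈ primClasses 𝔣 := fun x => Set.Finite.mem_toFinset _
  have h𝔞 := fun j (α : traceDual (I j : FractionalIdeal (𝓞 K)⁰ K)) =>
    (exists_ideal_eq hK hδ (hI.ne_bot j) α).1 α.2
  choose 𝔞 h𝔞 using h𝔞
  have hsum := fun j => hF.hasSum_traceDual hφ hK hδ (hI.ne_bot j) (hinf j) hq hr hψ h𝔣 (h𝔣I j) hs'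
    (fun x hx => (ha j x ((hs' x).1 hx)).1) (fun x hx => (ha j x ((hs' x).1 hx)).2.1) (h𝔞 j)
  choose σ hσ using hsum
  set ψI : ClassGroup (𝓞 K) → ℂ := fun j =>
    ((ψ (1, ideleOf (I j : FractionalIdeal (𝓞 K)⁰ K)) : ℂˣ) : ℂ) with hψI
  set W := gaussSum τ δ ψ 𝔣 with hW
  have hN : ∀ j, (Ideal.absNorm (I j) : ℂ) ≠ 0 := fun j => by
    exact_mod_cast Ideal.absNorm_eq_zero_iff.not.2 (hI.ne_bot j)
  -- The continuation is the finite combination of Mellin transforms itself, entire because these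
  -- and `1 / Γ` are. The sum of the `|σ j|` bounds all the abscissas at once.
  refine ⟨fun w => lFactor k ℓ q r (discr K).natAbs W w * (∑ j, ψI j * (Ideal.absNorm (I j) : ℂ) ^ (1 - w) *
    ∑ x ∈ s, finitePart ψ 𝔣 (a j x) * mellin (fun t =>
      (descent F (I j) (τ (a j x)) t).comp (ℓ + 1 + q - r)) (q + r + 2 * w - 1)) / Nat.card (𝓞 K)ˣ,
    ⟨?_, ∑ j, |σ j|, fun w hw => ?_⟩, ?_⟩
  · refine ((differentiable_lFactor k ℓ q r hD W).mul (Differentiable.fun_sum fun j _ =>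
      Differentiable.mul (Differentiable.mul (differentiable_const _) fun w => ?_)
        (Differentiable.fun_sum fun x hx => (differentiable_const _).mul ?_))).div_const _
    · exact DifferentiableAt.const_cpow (by fun_prop) (Or.inl (hN j))
    · exact ((hrd j x ((hs' x).1 hx)).differentiable_mellin).comp (by fun_prop)
  · have h1 := hI.hasSum_ideals τ hK hδ h𝔞 (g := fun 𝔟 => fourierCoeff τ (Ideal.span {δ}) F 𝔟 *
      onIdeals ψ 𝔣 𝔟 * (Ideal.absNorm 𝔟 : ℂ) ^ (-w)) (by rw [fourierCoeff_bot]; ring) (fun j => hσ j w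
        (((le_abs_self _).trans (Finset.single_le_sum (f := fun j => |σ j|) (fun _ _ => abs_nonneg _)
          (Finset.mem_univ j))).trans_lt hw))
    simp only [mellin_finsetSum s _ (fun x hx => hrd _ x ((hs' x).1 hx))] at h1
    rw [← Finset.mul_sum] at h1
    exact h1
  · have hS : ∀ j, ∑ᶠ x ∈ primClasses 𝔣, atIdeal ψ 𝔣 (algebraMap K (Af K) (a j x)) *
        mellinCoeff k ℓ (descent F (I j)) q r (τ (a j x)) =
        2 * ((k + ℓ + 2).choose (ℓ + 1 + q - r) : ℂ)⁻¹ * (-1) ^ (ℓ + 1 - r) *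
          ∑ x ∈ s, finitePart ψ 𝔣 (a j x) * mellin (fun t =>
            (descent F (I j) (τ (a j x)) t).comp (ℓ + 1 + q - r)) (((q + r : ℕ) : ℂ) + 1) := by
      intro j
      rw [finsum_mem_eq_finite_toFinset_sum _ (finite_primClasses h𝔣.1), Finset.mul_sum]
      refine Finset.sum_congr rfl fun x _ => ?_
      rw [mellin_eq_integral_pow, mellinCoeff, finitePart]
      ring
    -- At `w = 1` the Mellin variable becomes `q + r + 1`, and the powers `N(I_j) ^ (1 - w)`
    -- disappear.
    have he : (q : ℂ) + r + 2 - 1 = ((q + r : ℕ) : ℂ) + 1 := by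
      push_cast
      ring
    simp only [hS, sub_self, Complex.cpow_zero, mul_one, he, lFactor_one k q hr]
    have hB : ∀ (B : ℂ) (T : ClassGroup (𝓞 K) → ℂ),
        ∑ j, ψI j * (B * T j) = B * ∑ j, ψI j * T j := fun B T => by
      rw [Finset.mul_sum]
      exact Finset.sum_congr rfl fun j _ => by ring
    rw [hB]
    simp only [div_eq_mul_inv, mul_inv]
    ring
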